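/- **Setting.** Let $\Omega=\mathbb R^3$ or $\Omega=\mathbb T^3=(\mathbb R/L\mathbb Z)^3$ with any period $L>0$, let $-3<\gamma\le 1$, and let $B(v-u,\theta)=|v-u|^\gamma b(\theta)$, $\cos\theta=(v-u)\cdot\omega/|v-u|$, where $b$ is measurable and $0\le b(\theta)\le C_b|\cos\theta|$ on $[0,\pi]$ for a fixed constant $C_b>0$. With $u'=u+[(v-u)\cdot\omega]\omega$ and $v'=v-[(v-u)\cdot\omega]\omega$, put $$Q(F_1,F_2)(v)=\int_{\mathbb R^3}\int_{\mathbb S^2}B(v-u,\theta)\,[F_1(u')F_2(v')-F_1(u)F_2(v)]\,d\omega\,du,$$ $\mu(v)=(2\pi)^{-3/2}e^{-|v|^2/2}$, $w_\beta(v)=(1+|v|^2)^{\beta/2}$, $\nu(v)=\int\!\!\int B(v-u,\theta)\mu(u)\,d\omega\,du$, $\Gamma(f,f)=\mu^{-1/2}Q(\sqrt\mu f,\sqrt\mu f)$ and $Kf=K_2f-K_1f$, where $$K_1f(v)=\int\!\!\int B\sqrt{\mu(v)\mu(u)}\,f(u)\,d\omega\,du,\qquad K_2f(v)=\int\!\!\int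 B\sqrt{\mu(u)\mu(u')}\,f(v')\,d\omega\,du+\int\!\!\int B\sqrt{\mu(u)\mu(v')}\,f(u')\,d\omega\,du .$$ All $L^\infty$ norms are essential suprema over $\Omega\times\mathbb R^3$. A nonnegative mild solution on $[0,T]$ of the Boltzmann equation $F_t+v\cdot\nabla_xF=Q(F,F)$ with data $F_0=\mu+\sqrt\mu f_0$ is a function $F=\mu+\sqrt\mu f$, measurable on $[0,T]\times\Omega\times\mathbb R^3$, such that $\sup_{0\le t\le T}\|w_\beta f(t)\|_{L^\infty}<\infty$ and, for every $t\in[0,T]$ and almost every $(x,v)$, $F(t,x,v)\ge0$ and $$f(t,x,v)=e^{-\nu(v)t}f_0(x-vt,v)+\int_0^te^{-\nu(v)(t-s)}\big[Kf+\Gamma(f,f)\big](s,x-v(t-s),v)\,ds .$$ **Proposition (Local existence).** Let $-3<\gamma\le1$, $\beta>3$ and $C_b>0$. There is a constant $\tilde C_4\ge1$, depending only on $\gamma$, $\beta$ and the fixed cut-off constant $C_b$, such that the following holds for every $b$ as above, for $\Omega=\mathbb R^3$ and for $\Omega=\mathbb T^3$. Let $f_0$ be measurable on $\Omega\times\mathbb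 R^3$ with $\|w_\beta f_0\|_{L^\infty}<\infty$ and $F_0=\mu+\sqrt\mu f_0\ge0$ almost everywhere, and put $$t_1=\big(8\tilde C_4[1+\|w_\beta f_0\|_{L^\infty}]\big)^{-1}>0 .$$ 1. There is a nonnegative mild solution $F=\mu+\sqrt\mu f$ on $[0,t_1]$ with data $F_0$, and $\sup_{0\le t\le t_1}\|w_\beta f(t)\|_{L^\infty}\le2\|w_\beta f_0\|_{L^\infty}$. 2. It is unique: every nonnegative mild solution on $[0,t_1]$ with data $F_0$ agrees with it almost everywhere on $\Omega\times\mathbb R^3$, for each $t\in[0,t_1]$. 3. Suppose that $(1+|v|^2)(F_0-\mu)\in L^1(\Omega\times\mathbb R^3)$; for $\Omega=\mathbb T^3$ this is automatic. Then $F_0\ln F_0-\mu\ln\mu$ is integrable on $\Omega\times\mathbb R^3$, and for every $t\in[0,t_1]$ the functions $(1+|v|^2)(F(t)-\mu)$ and $F(t)\ln F(t)-\mu\ln\mu$ are integrable on $\Omega\times\mathbb R^3$ and $$\int_\Omega\int_{\mathbb R^3}\begin{pmatrix}1\\ v\\ |v|^2\end{pmatrix}(F(t)-\mu)\,dv\,dx=\int_\Omega\int_{\mathbb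 R^3}\begin{pmatrix}1\\ v\\ |v|^2\end{pmatrix}(F_0-\mu)\,dv\,dx,$$ $$\int_\Omega\int_{\mathbb R^3}\{F(t)\ln F(t)-\mu\ln\mu\}\,dv\,dx\le\int_\Omega\int_{\mathbb R^3}\{F_0\ln F_0-\mu\ln\mu\}\,dv\,dx .$$ 4. If $f_0$ is continuous on $\Omega\times\mathbb R^3$, then $f$ (a suitable representative of it) is continuous on $[0,t_1]\times\Omega\times\mathbb R^3$. -/

import Mathlib

open MeasureTheory Set
open scoped ENNReal

noncomputable section

namespace Boltzmann

/-- The velocity space, with its Euclidean structure and Lebesgue measure. -/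
abbrev E3 : Type := EuclideanSpace ℝ (Fin 3)

/-- The unit sphere of the velocity space. -/
abbrev S2 : Type := Metric.sphere (0 : E3) 1

/-- Surface measure on the unit sphere (total mass `4 π`). -/
def sphereMeasure : Measure S2 := (volume : Measure E3).toSphere

/-- The measure `dω du` on the pairs `(u, ω)`. -/
def collisionMeasure : Measure (E3 × S2) := (volume : Measure E3).prod sphereMeasure

/-- The torus `(ℝ / L ℤ)³`. -/
abbrev T3 (L : ℝ) : Type := Fin 3 → AddCircle L

/-- The covering map from `ℝ³` onto the torus. -/
def toTorus (L : ℝ) (x : E3) : T3 L := fun i => (x i : AddCircle L)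

/-! ### Collisions -/

/-- `u' = u + [(v - u) · ω] ω`. -/
def postU (v u : E3) (ω : S2) : E3 := u + (inner ℝ (v - u) (ω : E3)) • (ω : E3)

/-- `v' = v - [(v - u) · ω] ω`. -/
def postV (v u : E3) (ω : S2) : E3 := v - (inner ℝ (v - u) (ω : E3)) • (ω : E3)

/-- The angular function `b : [0, π] → ℝ` satisfies the angular cut-off bound with constant `Cb`. -/
structure IsCutoff (Cb : ℝ) (b : ℝ → ℝ) : Prop where
  measurable : Measurable b
  nonneg : ∀ θ ∈ Icc (0 : ℝ) Real.pi, 0 ≤ b θ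
  le : ∀ θ ∈ Icc (0 : ℝ) Real.pi, b θ ≤ Cb * |Real.cos θ|

/-- The collision kernel `B(z, θ) = |z| ^ γ b(θ)`, where `θ ∈ [0, π]` is the angle between
the relative velocity `z = v - u` and `ω`. -/
def kernel (γ : ℝ) (b : ℝ → ℝ) (z : E3) (ω : S2) : ℝ :=
  ‖z‖ ^ γ * b (InnerProductGeometry.angle z (ω : E3))

/-- The gain part `Q₊(F₁, F₂)` of the collision operator. -/
def Qgain (γ : ℝ) (b : ℝ → ℝ) (F₁ F₂ : E3 → ℝ) (v : E3) : ℝ :=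
  ∫ p : E3 × S2, kernel γ b (v - p.1) p.2 * F₁ (postU v p.1 p.2) * F₂ (postV v p.1 p.2)
    ∂collisionMeasure

/-- The loss part `Q₋(F₁, F₂)` of the collision operator. -/
def Qloss (γ : ℝ) (b : ℝ → ℝ) (F₁ F₂ : E3 → ℝ) (v : E3) : ℝ :=
  ∫ p : E3 × S2, kernel γ b (v - p.1) p.2 * F₁ p.1 * F₂ v ∂collisionMeasure

/-- The bilinear collision operator `Q = Q₊ - Q₋`. -/
def Q (γ : ℝ) (b : ℝ → ℝ) (F₁ F₂ : E3 → ℝ) (v : E3) : ℝ :=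
  Qgain γ b F₁ F₂ v - Qloss γ b F₁ F₂ v

/-! ### Perturbation of the global Maxwellian -/

/-- The global Maxwellian `μ(v) = (2 π) ^ (-3/2) exp (-|v|² / 2)`. -/
def maxwellian (v : E3) : ℝ := ((2 * Real.pi) ^ (3 / 2 : ℝ))⁻¹ * Real.exp (-‖v‖ ^ 2 / 2)

/-- `√μ`. -/
def sqrtM (v : E3) : ℝ := Real.sqrt (maxwellian v)

/-- The weight `w_β(v) = (1 + |v|²) ^ (β / 2)`. -/
def weight (β : ℝ) (v : E3) : ℝ := (1 + ‖v‖ ^ 2) ^ (β / 2)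

/-- The collision frequency `ν(v)`. -/
def collisionFreq (γ : ℝ) (b : ℝ → ℝ) (v : E3) : ℝ :=
  ∫ p : E3 × S2, kernel γ b (v - p.1) p.2 * maxwellian p.1 ∂collisionMeasure

/-- The operator `K₁`. -/
def K₁ (γ : ℝ) (b : ℝ → ℝ) (f : E3 → ℝ) (v : E3) : ℝ :=
  ∫ p : E3 × S2, kernel γ b (v - p.1) p.2 * (sqrtM v * sqrtM p.1) * f p.1 ∂collisionMeasure

/-- The operator `K₂`. -/
def K₂ (γ : ℝ) (b : ℝ → ℝ) (f : E3 → ℝ) (v : E3) : ℝ :=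
  (∫ p : E3 × S2, kernel γ b (v - p.1) p.2 *
      (sqrtM p.1 * sqrtM (postU v p.1 p.2)) * f (postV v p.1 p.2) ∂collisionMeasure) +
  ∫ p : E3 × S2, kernel γ b (v - p.1) p.2 *
      (sqrtM p.1 * sqrtM (postV v p.1 p.2)) * f (postU v p.1 p.2) ∂collisionMeasure

/-- `K = K₂ - K₁`. -/
def K (γ : ℝ) (b : ℝ → ℝ) (f : E3 → ℝ) (v : E3) : ℝ := K₂ γ b f v - K₁ γ b f v

/-- The nonlinear term `Γ(f, g) = μ ^ (-1/2) Q(√μ f, √μ g)`. -/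
def Gam (γ : ℝ) (b : ℝ → ℝ) (f g : E3 → ℝ) (v : E3) : ℝ :=
  (sqrtM v)⁻¹ * Q γ b (fun u => sqrtM u * f u) (fun u => sqrtM u * g u) v

/-- The density `F = μ + √μ f` whose perturbation is `f`. -/
def density {Ω : Type} (f : Ω → E3 → ℝ) (x : Ω) (v : E3) : ℝ := maxwellian v + sqrtM v * f x v

/-! ### Mild solutions

The position space `Ω` is used through its group structure and a map `π : ℝ³ → Ω`
(the identity of `ℝ³`, or the covering map of the torus): the point `x - v t` is `x - π (t v)`. -/

section Solutions

variable {Ω : Type} [AddCommGroup Ω] [MeasureSpace Ω]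

/-- `‖w_β f‖_{L^∞(Ω × ℝ³)}`, an essential supremum. -/
def wNorm (β : ℝ) (f : Ω → E3 → ℝ) : ℝ≥0∞ :=
  eLpNorm (fun p : Ω × E3 => weight β p.2 * f p.1 p.2) ∞ volume

/-- `f` is (the perturbation of) a nonnegative mild solution `F = μ + √μ f` of the Boltzmann
equation on `[0, T]` with initial perturbation `f₀`, in the class `sup_t ‖w_β f(t)‖_{L^∞} < ∞`.
The last field is the mild form of the equation; for `t = 0` it is the initial condition.
For `β > 3` and `γ > -3` all integrals in it converge absolutely for functions of this class. -/
structure IsMildSolution (π : E3 → Ω) (γ : ℝ) (b : ℝ → ℝ) (β T : ℝ) (f₀ : Ω → E3 → ℝ)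
    (f : ℝ → Ω → E3 → ℝ) : Prop where
  measurable : AEStronglyMeasurable (fun p : ℝ × Ω × E3 => f p.1 p.2.1 p.2.2)
    ((volume.restrict (Icc 0 T)).prod volume)
  bounded : ∃ M : ℝ, ∀ t ∈ Icc 0 T, wNorm β (f t) ≤ ENNReal.ofReal M
  nonneg : ∀ t ∈ Icc 0 T, ∀ᵐ p : Ω × E3, 0 ≤ density (f t) p.1 p.2
  mild : ∀ t ∈ Icc 0 T, ∀ᵐ p : Ω × E3,
    f t p.1 p.2 =
      Real.exp (-collisionFreq γ b p.2 * t) * f₀ (p.1 - π (t • p.2)) p.2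
      + (∫ s in (0 : ℝ)..t, Real.exp (-collisionFreq γ b p.2 * (t - s)) *
          K γ b (f s (p.1 - π ((t - s) • p.2))) p.2)
      + ∫ s in (0 : ℝ)..t, Real.exp (-collisionFreq γ b p.2 * (t - s)) *
          Gam γ b (f s (p.1 - π ((t - s) • p.2))) (f s (p.1 - π ((t - s) • p.2))) p.2

/-- The defect `F - μ` has finite mass, momentum and energy:
`(1 + |v|²) (F - μ)` is integrable on `Ω × ℝ³`. -/
def FiniteDefect (f : Ω → E3 → ℝ) : Prop :=
  Integrable (fun p : Ω × E3 => (1 + ‖p.2‖ ^ 2) * (density f p.1 p.2 - maxwellian p.2)) volume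

/-- Defect mass `∫∫ (F - μ) dv dx`. -/
def defectMass (f : Ω → E3 → ℝ) : ℝ :=
  ∫ p : Ω × E3, (density f p.1 p.2 - maxwellian p.2)

/-- Defect momentum `∫∫ v (F - μ) dv dx`. -/
def defectMomentum (f : Ω → E3 → ℝ) : E3 :=
  ∫ p : Ω × E3, (density f p.1 p.2 - maxwellian p.2) • p.2

/-- Defect energy `∫∫ |v|² (F - μ) dv dx`. -/
def defectEnergy (f : Ω → E3 → ℝ) : ℝ :=
  ∫ p : Ω × E3, ‖p.2‖ ^ 2 * (density f p.1 p.2 - maxwellian p.2)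

/-- The integrand `F ln F - μ ln μ` of the defect entropy (with `0 ln 0 = 0`). -/
def entropyDensity (f : Ω → E3 → ℝ) (p : Ω × E3) : ℝ :=
  density f p.1 p.2 * Real.log (density f p.1 p.2) - maxwellian p.2 * Real.log (maxwellian p.2)

/-- Defect entropy `∫∫ (F ln F - μ ln μ) dv dx`. -/
def defectEntropy (f : Ω → E3 → ℝ) : ℝ := ∫ p : Ω × E3, entropyDensity f p

/-- The time `(8 C [1 + ‖w_β f₀‖_{L^∞}])⁻¹`. -/
def lifespan (C β : ℝ) (f₀ : Ω → E3 → ℝ) : ℝ := (8 * C * (1 + (wNorm β f₀).toReal))⁻¹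

variable [TopologicalSpace Ω]

/-- Local existence on the position space `Ω` with the constant `C` in the lifespan: for all data
`f₀` with `‖w_β f₀‖_{L^∞} < ∞` and `F₀ = μ + √μ f₀ ≥ 0` there is a nonnegative mild solution `f`
on `[0, t₁]`, bounded by twice the norm of the data, unique in the class of `IsMildSolution`;
it satisfies the conservation laws and the entropy inequality as soon as the defect
mass, momentum and energy of the data are defined, and it is continuous if `f₀` is. -/
def LocalExistence (π : E3 → Ω) (γ : ℝ) (b : ℝ → ℝ) (β C : ℝ) : Prop :=
  ∀ f₀ : Ω → E3 → ℝ,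
    AEStronglyMeasurable (fun p : Ω × E3 => f₀ p.1 p.2) volume →
    wNorm β f₀ < ∞ →
    (∀ᵐ p : Ω × E3, 0 ≤ density f₀ p.1 p.2) →
    ∃ f : ℝ → Ω → E3 → ℝ,
      IsMildSolution π γ b β (lifespan C β f₀) f₀ f ∧
      (∀ t ∈ Icc 0 (lifespan C β f₀), wNorm β (f t) ≤ 2 * wNorm β f₀) ∧
      (∀ g : ℝ → Ω → E3 → ℝ, IsMildSolution π γ b β (lifespan C β f₀) f₀ g →
        ∀ t ∈ Icc 0 (lifespan C β f₀), ∀ᵐ p : Ω × E3, g t p.1 p.2 = f t p.1 p.2) ∧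
      (FiniteDefect f₀ → Integrable (entropyDensity f₀) volume ∧
        ∀ t ∈ Icc 0 (lifespan C β f₀),
          FiniteDefect (f t) ∧ Integrable (entropyDensity (f t)) volume ∧
          defectMass (f t) = defectMass f₀ ∧
          defectMomentum (f t) = defectMomentum f₀ ∧
          defectEnergy (f t) = defectEnergy f₀ ∧
          defectEntropy (f t) ≤ defectEntropy f₀) ∧
      (Continuous (fun p : Ω × E3 => f₀ p.1 p.2) →
        ContinuousOn (fun p : ℝ × Ω × E3 => f p.1 p.2.1 p.2.2)
          (Icc 0 (lifespan C β f₀) ×ˢ univ))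

end Solutions

end Boltzmann

end

noncomputable section

namespace Boltzmann

/-! ### Velocity weights and the square root of the Maxwellian -/

/-! Write F = √μ (√μ + f). Along a characteristic y + t v the equation becomes f' = `source` f −
`freq (shift f)` · f, or equivalently (√μ + f)' = `gain (shift f) (shift f)` − `freq (shift f)` ·
(√μ + f). Freezing the coefficients at the previous iterate leaves a scalar linear equation, solved
by `duhamel`. The whole loss frequency of F acts as damping. It may grow linearly in v, but it is
nonnegative, so it drops out of every size estimate; and the second form has a nonnegative
right-hand source, so the iteration preserves F ≥ 0.

The source costs no velocity weight, although the kernel may grow like |v − u|. This rests on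
`exists_integral_gain_le`. For |v − u| < 1 the singularity |z|^γ is integrable because γ > −3.
Otherwise the cut-off factor gives |v − u| |cos θ| = |u' − u| ≤ 2 J(u) J(u'), while |v − u| sin θ =
|v' − u| ≤ 2 J(u) J(v') and 1 / sin θ is integrable on the sphere. So a factor 1 / J(u') or 1 /
J(v') pays for the growth. Since |v|² ≤ |u'|² + |v'|², the weight at v is dominated by the weights
at u' and v': one profile supplies the weight, the other the factor 1 / J. These facts make up
`Bounds`, and they bound the iterates by twice the data on the stated interval.

Differences of solutions contain `freq (f − g)` · g, which grows in v and has no sign. They are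
therefore measured with the weaker weight w_{β−2}; the two spare powers of g absorb the growth, and
β − 2 > 1 is where β > 3 enters. With an exponential factor in time the map `step` contracts by 1/2,
which gives `sol`. Two kinds of weights in space are carried through these estimates, a slowly
growing κ and a decay rate ϑ, both evaluated at the foot of the characteristic. For uniqueness, an
arbitrary mild solution is replaced by an admissible representative, and the contraction is iterated
on it (`Setting.unique`).

Conservation laws and entropy are first proved for data cut off in space and lifted above a multiple
of μ. Their solutions decay in space at an integrable rate and stay positive, so weak forms of the
collision operator, Fubini and the chain rule for r ln r are all legitimate. The cut-off is removed
by stability in L¹ with weight 1 + |v|² (`Setting.exists_integral_abs_sub_le`), where energy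
conservation cancels the dangerous growth. The L¹ convergence carries the moments to the limit.
Fatou's lemma carries the relative entropy, and F ln F − μ ln μ differs from the relative entropy by
(1 + ln μ)(F − μ), a combination of conserved quantities. -/

/-- The Japanese bracket `(1 + |v|²) ^ (1/2)`. -/
def jap (v : E3) : ℝ := Real.sqrt (1 + ‖v‖ ^ 2)

lemma jap_sq (v : E3) : jap v ^ 2 = 1 + ‖v‖ ^ 2 := Real.sq_sqrt (by positivity)

lemma one_le_jap (v : E3) : 1 ≤ jap v := by
  rw [jap, Real.one_le_sqrt]; nlinarith [sq_nonneg ‖v‖]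

lemma jap_pos (v : E3) : 0 < jap v := lt_of_lt_of_le one_pos (one_le_jap v)

lemma norm_le_jap (v : E3) : ‖v‖ ≤ jap v := Real.le_sqrt_of_sq_le (by linarith)

lemma continuous_jap : Continuous jap := by unfold jap; fun_prop

lemma measurable_jap : Measurable jap := continuous_jap.measurable

lemma weight_eq (β : ℝ) (v : E3) : weight β v = jap v ^ β := by
  rw [weight, jap, Real.sqrt_eq_rpow, ← Real.rpow_mul (by positivity)]; congr 1; ring

lemma weight_pos (β : ℝ) (v : E3) : 0 < weight β v := by unfold weight; positivity

lemma continuous_weight (β : ℝ) : Continuous (weight β) := by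
  unfold weight
  refine Continuous.rpow_const (by fun_prop) fun v => Or.inl (by positivity)

lemma weight_add_two (a : ℝ) (v : E3) : weight (a + 2) v = weight a v * jap v ^ 2 := by
  rw [weight_eq, weight_eq, Real.rpow_add (jap_pos v)]; norm_num

lemma jap_le_weight {a : ℝ} (ha : 1 ≤ a) (v : E3) : jap v ≤ weight a v := by
  rw [weight_eq]
  simpa using Real.rpow_le_rpow_of_exponent_le (one_le_jap v) ha

lemma weight_le_pow {a : ℝ} {n : ℕ} (ha : a ≤ n) (v : E3) : weight a v ≤ jap v ^ n := by
  rw [weight_eq, ← Real.rpow_natCast]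
  exact Real.rpow_le_rpow_of_exponent_le (one_le_jap v) ha

lemma one_le_weight {a : ℝ} (ha : 0 ≤ a) (v : E3) : 1 ≤ weight a v := by
  rw [weight_eq]; exact Real.one_le_rpow (one_le_jap v) ha

lemma weight_inv_le_one {a : ℝ} (ha : 0 ≤ a) (v : E3) : (weight a v)⁻¹ ≤ 1 :=
  inv_le_one_of_one_le₀ (one_le_weight ha v)

lemma one_add_norm_sub_le (u v : E3) : 1 + ‖v - u‖ ≤ 3 * (jap v * jap u) := by
  have h1 := norm_sub_le v u
  have := norm_le_jap u
  have := norm_le_jap v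
  have := one_le_jap u
  have := one_le_jap v
  nlinarith [mul_nonneg (sub_nonneg.2 (one_le_jap u)) (sub_nonneg.2 (one_le_jap v))]

lemma maxwellian_pos (v : E3) : 0 < maxwellian v := by unfold maxwellian; positivity

lemma sqrtM_pos (v : E3) : 0 < sqrtM v := Real.sqrt_pos.2 (maxwellian_pos v)

lemma sqrtM_mul_self (v : E3) : sqrtM v * sqrtM v = maxwellian v :=
  Real.mul_self_sqrt (maxwellian_pos v).le

lemma continuous_maxwellian : Continuous maxwellian := by unfold maxwellian; fun_prop

lemma continuous_sqrtM : Continuous sqrtM := continuous_maxwellian.sqrt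

lemma measurable_sqrtM : Measurable sqrtM := continuous_sqrtM.measurable

lemma two_pi_rpow_ge_one : (1 : ℝ) ≤ (2 * Real.pi) ^ (3 / 2 : ℝ) :=
  Real.one_le_rpow (by nlinarith [Real.pi_gt_three]) (by norm_num)

lemma maxwellian_le (v : E3) : maxwellian v ≤ Real.exp (-‖v‖ ^ 2 / 2) := by
  unfold maxwellian
  have := inv_le_one_of_one_le₀ two_pi_rpow_ge_one
  nlinarith [Real.exp_pos (-‖v‖ ^ 2 / 2)]

lemma sqrtM_le (v : E3) : sqrtM v ≤ Real.exp (-‖v‖ ^ 2 / 4) := by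
  rw [sqrtM, Real.sqrt_le_left (Real.exp_pos _).le, ← Real.exp_nat_mul]
  refine (maxwellian_le v).trans_eq ?_
  congr 1; push_cast; ring

lemma sqrtM_le_one (v : E3) : sqrtM v ≤ 1 :=
  (sqrtM_le v).trans (Real.exp_le_one_iff.2 (by nlinarith [sq_nonneg ‖v‖]))

/-- The logarithm of `√μ` is `-(c + |v|²/4)` with `c ≥ 0`. -/
lemma log_maxwellian (v : E3) :
    Real.log (maxwellian v) = -Real.log ((2 * Real.pi) ^ (3 / 2 : ℝ)) - ‖v‖ ^ 2 / 2 := by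
  unfold maxwellian
  rw [Real.log_mul (by positivity) (by positivity), Real.log_exp, Real.log_inv]; ring

lemma exists_jap_pow_mul_exp_le (n : ℕ) (c : ℝ) (hc : 0 < c) :
    ∃ C : ℝ, 0 < C ∧ ∀ v : E3, jap v ^ n * Real.exp (-(c * ‖v‖ ^ 2)) ≤ C := by
  -- The second summand suffices: x ^ n ≤ n! exp x at x = c J(v)², and exp (c J²) exp (−c |v|²) =
  -- exp c. The first is slack.
  refine ⟨n.factorial * Real.exp (1 / c + c) * c⁻¹ ^ n + (n.factorial * Real.exp c * c⁻¹ ^ n), by positivity, fun v => ?_⟩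
  have h1 : jap v ^ n ≤ (jap v ^ 2) ^ n :=
    pow_le_pow_left₀ (jap_pos v).le (by nlinarith [one_le_jap v]) n
  have h2 := Real.pow_div_factorial_le_exp (c * jap v ^ 2) (by positivity) n
  rw [div_le_iff₀ (by positivity)] at h2
  have h3 : jap v ^ n ≤ Real.exp (c * jap v ^ 2) * n.factorial * c⁻¹ ^ n := by
    calc jap v ^ n ≤ (jap v ^ 2) ^ n := h1
      _ = (c * jap v ^ 2) ^ n * c⁻¹ ^ n := by rw [← mul_pow]; congr 1; field_simp
      _ ≤ _ := by gcongr
  calc jap v ^ n * Real.exp (-(c * ‖v‖ ^ 2))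
      ≤ Real.exp (c * jap v ^ 2) * n.factorial * c⁻¹ ^ n * Real.exp (-(c * ‖v‖ ^ 2)) := by gcongr
    _ = n.factorial * (Real.exp (c * jap v ^ 2) * Real.exp (-(c * ‖v‖ ^ 2))) * c⁻¹ ^ n := by ring
    _ = n.factorial * Real.exp c * c⁻¹ ^ n := by
        rw [← Real.exp_add, jap_sq]; congr 3; ring
    _ ≤ _ := le_add_of_nonneg_left (by positivity)

lemma exists_sqrtM_mul_jap_pow_le (n : ℕ) :
    ∃ C : ℝ, 0 < C ∧ ∀ v : E3, sqrtM v * jap v ^ n ≤ C := by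
  obtain ⟨C, hC, h⟩ := exists_jap_pow_mul_exp_le n (1 / 4) (by norm_num)
  refine ⟨C, hC, fun v => le_trans ?_ (h v)⟩
  rw [mul_comm]
  have := sqrtM_le v
  have h2 : -‖v‖ ^ 2 / 4 = -(1 / 4 * ‖v‖ ^ 2) := by ring
  rw [h2] at this
  gcongr
  exact pow_nonneg (jap_pos v).le n

/-! ### The geometry of a collision -/

lemma sphere_inner_self (ω : S2) : inner ℝ (ω : E3) (ω : E3) = 1 := by
  rw [real_inner_self_eq_norm_sq, norm_eq_of_mem_sphere]; norm_num

lemma postU_add_postV (v u : E3) (ω : S2) : postU v u ω + postV v u ω = u + v := by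
  unfold postU postV; abel

lemma sub_postV (v u : E3) (ω : S2) : v - postV v u ω = postU v u ω - u := by
  unfold postU postV; abel

lemma sub_postU (v u : E3) (ω : S2) : v - postU v u ω = postV v u ω - u := by
  unfold postU postV; abel

lemma norm_sub_sq_postU_add_postV (x v u : E3) (ω : S2) :
    ‖x - postU v u ω‖ ^ 2 + ‖x - postV v u ω‖ ^ 2 = ‖x - u‖ ^ 2 + ‖x - v‖ ^ 2 := by
  have h := sphere_inner_self ω
  unfold postU postV
  simp only [← real_inner_self_eq_norm_sq, inner_sub_left, inner_sub_right, inner_add_left,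
    inner_add_right, inner_smul_left, inner_smul_right, real_inner_comm, h,
    RCLike.conj_to_real]
  rw [real_inner_comm (ω : E3) u, real_inner_comm (ω : E3) v, real_inner_comm (ω : E3) x]
  ring

lemma norm_sq_postU_add_postV (v u : E3) (ω : S2) :
    ‖postU v u ω‖ ^ 2 + ‖postV v u ω‖ ^ 2 = ‖u‖ ^ 2 + ‖v‖ ^ 2 := by
  simpa using norm_sub_sq_postU_add_postV 0 v u ω

/-- Energy conservation in exponential form. It lets √μ(v) be divided out of the gain operator,
leaving `gain`, and makes the measure of colliding pairs invariant under collisions. -/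
lemma sqrtM_postU_mul_postV (v u : E3) (ω : S2) :
    sqrtM (postU v u ω) * sqrtM (postV v u ω) = sqrtM u * sqrtM v := by
  unfold sqrtM
  rw [← Real.sqrt_mul (maxwellian_pos _).le, ← Real.sqrt_mul (maxwellian_pos _).le]
  congr 1
  unfold maxwellian
  have h := norm_sq_postU_add_postV v u ω
  calc _ = (((2 * Real.pi) ^ (3 / 2 : ℝ))⁻¹) ^ 2 *
        (Real.exp (-‖postU v u ω‖ ^ 2 / 2) * Real.exp (-‖postV v u ω‖ ^ 2 / 2)) := by ring
    _ = (((2 * Real.pi) ^ (3 / 2 : ℝ))⁻¹) ^ 2 *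
        (Real.exp (-‖u‖ ^ 2 / 2) * Real.exp (-‖v‖ ^ 2 / 2)) := by
        rw [← Real.exp_add, ← Real.exp_add]; congr 2; linarith
    _ = _ := by ring

lemma norm_sq_le_postU_add_postV (v u : E3) (ω : S2) :
    ‖v‖ ^ 2 ≤ ‖postU v u ω‖ ^ 2 + ‖postV v u ω‖ ^ 2 := by
  rw [norm_sq_postU_add_postV]; nlinarith [sq_nonneg ‖u‖]

/-- The faster of the two outgoing particles carries at least half of |v|², whence the factor 2 ^ (a
/ 2). -/
lemma weight_le_postU_add_postV {a : ℝ} (ha : 0 ≤ a) (v u : E3) (ω : S2) :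
    weight a v ≤ 2 ^ (a / 2) * (weight a (postU v u ω) + weight a (postV v u ω)) := by
  have h := norm_sq_le_postU_add_postV v u ω
  have key : ∀ p q : E3, ‖v‖ ^ 2 ≤ ‖p‖ ^ 2 + ‖q‖ ^ 2 → ‖p‖ ≤ ‖q‖ →
      weight a v ≤ 2 ^ (a / 2) * weight a q := by
    intro p q h1 h2
    unfold weight
    rw [← Real.mul_rpow (by norm_num) (by positivity)]
    refine Real.rpow_le_rpow (by positivity) ?_ (by positivity)
    nlinarith [norm_nonneg p, norm_nonneg q]
  have p1 := weight_pos a (postU v u ω)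
  have p2 := weight_pos a (postV v u ω)
  have p3 : (0 : ℝ) < 2 ^ (a / 2) := by positivity
  rcases le_total ‖postU v u ω‖ ‖postV v u ω‖ with h2 | h2
  · nlinarith [key _ _ h h2, mul_pos p3 p1]
  · nlinarith [key _ _ (by linarith) h2, mul_pos p3 p2]

lemma inner_relVel_post (v u : E3) (ω : S2) :
    inner ℝ (postV v u ω - postU v u ω) (ω : E3) = -inner ℝ (v - u) (ω : E3) := by
  have h := sphere_inner_self ω
  unfold postU postV
  simp only [inner_sub_left, inner_add_left, inner_smul_left, h, RCLike.conj_to_real]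
  ring

lemma norm_relVel_post (v u : E3) (ω : S2) :
    ‖postV v u ω - postU v u ω‖ = ‖v - u‖ := by
  rw [← sq_eq_sq₀ (norm_nonneg _) (norm_nonneg _)]
  have h1 := norm_sq_postU_add_postV v u ω
  have h2 := parallelogram_law_with_norm ℝ (postV v u ω) (postU v u ω)
  have h3 := parallelogram_law_with_norm ℝ v u
  have h4 : postV v u ω + postU v u ω = v + u := by rw [add_comm, postU_add_postV, add_comm]
  rw [h4] at h2
  nlinarith

lemma postV_post (v u : E3) (ω : S2) :
    postV (postV v u ω) (postU v u ω) (-ω) = v := by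
  have := inner_relVel_post v u ω
  rw [postV]
  simp only [coe_neg_sphere, inner_neg_right, this]
  unfold postV
  simp

lemma postU_post (v u : E3) (ω : S2) :
    postU (postV v u ω) (postU v u ω) (-ω) = u := by
  have := inner_relVel_post v u ω
  rw [postU]
  simp only [coe_neg_sphere, inner_neg_right, this]
  unfold postU
  simp

lemma postV_swap (v u : E3) (ω : S2) : postV u v (-ω) = postU v u ω := by
  unfold postU postV
  simp only [coe_neg_sphere, inner_neg_right, smul_neg, neg_smul, neg_neg]
  rw [← neg_sub v u, inner_neg_left, neg_smul, sub_neg_eq_add]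

/-- A collision reverses the component of the relative velocity along ω. No symmetry of b under θ ↦
π − θ is assumed, so ω must be replaced by −ω to recover the same angle; the same sign appears in
`kernel_swap`. -/
lemma kernel_post (γ : ℝ) (b : ℝ → ℝ) (v u : E3) (ω : S2) :
    kernel γ b (postV v u ω - postU v u ω) (-ω) = kernel γ b (v - u) ω := by
  unfold kernel InnerProductGeometry.angle
  simp [norm_relVel_post, inner_relVel_post]

lemma kernel_swap (γ : ℝ) (b : ℝ → ℝ) (v u : E3) (ω : S2) :
    kernel γ b (u - v) (-ω) = kernel γ b (v - u) ω := by
  unfold kernel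
  rw [← neg_sub v u, norm_neg, coe_neg_sphere, InnerProductGeometry.angle_neg_neg]

/-! ### Measures on the sphere and on collisions -/

instance : IsFiniteMeasure sphereMeasure := by unfold sphereMeasure; infer_instance

instance : SFinite collisionMeasure := by unfold collisionMeasure; infer_instance

instance : SigmaFinite collisionMeasure := by unfold collisionMeasure; infer_instance

open scoped Pointwise in
-- The surface measure is defined through volumes of cones, and Lebesgue measure is even.
lemma measurePreserving_neg_sphere :
    MeasurePreserving (fun ω : S2 => -ω) sphereMeasure sphereMeasure := by
  have hm : Measurable (fun ω : S2 => -ω) := continuous_neg.measurable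
  refine ⟨hm, Measure.ext fun s hs => ?_⟩
  rw [Measure.map_apply hm hs, sphereMeasure, Measure.toSphere_apply' _ hs,
    Measure.toSphere_apply' _ (hm hs)]
  congr 1
  have : Ioo (0 : ℝ) 1 • ((↑) '' ((fun ω : S2 => -ω) ⁻¹' s) : Set E3) =
      -(Ioo (0 : ℝ) 1 • ((↑) '' s : Set E3)) := by
    ext x
    simp only [Set.mem_smul, Set.mem_neg, mem_image, mem_preimage]
    constructor
    · rintro ⟨r, hr, y, ⟨ω, hω, rfl⟩, rfl⟩
      exact ⟨r, hr, _, ⟨-ω, hω, rfl⟩, by simp⟩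
    · rintro ⟨r, hr, y, ⟨ω, hω, rfl⟩, h⟩
      refine ⟨r, hr, _, ⟨-ω, by simpa using hω, rfl⟩, ?_⟩
      simp [h]
  rw [this, Measure.measure_neg]

/-- The measure `dv du dω`. -/
def tripleMeasure : Measure (E3 × E3 × S2) := (volume : Measure E3).prod collisionMeasure

instance : SigmaFinite tripleMeasure := by unfold tripleMeasure; infer_instance

/-- An involution has determinant ±1. This replaces the computation of the Jacobian of the collision
map at fixed ω. -/
lemma measurePreserving_of_involutive_linear (f : (E3 × E3) →ₗ[ℝ] (E3 × E3))
    (hf : ∀ p, f (f p) = p) :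
    MeasurePreserving f ((volume : Measure E3).prod volume) ((volume : Measure E3).prod volume) := by
  have hd : LinearMap.det f * LinearMap.det f = 1 := by
    rw [← LinearMap.det_comp]
    have : f ∘ₗ f = LinearMap.id := LinearMap.ext hf
    rw [this, LinearMap.det_id]
  have hd0 : LinearMap.det f ≠ 0 := fun h => by simp [h] at hd
  refine ⟨f.continuous_of_finiteDimensional.measurable, ?_⟩
  rw [Measure.map_linearMap_addHaar_eq_smul_addHaar _ hd0]
  have : |(LinearMap.det f)⁻¹| = 1 := by
    rw [abs_inv, inv_eq_one]
    have := mul_self_eq_one_iff.1 hd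
    rcases this with h | h <;> simp [h]
  simp [this]

lemma measurePreserving_triple_of_skew (g : S2 → (E3 × E3) → (E3 × E3))
    (hgm : Measurable (Function.uncurry g))
    (hg : ∀ ω, MeasurePreserving (g ω) ((volume : Measure E3).prod volume)
      ((volume : Measure E3).prod volume)) :
    MeasurePreserving
      (fun p : E3 × E3 × S2 => ((g p.2.2 (p.1, p.2.1)).1, (g p.2.2 (p.1, p.2.1)).2, -p.2.2))
      tripleMeasure tripleMeasure := by
  have h1 := MeasurePreserving.skew_product (μa := sphereMeasure) (μb := sphereMeasure)
    (μc := (volume : Measure E3).prod volume) (μd := (volume : Measure E3).prod volume)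
    measurePreserving_neg_sphere hgm (Filter.Eventually.of_forall fun ω => (hg ω).map_eq)
  have ha := measurePreserving_prodAssoc (volume : Measure E3) (volume : Measure E3) sphereMeasure
  have hs := Measure.measurePreserving_swap (μ := (volume : Measure E3).prod (volume : Measure E3))
    (ν := sphereMeasure)
  have hs' := Measure.measurePreserving_swap (ν := (volume : Measure E3).prod (volume : Measure E3))
    (μ := sphereMeasure)
  exact (ha.comp hs').comp (h1.comp (hs.comp (ha.symm _)))

/-- The pre-post collisional change of variables. -/
def collide (p : E3 × E3 × S2) : E3 × E3 × S2 :=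
  (postV p.1 p.2.1 p.2.2, postU p.1 p.2.1 p.2.2, -p.2.2)

/-- The exchange of the two particles. -/
def exchange (p : E3 × E3 × S2) : E3 × E3 × S2 := (p.2.1, p.1, -p.2.2)

lemma continuous_postV : Continuous (fun p : E3 × E3 × S2 => postV p.1 p.2.1 p.2.2) := by
  unfold postV; fun_prop

lemma continuous_postU : Continuous (fun p : E3 × E3 × S2 => postU p.1 p.2.1 p.2.2) := by
  unfold postU; fun_prop

lemma measurePreserving_exchange : MeasurePreserving exchange tripleMeasure tripleMeasure :=
  measurePreserving_triple_of_skew (fun _ p => p.swap) (by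
    exact measurable_swap.comp measurable_snd) fun _ => Measure.measurePreserving_swap

lemma measurePreserving_collide : MeasurePreserving collide tripleMeasure tripleMeasure := by
  refine measurePreserving_triple_of_skew (fun ω p => (postV p.1 p.2 ω, postU p.1 p.2 ω)) ?_ ?_
  · refine Continuous.measurable ?_
    unfold postU postV Function.uncurry; fun_prop
  · intro ω
    let f : (E3 × E3) →ₗ[ℝ] (E3 × E3) :=
      { toFun := fun p => (postV p.1 p.2 ω, postU p.1 p.2 ω)
        map_add' := by
          intro p q
          ext i <;> simp [postV, postU, inner_sub_left, inner_add_left] <;> ring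
        map_smul' := by
          intro c p
          ext i <;> simp [postV, postU, inner_sub_left, inner_smul_left] <;> ring }
    refine measurePreserving_of_involutive_linear f fun p => ?_
    have h1 := postV_post p.1 p.2 ω
    have h2 := postU_post p.1 p.2 ω
    have e1 : ∀ x y : E3, postV x y (-ω) = postV x y ω := fun x y => by simp [postV]
    have e2 : ∀ x y : E3, postU x y (-ω) = postU x y ω := fun x y => by simp [postU]
    rw [e1] at h1
    rw [e2] at h2
    exact Prod.ext h1 h2

/-! ### An angular integral -/

/-- Polar coordinates in the unit ball: `G` dominates `g` along each ray, and 3 is the reciprocal of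
∫₀¹ r² dr. -/
lemma lintegral_sphere_le {g : S2 → ℝ≥0∞} {G : E3 → ℝ≥0∞} (hg : Measurable g)
    (h : ∀ (ω : S2) (r : ℝ), 0 < r → r < 1 → g ω ≤ G (r • (ω : E3))) :
    ∫⁻ ω, g ω ∂sphereMeasure ≤ 3 * ∫⁻ x in Metric.ball (0 : E3) 1, G x := by
  have hmp := (volume : Measure E3).measurePreserving_homeomorphUnitSphereProd
  have hF : Measurable (fun p : S2 × Ioi (0 : ℝ) =>
      g p.1 * (Iio (⟨1, mem_Ioi.2 one_pos⟩ : Ioi (0 : ℝ))).indicator 1 p.2) :=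
    (hg.comp measurable_fst).mul
      ((measurable_one.indicator measurableSet_Iio).comp measurable_snd)
  have h1 := hmp.lintegral_comp hF
  rw [lintegral_prod_mul hg.aemeasurable
    (measurable_one.indicator measurableSet_Iio).aemeasurable,
    lintegral_indicator_one measurableSet_Iio, Measure.volumeIoiPow_apply_Iio] at h1
  simp only [finrank_euclideanSpace, Fintype.card_fin, one_pow] at h1
  have h2 : ENNReal.ofReal (1 / (((3 - 1 : ℕ) : ℝ) + 1)) = 3⁻¹ := by
    rw [one_div, ENNReal.ofReal_inv_of_pos (by norm_num)]; norm_num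
  rw [h2] at h1
  have h3 : ∫⁻ ω, g ω ∂sphereMeasure = 3 * ((∫⁻ ω, g ω ∂sphereMeasure) * 3⁻¹) := by
    rw [mul_comm, mul_assoc, ENNReal.inv_mul_cancel (by norm_num) (by norm_num), mul_one]
  rw [h3]
  gcongr
  rw [show (∫⁻ ω, g ω ∂sphereMeasure) * 3⁻¹ = _ from h1.symm]
  calc _ ≤ ∫⁻ x : ({0}ᶜ : Set E3), (Metric.ball (0 : E3) 1).indicator G x
        ∂((volume : Measure E3).comap (↑)) := by
        refine lintegral_mono fun x => ?_
        have hx : (x : E3) ≠ 0 := x.2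
        by_cases hx1 : ‖(x : E3)‖ < 1
        · rw [indicator_of_mem (by rw [mem_Iio, ← Subtype.coe_lt_coe]; simpa using hx1), indicator_of_mem]
          · have := h ((homeomorphUnitSphereProd E3 x).1) ‖(x : E3)‖ (norm_pos_iff.2 hx) hx1
            simp only [Pi.one_apply, mul_one]
            convert this using 2
            simp [smul_smul, hx]
          · simpa using hx1
        · rw [indicator_of_notMem (s := Iio _)]
          · simp
          · rw [mem_Iio, ← Subtype.coe_lt_coe]; simpa using hx1
    _ = ∫⁻ x in ({0}ᶜ : Set E3), (Metric.ball (0 : E3) 1).indicator G x :=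
        lintegral_subtype_comap (measurableSet_singleton _).compl _
    _ ≤ _ := by
        rw [← lintegral_indicator Metric.isOpen_ball.measurableSet]
        exact setLIntegral_le_lintegral _ _

lemma integrable_inv_sqrt_abs :
    Integrable ((Metric.ball (0 : ℝ) 1).indicator fun t : ℝ => (Real.sqrt ‖t‖)⁻¹) := by
  rw [integrable_indicator_iff Metric.isOpen_ball.measurableSet]
  rw [integrableOn_fun_norm_addHaar volume (E := ℝ) (f := fun t => (Real.sqrt t)⁻¹)]
  have := (intervalIntegral.integrableOn_Ioo_rpow_iff (s := -(1 / 2)) one_pos).2 (by norm_num)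
  refine this.congr_fun (fun t ht => ?_) measurableSet_Ioo
  simp only [Module.finrank_self, tsub_self, pow_zero, one_smul]
  rw [Real.rpow_neg ht.1.le, Real.sqrt_eq_rpow]

/-- The component of `x` orthogonal to the unit vector `e`. -/
def perp (e x : E3) : E3 := x - (inner ℝ x e) • e

lemma norm_perp_sq {e : E3} (he : ‖e‖ = 1) (x : E3) :
    ‖perp e x‖ ^ 2 = ‖x‖ ^ 2 - (inner ℝ x e) ^ 2 := by
  unfold perp
  rw [norm_sub_sq_real, inner_smul_right, norm_smul, he]
  simp; ring

/-- In an orthonormal basis starting with `e`, the orthogonal part satisfies |perp|² = c₁² + c₂² ≥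
|c₁| |c₂|. Hence 1 / |perp| is at most |c₁|^(−1/2) |c₂|^(−1/2), a product of integrable functions of
one variable on the cube containing the ball. Rotation invariance makes the bound uniform in `e`. -/
lemma exists_lintegral_ball_perp_le :
    ∃ C : ℝ≥0∞, C ≠ ∞ ∧ ∀ e : E3, ‖e‖ = 1 →
      ∫⁻ x in Metric.ball (0 : E3) 1, (ENNReal.ofReal ‖perp e x‖)⁻¹ ≤ C := by
  let f : Fin 3 → ℝ → ℝ := ![(Metric.ball (0 : ℝ) 1).indicator 1,
    (Metric.ball (0 : ℝ) 1).indicator fun t : ℝ => (Real.sqrt ‖t‖)⁻¹,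
    (Metric.ball (0 : ℝ) 1).indicator fun t : ℝ => (Real.sqrt ‖t‖)⁻¹]
  have hf : ∀ i, Integrable (f i) := by
    intro i
    fin_cases i
    · exact (integrable_indicator_iff Metric.isOpen_ball.measurableSet).2
        (integrableOn_const measure_ball_lt_top.ne)
    · exact integrable_inv_sqrt_abs
    · exact integrable_inv_sqrt_abs
  have hint : Integrable (fun x : Fin 3 → ℝ => ∏ i, f i (x i)) := Integrable.fintype_prod hf
  refine ⟨∫⁻ x : Fin 3 → ℝ, ENNReal.ofReal (∏ i, f i (x i)), ?_, fun e he => ?_⟩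
  · exact hint.lintegral_lt_top.ne
  obtain ⟨b, hb⟩ := Orthonormal.exists_orthonormalBasis_extension_of_card_eq (𝕜 := ℝ)
    (E := E3) (ι := Fin 3) (by simp) (v := fun _ => e) (s := {0}) (by
      refine ⟨fun i => he, fun i j hij => ?_⟩
      exact absurd (Subsingleton.elim i j) hij)
  have hb0 : b 0 = e := hb 0 rfl
  have hmp : MeasurePreserving (fun x : E3 => (b.repr x).ofLp) volume volume :=
    (PiLp.volume_preserving_ofLp (Fin 3)).comp b.measurePreserving_repr
  have hmeas : Measurable (fun x : Fin 3 → ℝ => ENNReal.ofReal (∏ i, f i (x i))) := by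
    refine ENNReal.measurable_ofReal.comp (Finset.measurable_prod _ fun i _ => ?_)
    have hfi : Measurable (f i) := by
      fin_cases i
      · exact measurable_one.indicator Metric.isOpen_ball.measurableSet
      · exact (by fun_prop : Measurable fun t : ℝ => (Real.sqrt ‖t‖)⁻¹).indicator
          Metric.isOpen_ball.measurableSet
      · exact (by fun_prop : Measurable fun t : ℝ => (Real.sqrt ‖t‖)⁻¹).indicator
          Metric.isOpen_ball.measurableSet
    exact hfi.comp (measurable_pi_apply i)
  rw [← hmp.lintegral_comp hmeas, ← lintegral_indicator Metric.isOpen_ball.measurableSet]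
  have hz : ∀ i : Fin 3, ∀ᵐ x : E3, (b.repr x).ofLp i ≠ 0 := by
    intro i
    have : ∀ᵐ y : Fin 3 → ℝ, y i ≠ 0 := by
      have := Measure.pi_hyperplane (fun _ : Fin 3 => (volume : Measure ℝ)) i 0
      rw [ae_iff]
      simpa [volume_pi] using this
    exact hmp.quasiMeasurePreserving.ae this
  refine lintegral_mono_ae ?_
  filter_upwards [hz 1, hz 2] with x h1 h2
  by_cases hx : x ∈ Metric.ball (0 : E3) 1
  swap
  · rw [indicator_of_notMem hx]; exact zero_le
  rw [indicator_of_mem hx]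
  have hx1 : ‖x‖ < 1 := by simpa using hx
  set c := (b.repr x).ofLp with hc
  have hn : ‖x‖ ^ 2 = c 0 ^ 2 + c 1 ^ 2 + c 2 ^ 2 := by
    rw [← b.repr.norm_map x, EuclideanSpace.real_norm_sq_eq, Fin.sum_univ_three]
  have hc0 : inner ℝ x e = c 0 := by
    rw [← hb0, real_inner_comm, hc]; exact (b.repr_apply_apply x 0).symm
  have hlt : ∀ i, c i ∈ Metric.ball (0 : ℝ) 1 := by
    intro i
    rw [mem_ball_zero_iff, Real.norm_eq_abs, ← sq_lt_one_iff_abs_lt_one]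
    have : c i ^ 2 ≤ ‖x‖ ^ 2 := by
      rw [hn]; fin_cases i <;> simp <;> nlinarith [sq_nonneg (c 0), sq_nonneg (c 1), sq_nonneg (c 2)]
    nlinarith [norm_nonneg x]
  have hprod : ∏ i, f i (c i) = (Real.sqrt ‖c 1‖)⁻¹ * (Real.sqrt ‖c 2‖)⁻¹ := by
    rw [Fin.prod_univ_three]
    simp only [f, Matrix.cons_val_zero, Matrix.cons_val_one, Matrix.cons_val]
    rw [indicator_of_mem (hlt 0), indicator_of_mem (hlt 1), indicator_of_mem (hlt 2)]
    simp
  rw [hprod]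
  have hp : ‖perp e x‖ ^ 2 = c 1 ^ 2 + c 2 ^ 2 := by
    rw [norm_perp_sq he, hn, hc0]; ring
  have h12 : 0 < ‖c 1‖ * ‖c 2‖ := mul_pos (norm_pos_iff.2 h1) (norm_pos_iff.2 h2)
  have hle : Real.sqrt (‖c 1‖ * ‖c 2‖) ≤ ‖perp e x‖ := by
    rw [Real.sqrt_le_left (norm_nonneg _), hp]
    simp only [Real.norm_eq_abs]
    nlinarith [sq_nonneg (|c 1| - |c 2|), sq_abs (c 1), sq_abs (c 2), sq_nonneg (c 1), sq_nonneg (c 2)]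
  have hs : 0 < Real.sqrt (‖c 1‖ * ‖c 2‖) := Real.sqrt_pos.2 h12
  rw [← ENNReal.ofReal_inv_of_pos (hs.trans_le hle), ← mul_inv, ← Real.sqrt_mul (norm_nonneg _)]
  exact ENNReal.ofReal_le_ofReal (inv_anti₀ hs hle)

/-- Uniform bound of `∫ 1 / sin` over the sphere. -/
lemma exists_lintegral_sphere_perp_le :
    ∃ C : ℝ≥0∞, C ≠ ∞ ∧ ∀ e : E3, ‖e‖ = 1 →
      ∫⁻ ω : S2, (ENNReal.ofReal ‖perp e ω‖)⁻¹ ∂sphereMeasure ≤ C := by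
  obtain ⟨C, hC, h⟩ := exists_lintegral_ball_perp_le
  refine ⟨3 * C, ENNReal.mul_ne_top (by norm_num) hC, fun e he => ?_⟩
  have hm : Measurable (fun x : E3 => (ENNReal.ofReal ‖perp e x‖)⁻¹) := by
    unfold perp; fun_prop
  refine (lintegral_sphere_le (G := fun x => (ENNReal.ofReal ‖perp e x‖)⁻¹)
    (hm.comp measurable_subtype_coe) fun ω r hr hr1 => ?_).trans (mul_le_mul_right (h e he) 3)
  -- The orthogonal part is homogeneous of degree one, so moving inwards along a ray only increases
  -- its reciprocal.
  refine ENNReal.inv_le_inv.2 ?_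
  refine ENNReal.ofReal_le_ofReal ?_
  have : perp e (r • (ω : E3)) = r • perp e ω := by
    unfold perp; rw [inner_smul_left, smul_sub, smul_smul]; simp
  rw [this, norm_smul, Real.norm_of_nonneg hr.le]
  exact mul_le_of_le_one_left (norm_nonneg _) hr1.le

/-! ### Integrals of the kernel against Gaussians -/

lemma integrable_ball_rpow {γ : ℝ} (hγ : -3 < γ) :
    Integrable ((Metric.ball (0 : E3) 1).indicator fun z => ‖z‖ ^ γ) := by
  rw [integrable_indicator_iff Metric.isOpen_ball.measurableSet]
  rw [integrableOn_fun_norm_addHaar volume (E := E3) (f := fun t => t ^ γ)]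
  have := (intervalIntegral.integrableOn_Ioo_rpow_iff (s := γ + 2) one_pos).2 (by linarith)
  refine this.congr_fun (fun t ht => ?_) measurableSet_Ioo
  simp only [finrank_euclideanSpace, Fintype.card_fin, smul_eq_mul]
  rw [Real.rpow_add ht.1, mul_comm]; norm_num

lemma integrable_jap_pow_mul_exp (n : ℕ) {c : ℝ} (hc : 0 < c) :
    Integrable (fun v : E3 => jap v ^ n * Real.exp (-(c * ‖v‖ ^ 2))) := by
  obtain ⟨C, hC, h⟩ := exists_jap_pow_mul_exp_le (n + 4) c hc
  have hi := integrable_rpow_neg_one_add_norm_sq (E := E3) (μ := volume) (r := 4)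
    (by simp; norm_num)
  refine (hi.const_mul C).mono' ?_ (Filter.Eventually.of_forall fun v => ?_)
  · have := continuous_jap
    exact (by fun_prop : Continuous fun v : E3 => jap v ^ n * Real.exp (-(c * ‖v‖ ^ 2))).aestronglyMeasurable
  · have hj := jap_pos v
    rw [Real.norm_of_nonneg (by positivity)]
    have : ((1 + ‖v‖ ^ 2) ^ (-4 / 2 : ℝ)) = (jap v ^ 4)⁻¹ := by
      rw [show jap v ^ 4 = (jap v ^ 2) ^ 2 by ring, jap_sq]
      rw [show (-4 / 2 : ℝ) = -((2 : ℕ) : ℝ) by norm_num, Real.rpow_neg (by positivity),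
        Real.rpow_natCast]
    rw [this, ← div_eq_mul_inv, le_div_iff₀ (by positivity)]
    calc _ = jap v ^ (n + 4) * Real.exp (-(c * ‖v‖ ^ 2)) := by ring
      _ ≤ C := h v

lemma measurable_jap_pow_mul_exp (n : ℕ) (c : ℝ) :
    Measurable (fun v : E3 => jap v ^ n * Real.exp (-(c * ‖v‖ ^ 2))) := by
  have := measurable_jap
  fun_prop

/-- Separates the local singularity, integrable for γ > −3, from growth that is at most linear. -/
lemma rpow_le_indicator_add {γ : ℝ} (hγ1 : γ ≤ 1) (z : E3) :
    ‖z‖ ^ γ ≤ (Metric.ball (0 : E3) 1).indicator (fun z => ‖z‖ ^ γ) z + ‖z‖ := by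
  by_cases hz : z ∈ Metric.ball (0 : E3) 1
  · rw [indicator_of_mem hz]; linarith [norm_nonneg z]
  · rw [indicator_of_notMem hz, zero_add]
    have : 1 ≤ ‖z‖ := by simpa using hz
    simpa using Real.rpow_le_rpow_of_exponent_le this hγ1

lemma integrable_of_lintegral_le {α : Type*} [MeasurableSpace α] {μ : Measure α} {f : α → ℝ}
    (hf : Measurable f) (h0 : ∀ x, 0 ≤ f x) {C : ℝ≥0∞} (hC : C ≠ ∞)
    (h : ∫⁻ x, ENNReal.ofReal (f x) ∂μ ≤ C) : Integrable f μ ∧ ∫ x, f x ∂μ ≤ C.toReal := by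
  have hi : Integrable f μ := by
    refine ⟨hf.aestronglyMeasurable, ?_⟩
    rw [hasFiniteIntegral_iff_ofReal (Filter.Eventually.of_forall h0)]
    exact h.trans_lt hC.lt_top
  refine ⟨hi, ?_⟩
  rw [integral_eq_lintegral_of_nonneg_ae (Filter.Eventually.of_forall h0) hf.aestronglyMeasurable]
  exact ENNReal.toReal_mono hC h

lemma lintegral_collision_fst {φ : E3 → ℝ≥0∞} (hφ : Measurable φ) :
    ∫⁻ p, φ p.1 ∂collisionMeasure = (∫⁻ u, φ u) * sphereMeasure univ := by
  unfold collisionMeasure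
  rw [lintegral_prod (fun p : E3 × S2 => φ p.1) (hφ.comp measurable_fst).aemeasurable]
  simp only [lintegral_const]
  rw [lintegral_mul_const _ hφ]

/-- `∫∫ |v - u|^γ J(u)^n exp(-c|u|²) du dω ≤ C J(v)`. -/
lemma exists_integral_rpow_mul_gaussian_le {γ : ℝ} (hγ : -3 < γ) (hγ1 : γ ≤ 1) (n : ℕ) {c : ℝ}
    (hc : 0 < c) : ∃ C : ℝ, 0 ≤ C ∧ ∀ v : E3,
      Integrable (fun p : E3 × S2 =>
        ‖v - p.1‖ ^ γ * (jap p.1 ^ n * Real.exp (-(c * ‖p.1‖ ^ 2)))) collisionMeasure ∧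
      ∫ p : E3 × S2, ‖v - p.1‖ ^ γ * (jap p.1 ^ n * Real.exp (-(c * ‖p.1‖ ^ 2)))
        ∂collisionMeasure ≤ C * jap v := by
  obtain ⟨A, hA, hAb⟩ := exists_jap_pow_mul_exp_le n c hc
  let I : E3 → ℝ := (Metric.ball (0 : E3) 1).indicator fun z => ‖z‖ ^ γ
  have hI : Integrable I := integrable_ball_rpow hγ
  have hI0 : ∀ z, 0 ≤ I z := fun z => indicator_nonneg (fun _ _ => by positivity) z
  let g : E3 → ℝ := fun u => jap u ^ (n + 1) * Real.exp (-(c * ‖u‖ ^ 2))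
  have hg : Integrable g := integrable_jap_pow_mul_exp (n + 1) hc
  have hIm : Measurable I := (by fun_prop : Measurable fun z : E3 => ‖z‖ ^ γ).indicator
    Metric.isOpen_ball.measurableSet
  have hgm : Measurable g := measurable_jap_pow_mul_exp (n + 1) c
  have hg0 : ∀ u, 0 ≤ g u := fun u => by have := jap_pos u; positivity
  let S : ℝ := (sphereMeasure univ).toReal
  refine ⟨(A * ∫ z, I z) * S + (2 * ∫ u, g u) * S, ?_, fun v => ?_⟩
  · have := integral_nonneg (μ := volume) (f := I) hI0
    have := integral_nonneg (μ := volume) (f := g) hg0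
    positivity
  have hmaj : Integrable (fun p : E3 × S2 => A * I (v - p.1) + 2 * jap v * g p.1)
      collisionMeasure := by
    have h : Integrable (fun u => A * I (v - u) + 2 * jap v * g u) :=
      ((hI.comp_sub_left v).const_mul A).add (hg.const_mul _)
    exact h.comp_fst sphereMeasure
  have hle : ∀ p : E3 × S2, ‖v - p.1‖ ^ γ * (jap p.1 ^ n * Real.exp (-(c * ‖p.1‖ ^ 2))) ≤
      A * I (v - p.1) + 2 * jap v * g p.1 := by
    intro p
    have h1 := rpow_le_indicator_add hγ1 (v - p.1)
    have h2 := hAb p.1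
    have h3 : ‖v - p.1‖ ≤ 2 * jap v * jap p.1 := by
      have := norm_sub_le v p.1
      nlinarith [norm_le_jap v, norm_le_jap p.1, one_le_jap v, one_le_jap p.1]
    have hj := jap_pos p.1
    have hpos : 0 ≤ jap p.1 ^ n * Real.exp (-(c * ‖p.1‖ ^ 2)) := by positivity
    calc _ ≤ (I (v - p.1) + 2 * jap v * jap p.1) *
          (jap p.1 ^ n * Real.exp (-(c * ‖p.1‖ ^ 2))) := by
          gcongr; exact h1.trans (by simp only [I]; gcongr)
      _ = I (v - p.1) * (jap p.1 ^ n * Real.exp (-(c * ‖p.1‖ ^ 2))) + 2 * jap v * g p.1 := by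
          simp only [g]; ring
      _ ≤ _ := by
          have := mul_le_mul_of_nonneg_left h2 (hI0 (v - p.1))
          linarith
  have hnn : ∀ p : E3 × S2,
      0 ≤ ‖v - p.1‖ ^ γ * (jap p.1 ^ n * Real.exp (-(c * ‖p.1‖ ^ 2))) := fun p => by
    have hj := jap_pos p.1; positivity
  have hint : Integrable (fun p : E3 × S2 =>
        ‖v - p.1‖ ^ γ * (jap p.1 ^ n * Real.exp (-(c * ‖p.1‖ ^ 2)))) collisionMeasure := by
    refine hmaj.mono' ?_ (Filter.Eventually.of_forall fun p => ?_)
    · have := measurable_jap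
      exact (by fun_prop : Measurable fun p : E3 × S2 =>
        ‖v - p.1‖ ^ γ * (jap p.1 ^ n * Real.exp (-(c * ‖p.1‖ ^ 2)))).aestronglyMeasurable
    · rw [Real.norm_of_nonneg (hnn p)]; exact hle p
  refine ⟨hint, (integral_mono hint hmaj hle).trans ?_⟩
  have e1 : ∫ p : E3 × S2, (A * I (v - p.1) + 2 * jap v * g p.1) ∂collisionMeasure =
      ∫ u, (∫ _ω : S2, (A * I (v - u) + 2 * jap v * g u) ∂sphereMeasure) :=
    integral_prod _ hmaj
  rw [e1]
  simp only [integral_const, smul_eq_mul]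
  rw [integral_const_mul, integral_add ((hI.comp_sub_left v).const_mul A) (hg.const_mul _),
    integral_const_mul, integral_const_mul, integral_sub_left_eq_self I volume v]
  have hS : sphereMeasure.real univ = S := rfl
  rw [hS]
  have hIp := integral_nonneg (μ := volume) (f := I) hI0
  have hj := one_le_jap v
  have : 0 ≤ (A * ∫ z, I z) * S := by positivity
  nlinarith

/-- The reciprocal of the sine of the angle between `z` and `ω`, with value `∞` at `0` and `π`. -/
def recipSin (z : E3) (ω : S2) : ℝ≥0∞ := (ENNReal.ofReal ‖perp (‖z‖⁻¹ • z) ω‖)⁻¹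

lemma Measurable.recipSin {α : Type*} [MeasurableSpace α] {f : α → E3} {g : α → S2}
    (hf : Measurable f) (hg : Measurable g) : Measurable fun x => recipSin (f x) (g x) := by
  unfold Boltzmann.recipSin perp
  fun_prop

lemma exists_lintegral_recipSin_le :
    ∃ C : ℝ≥0∞, C ≠ ∞ ∧ ∀ z : E3, ∫⁻ ω, recipSin z ω ∂sphereMeasure ≤ C := by
  obtain ⟨C, hC, h⟩ := exists_lintegral_sphere_perp_le
  refine ⟨C + sphereMeasure univ, ENNReal.add_ne_top.2 ⟨hC, measure_ne_top _ _⟩, fun z => ?_⟩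
  by_cases hz : z = 0
  · refine le_trans (le_of_eq ?_) le_add_self
    simp [recipSin, hz, perp]
  · refine le_trans (h _ ?_) le_self_add
    rw [norm_smul, norm_inv, norm_norm, inv_mul_cancel₀ (norm_ne_zero_iff.2 hz)]

lemma norm_mul_cos_angle (z : E3) (ω : S2) :
    ‖z‖ * Real.cos (InnerProductGeometry.angle z (ω : E3)) = inner ℝ z (ω : E3) := by
  have h := InnerProductGeometry.cos_angle_mul_norm_mul_norm z (ω : E3)
  rw [norm_eq_of_mem_sphere, mul_one] at h
  rw [mul_comm]; exact h

/-- The vector v' − u is the part of v − u orthogonal to ω. Its length is |v − u| sin θ, and the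
sine is symmetric in the two directions, so it may be read off from ω relative to the direction of v
− u, as `recipSin` does. -/
lemma norm_postV_sub (v u : E3) (ω : S2) (h : v ≠ u) :
    ‖postV v u ω - u‖ = ‖v - u‖ * ‖perp (‖v - u‖⁻¹ • (v - u)) ω‖ := by
  have hz : ‖v - u‖ ≠ 0 := norm_ne_zero_iff.2 (sub_ne_zero.2 h)
  have hω : ‖(ω : E3)‖ = 1 := norm_eq_of_mem_sphere ω
  rw [← sq_eq_sq₀ (norm_nonneg _) (by positivity), mul_pow, norm_perp_sq (by
    rw [norm_smul, norm_inv, norm_norm, inv_mul_cancel₀ hz])]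
  have : postV v u ω - u = perp ω (v - u) := by unfold postV perp; abel
  rw [this, norm_perp_sq hω, hω, inner_smul_right, real_inner_comm]
  field_simp

/-- `∫∫ |v - u|^γ |cos θ| √μ(u) J(u)^n (1 / J(u') + 1 / J(v')) du dω ≤ C`. -/
lemma exists_integral_gain_le {γ : ℝ} (hγ : -3 < γ) (hγ1 : γ ≤ 1) (n : ℕ) :
    ∃ C : ℝ, 0 ≤ C ∧ ∀ v : E3,
      Integrable (fun p : E3 × S2 =>
        ‖v - p.1‖ ^ γ * |Real.cos (InnerProductGeometry.angle (v - p.1) (p.2 : E3))| *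
          (sqrtM p.1 * jap p.1 ^ n * ((jap (postU v p.1 p.2))⁻¹ + (jap (postV v p.1 p.2))⁻¹)))
        collisionMeasure ∧
      ∫ p : E3 × S2,
        ‖v - p.1‖ ^ γ * |Real.cos (InnerProductGeometry.angle (v - p.1) (p.2 : E3))| *
          (sqrtM p.1 * jap p.1 ^ n * ((jap (postU v p.1 p.2))⁻¹ + (jap (postV v p.1 p.2))⁻¹))
        ∂collisionMeasure ≤ C := by
  obtain ⟨A, hA, hAb⟩ := exists_sqrtM_mul_jap_pow_le n
  obtain ⟨B, hB, hBb⟩ := exists_lintegral_recipSin_le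
  let I : E3 → ℝ := (Metric.ball (0 : E3) 1).indicator fun z => ‖z‖ ^ γ
  have hI : Integrable I := integrable_ball_rpow hγ
  have hI0 : ∀ z, 0 ≤ I z := fun z => indicator_nonneg (fun _ _ => by positivity) z
  have hIm : Measurable I := (by fun_prop : Measurable fun z : E3 => ‖z‖ ^ γ).indicator
    Metric.isOpen_ball.measurableSet
  let g : E3 → ℝ := fun u => 2 * (jap u ^ (n + 1) * Real.exp (-(1 / 4 * ‖u‖ ^ 2)))
  have hg : Integrable g := (integrable_jap_pow_mul_exp (n + 1) (by norm_num)).const_mul 2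
  have hgm : Measurable g := (measurable_jap_pow_mul_exp (n + 1) (1 / 4)).const_mul 2
  let C : ℝ≥0∞ := (∫⁻ z, ENNReal.ofReal (2 * A * I z)) * sphereMeasure univ +
    (∫⁻ u, ENNReal.ofReal (g u)) * (sphereMeasure univ + B)
  have hC : C ≠ ∞ := by
    refine ENNReal.add_ne_top.2 ⟨ENNReal.mul_ne_top ?_ (measure_ne_top _ _), ENNReal.mul_ne_top ?_
      (ENNReal.add_ne_top.2 ⟨measure_ne_top _ _, hB⟩)⟩
    · exact (hI.const_mul _).lintegral_lt_top.ne
    · exact hg.lintegral_lt_top.ne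
  refine ⟨C.toReal, ENNReal.toReal_nonneg, fun v => ?_⟩
  have hcU : Continuous fun p : E3 × S2 => postU v p.1 p.2 := by unfold postU; fun_prop
  have hcV : Continuous fun p : E3 × S2 => postV v p.1 p.2 := by unfold postV; fun_prop
  have hang : Measurable fun p : E3 × S2 =>
      InnerProductGeometry.angle (v - p.1) (p.2 : E3) := by
    unfold InnerProductGeometry.angle; fun_prop
  refine integrable_of_lintegral_le ?_ (fun p => ?_) hC ?_
  · have := measurable_jap
    have := measurable_sqrtM
    have := hcU.measurable
    have := hcV.measurable
    fun_prop
  · have := jap_pos p.1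
    have := jap_pos (postU v p.1 p.2)
    have := jap_pos (postV v p.1 p.2)
    have := sqrtM_pos p.1
    positivity
  calc _ ≤ ∫⁻ p : E3 × S2, (ENNReal.ofReal (2 * A * I (v - p.1)) +
        ENNReal.ofReal (g p.1) * (1 + recipSin (v - p.1) p.2)) ∂collisionMeasure := by
        refine lintegral_mono fun p => ?_
        obtain ⟨u, ω⟩ := p
        simp only
        by_cases hvu : v = u
        · simp [hvu]
        have ju := one_le_jap u
        have jU := one_le_jap (postU v u ω)
        have jV := one_le_jap (postV v u ω)
        have hm := sqrtM_pos u
        have iU : (jap (postU v u ω))⁻¹ ≤ 1 := inv_le_one_of_one_le₀ jU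
        have iV : (jap (postV v u ω))⁻¹ ≤ 1 := inv_le_one_of_one_le₀ jV
        have iU0 : 0 < (jap (postU v u ω))⁻¹ := inv_pos.2 (jap_pos _)
        have iV0 : 0 < (jap (postV v u ω))⁻¹ := inv_pos.2 (jap_pos _)
        have hcos : |Real.cos (InnerProductGeometry.angle (v - u) (ω : E3))| ≤ 1 :=
          Real.abs_cos_le_one _
        -- Near the singularity the reciprocals and the cosine are bounded by 1, and only
        -- integrability of |z|^γ is used.
        by_cases hz : v - u ∈ Metric.ball (0 : E3) 1
        · refine le_trans (ENNReal.ofReal_le_ofReal ?_) le_self_add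
          simp only [I]
          rw [indicator_of_mem hz]
          have hr : 0 ≤ ‖v - u‖ ^ γ := by positivity
          calc _ ≤ ‖v - u‖ ^ γ * 1 * (A * (1 + 1)) := by
                gcongr; exact hAb u
            _ = _ := by ring
        · refine le_trans ?_ le_add_self
          have hz1 : 1 ≤ ‖v - u‖ := by simpa using hz
          set σ := ‖perp (‖v - u‖⁻¹ • (v - u)) ω‖ with hσ
          have hmu : sqrtM u * jap u ^ n * (2 * jap u) ≤ g u := by
            have h1 : sqrtM u ≤ Real.exp (-(1 / 4 * ‖u‖ ^ 2)) :=
              (sqrtM_le u).trans_eq (by congr 1; ring)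
            simp only [g]
            calc _ = 2 * (jap u ^ (n + 1) * sqrtM u) := by ring
              _ ≤ _ := by gcongr
          have hX : ‖v - u‖ ^ γ * |Real.cos (InnerProductGeometry.angle (v - u) (ω : E3))| ≤
              |inner ℝ (v - u) (ω : E3)| := by
            rw [← norm_mul_cos_angle, abs_mul, abs_norm]
            gcongr
            simpa using Real.rpow_le_rpow_of_exponent_le hz1 hγ1
          -- The component of v − u along ω is the displacement u' − u, so division by J(u') leaves
          -- only a power of J(u), absorbed by √μ(u).
          have hX1 : |inner ℝ (v - u) (ω : E3)| * (jap (postU v u ω))⁻¹ ≤ 2 * jap u := by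
            rw [← div_eq_mul_inv, div_le_iff₀ (jap_pos _)]
            have h1 : |inner ℝ (v - u) (ω : E3)| = ‖postU v u ω - u‖ := by
              unfold postU
              rw [add_sub_cancel_left, norm_smul, norm_eq_of_mem_sphere, mul_one, Real.norm_eq_abs]
            rw [h1]
            have := norm_sub_le (postU v u ω) u
            nlinarith [norm_le_jap u, norm_le_jap (postU v u ω)]
          have hX2 : |inner ℝ (v - u) (ω : E3)| ≤ ‖v - u‖ := by
            have := abs_real_inner_le_norm (v - u) (ω : E3)
            rwa [norm_eq_of_mem_sphere, mul_one] at this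
          -- For the term with 1 / J(v') the growth is traded for 1 / sin θ, through v' − u.
          have hX3 : ‖v - u‖ * σ ≤ 2 * jap u * jap (postV v u ω) := by
            rw [hσ, ← norm_postV_sub v u ω hvu]
            have := norm_sub_le (postV v u ω) u
            nlinarith [norm_le_jap u, norm_le_jap (postV v u ω)]
          have hg0 : 0 < g u := by simp only [g]; positivity
          -- Where the sine vanishes the majorant is ∞; for this reason the estimate is carried out
          -- in `ℝ≥0∞`.
          by_cases hσ0 : σ = 0
          · have : recipSin (v - u) ω = ∞ := by simp [recipSin, ← hσ, hσ0]
            rw [this, add_top, ENNReal.mul_top (by simpa using hg0)]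
            exact le_top
          have hσp : 0 < σ := lt_of_le_of_ne (norm_nonneg _) (Ne.symm hσ0)
          have : recipSin (v - u) ω = ENNReal.ofReal σ⁻¹ := by
            rw [recipSin, ← hσ, ENNReal.ofReal_inv_of_pos hσp]
          rw [this, ← ENNReal.ofReal_one, ← ENNReal.ofReal_add (by norm_num) (by positivity),
            ← ENNReal.ofReal_mul hg0.le]
          refine ENNReal.ofReal_le_ofReal ?_
          have hX4 : |inner ℝ (v - u) (ω : E3)| * (jap (postV v u ω))⁻¹ ≤ 2 * jap u * σ⁻¹ := by
            rw [← div_eq_mul_inv, ← div_eq_mul_inv, div_le_div_iff₀ (jap_pos _) hσp]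
            exact (mul_le_mul_of_nonneg_right hX2 hσp.le).trans hX3
          calc _ ≤ |inner ℝ (v - u) (ω : E3)| * (sqrtM u * jap u ^ n *
                ((jap (postU v u ω))⁻¹ + (jap (postV v u ω))⁻¹)) := by gcongr
            _ = sqrtM u * jap u ^ n * (|inner ℝ (v - u) (ω : E3)| * (jap (postU v u ω))⁻¹ +
                |inner ℝ (v - u) (ω : E3)| * (jap (postV v u ω))⁻¹) := by ring
            _ ≤ sqrtM u * jap u ^ n * (2 * jap u + 2 * jap u * σ⁻¹) := by gcongr
            _ = sqrtM u * jap u ^ n * (2 * jap u) * (1 + σ⁻¹) := by ring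
            _ ≤ _ := by gcongr
    _ = (∫⁻ p : E3 × S2, ENNReal.ofReal (2 * A * I (v - p.1)) ∂collisionMeasure) +
        ∫⁻ p : E3 × S2, ENNReal.ofReal (g p.1) * (1 + recipSin (v - p.1) p.2)
          ∂collisionMeasure := lintegral_add_left (by fun_prop) _
    _ ≤ C := by
        refine add_le_add ?_ ?_
        · rw [lintegral_collision_fst (φ := fun u => ENNReal.ofReal (2 * A * I (v - u)))
            (by fun_prop), lintegral_sub_left_eq_self (fun u => ENNReal.ofReal (2 * A * I u)) v]
        · have hrm : Measurable fun p : E3 × S2 => recipSin (v - p.1) p.2 :=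
            Measurable.recipSin (by fun_prop) measurable_snd
          unfold collisionMeasure
          rw [lintegral_prod _ (by fun_prop), ← lintegral_mul_const _ (by fun_prop)]
          refine lintegral_mono fun u => ?_
          simp only
          have hru : Measurable fun ω : S2 => recipSin (v - u) ω :=
            Measurable.recipSin measurable_const measurable_id
          rw [lintegral_const_mul _ (by fun_prop)]
          gcongr
          rw [lintegral_add_left measurable_const, lintegral_const, one_mul]
          gcongr
          exact hBb _

/-! ### The normalised collision operators -/

lemma measurable_comp₂ {α β δ ε : Type*} [MeasurableSpace α] [MeasurableSpace β]
    [MeasurableSpace δ] [MeasurableSpace ε] {f : α → β → ε}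
    (hf : Measurable fun p : α × β => f p.1 p.2) {g : δ → α} {h : δ → β} (hg : Measurable g)
    (hh : Measurable h) : Measurable fun x => f (g x) (h x) :=
  hf.comp (hg.prodMk hh)

lemma measurable_kernel {γ : ℝ} {b : ℝ → ℝ} (hb : Measurable b) :
    Measurable (fun p : E3 × S2 => kernel γ b p.1 p.2) := by
  unfold kernel InnerProductGeometry.angle
  fun_prop

lemma kernel_nonneg {γ Cb : ℝ} {b : ℝ → ℝ} (hb : IsCutoff Cb b) (z : E3) (ω : S2) :
    0 ≤ kernel γ b z ω :=
  mul_nonneg (by positivity)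
    (hb.nonneg _ ⟨InnerProductGeometry.angle_nonneg _ _, InnerProductGeometry.angle_le_pi _ _⟩)

lemma kernel_le {γ Cb : ℝ} {b : ℝ → ℝ} (hb : IsCutoff Cb b) (z : E3) (ω : S2) :
    kernel γ b z ω ≤
      Cb * (‖z‖ ^ γ * |Real.cos (InnerProductGeometry.angle z (ω : E3))|) := by
  unfold kernel
  have := hb.le _ ⟨InnerProductGeometry.angle_nonneg z (ω : E3),
    InnerProductGeometry.angle_le_pi _ _⟩
  calc _ ≤ ‖z‖ ^ γ * (Cb * |Real.cos (InnerProductGeometry.angle z (ω : E3))|) := by gcongr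
    _ = _ := by ring

/-- The weight `J(u)⁴ (1 / J(u') + 1 / J(v'))` against which the gain term is estimated. -/
def gainWeight (v : E3) (p : E3 × S2) : ℝ :=
  jap p.1 ^ 4 * ((jap (postU v p.1 p.2))⁻¹ + (jap (postV v p.1 p.2))⁻¹)

lemma gainWeight_pos (v : E3) (p : E3 × S2) : 0 < gainWeight v p := by
  have := jap_pos p.1
  have := jap_pos (postU v p.1 p.2)
  have := jap_pos (postV v p.1 p.2)
  unfold gainWeight; positivity

/-- The bounds on the collision kernel on which all estimates rest. -/
structure KernelBounds (γ : ℝ) (b : ℝ → ℝ) (C : ℝ) : Prop where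
  one_le : 1 ≤ C
  measurable : Measurable (fun p : E3 × S2 => kernel γ b p.1 p.2)
  nonneg : ∀ z ω, 0 ≤ kernel γ b z ω
  gain_integrable : ∀ v, Integrable (fun p : E3 × S2 =>
    kernel γ b (v - p.1) p.2 * sqrtM p.1 * gainWeight v p) collisionMeasure
  gain_le : ∀ v, ∫ p : E3 × S2,
    kernel γ b (v - p.1) p.2 * sqrtM p.1 * gainWeight v p ∂collisionMeasure ≤ C
  freq_integrable : ∀ v, Integrable (fun p : E3 × S2 =>
    kernel γ b (v - p.1) p.2 * (jap p.1 ^ 4 * Real.exp (-(1 / 16 * ‖p.1‖ ^ 2)))) collisionMeasure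
  freq_le : ∀ v, ∫ p : E3 × S2,
    kernel γ b (v - p.1) p.2 * (jap p.1 ^ 4 * Real.exp (-(1 / 16 * ‖p.1‖ ^ 2)))
      ∂collisionMeasure ≤ C * jap v

lemma Measurable.postU {α : Type*} [MeasurableSpace α] {f g : α → E3} {h : α → S2}
    (hf : Measurable f) (hg : Measurable g) (hh : Measurable h) :
    Measurable fun x => postU (f x) (g x) (h x) := by
  unfold Boltzmann.postU; fun_prop

lemma Measurable.postV {α : Type*} [MeasurableSpace α] {f g : α → E3} {h : α → S2}
    (hf : Measurable f) (hg : Measurable g) (hh : Measurable h) :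
    Measurable fun x => postV (f x) (g x) (h x) := by
  unfold Boltzmann.postV; fun_prop

lemma measurable_gainWeight (v : E3) : Measurable (gainWeight v) := by
  unfold gainWeight
  have h1 := measurable_jap
  have h2 : Measurable fun p : E3 × S2 => postU v p.1 p.2 :=
    Measurable.postU measurable_const measurable_fst measurable_snd
  have h3 : Measurable fun p : E3 × S2 => postV v p.1 p.2 :=
    Measurable.postV measurable_const measurable_fst measurable_snd
  fun_prop

/-- The constant is chosen before `b`: only the bound `Cb * |cos θ|` enters, which makes the
lifespan uniform over all admissible angular functions. -/
lemma exists_kernelBounds {γ : ℝ} (hγ : -3 < γ) (hγ1 : γ ≤ 1) {Cb : ℝ} (hCb : 0 < Cb) :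
    ∃ C : ℝ, ∀ b : ℝ → ℝ, IsCutoff Cb b → KernelBounds γ b C := by
  obtain ⟨C1, hC1, h1⟩ := exists_integral_gain_le hγ hγ1 4
  obtain ⟨C2, hC2, h2⟩ := exists_integral_rpow_mul_gaussian_le hγ hγ1 4
    (c := 1 / 16) (by norm_num)
  refine ⟨1 + Cb * C1 + Cb * C2, fun b hb => ?_⟩
  have hCC : 0 ≤ Cb * C1 := by positivity
  have hCC2 : 0 ≤ Cb * C2 := by positivity
  have hk := measurable_kernel (γ := γ) hb.measurable
  have hkv : ∀ v : E3, Measurable fun p : E3 × S2 => kernel γ b (v - p.1) p.2 := fun v =>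
    measurable_comp₂ hk (g := fun p : E3 × S2 => v - p.1) (by fun_prop) measurable_snd
  have hle1 : ∀ v (p : E3 × S2), kernel γ b (v - p.1) p.2 * sqrtM p.1 * gainWeight v p ≤
      Cb * (‖v - p.1‖ ^ γ * |Real.cos (InnerProductGeometry.angle (v - p.1) (p.2 : E3))| *
          (sqrtM p.1 * jap p.1 ^ 4 *
            ((jap (postU v p.1 p.2))⁻¹ + (jap (postV v p.1 p.2))⁻¹))) := by
    intro v p
    have hg := gainWeight_pos v p
    have hm := sqrtM_pos p.1
    have := mul_le_mul_of_nonneg_right (kernel_le (γ := γ) hb (v - p.1) p.2) (mul_pos hm hg).le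
    unfold gainWeight at this ⊢
    linarith
  have hle2 : ∀ v (p : E3 × S2),
      kernel γ b (v - p.1) p.2 * (jap p.1 ^ 4 * Real.exp (-(1 / 16 * ‖p.1‖ ^ 2))) ≤
      Cb * (‖v - p.1‖ ^ γ * (jap p.1 ^ 4 * Real.exp (-(1 / 16 * ‖p.1‖ ^ 2)))) := by
    intro v p
    have hj := jap_pos p.1
    have hc := Real.abs_cos_le_one (InnerProductGeometry.angle (v - p.1) (p.2 : E3))
    have hz : 0 ≤ ‖v - p.1‖ ^ γ := by positivity
    have := kernel_le (γ := γ) hb (v - p.1) p.2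
    calc _ ≤ (Cb * (‖v - p.1‖ ^ γ * 1)) * (jap p.1 ^ 4 * Real.exp (-(1 / 16 * ‖p.1‖ ^ 2))) := by
          gcongr; exact this.trans (by gcongr)
      _ = _ := by ring
  have hn1 : ∀ v (p : E3 × S2), 0 ≤ kernel γ b (v - p.1) p.2 * sqrtM p.1 * gainWeight v p :=
    fun v p => mul_nonneg (mul_nonneg (kernel_nonneg hb _ _) (sqrtM_pos _).le)
      (gainWeight_pos v p).le
  have hn2 : ∀ v (p : E3 × S2), 0 ≤
      kernel γ b (v - p.1) p.2 * (jap p.1 ^ 4 * Real.exp (-(1 / 16 * ‖p.1‖ ^ 2))) := by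
    intro v p
    have := jap_pos p.1
    exact mul_nonneg (kernel_nonneg hb _ _) (by positivity)
  have hi1 : ∀ v, Integrable (fun p : E3 × S2 =>
      kernel γ b (v - p.1) p.2 * sqrtM p.1 * gainWeight v p) collisionMeasure := by
    intro v
    refine ((h1 v).1.const_mul Cb).mono' ?_ (Filter.Eventually.of_forall fun p => ?_)
    · have := measurable_sqrtM
      have := measurable_gainWeight v
      have := hkv v
      exact (by fun_prop : Measurable fun p : E3 × S2 =>
        kernel γ b (v - p.1) p.2 * sqrtM p.1 * gainWeight v p).aestronglyMeasurable
    · rw [Real.norm_of_nonneg (hn1 v p)]; exact hle1 v p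
  have hi2 : ∀ v, Integrable (fun p : E3 × S2 =>
      kernel γ b (v - p.1) p.2 * (jap p.1 ^ 4 * Real.exp (-(1 / 16 * ‖p.1‖ ^ 2))))
      collisionMeasure := by
    intro v
    refine ((h2 v).1.const_mul Cb).mono' ?_ (Filter.Eventually.of_forall fun p => ?_)
    · have := measurable_jap
      have := hkv v
      exact (by fun_prop : Measurable fun p : E3 × S2 =>
        kernel γ b (v - p.1) p.2 *
          (jap p.1 ^ 4 * Real.exp (-(1 / 16 * ‖p.1‖ ^ 2)))).aestronglyMeasurable
    · rw [Real.norm_of_nonneg (hn2 v p)]; exact hle2 v p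
  refine ⟨by linarith, hk, fun z ω => kernel_nonneg hb z ω, hi1, fun v => ?_, hi2, fun v => ?_⟩
  · refine (integral_mono (hi1 v) ((h1 v).1.const_mul Cb) (hle1 v)).trans ?_
    rw [integral_const_mul]
    have := mul_le_mul_of_nonneg_left (h1 v).2 hCb.le
    linarith
  · refine (integral_mono (hi2 v) ((h2 v).1.const_mul Cb) (hle2 v)).trans ?_
    rw [integral_const_mul]
    have := mul_le_mul_of_nonneg_left (h2 v).2 hCb.le
    have := jap_pos v
    nlinarith

/-- The normalised gain term `μ^{-1/2} Q₊(√μ f, √μ g)`. -/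
def gain (γ : ℝ) (b : ℝ → ℝ) (f g : E3 → ℝ) (v : E3) : ℝ :=
  ∫ p : E3 × S2, kernel γ b (v - p.1) p.2 * sqrtM p.1 *
    (f (postU v p.1 p.2) * g (postV v p.1 p.2)) ∂collisionMeasure

/-- The collision frequency generated by the density `√μ f`. -/
def freq (γ : ℝ) (b : ℝ → ℝ) (f : E3 → ℝ) (v : E3) : ℝ :=
  ∫ p : E3 × S2, kernel γ b (v - p.1) p.2 * sqrtM p.1 * f p.1 ∂collisionMeasure

/-- The density `F = μ + √μ f` divided by `√μ`. -/
def shift (f : E3 → ℝ) (v : E3) : ℝ := sqrtM v + f v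

/-- The part `K f + Γ₊(f, f)` of the equation for the perturbation. -/
def source (γ : ℝ) (b : ℝ → ℝ) (f : E3 → ℝ) (v : E3) : ℝ :=
  gain γ b sqrtM f v + gain γ b f sqrtM v + gain γ b f f v - sqrtM v * freq γ b f v

/-- Measurable profiles bounded by a multiple of `1 / J`. -/
structure Decays (E : ℝ) (f : E3 → ℝ) : Prop where
  measurable : Measurable f
  bound : ∀ v, |f v| ≤ E * (jap v)⁻¹

lemma Decays.nonneg {E : ℝ} {f : E3 → ℝ} (hf : Decays E f) : 0 ≤ E := by
  have h := (abs_nonneg _).trans (hf.bound 0)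
  have := inv_pos.2 (jap_pos 0)
  exact nonneg_of_mul_nonneg_left h this

lemma Decays.abs_le {E : ℝ} {f : E3 → ℝ} (hf : Decays E f) (v : E3) : |f v| ≤ E :=
  (hf.bound v).trans (mul_le_of_le_one_right hf.nonneg (inv_le_one_of_one_le₀ (one_le_jap v)))

lemma Decays.add {E F : ℝ} {f g : E3 → ℝ} (hf : Decays E f) (hg : Decays F g) :
    Decays (E + F) (fun v => f v + g v) :=
  ⟨hf.measurable.add hg.measurable, fun v => by
    have := hf.bound v; have := hg.bound v
    rw [add_mul]; exact (abs_add_le _ _).trans (by linarith)⟩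

lemma Decays.sub {E F : ℝ} {f g : E3 → ℝ} (hf : Decays E f) (hg : Decays F g) :
    Decays (E + F) (fun v => f v - g v) :=
  ⟨hf.measurable.sub hg.measurable, fun v => by
    have := hf.bound v; have := hg.bound v
    rw [add_mul]; exact (abs_sub _ _).trans (by linarith)⟩

lemma Decays.abs {E : ℝ} {f : E3 → ℝ} (hf : Decays E f) : Decays E (fun v => |f v|) :=
  ⟨hf.measurable.abs, fun v => by rw [abs_abs]; exact hf.bound v⟩

lemma Decays.of_weight {a E : ℝ} (ha : 1 ≤ a) (hE : 0 ≤ E) {f : E3 → ℝ} (hf : Measurable f)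
    (h : ∀ v, |f v| ≤ E * (weight a v)⁻¹) : Decays E f :=
  ⟨hf, fun v => (h v).trans
    (mul_le_mul_of_nonneg_left (inv_anti₀ (jap_pos v) (jap_le_weight ha v)) hE)⟩

lemma exists_decays_sqrtM : ∃ E, 1 ≤ E ∧ Decays E sqrtM := by
  obtain ⟨C, hC, h⟩ := exists_sqrtM_mul_jap_pow_le 1
  refine ⟨1 + C, by linarith, measurable_sqrtM, fun v => ?_⟩
  rw [abs_of_pos (sqrtM_pos v), ← div_eq_mul_inv, le_div_iff₀ (jap_pos v)]
  have := h v
  rw [pow_one] at this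
  linarith

/-! ### Integrability and bilinearity of gain and frequency, and the splitting of the equation. -/

section Bounds

variable {γ C : ℝ} {b : ℝ → ℝ}

lemma KernelBounds.measurable_sub (hK : KernelBounds γ b C) (v : E3) :
    Measurable fun p : E3 × S2 => kernel γ b (v - p.1) p.2 :=
  measurable_comp₂ hK.measurable (g := fun p : E3 × S2 => v - p.1) (by fun_prop) measurable_snd

lemma measurable_post_mul {f g : E3 → ℝ} (hf : Measurable f) (hg : Measurable g) (v : E3) :
    Measurable fun p : E3 × S2 => f (postU v p.1 p.2) * g (postV v p.1 p.2) :=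
  (hf.comp (Measurable.postU measurable_const measurable_fst measurable_snd)).mul
    (hg.comp (Measurable.postV measurable_const measurable_fst measurable_snd))

lemma integrable_gain (hK : KernelBounds γ b C) {f g : E3 → ℝ} (hf : Measurable f)
    (hg : Measurable g) {v : E3} {X : ℝ}
    (h : ∀ p : E3 × S2,
      |f (postU v p.1 p.2) * g (postV v p.1 p.2)| ≤ X * gainWeight v p) :
    Integrable (fun p : E3 × S2 => kernel γ b (v - p.1) p.2 * sqrtM p.1 *
      (f (postU v p.1 p.2) * g (postV v p.1 p.2))) collisionMeasure := by
  refine ((hK.gain_integrable v).const_mul X).mono' ?_ (Filter.Eventually.of_forall fun p => ?_)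
  · exact (((hK.measurable_sub v).mul (measurable_sqrtM.comp measurable_fst)).mul
      (measurable_post_mul hf hg v)).aestronglyMeasurable
  · have hk := mul_nonneg (hK.nonneg (v - p.1) p.2) (sqrtM_pos p.1).le
    rw [Real.norm_eq_abs, abs_mul, abs_of_nonneg hk]
    exact (mul_le_mul_of_nonneg_left (h p) hk).trans_eq (by ring)

lemma abs_gain_le (hK : KernelBounds γ b C) {f g : E3 → ℝ} {v : E3} {X : ℝ} (hX : 0 ≤ X)
    (h : ∀ p : E3 × S2,
      |f (postU v p.1 p.2) * g (postV v p.1 p.2)| ≤ X * gainWeight v p) :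
    |gain γ b f g v| ≤ C * X := by
  have h1 : |gain γ b f g v| ≤ ∫ p : E3 × S2,
      X * (kernel γ b (v - p.1) p.2 * sqrtM p.1 * gainWeight v p) ∂collisionMeasure := by
    rw [← Real.norm_eq_abs]
    refine norm_integral_le_of_norm_le ((hK.gain_integrable v).const_mul X)
      (Filter.Eventually.of_forall fun p => ?_)
    have hk := mul_nonneg (hK.nonneg (v - p.1) p.2) (sqrtM_pos p.1).le
    rw [Real.norm_eq_abs, abs_mul, abs_of_nonneg hk]
    exact (mul_le_mul_of_nonneg_left (h p) hk).trans_eq (by ring)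
  rw [integral_const_mul] at h1
  nlinarith [mul_le_mul_of_nonneg_left (hK.gain_le v) hX]

lemma sqrtM_le_gaussian (u : E3) : sqrtM u ≤ Real.exp (-(1 / 16 * ‖u‖ ^ 2)) :=
  (sqrtM_le u).trans (Real.exp_le_exp.2 (by nlinarith [sq_nonneg ‖u‖]))

lemma integrable_freq_of_le (hK : KernelBounds γ b C) {f : E3 → ℝ} (hf : Measurable f) {v : E3}
    {X : ℝ} (h : ∀ u, |f u| ≤ X * (jap u ^ 4 * Real.exp (-(1 / 16 * ‖u‖ ^ 2)))) :
    Integrable (fun p : E3 × S2 => kernel γ b (v - p.1) p.2 * f p.1) collisionMeasure := by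
  refine ((hK.freq_integrable v).const_mul X).mono' ?_ (Filter.Eventually.of_forall fun p => ?_)
  · exact ((hK.measurable_sub v).mul (hf.comp measurable_fst)).aestronglyMeasurable
  · have hk := hK.nonneg (v - p.1) p.2
    rw [Real.norm_eq_abs, abs_mul, abs_of_nonneg hk]
    exact (mul_le_mul_of_nonneg_left (h p.1) hk).trans_eq (by ring)

lemma abs_freq_le_aux (hK : KernelBounds γ b C) {f : E3 → ℝ} {v : E3} {X : ℝ} (hX : 0 ≤ X)
    (h : ∀ u, |f u| ≤ X * (jap u ^ 4 * Real.exp (-(1 / 16 * ‖u‖ ^ 2)))) :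
    |∫ p : E3 × S2, kernel γ b (v - p.1) p.2 * f p.1 ∂collisionMeasure| ≤ C * X * jap v := by
  have h1 : |∫ p : E3 × S2, kernel γ b (v - p.1) p.2 * f p.1 ∂collisionMeasure| ≤
      ∫ p : E3 × S2, X * (kernel γ b (v - p.1) p.2 *
        (jap p.1 ^ 4 * Real.exp (-(1 / 16 * ‖p.1‖ ^ 2)))) ∂collisionMeasure := by
    rw [← Real.norm_eq_abs]
    refine norm_integral_le_of_norm_le ((hK.freq_integrable v).const_mul X)
      (Filter.Eventually.of_forall fun p => ?_)
    have hk := hK.nonneg (v - p.1) p.2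
    rw [Real.norm_eq_abs, abs_mul, abs_of_nonneg hk]
    exact (mul_le_mul_of_nonneg_left (h p.1) hk).trans_eq (by ring)
  rw [integral_const_mul] at h1
  nlinarith [mul_le_mul_of_nonneg_left (hK.freq_le v) hX]

lemma abs_sqrtM_mul_le {f : E3 → ℝ} {X : ℝ} {u : E3} (h : |f u| ≤ X * jap u ^ 4) :
    |sqrtM u * f u| ≤ X * (jap u ^ 4 * Real.exp (-(1 / 16 * ‖u‖ ^ 2))) := by
  rw [abs_mul, abs_of_pos (sqrtM_pos u)]
  have h0 := (abs_nonneg _).trans h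
  calc _ ≤ Real.exp (-(1 / 16 * ‖u‖ ^ 2)) * (X * jap u ^ 4) :=
        mul_le_mul (sqrtM_le_gaussian u) h (abs_nonneg _) (Real.exp_pos _).le
    _ = _ := by ring

lemma integrable_freq (hK : KernelBounds γ b C) {f : E3 → ℝ} (hf : Measurable f) {v : E3}
    {X : ℝ} (h : ∀ u, |f u| ≤ X * jap u ^ 4) :
    Integrable (fun p : E3 × S2 => kernel γ b (v - p.1) p.2 * sqrtM p.1 * f p.1)
      collisionMeasure := by
  simp only [mul_assoc]
  exact integrable_freq_of_le hK (f := fun u => sqrtM u * f u) (measurable_sqrtM.mul hf)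
    fun u => abs_sqrtM_mul_le (h u)

lemma abs_freq_le (hK : KernelBounds γ b C) {f : E3 → ℝ} {v : E3} {X : ℝ} (hX : 0 ≤ X)
    (h : ∀ u, |f u| ≤ X * jap u ^ 4) : |freq γ b f v| ≤ C * X * jap v := by
  unfold freq
  simp only [mul_assoc (kernel _ _ _ _)]
  exact abs_freq_le_aux hK (f := fun u => sqrtM u * f u) hX fun u => abs_sqrtM_mul_le (h u)

lemma freq_nonneg (hK : KernelBounds γ b C) {f : E3 → ℝ} (hf : ∀ u, 0 ≤ f u) (v : E3) :
    0 ≤ freq γ b f v :=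
  integral_nonneg fun _ => mul_nonneg (mul_nonneg (hK.nonneg _ _) (sqrtM_pos _).le) (hf _)

lemma gain_nonneg (hK : KernelBounds γ b C) {f g : E3 → ℝ} (hf : ∀ u, 0 ≤ f u)
    (hg : ∀ u, 0 ≤ g u) (v : E3) : 0 ≤ gain γ b f g v :=
  integral_nonneg fun _ => mul_nonneg (mul_nonneg (hK.nonneg _ _) (sqrtM_pos _).le)
    (mul_nonneg (hf _) (hg _))

lemma Decays.mul_le_gainWeight {E F : ℝ} {f g : E3 → ℝ} (hf : Decays E f) (hg : Decays F g)
    (v : E3) (p : E3 × S2) :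
    |f (postU v p.1 p.2) * g (postV v p.1 p.2)| ≤ E * F * gainWeight v p := by
  have hE := hf.nonneg
  have hF := hg.nonneg
  have hU := inv_pos.2 (jap_pos (postU v p.1 p.2))
  have hV := inv_pos.2 (jap_pos (postV v p.1 p.2))
  have h4 : 1 ≤ jap p.1 ^ 4 := one_le_pow₀ (one_le_jap _)
  rw [abs_mul]
  calc _ ≤ (E * (jap (postU v p.1 p.2))⁻¹) * F :=
        mul_le_mul (hf.bound _) (hg.abs_le _) (abs_nonneg _) (by positivity)
    _ = E * F * (1 * ((jap (postU v p.1 p.2))⁻¹ + 0)) := by ring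
    _ ≤ E * F * gainWeight v p := by
        unfold gainWeight; gcongr

lemma Decays.le_jap_pow {E : ℝ} {f : E3 → ℝ} (hf : Decays E f) (u : E3) :
    |f u| ≤ E * jap u ^ 4 :=
  (hf.abs_le u).trans (le_mul_of_one_le_right hf.nonneg (one_le_pow₀ (one_le_jap u)))

lemma Decays.integrable_gain (hK : KernelBounds γ b C) {E F : ℝ} {f g : E3 → ℝ}
    (hf : Decays E f) (hg : Decays F g) (v : E3) :
    Integrable (fun p : E3 × S2 => kernel γ b (v - p.1) p.2 * sqrtM p.1 *
      (f (postU v p.1 p.2) * g (postV v p.1 p.2))) collisionMeasure :=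
  Boltzmann.integrable_gain hK hf.measurable hg.measurable (hf.mul_le_gainWeight hg v)

lemma Decays.integrable_freq (hK : KernelBounds γ b C) {E : ℝ} {f : E3 → ℝ}
    (hf : Decays E f) (v : E3) :
    Integrable (fun p : E3 × S2 => kernel γ b (v - p.1) p.2 * sqrtM p.1 * f p.1)
      collisionMeasure :=
  Boltzmann.integrable_freq hK hf.measurable hf.le_jap_pow

lemma gain_add_left (hK : KernelBounds γ b C) {E F G : ℝ} {f g h : E3 → ℝ} (hf : Decays E f)
    (hg : Decays F g) (hh : Decays G h) (v : E3) :
    gain γ b (fun u => f u + g u) h v = gain γ b f h v + gain γ b g h v := by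
  unfold gain
  rw [← integral_add (hf.integrable_gain hK hh v) (hg.integrable_gain hK hh v)]
  congr 1; ext p; ring

lemma gain_add_right (hK : KernelBounds γ b C) {E F G : ℝ} {f g h : E3 → ℝ} (hf : Decays E f)
    (hg : Decays F g) (hh : Decays G h) (v : E3) :
    gain γ b h (fun u => f u + g u) v = gain γ b h f v + gain γ b h g v := by
  unfold gain
  rw [← integral_add (hh.integrable_gain hK hf v) (hh.integrable_gain hK hg v)]
  congr 1; ext p; ring

lemma gain_sub_left (hK : KernelBounds γ b C) {E F G : ℝ} {f g h : E3 → ℝ} (hf : Decays E f)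
    (hg : Decays F g) (hh : Decays G h) (v : E3) :
    gain γ b (fun u => f u - g u) h v = gain γ b f h v - gain γ b g h v := by
  unfold gain
  rw [← integral_sub (hf.integrable_gain hK hh v) (hg.integrable_gain hK hh v)]
  congr 1; ext p; ring

lemma gain_sub_right (hK : KernelBounds γ b C) {E F G : ℝ} {f g h : E3 → ℝ} (hf : Decays E f)
    (hg : Decays F g) (hh : Decays G h) (v : E3) :
    gain γ b h (fun u => f u - g u) v = gain γ b h f v - gain γ b h g v := by
  unfold gain
  rw [← integral_sub (hh.integrable_gain hK hf v) (hh.integrable_gain hK hg v)]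
  congr 1; ext p; ring

lemma freq_add (hK : KernelBounds γ b C) {E F : ℝ} {f g : E3 → ℝ} (hf : Decays E f)
    (hg : Decays F g) (v : E3) :
    freq γ b (fun u => f u + g u) v = freq γ b f v + freq γ b g v := by
  unfold freq
  rw [← integral_add (hf.integrable_freq hK v) (hg.integrable_freq hK v)]
  congr 1; ext p; ring

lemma freq_sub (hK : KernelBounds γ b C) {E F : ℝ} {f g : E3 → ℝ} (hf : Decays E f)
    (hg : Decays F g) (v : E3) :
    freq γ b (fun u => f u - g u) v = freq γ b f v - freq γ b g v := by
  unfold freq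
  rw [← integral_sub (hf.integrable_freq hK v) (hg.integrable_freq hK v)]
  congr 1; ext p; ring

/-- Detailed balance of the Maxwellian: gain and loss agree under the integral, because √μ(u')
√μ(v') = √μ(u) √μ(v). -/
lemma gain_sqrtM (v : E3) : gain γ b sqrtM sqrtM v = sqrtM v * freq γ b sqrtM v := by
  unfold gain freq
  rw [← integral_const_mul]
  congr 1; ext p
  rw [sqrtM_postU_mul_postV]; ring

/-- Links the two forms of the equation: `source` − `freq (shift f)` · f equals `gain (shift f)
(shift f)` − `freq (shift f)` · `shift f`. The first form is used for bounds, the second for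
positivity. -/
lemma gain_shift (hK : KernelBounds γ b C) {E : ℝ} {f : E3 → ℝ} (hf : Decays E f) (v : E3) :
    gain γ b (shift f) (shift f) v = source γ b f v + sqrtM v * freq γ b (shift f) v := by
  obtain ⟨E₀, _, hm⟩ := exists_decays_sqrtM
  have hs : Decays (E₀ + E) (shift f) := hm.add hf
  have h1 : gain γ b (shift f) (shift f) v =
      gain γ b sqrtM (shift f) v + gain γ b f (shift f) v := gain_add_left hK hm hf hs v
  have h2 : gain γ b sqrtM (shift f) v = _ := gain_add_right hK hm hf hm v
  have h3 : gain γ b f (shift f) v = _ := gain_add_right hK hm hf hf v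
  have h4 : freq γ b (shift f) v = _ := freq_add hK hm hf v
  rw [h1, h2, h3, h4, gain_sqrtM, source]; ring

/-- Polarisation of the quadratic gain. The linear terms combine with the quadratic ones so that the
difference meets only the full densities `shift f` and `shift g`. -/
lemma source_sub_source (hK : KernelBounds γ b C) {E F : ℝ} {f g : E3 → ℝ} (hf : Decays E f)
    (hg : Decays F g) (v : E3) :
    source γ b f v - source γ b g v =
      gain γ b (fun u => f u - g u) (shift f) v + gain γ b (shift g) (fun u => f u - g u) v -
        sqrtM v * freq γ b (fun u => f u - g u) v := by
  obtain ⟨E₀, _, hm⟩ := exists_decays_sqrtM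
  have hs : Decays (E₀ + E) (shift f) := hm.add hf
  have hd := hf.sub hg
  have h1 : gain γ b (fun u => f u - g u) (shift f) v = _ := gain_add_right hK hm hf hd v
  have h2 : gain γ b (shift g) (fun u => f u - g u) v = _ := gain_add_left hK hm hg hd v
  rw [h1, h2, gain_sub_left hK hf hg hm, gain_sub_left hK hf hg hf, gain_sub_right hK hf hg hm,
    gain_sub_right hK hf hg hg, freq_sub hK hf hg, source, source]
  ring

lemma collisionFreq_eq (v : E3) : collisionFreq γ b v = freq γ b sqrtM v := by
  unfold collisionFreq freq
  congr 1; ext p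
  rw [← sqrtM_mul_self]; ring

lemma K_eq (f : E3 → ℝ) (v : E3) :
    K γ b f v = gain γ b sqrtM f v + gain γ b f sqrtM v - sqrtM v * freq γ b f v := by
  have h1 : K₁ γ b f v = sqrtM v * freq γ b f v := by
    unfold K₁ freq
    rw [← integral_const_mul]
    congr 1; ext p; ring
  rw [K, h1, K₂, gain, gain]
  congr 2 <;> · congr 1; ext p; ring

lemma Gam_eq (f : E3 → ℝ) (v : E3) :
    Gam γ b f f v = gain γ b f f v - f v * freq γ b f v := by
  have hm := (sqrtM_pos v).ne'
  have h1 : Qgain γ b (fun u => sqrtM u * f u) (fun u => sqrtM u * f u) v =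
      sqrtM v * gain γ b f f v := by
    unfold Qgain gain
    rw [← integral_const_mul]
    congr 1; ext p
    have := sqrtM_postU_mul_postV v p.1 p.2
    linear_combination (kernel γ b (v - p.1) p.2 * f (postU v p.1 p.2) *
      f (postV v p.1 p.2)) * this
  have h2 : Qloss γ b (fun u => sqrtM u * f u) (fun u => sqrtM u * f u) v =
      sqrtM v * (f v * freq γ b f v) := by
    unfold Qloss freq
    rw [← integral_const_mul, ← integral_const_mul]
    congr 1; ext p; ring
  rw [Gam, Q, h1, h2]
  field_simp

/-- The extra term ν f is cancelled by the factor exp (−ν t) of the mild formula, so damping by ν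
with right-hand side K f + Γ(f, f) is the same equation as damping by the full frequency with
right-hand side `source`. -/
lemma K_add_Gam (hK : KernelBounds γ b C) {E : ℝ} {f : E3 → ℝ} (hf : Decays E f) (v : E3) :
    K γ b f v + Gam γ b f f v =
      source γ b f v - f v * freq γ b (shift f) v + collisionFreq γ b v * f v := by
  obtain ⟨E₀, _, hm⟩ := exists_decays_sqrtM
  have h4 : freq γ b (shift f) v = _ := freq_add hK hm hf v
  rw [K_eq, Gam_eq, collisionFreq_eq, h4, source]; ring

end Bounds

/-! ### Weighted estimates of the collision operators -/

section Weighted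

variable {γ C : ℝ} {b : ℝ → ℝ}

/-- The algebra behind the gain estimates: here `x`, `y` are the weights and `p`, `q` the brackets
at the two outgoing velocities. -/
lemma add_mul_inv_le {x y p q : ℝ} (hp : 1 ≤ p) (hq : 1 ≤ q) (hx : p ≤ x) (hy : q ≤ y) :
    (x + y) * q * (x⁻¹ * (y * q ^ 2)⁻¹) ≤ p⁻¹ + q⁻¹ := by
  have hp0 : 0 < p := by linarith
  have hq0 : 0 < q := by linarith
  have hx0 : 0 < x := by linarith
  have hy0 : 0 < y := by linarith
  have e : (x + y) * q * (x⁻¹ * (y * q ^ 2)⁻¹) = y⁻¹ * q⁻¹ + x⁻¹ * q⁻¹ := by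
    field_simp
  have h1 : y⁻¹ ≤ 1 := inv_le_one_of_one_le₀ (by linarith)
  have h2 : q⁻¹ ≤ 1 := inv_le_one_of_one_le₀ hq
  have h3 : x⁻¹ ≤ p⁻¹ := inv_anti₀ hp0 hx
  have := inv_pos.2 hq0
  have := inv_pos.2 hx0
  rw [e]
  nlinarith

/-- A profile weight that changes slowly with the velocity. -/
structure SlowWeight (κ : E3 → ℝ) : Prop where
  pos : ∀ v, 0 < κ v
  le : ∀ v v', κ v ≤ (1 + ‖v - v'‖) * κ v'

lemma jap_le_jap_pow_four (u : E3) : jap u ≤ jap u ^ 4 := by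
  have := one_le_jap u
  calc jap u = jap u ^ 1 := (pow_one _).symm
    _ ≤ _ := pow_le_pow_right₀ this (by norm_num)

/-- Since v − u' = v' − u, moving κ from u' to v costs J(v') J(u). Of the two extra powers of decay
of `e`, one pays for this J(v'); the other, or the weight at u', supplies the factor 1 / J required
by `gainWeight`. -/
lemma abs_gain_left_le (hK : KernelBounds γ b C) {a : ℝ} (ha : 1 ≤ a) {κ : E3 → ℝ}
    (hκ : SlowWeight κ) {d e : E3 → ℝ} {D E : ℝ} (hD : 0 ≤ D) (hE : 0 ≤ E)
    (hd : ∀ v, |d v| ≤ D * ((weight a v)⁻¹ * κ v))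
    (he : ∀ v, |e v| ≤ E * (weight (a + 2) v)⁻¹) (v : E3) :
    |gain γ b d e v| ≤ C * (3 * 2 ^ (a / 2) * D * E * ((weight a v)⁻¹ * κ v)) := by
  have hκv := hκ.pos v
  have hwv := weight_pos a v
  refine abs_gain_le hK (by positivity) fun p => ?_
  obtain ⟨u, ω⟩ := p
  simp only [gainWeight]
  set U := postU v u ω
  set V := postV v u ω
  have hU := one_le_jap U
  have hV := one_le_jap V
  have hu := jap_pos u
  have hwU := weight_pos a U
  have hwV := weight_pos a V
  have h1 : κ U ≤ 3 * (jap V * jap u) * κ v := by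
    refine (hκ.le U v).trans (mul_le_mul_of_nonneg_right ?_ hκv.le)
    rw [norm_sub_rev, sub_postU]
    exact one_add_norm_sub_le u V
  have h2 : 1 ≤ (weight a v)⁻¹ * (2 ^ (a / 2) * (weight a U + weight a V)) := by
    rw [inv_mul_eq_div, one_le_div hwv]
    exact weight_le_postU_add_postV (by linarith) v u ω
  rw [abs_mul]
  calc |d U| * |e V| ≤ (D * ((weight a U)⁻¹ * κ U)) * (E * (weight (a + 2) V)⁻¹) :=
        mul_le_mul (hd U) (he V) (abs_nonneg _) (by have := hκ.pos U; positivity)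
    _ ≤ (D * ((weight a U)⁻¹ * (3 * (jap V * jap u) * κ v))) *
          (E * (weight a V * jap V ^ 2)⁻¹) * 1 := by
        rw [weight_add_two, mul_one]; gcongr
    _ ≤ (D * ((weight a U)⁻¹ * (3 * (jap V * jap u) * κ v))) *
          (E * (weight a V * jap V ^ 2)⁻¹) *
          ((weight a v)⁻¹ * (2 ^ (a / 2) * (weight a U + weight a V))) := by
        gcongr
    _ = (3 * 2 ^ (a / 2) * D * E * ((weight a v)⁻¹ * κ v)) * (jap u *
        ((weight a U + weight a V) * jap V * ((weight a U)⁻¹ * (weight a V * jap V ^ 2)⁻¹))) := by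
        ring
    _ ≤ (3 * 2 ^ (a / 2) * D * E * ((weight a v)⁻¹ * κ v)) *
        (jap u ^ 4 * ((jap U)⁻¹ + (jap V)⁻¹)) := by
        gcongr
        · exact jap_le_jap_pow_four u
        · exact add_mul_inv_le hU hV (jap_le_weight ha U) (jap_le_weight ha V)

lemma abs_gain_right_le (hK : KernelBounds γ b C) {a : ℝ} (ha : 1 ≤ a) {κ : E3 → ℝ}
    (hκ : SlowWeight κ) {d e : E3 → ℝ} {D E : ℝ} (hD : 0 ≤ D) (hE : 0 ≤ E)
    (hd : ∀ v, |d v| ≤ D * ((weight a v)⁻¹ * κ v))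
    (he : ∀ v, |e v| ≤ E * (weight (a + 2) v)⁻¹) (v : E3) :
    |gain γ b e d v| ≤ C * (3 * 2 ^ (a / 2) * D * E * ((weight a v)⁻¹ * κ v)) := by
  have hκv := hκ.pos v
  have hwv := weight_pos a v
  refine abs_gain_le hK (by positivity) fun p => ?_
  obtain ⟨u, ω⟩ := p
  simp only [gainWeight]
  set U := postU v u ω
  set V := postV v u ω
  have hU := one_le_jap U
  have hV := one_le_jap V
  have hu := jap_pos u
  have hwU := weight_pos a U
  have hwV := weight_pos a V
  have h1 : κ V ≤ 3 * (jap U * jap u) * κ v := by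
    refine (hκ.le V v).trans (mul_le_mul_of_nonneg_right ?_ hκv.le)
    rw [norm_sub_rev, sub_postV]
    exact one_add_norm_sub_le u U
  have h2 : 1 ≤ (weight a v)⁻¹ * (2 ^ (a / 2) * (weight a U + weight a V)) := by
    rw [inv_mul_eq_div, one_le_div hwv]
    exact weight_le_postU_add_postV (by linarith) v u ω
  rw [abs_mul]
  calc |e U| * |d V| ≤ (E * (weight (a + 2) U)⁻¹) * (D * ((weight a V)⁻¹ * κ V)) :=
        mul_le_mul (he U) (hd V) (abs_nonneg _) (by have := weight_pos (a + 2) U; positivity)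
    _ ≤ (E * (weight a U * jap U ^ 2)⁻¹) *
          (D * ((weight a V)⁻¹ * (3 * (jap U * jap u) * κ v))) * 1 := by
        rw [weight_add_two, mul_one]; gcongr
    _ ≤ (E * (weight a U * jap U ^ 2)⁻¹) *
          (D * ((weight a V)⁻¹ * (3 * (jap U * jap u) * κ v))) *
          ((weight a v)⁻¹ * (2 ^ (a / 2) * (weight a U + weight a V))) := by
        gcongr
    _ = (3 * 2 ^ (a / 2) * D * E * ((weight a v)⁻¹ * κ v)) * (jap u *
        ((weight a V + weight a U) * jap U * ((weight a V)⁻¹ * (weight a U * jap U ^ 2)⁻¹))) := by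
        ring
    _ ≤ (3 * 2 ^ (a / 2) * D * E * ((weight a v)⁻¹ * κ v)) *
        (jap u ^ 4 * ((jap V)⁻¹ + (jap U)⁻¹)) := by
        gcongr
        · exact jap_le_jap_pow_four u
        · exact add_mul_inv_le hV hU (jap_le_weight ha V) (jap_le_weight ha U)
    _ = _ := by ring

/-- The loss term loses one power of J(v) from the frequency and one from moving κ to v; these are
exactly the two extra powers in the decay of `e`. -/
lemma abs_mul_freq_le (hK : KernelBounds γ b C) {a : ℝ} (ha : 1 ≤ a) {κ : E3 → ℝ}
    (hκ : SlowWeight κ) {d e : E3 → ℝ} {D E : ℝ} (hD : 0 ≤ D) (hE : 0 ≤ E)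
    (hd : ∀ v, |d v| ≤ D * ((weight a v)⁻¹ * κ v))
    (he : ∀ v, |e v| ≤ E * (weight (a + 2) v)⁻¹) (v : E3) :
    |e v| * |freq γ b d v| ≤ C * (3 * 2 ^ (a / 2) * D * E * ((weight a v)⁻¹ * κ v)) := by
  have hκv := hκ.pos v
  have hwv := weight_pos a v
  have hv := jap_pos v
  have hC := hK.one_le
  have h2 : (1 : ℝ) ≤ 2 ^ (a / 2) := Real.one_le_rpow (by norm_num) (by linarith)
  have h1 : |freq γ b d v| ≤ C * (3 * D * κ v * jap v) * jap v := by
    refine abs_freq_le hK (by positivity) fun u => ?_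
    have hu := jap_pos u
    calc |d u| ≤ D * ((weight a u)⁻¹ * κ u) := hd u
      _ ≤ D * (1 * (3 * (jap u * jap v) * κ v)) := by
          have h3 : κ u ≤ 3 * (jap u * jap v) * κ v :=
            (hκ.le u v).trans (mul_le_mul_of_nonneg_right (one_add_norm_sub_le v u) hκv.le)
          have h4 := weight_inv_le_one (by linarith : (0 : ℝ) ≤ a) u
          have := hκ.pos u
          gcongr
      _ = 3 * D * κ v * jap v * jap u := by ring
      _ ≤ _ := by gcongr; exact jap_le_jap_pow_four u
  calc |e v| * |freq γ b d v| ≤ (E * (weight a v * jap v ^ 2)⁻¹) *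
        (C * (3 * D * κ v * jap v) * jap v) := by
        rw [← weight_add_two]
        exact mul_le_mul (he v) h1 (abs_nonneg _) (by have := weight_pos (a + 2) v; positivity)
    _ = C * (3 * 1 * D * E * ((weight a v)⁻¹ * κ v)) := by
        field_simp
    _ ≤ _ := by gcongr

/-- A profile weight compatible with the quadratic gain term. -/
structure GrowthWeight (ϑ : E3 → ℝ) : Prop where
  pos : ∀ v, 0 < ϑ v
  le : ∀ v v', ϑ v ≤ (1 + ‖v - v'‖) ^ 4 * ϑ v'
  le_add : ∀ v u ω, ϑ v ≤ 8 * (ϑ (postU v u ω) + ϑ (postV v u ω))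

lemma GrowthWeight.one : GrowthWeight fun _ => 1 :=
  ⟨fun _ => one_pos, fun v v' => by
    rw [mul_one]; exact one_le_pow₀ (by linarith [norm_nonneg (v - v')]),
    fun _ _ _ => by norm_num⟩

/-- In each of the four products one factor is estimated with its decay constant `A` and the other
with the plain bound `M`. Hence the quadratic term is linear in `A`, and decay propagates by a
linear inequality. -/
lemma quadratic_weight_le {F G x y p q A M : ℝ} (hG : 0 ≤ G) (hx : 0 < x) (hy : 0 < y)
    (hp : 0 < p) (hq : 0 < q) (hA : 0 ≤ A) (hM : 0 ≤ M)
    (h1 : F ≤ M * x⁻¹) (h2 : F ≤ A * (x⁻¹ * p⁻¹)) (h3 : G ≤ M * y⁻¹) (h4 : G ≤ A * (y⁻¹ * q⁻¹)) :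
    F * G * ((p + q) * (x + y)) ≤ 2 * A * M * (x⁻¹ + y⁻¹) := by
  have a1 : F * x ≤ M := by
    calc F * x ≤ M * x⁻¹ * x := by gcongr
      _ = M := by field_simp
  have a2 : F * x * p ≤ A := by
    calc F * x * p ≤ A * (x⁻¹ * p⁻¹) * x * p := by gcongr
      _ = A := by field_simp
  have a3 : G * y ≤ M := by
    calc G * y ≤ M * y⁻¹ * y := by gcongr
      _ = M := by field_simp
  have a4 : G * y * q ≤ A := by
    calc G * y * q ≤ A * (y⁻¹ * q⁻¹) * y * q := by gcongr
      _ = A := by field_simp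
  have hX := inv_pos.2 hx
  have hY := inv_pos.2 hy
  have b1 : F * p ≤ A * x⁻¹ := by
    calc F * p = (F * x * p) * x⁻¹ := by field_simp
      _ ≤ _ := by gcongr
  have b2 : G * q ≤ A * y⁻¹ := by
    calc G * q = (G * y * q) * y⁻¹ := by field_simp
      _ ≤ _ := by gcongr
  calc F * G * ((p + q) * (x + y)) = (F * x * p) * G + (F * p) * (G * y) + (F * x) * (G * q) +
        F * (G * y * q) := by ring
    _ ≤ A * (M * y⁻¹) + (A * x⁻¹) * M + M * (A * y⁻¹) + (M * x⁻¹) * A := by gcongr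
    _ = _ := by ring

/-- Both the velocity weight and ϑ at v are dominated by their sums over the outgoing velocities;
the product of the sums is handled by `quadratic_weight_le`. The 16 is 8 from `le_add` times 2 from
that lemma. -/
lemma abs_gain_self_le (hK : KernelBounds γ b C) {β : ℝ} (hβ : 1 ≤ β) {ϑ : E3 → ℝ}
    (hϑ : GrowthWeight ϑ) {f : E3 → ℝ} {A M : ℝ} (hA : 0 ≤ A) (hM : 0 ≤ M)
    (h1 : ∀ v, |f v| ≤ M * (weight β v)⁻¹)
    (h2 : ∀ v, |f v| ≤ A * ((weight β v)⁻¹ * (ϑ v)⁻¹)) (v : E3) :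
    |gain γ b f f v| ≤ C * (16 * 2 ^ (β / 2) * A * M * ((weight β v)⁻¹ * (ϑ v)⁻¹)) := by
  have hϑv := hϑ.pos v
  have hwv := weight_pos β v
  refine abs_gain_le hK (by positivity) fun p => ?_
  obtain ⟨u, ω⟩ := p
  simp only [gainWeight]
  set U := postU v u ω
  set V := postV v u ω
  have hu := one_le_jap u
  have h3 : 1 ≤ (weight β v)⁻¹ * (2 ^ (β / 2) * (weight β U + weight β V)) := by
    rw [inv_mul_eq_div, one_le_div hwv]
    exact weight_le_postU_add_postV (by linarith) v u ω
  have h4 : 1 ≤ (ϑ v)⁻¹ * (8 * (ϑ U + ϑ V)) := by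
    rw [inv_mul_eq_div, one_le_div hϑv]
    exact hϑ.le_add v u ω
  have key := quadratic_weight_le (abs_nonneg (f V)) (weight_pos β U)
    (weight_pos β V) (hϑ.pos U) (hϑ.pos V) hA hM (h1 U) (h2 U) (h1 V) (h2 V)
  have hwU := inv_anti₀ (jap_pos U) (jap_le_weight hβ U)
  have hwV := inv_anti₀ (jap_pos V) (jap_le_weight hβ V)
  have hjU := inv_pos.2 (jap_pos U)
  have hjV := inv_pos.2 (jap_pos V)
  have h5 : 1 ≤ jap u ^ 4 := one_le_pow₀ hu
  have pU := weight_pos β U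
  have pV := weight_pos β V
  have qU := hϑ.pos U
  have qV := hϑ.pos V
  rw [abs_mul]
  calc |f U| * |f V| = |f U| * |f V| * 1 * 1 := by ring
    _ ≤ |f U| * |f V| * ((weight β v)⁻¹ * (2 ^ (β / 2) * (weight β U + weight β V))) *
        ((ϑ v)⁻¹ * (8 * (ϑ U + ϑ V))) := by gcongr
    _ = 8 * 2 ^ (β / 2) * ((weight β v)⁻¹ * (ϑ v)⁻¹) *
        (|f U| * |f V| * ((ϑ U + ϑ V) * (weight β U + weight β V))) := by ring
    _ ≤ 8 * 2 ^ (β / 2) * ((weight β v)⁻¹ * (ϑ v)⁻¹) *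
        (2 * A * M * ((weight β U)⁻¹ + (weight β V)⁻¹)) := by gcongr
    _ = 16 * 2 ^ (β / 2) * A * M * ((weight β v)⁻¹ * (ϑ v)⁻¹) *
        (1 * ((weight β U)⁻¹ + (weight β V)⁻¹)) := by ring
    _ ≤ _ := by gcongr

/-- The Gaussian profile `√μ` absorbs every weight. -/
lemma exists_sqrtM_weight_le (β : ℝ) (n : ℕ) :
    ∃ B : ℝ, 1 ≤ B ∧ ∀ v : E3, sqrtM v * (jap v ^ n * weight β v) ≤ B := by
  obtain ⟨k, hk⟩ := exists_nat_ge β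
  obtain ⟨B, hB, h⟩ := exists_sqrtM_mul_jap_pow_le (n + k)
  refine ⟨1 + B, by linarith, fun v => ?_⟩
  have h1 := weight_le_pow hk v
  have := sqrtM_pos v
  have := jap_pos v
  calc _ ≤ sqrtM v * (jap v ^ n * jap v ^ k) := by gcongr
    _ = sqrtM v * jap v ^ (n + k) := by ring
    _ ≤ 1 + B := by linarith [h v]

lemma gaussian_weight_le {B x y X Y m c : ℝ} (hm : 0 < m) (hx : 0 < x) (hX : 1 ≤ X)
    (hY : 0 < Y) (hYy : Y ≤ y) (hB : 1 ≤ B) (h : m * (X ^ 5 * x) ≤ B)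
    (hB2 : m * X ^ 5 ≤ B) (hc : 0 ≤ c) :
    m * (X ^ 4) * (c * (x + y)) * y⁻¹ ≤ c * B * (X⁻¹ + Y⁻¹) := by
  have hy : 0 < y := by linarith
  have h1 : m * X ^ 4 * x ≤ B := by
    refine le_trans ?_ h
    have : X ^ 4 ≤ X ^ 5 := pow_le_pow_right₀ hX (by norm_num)
    calc m * X ^ 4 * x = m * (X ^ 4 * x) := by ring
      _ ≤ _ := by gcongr
  have h2 : m * X ^ 4 ≤ B * X⁻¹ := by
    rw [← div_eq_mul_inv, le_div_iff₀ (by linarith)]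
    calc _ = m * X ^ 5 := by ring
      _ ≤ B := hB2
  have h3 : y⁻¹ ≤ Y⁻¹ := inv_anti₀ hY hYy
  calc m * (X ^ 4) * (c * (x + y)) * y⁻¹ = c * ((m * X ^ 4 * x) * y⁻¹ + m * X ^ 4) := by
        field_simp
    _ ≤ c * (B * Y⁻¹ + B * X⁻¹) := by gcongr
    _ = _ := by ring

/-- Against a Gaussian factor at X every power of J(X) is free, so ϑ may be moved from the other
velocity to v with the crude fourth-power bound. This costs (3 J(X) J(u))⁴: hence 81, and hence the
power J(u)⁴ in `gainWeight`. -/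
lemma abs_gain_sqrtM_le (hK : KernelBounds γ b C) {β : ℝ} (hβ : 1 ≤ β) {ϑ : E3 → ℝ}
    (hϑ : GrowthWeight ϑ) {f : E3 → ℝ} {A B : ℝ} (hA : 0 ≤ A) (hB : 1 ≤ B)
    (hBb : ∀ v : E3, sqrtM v * (jap v ^ 5 * weight β v) ≤ B)
    (h2 : ∀ v, |f v| ≤ A * ((weight β v)⁻¹ * (ϑ v)⁻¹)) (v : E3) :
    |gain γ b sqrtM f v| ≤ C * (81 * 2 ^ (β / 2) * B * A * ((weight β v)⁻¹ * (ϑ v)⁻¹)) ∧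
    |gain γ b f sqrtM v| ≤ C * (81 * 2 ^ (β / 2) * B * A * ((weight β v)⁻¹ * (ϑ v)⁻¹)) ∧
    |sqrtM v * freq γ b f v| ≤ C * (81 * 2 ^ (β / 2) * B * A * ((weight β v)⁻¹ * (ϑ v)⁻¹)) := by
  have hϑv := hϑ.pos v
  have hwv := weight_pos β v
  have hc1 : (1 : ℝ) ≤ 2 ^ (β / 2) := Real.one_le_rpow (by norm_num) (by linarith)
  have hBb' : ∀ v : E3, sqrtM v * jap v ^ 5 ≤ B := fun v => by
    have := sqrtM_pos v
    have := jap_pos v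
    refine le_trans ?_ (hBb v)
    gcongr
    exact le_mul_of_one_le_right (by positivity) (one_le_weight (by linarith) v)
  have hpos : 0 ≤ 81 * 2 ^ (β / 2) * B * A * ((weight β v)⁻¹ * (ϑ v)⁻¹) := by positivity
  have step : ∀ (u X Y : E3), 1 + ‖v - Y‖ ≤ 3 * (jap X * jap u) →
      weight β v ≤ 2 ^ (β / 2) * (weight β X + weight β Y) →
      sqrtM X * |f Y| ≤ 81 * 2 ^ (β / 2) * B * A * ((weight β v)⁻¹ * (ϑ v)⁻¹) *
        (jap u ^ 4 * ((jap X)⁻¹ + (jap Y)⁻¹)) := by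
    intro u X Y h3 h4
    have hY := hϑ.pos Y
    have mX := sqrtM_pos X
    have wX := weight_pos β X
    have wY := weight_pos β Y
    have ju := jap_pos u
    have jX := jap_pos X
    -- The distance from v to one outgoing velocity equals the distance from u to the other, and so
    -- is controlled by J(X) J(u).
    have h5 : (ϑ Y)⁻¹ ≤ (3 * (jap X * jap u)) ^ 4 * (ϑ v)⁻¹ := by
      rw [← div_eq_mul_inv, le_div_iff₀ hϑv, inv_mul_le_iff₀ hY, mul_comm (ϑ Y)]
      refine (hϑ.le v Y).trans ?_
      gcongr
    have h6 : 1 ≤ (weight β v)⁻¹ * (2 ^ (β / 2) * (weight β X + weight β Y)) := by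
      rw [inv_mul_eq_div, one_le_div hwv]; exact h4
    have h7 := gaussian_weight_le mX wX (one_le_jap X) (jap_pos Y)
      (jap_le_weight hβ Y) hB (hBb X) (hBb' X) (c := 2 ^ (β / 2)) (by positivity)
    calc sqrtM X * |f Y| ≤ sqrtM X * (A * ((weight β Y)⁻¹ *
          ((3 * (jap X * jap u)) ^ 4 * (ϑ v)⁻¹))) * 1 := by
          rw [mul_one]
          have := h2 Y
          gcongr
          exact this.trans (by gcongr)
      _ ≤ sqrtM X * (A * ((weight β Y)⁻¹ * ((3 * (jap X * jap u)) ^ 4 * (ϑ v)⁻¹))) *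
          ((weight β v)⁻¹ * (2 ^ (β / 2) * (weight β X + weight β Y))) := by gcongr
      _ = 81 * A * ((weight β v)⁻¹ * (ϑ v)⁻¹) * (jap u ^ 4 *
          (sqrtM X * jap X ^ 4 * (2 ^ (β / 2) * (weight β X + weight β Y)) * (weight β Y)⁻¹)) := by
          ring
      _ ≤ 81 * A * ((weight β v)⁻¹ * (ϑ v)⁻¹) * (jap u ^ 4 *
          (2 ^ (β / 2) * B * ((jap X)⁻¹ + (jap Y)⁻¹))) := by gcongr
      _ = _ := by ring
  refine ⟨abs_gain_le hK hpos fun p => ?_, abs_gain_le hK hpos fun p => ?_, ?_⟩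
  · rw [abs_mul, abs_of_pos (sqrtM_pos _)]
    refine step p.1 _ _ ?_ (weight_le_postU_add_postV (by linarith) v p.1 p.2)
    rw [sub_postV]
    exact one_add_norm_sub_le _ _
  · rw [abs_mul, abs_of_pos (sqrtM_pos _), mul_comm]
    refine (step p.1 _ _ ?_ ((weight_le_postU_add_postV (by linarith) v p.1 p.2).trans_eq
      (by rw [add_comm (weight β (postU v p.1 p.2))]))).trans_eq ?_
    · rw [sub_postU]
      exact one_add_norm_sub_le _ _
    · unfold gainWeight
      rw [add_comm (jap (postU v p.1 p.2))⁻¹]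
  · have hv := jap_pos v
    have h1 : |freq γ b f v| ≤ C * (81 * A * jap v ^ 4 * (ϑ v)⁻¹) * jap v := by
      refine abs_freq_le hK (by positivity) fun u => ?_
      have hu := hϑ.pos u
      have ju := jap_pos u
      have h5 : (ϑ u)⁻¹ ≤ (3 * (jap v * jap u)) ^ 4 * (ϑ v)⁻¹ := by
        rw [← div_eq_mul_inv, le_div_iff₀ hϑv, inv_mul_le_iff₀ hu, mul_comm (ϑ u)]
        refine (hϑ.le v u).trans ?_
        gcongr
        exact one_add_norm_sub_le _ _
      calc |f u| ≤ A * ((weight β u)⁻¹ * (ϑ u)⁻¹) := h2 u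
        _ ≤ A * (1 * ((3 * (jap v * jap u)) ^ 4 * (ϑ v)⁻¹)) := by
            have := weight_inv_le_one (by linarith : (0 : ℝ) ≤ β) u
            gcongr
        _ = _ := by ring
    have hC := hK.one_le
    have hm := sqrtM_pos v
    rw [abs_mul, abs_of_pos hm]
    calc sqrtM v * |freq γ b f v| ≤ sqrtM v * (C * (81 * A * jap v ^ 4 * (ϑ v)⁻¹) * jap v) := by
          gcongr
      _ = C * 81 * A * ((weight β v)⁻¹ * (ϑ v)⁻¹) * (sqrtM v * (jap v ^ 5 * weight β v)) := by
          field_simp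
      _ ≤ C * 81 * A * ((weight β v)⁻¹ * (ϑ v)⁻¹) * B := by gcongr; exact hBb v
      _ = C * (81 * 1 * B * A * ((weight β v)⁻¹ * (ϑ v)⁻¹)) := by ring
      _ ≤ _ := by gcongr

/-- The constants on which the local theory for the weight `w_β` depends. -/
structure Bounds (γ β : ℝ) (b : ℝ → ℝ) (C : ℝ) : Prop where
  one_le : 1 ≤ C
  source_le : ∀ {ϑ : E3 → ℝ}, GrowthWeight ϑ → ∀ {f : E3 → ℝ} {A M : ℝ}, 0 ≤ A → 0 ≤ M →
    (∀ v, |f v| ≤ M * (weight β v)⁻¹) → (∀ v, |f v| ≤ A * ((weight β v)⁻¹ * (ϑ v)⁻¹)) →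
    ∀ v, |source γ b f v| ≤ C * (A * (1 + M) * ((weight β v)⁻¹ * (ϑ v)⁻¹))
  diff_le : ∀ {κ : E3 → ℝ}, SlowWeight κ → ∀ {d e : E3 → ℝ} {D E : ℝ}, 0 ≤ D → 0 ≤ E →
    (∀ v, |d v| ≤ D * ((weight (β - 2) v)⁻¹ * κ v)) → (∀ v, |e v| ≤ E * (weight β v)⁻¹) →
    ∀ v, |gain γ b d e v| ≤ C * (D * E * ((weight (β - 2) v)⁻¹ * κ v)) ∧
      |gain γ b e d v| ≤ C * (D * E * ((weight (β - 2) v)⁻¹ * κ v)) ∧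
      |e v| * |freq γ b d v| ≤ C * (D * E * ((weight (β - 2) v)⁻¹ * κ v))
  sqrtM_le : ∀ v, sqrtM v ≤ C * (weight β v)⁻¹

lemma exists_bounds {β : ℝ} (hβ : 3 < β) (C : ℝ) :
    ∃ C' : ℝ, ∀ b : ℝ → ℝ, KernelBounds γ b C → Bounds γ β b C' := by
  obtain ⟨B, hB, hBb⟩ := exists_sqrtM_weight_le β 5
  have hc1 : (1 : ℝ) ≤ 2 ^ (β / 2) := Real.one_le_rpow (by norm_num) (by linarith)
  have hc2 : (2 : ℝ) ^ ((β - 2) / 2) ≤ 2 ^ (β / 2) :=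
    Real.rpow_le_rpow_of_exponent_le (by norm_num) (by linarith)
  have hc3 : (0 : ℝ) < 2 ^ ((β - 2) / 2) := by positivity
  -- `C` is an arbitrary real here; if it is below 1, no kernel satisfies `KernelBounds` and nothing
  -- is to be proved.
  by_cases hC : 1 ≤ C
  swap
  · exact ⟨1, fun b hK => absurd hK.one_le hC⟩
  set c : ℝ := 2 ^ (β / 2) with hc
  have hcB : 1 ≤ c * B := by nlinarith
  have hCcB : 1 ≤ C * (c * B) := by nlinarith
  refine ⟨C * (300 * (c * B)), fun b hK => ⟨by nlinarith, ?_, ?_, fun v => ?_⟩⟩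
  · intro ϑ hϑ f A M hA hM h1 h2 v
    have g1 := abs_gain_self_le hK (by linarith) hϑ hA hM h1 h2 v
    obtain ⟨g2, g3, g4⟩ := abs_gain_sqrtM_le hK (by linarith) hϑ hA hB hBb h2 v
    have hϑv := hϑ.pos v
    have hwv := weight_pos β v
    set R := (weight β v)⁻¹ * (ϑ v)⁻¹ with hR
    have hR0 : 0 < R := by positivity
    have t : |source γ b f v| ≤ |gain γ b sqrtM f v| + |gain γ b f sqrtM v| + |gain γ b f f v| +
        |sqrtM v * freq γ b f v| := by
      unfold source
      have t1 := abs_sub (gain γ b sqrtM f v + gain γ b f sqrtM v + gain γ b f f v)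
        (sqrtM v * freq γ b f v)
      have t2 := abs_add_le (gain γ b sqrtM f v + gain γ b f sqrtM v) (gain γ b f f v)
      have t3 := abs_add_le (gain γ b sqrtM f v) (gain γ b f sqrtM v)
      linarith
    have e1 : C * (16 * c * A * M * R) ≤ C * (16 * (c * B) * A * M * R) := by
      have : c ≤ c * B := le_mul_of_one_le_right (by linarith) hB
      gcongr
    calc |source γ b f v| ≤ 3 * (C * (81 * c * B * A * R)) + C * (16 * (c * B) * A * M * R) := by
          linarith
      _ ≤ 3 * (C * (100 * (c * B) * A * R)) + C * (300 * (c * B) * A * M * R) := by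
          have : 81 * c * B ≤ 100 * (c * B) := by nlinarith
          gcongr
          norm_num
      _ = _ := by ring
  · intro κ hκ d e D E hD hE hd he v
    have he' : ∀ v, |e v| ≤ E * (weight (β - 2 + 2) v)⁻¹ := by simpa using he
    have hκv := hκ.pos v
    have hwv := weight_pos (β - 2) v
    -- The place where β > 3 is used: after giving up two powers, the weight must still dominate J.
    have ha : 1 ≤ β - 2 := by linarith
    have fin : C * (3 * 2 ^ ((β - 2) / 2) * D * E * ((weight (β - 2) v)⁻¹ * κ v)) ≤
        C * (300 * (c * B)) * (D * E * ((weight (β - 2) v)⁻¹ * κ v)) := by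
      have : 3 * (2 : ℝ) ^ ((β - 2) / 2) ≤ 300 * (c * B) := by nlinarith
      calc _ = C * (3 * 2 ^ ((β - 2) / 2)) * (D * E * ((weight (β - 2) v)⁻¹ * κ v)) := by ring
        _ ≤ _ := by gcongr
    exact ⟨(abs_gain_left_le hK ha hκ hD hE hd he' v).trans fin,
      (abs_gain_right_le hK ha hκ hD hE hd he' v).trans fin,
      (abs_mul_freq_le hK ha hκ hD hE hd he' v).trans fin⟩
  · rw [← div_eq_mul_inv, le_div_iff₀ (weight_pos β v)]
    have h := hBb v
    have h5 : 1 ≤ jap v ^ 5 := one_le_pow₀ (one_le_jap v)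
    have := weight_pos β v
    have := sqrtM_pos v
    calc sqrtM v * weight β v ≤ sqrtM v * (jap v ^ 5 * weight β v) := by
          gcongr; exact le_mul_of_one_le_left (by positivity) h5
      _ ≤ B := h
      _ ≤ _ := by nlinarith

end Weighted

/-! ### Linear equations along a characteristic -/

/-- On `[0, T]` the function `y` is absolutely continuous with derivative `q` almost everywhere. -/
def IsPrim (T : ℝ) (y q : ℝ → ℝ) : Prop :=
  AbsolutelyContinuousOnInterval y 0 T ∧ ∀ᵐ t, t ∈ uIcc 0 T → HasDerivAt y (q t) t

lemma absolutelyContinuous_congr {a b : ℝ} {y z : ℝ → ℝ}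
    (hy : AbsolutelyContinuousOnInterval y a b) (h : ∀ t ∈ uIcc a b, y t = z t) :
    AbsolutelyContinuousOnInterval z a b := by
  rw [absolutelyContinuousOnInterval_iff] at hy ⊢
  intro ε hε
  obtain ⟨δ, hδ, H⟩ := hy ε hε
  refine ⟨δ, hδ, fun E hE hlt => ?_⟩
  have := H E hE hlt
  refine lt_of_eq_of_lt (Finset.sum_congr rfl fun i hi => ?_) this
  rw [h _ (hE.1 i hi).1, h _ (hE.1 i hi).2]

lemma absolutelyContinuous_comp {a b : ℝ} {y φ : ℝ → ℝ} {s : Set ℝ} {L : NNReal}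
    (hy : AbsolutelyContinuousOnInterval y a b) (hφ : LipschitzOnWith L φ s)
    (hs : ∀ t ∈ uIcc a b, y t ∈ s) : AbsolutelyContinuousOnInterval (fun t => φ (y t)) a b := by
  rw [absolutelyContinuousOnInterval_iff] at hy ⊢
  intro ε hε
  -- Dividing by L + 1 avoids the case L = 0 and makes the final inequality strict.
  obtain ⟨δ, hδ, H⟩ := hy (ε / (L + 1)) (by positivity)
  refine ⟨δ, hδ, fun E hE hlt => ?_⟩
  have := H E hE hlt
  calc _ ≤ ∑ i ∈ Finset.range E.1, L * dist (y (E.2 i).1) (y (E.2 i).2) :=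
        Finset.sum_le_sum fun i hi => hφ.dist_le_mul _ (hs _ (hE.1 i hi).1) _ (hs _ (hE.1 i hi).2)
    _ = L * ∑ i ∈ Finset.range E.1, dist (y (E.2 i).1) (y (E.2 i).2) := by
        rw [Finset.mul_sum]
    _ ≤ L * (ε / (L + 1)) := by gcongr
    _ < (L + 1) * (ε / (L + 1)) := by gcongr; linarith
    _ = ε := by field

section Prim

variable {T : ℝ} {y z q r : ℝ → ℝ}

lemma IsPrim.eq_add_integral (hT : 0 ≤ T) (h : IsPrim T y q) {t : ℝ} (ht : t ∈ Icc 0 T) :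
    y t = y 0 + ∫ s in (0 : ℝ)..t, q s := by
  have hsub : uIcc 0 t ⊆ uIcc 0 T := by
    rw [uIcc_of_le ht.1, uIcc_of_le hT]; exact Icc_subset_Icc_right ht.2
  have h1 := (h.1.mono hsub).integral_deriv_eq_sub
  have h2 : ∫ s in (0 : ℝ)..t, q s = ∫ s in (0 : ℝ)..t, deriv y s := by
    refine intervalIntegral.integral_congr_ae ?_
    filter_upwards [h.2] with s hs hst
    exact (hs (hsub (uIoc_subset_uIcc hst))).deriv.symm
  rw [h2, h1]; ring

lemma IsPrim.congr (hT : 0 ≤ T) (h : IsPrim T y q) (hyz : ∀ t ∈ Icc 0 T, y t = z t)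
    (hqr : ∀ᵐ t, t ∈ Icc 0 T → q t = r t) : IsPrim T z r := by
  refine ⟨absolutelyContinuous_congr h.1 (by rwa [uIcc_of_le hT]), ?_⟩
  -- Agreement on [0, T] determines the two-sided derivative only at interior points, so the two
  -- endpoints are discarded.
  have h0 : ∀ᵐ x : ℝ, x ≠ 0 := by simp [ae_iff, measure_singleton]
  have hT' : ∀ᵐ x : ℝ, x ≠ T := by simp [ae_iff, measure_singleton]
  rw [uIcc_of_le hT]
  have h2 := h.2
  rw [uIcc_of_le hT] at h2
  filter_upwards [h2, h0, hT', hqr] with t h1 h2 h3 h4 ht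
  have hnhds : Icc 0 T ∈ nhds t :=
    Icc_mem_nhds (lt_of_le_of_ne ht.1 (Ne.symm h2)) (lt_of_le_of_ne ht.2 h3)
  rw [← h4 ht]
  exact (h1 ht).congr_of_eventuallyEq (Filter.mem_of_superset hnhds fun s hs => (hyz s hs).symm)

lemma isPrim_of_integral (hT : 0 ≤ T) (hq : IntervalIntegrable q volume 0 T) {c : ℝ}
    (h : ∀ t ∈ Icc 0 T, y t = c + ∫ s in (0 : ℝ)..t, q s) : IsPrim T y q := by
  have hp : IsPrim T (fun t => c + ∫ s in (0 : ℝ)..t, q s) q := by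
    refine ⟨?_, ?_⟩
    · have h1 : AbsolutelyContinuousOnInterval (fun _ : ℝ => c) 0 T :=
        (LipschitzWith.const c).lipschitzOnWith.absolutelyContinuousOnInterval
      exact h1.add (hq.absolutelyContinuousOnInterval_intervalIntegral (by simp))
    · filter_upwards [hq.ae_hasDerivAt_integral] with t ht hmem
      exact (ht hmem 0 (by simp)).const_add c
  exact hp.congr hT (fun t ht => (h t ht).symm) (Filter.Eventually.of_forall fun _ _ => rfl)

lemma IsPrim.mul (hy : IsPrim T y q) (hz : IsPrim T z r) :
    IsPrim T (fun t => y t * z t) (fun t => q t * z t + y t * r t) := by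
  refine ⟨hy.1.fun_mul hz.1, ?_⟩
  filter_upwards [hy.2, hz.2] with t h1 h2 ht
  exact (h1 ht).mul (h2 ht)

lemma IsPrim.sub (hy : IsPrim T y q) (hz : IsPrim T z r) :
    IsPrim T (fun t => y t - z t) (fun t => q t - r t) := by
  refine ⟨hy.1.sub hz.1, ?_⟩
  filter_upwards [hy.2, hz.2] with t h1 h2 ht
  exact (h1 ht).sub (h2 ht)

lemma IsPrim.add (hy : IsPrim T y q) (hz : IsPrim T z r) :
    IsPrim T (fun t => y t + z t) (fun t => q t + r t) := by
  refine ⟨hy.1.add hz.1, ?_⟩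
  filter_upwards [hy.2, hz.2] with t h1 h2 ht
  exact (h1 ht).add (h2 ht)

lemma isPrim_const (c : ℝ) : IsPrim T (fun _ => c) (fun _ => 0) :=
  ⟨(LipschitzWith.const c).lipschitzOnWith.absolutelyContinuousOnInterval,
    Filter.Eventually.of_forall fun t _ => hasDerivAt_const t c⟩

/-- A C¹ function is Lipschitz on a compact interval, so it preserves absolute continuity of curves
that stay in the interval. Exponentials and r ln r both enter this way. -/
lemma IsPrim.comp (hy : IsPrim T y q) {φ φ' : ℝ → ℝ} {lo hi : ℝ}
    (hφ : ContDiffOn ℝ 1 φ (Icc lo hi)) (hd : ∀ x ∈ Icc lo hi, HasDerivAt φ (φ' x) x)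
    (hr : ∀ t ∈ uIcc 0 T, y t ∈ Icc lo hi) :
    IsPrim T (fun t => φ (y t)) (fun t => φ' (y t) * q t) := by
  obtain ⟨L, hL⟩ := hφ.exists_lipschitzOnWith (by decide) (convex_Icc _ _) isCompact_Icc
  refine ⟨absolutelyContinuous_comp hy.1 hL hr, ?_⟩
  filter_upwards [hy.2] with t h1 ht
  exact (hd _ (hr t ht)).comp t (h1 ht)

lemma IsPrim.exp (hy : IsPrim T y q) :
    IsPrim T (fun t => Real.exp (y t)) (fun t => Real.exp (y t) * q t) := by
  obtain ⟨c, hc⟩ := hy.1.exists_bound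
  refine hy.comp (lo := -c) (hi := c) Real.contDiff_exp.contDiffOn
    (fun x _ => Real.hasDerivAt_exp x) fun t ht => ?_
  have := hc t ht
  rw [Real.norm_eq_abs] at this
  exact abs_le.1 this

lemma IsPrim.continuousOn (hy : IsPrim T y q) : ContinuousOn y (uIcc 0 T) := hy.1.continuousOn

/-- The solution of `y' = g - a y`, `y(0) = y₀`. -/
def duhamel (a g : ℝ → ℝ) (y₀ t : ℝ) : ℝ :=
  Real.exp (-∫ s in (0 : ℝ)..t, a s) *
    (y₀ + ∫ s in (0 : ℝ)..t, Real.exp (∫ τ in (0 : ℝ)..s, a τ) * g s)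

variable {a g : ℝ → ℝ} {y₀ : ℝ}

lemma isPrim_integral (hT : 0 ≤ T) (ha : IntervalIntegrable a volume 0 T) :
    IsPrim T (fun t => ∫ s in (0 : ℝ)..t, a s) a :=
  isPrim_of_integral (c := 0) hT ha fun _ _ => (zero_add _).symm

lemma intervalIntegrable_exp_mul (hT : 0 ≤ T) (ha : IntervalIntegrable a volume 0 T)
    (hg : IntervalIntegrable g volume 0 T) :
    IntervalIntegrable (fun s => Real.exp (∫ τ in (0 : ℝ)..s, a τ) * g s) volume 0 T :=
  hg.continuousOn_mul (isPrim_integral hT ha).exp.continuousOn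

lemma duhamel_zero : duhamel a g y₀ 0 = y₀ := by simp [duhamel]

lemma isPrim_duhamel (hT : 0 ≤ T) (ha : IntervalIntegrable a volume 0 T)
    (hg : IntervalIntegrable g volume 0 T) :
    IsPrim T (duhamel a g y₀) (fun t => g t - a t * duhamel a g y₀ t) := by
  have hA := isPrim_integral hT ha
  have h1 : IsPrim T (fun t => -∫ s in (0 : ℝ)..t, a s) (fun t => 0 - a t) :=
    ((isPrim_const 0).sub hA).congr hT (fun t _ => zero_sub _)
      (Filter.Eventually.of_forall fun _ _ => rfl)
  have h2 : IsPrim T (fun t => y₀ + ∫ s in (0 : ℝ)..t, Real.exp (∫ τ in (0 : ℝ)..s, a τ) * g s) _ :=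
    isPrim_of_integral hT (intervalIntegrable_exp_mul hT ha hg) fun t _ => rfl
  refine (h1.exp.mul h2).congr hT (fun t _ => rfl) (Filter.Eventually.of_forall fun t _ => ?_)
  simp only [duhamel]
  have : Real.exp (-∫ s in (0 : ℝ)..t, a s) * Real.exp (∫ s in (0 : ℝ)..t, a s) = 1 := by
    rw [← Real.exp_add]; simp
  linear_combination g t * this

/-- Integrating factor. Absolute continuity is what lets merely integrable coefficients determine
the solution from its initial value. -/
lemma IsPrim.eq_duhamel (hT : 0 ≤ T) (ha : IntervalIntegrable a volume 0 T)
    (hy : IsPrim T y (fun t => g t - a t * y t)) {t : ℝ} (ht : t ∈ Icc 0 T) :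
    y t = duhamel a g (y 0) t := by
  have h1 := ((isPrim_integral hT ha).exp.mul hy).eq_add_integral hT ht
  simp only [intervalIntegral.integral_same, Real.exp_zero, one_mul] at h1
  have h2 : ∫ s in (0 : ℝ)..t, (Real.exp (∫ τ in (0 : ℝ)..s, a τ) * a s * y s +
      Real.exp (∫ τ in (0 : ℝ)..s, a τ) * (g s - a s * y s)) =
      ∫ s in (0 : ℝ)..t, Real.exp (∫ τ in (0 : ℝ)..s, a τ) * g s := by
    congr 1; ext s; ring
  rw [h2] at h1
  rw [duhamel, ← h1, ← mul_assoc, ← Real.exp_add]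
  simp

lemma exp_neg_integral_mul_le (ha : IntervalIntegrable a volume 0 T) (ha0 : ∀ s ∈ Icc 0 T, 0 ≤ a s)
    {s t : ℝ} (hs : 0 ≤ s) (hst : s ≤ t) (ht : t ≤ T) :
    Real.exp (-∫ τ in (0 : ℝ)..t, a τ) * Real.exp (∫ τ in (0 : ℝ)..s, a τ) ≤ 1 := by
  rw [← Real.exp_add, Real.exp_le_one_iff]
  have i1 : IntervalIntegrable a volume 0 s := ha.mono_set (by
    rw [uIcc_of_le hs, uIcc_of_le (by linarith)]; exact Icc_subset_Icc_right (by linarith))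
  have i2 : IntervalIntegrable a volume s t := ha.mono_set (by
    rw [uIcc_of_le hst, uIcc_of_le (by linarith)]; exact Icc_subset_Icc hs ht)
  rw [← intervalIntegral.integral_add_adjacent_intervals i1 i2]
  have := intervalIntegral.integral_nonneg (μ := volume) hst
    fun τ hτ => ha0 τ ⟨hs.trans hτ.1, hτ.2.trans ht⟩
  linarith

lemma IntervalIntegrable.mono_right {h : ℝ → ℝ} (hh : IntervalIntegrable h volume 0 T) {t : ℝ}
    (ht : t ∈ Icc 0 T) : IntervalIntegrable h volume 0 t :=
  hh.mono_set (by
    rw [uIcc_of_le ht.1, uIcc_of_le (ht.1.trans ht.2)]; exact Icc_subset_Icc_right ht.2)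

/-- For a nonnegative coefficient the propagator is at most 1, so the size of `a` does not enter the
bound. An unbounded collision frequency is therefore harmless. -/
lemma abs_duhamel_le (ha : IntervalIntegrable a volume 0 T) (ha0 : ∀ s ∈ Icc 0 T, 0 ≤ a s)
    {h : ℝ → ℝ} (hh : IntervalIntegrable h volume 0 T) (hg : ∀ s ∈ Icc 0 T, |g s| ≤ h s) {t : ℝ}
    (ht : t ∈ Icc 0 T) : |duhamel a g y₀ t| ≤ |y₀| + ∫ s in (0 : ℝ)..t, h s := by
  have e : duhamel a g y₀ t = Real.exp (-∫ s in (0 : ℝ)..t, a s) * y₀ +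
      ∫ s in (0 : ℝ)..t, Real.exp (-∫ s in (0 : ℝ)..t, a s) *
        (Real.exp (∫ τ in (0 : ℝ)..s, a τ) * g s) := by
    rw [intervalIntegral.integral_const_mul, duhamel, mul_add]
  rw [e]
  have h0 := exp_neg_integral_mul_le ha ha0 le_rfl ht.1 ht.2
  rw [intervalIntegral.integral_same, Real.exp_zero, mul_one] at h0
  refine (abs_add_le _ _).trans (add_le_add ?_ ?_)
  · rw [abs_mul, Real.abs_exp]
    exact mul_le_of_le_one_left (abs_nonneg _) h0
  · rw [← Real.norm_eq_abs]
    refine intervalIntegral.norm_integral_le_of_norm_le ht.1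
      (Filter.Eventually.of_forall fun s hs => ?_) (IntervalIntegrable.mono_right hh ht)
    have hs' : s ∈ Icc 0 T := ⟨hs.1.le, hs.2.trans ht.2⟩
    rw [Real.norm_eq_abs, ← mul_assoc, abs_mul, abs_mul, Real.abs_exp, Real.abs_exp]
    refine (mul_le_of_le_one_left (abs_nonneg _) ?_).trans (hg s hs')
    exact exp_neg_integral_mul_le ha ha0 hs'.1 hs.2 ht.2

lemma duhamel_nonneg (hy₀ : 0 ≤ y₀) {t : ℝ} (ht : 0 ≤ t) (hg : ∀ s ∈ Icc 0 t, 0 ≤ g s) :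
    0 ≤ duhamel a g y₀ t :=
  mul_nonneg (Real.exp_pos _).le (add_nonneg hy₀ (intervalIntegral.integral_nonneg ht
    fun s hs => mul_nonneg (Real.exp_pos _).le (hg s hs)))

lemma le_duhamel {t : ℝ} (ht : 0 ≤ t) (hg : ∀ s ∈ Icc 0 t, 0 ≤ g s) :
    Real.exp (-∫ s in (0 : ℝ)..t, a s) * y₀ ≤ duhamel a g y₀ t := by
  unfold duhamel
  gcongr
  exact le_add_of_nonneg_right (intervalIntegral.integral_nonneg ht
    fun s hs => mul_nonneg (Real.exp_pos _).le (hg s hs))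

/-- The difference solves an equation with the first damping `a` and source g − g' − (a − a') y',
where y' is the second solution. Only y' meets the difference of frequencies. -/
lemma abs_duhamel_sub_le (hT : 0 ≤ T) {a' g' : ℝ → ℝ} {y₀' : ℝ}
    (ha : IntervalIntegrable a volume 0 T)
    (ha0 : ∀ s ∈ Icc 0 T, 0 ≤ a s) (hg : IntervalIntegrable g volume 0 T)
    (ha' : IntervalIntegrable a' volume 0 T) (hg' : IntervalIntegrable g' volume 0 T)
    {h : ℝ → ℝ} (hh : IntervalIntegrable h volume 0 T)
    (hle : ∀ s ∈ Icc 0 T, |g s - g' s| + |a s - a' s| * |duhamel a' g' y₀' s| ≤ h s) {t : ℝ}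
    (ht : t ∈ Icc 0 T) :
    |duhamel a g y₀ t - duhamel a' g' y₀' t| ≤ |y₀ - y₀'| + ∫ s in (0 : ℝ)..t, h s := by
  have hd := (isPrim_duhamel (y₀ := y₀) hT ha hg).sub (isPrim_duhamel (y₀ := y₀') hT ha' hg')
  have hd' : IsPrim T (fun t => duhamel a g y₀ t - duhamel a' g' y₀' t) (fun t =>
      (g t - g' t - (a t - a' t) * duhamel a' g' y₀' t) -
        a t * (duhamel a g y₀ t - duhamel a' g' y₀' t)) :=
    hd.congr hT (fun _ _ => rfl) (Filter.Eventually.of_forall fun t _ => by ring)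
  have e := IsPrim.eq_duhamel hT ha
    (g := fun t => g t - g' t - (a t - a' t) * duhamel a' g' y₀' t) hd' ht
  simp only [duhamel_zero] at e
  rw [e]
  refine abs_duhamel_le ha ha0 hh (fun s hs => ?_) ht
  refine le_trans (abs_sub _ _) ?_
  rw [abs_mul]; exact hle s hs

/-- Keeps the damping of |y|, unlike `abs_duhamel_le`. If Y solves the equation with source P and
initial value |y 0|, then |y| ≤ Y, and Y = |y 0| + ∫ (P − a Y) is at most the right-hand side
because a ≥ 0. -/
lemma IsPrim.abs_le (hT : 0 ≤ T) {p P : ℝ → ℝ} (ha : IntervalIntegrable a volume 0 T)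
    (ha0 : ∀ s ∈ Icc 0 T, 0 ≤ a s) (hP : IntervalIntegrable P volume 0 T)
    (hpP : ∀ s ∈ Icc 0 T, |p s| ≤ P s)
    (hy : IsPrim T y (fun t => p t - a t * y t)) {t : ℝ} (ht : t ∈ Icc 0 T) :
    |y t| ≤ |y 0| + ∫ s in (0 : ℝ)..t, (P s - a s * |y s|) := by
  have hY := isPrim_duhamel (y₀ := |y 0|) hT ha hP
  have hle : ∀ s ∈ Icc 0 T, |y s| ≤ duhamel a P |y 0| s := by
    intro s hs
    rw [hy.eq_duhamel hT ha hs]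
    unfold duhamel
    have hE := Real.exp_pos (-∫ s in (0 : ℝ)..s, a s)
    rw [abs_mul, abs_of_pos hE]
    refine mul_le_mul_of_nonneg_left ((abs_add_le _ _).trans ?_) hE.le
    refine add_le_add le_rfl ?_
    rw [← Real.norm_eq_abs]
    refine intervalIntegral.norm_integral_le_of_norm_le hs.1
      (Filter.Eventually.of_forall fun τ hτ => ?_)
      (IntervalIntegrable.mono_right (intervalIntegrable_exp_mul hT ha hP) hs)
    rw [Real.norm_eq_abs, abs_mul, Real.abs_exp]
    gcongr
    exact hpP τ ⟨hτ.1.le, hτ.2.trans hs.2⟩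
  refine (hle t ht).trans ?_
  rw [hY.eq_add_integral hT ht, duhamel_zero]
  refine add_le_add le_rfl (intervalIntegral.integral_mono_on ht.1 ?_ ?_ fun s hs => ?_)
  · exact IntervalIntegrable.mono_right (hP.sub (ha.mul_continuousOn hY.continuousOn)) ht
  · exact IntervalIntegrable.mono_right (hP.sub (ha.mul_continuousOn hy.continuousOn.abs)) ht
  · have hs' : s ∈ Icc 0 T := ⟨hs.1, hs.2.trans ht.2⟩
    have := mul_le_mul_of_nonneg_left (hle s hs') (ha0 s hs')
    linarith

end Prim

/-! ### Dependence of the collision operators on parameters -/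

section Parameters

variable {γ C : ℝ} {b : ℝ → ℝ}

lemma measurable_gain {α : Type*} [MeasurableSpace α] (hK : KernelBounds γ b C)
    {F G : α → E3 → ℝ} (hF : Measurable fun p : α × E3 => F p.1 p.2)
    (hG : Measurable fun p : α × E3 => G p.1 p.2) :
    Measurable fun p : α × E3 => gain γ b (F p.1) (G p.1) p.2 := by
  have hU : Measurable fun q : (α × E3) × E3 × S2 => postU q.1.2 q.2.1 q.2.2 :=
    Measurable.postU (by fun_prop) (by fun_prop) (by fun_prop)
  have hV : Measurable fun q : (α × E3) × E3 × S2 => postV q.1.2 q.2.1 q.2.2 :=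
    Measurable.postV (by fun_prop) (by fun_prop) (by fun_prop)
  have hk : Measurable fun q : (α × E3) × E3 × S2 => kernel γ b (q.1.2 - q.2.1) q.2.2 :=
    measurable_comp₂ hK.measurable (g := fun q : (α × E3) × E3 × S2 => q.1.2 - q.2.1)
      (by fun_prop) (by fun_prop)
  have hm : Measurable fun q : (α × E3) × E3 × S2 => sqrtM q.2.1 :=
    measurable_sqrtM.comp (by fun_prop)
  have h1 : Measurable fun q : (α × E3) × E3 × S2 => F q.1.1 (postU q.1.2 q.2.1 q.2.2) :=
    measurable_comp₂ hF (g := fun q : (α × E3) × E3 × S2 => q.1.1) (by fun_prop) hU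
  have h2 : Measurable fun q : (α × E3) × E3 × S2 => G q.1.1 (postV q.1.2 q.2.1 q.2.2) :=
    measurable_comp₂ hG (g := fun q : (α × E3) × E3 × S2 => q.1.1) (by fun_prop) hV
  exact (((hk.mul hm).mul (h1.mul h2)).stronglyMeasurable.integral_prod_right'
    (ν := collisionMeasure)).measurable

lemma measurable_freq {α : Type*} [MeasurableSpace α] (hK : KernelBounds γ b C)
    {F : α → E3 → ℝ} (hF : Measurable fun p : α × E3 => F p.1 p.2) :
    Measurable fun p : α × E3 => freq γ b (F p.1) p.2 := by
  have hk : Measurable fun q : (α × E3) × E3 × S2 => kernel γ b (q.1.2 - q.2.1) q.2.2 :=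
    measurable_comp₂ hK.measurable (g := fun q : (α × E3) × E3 × S2 => q.1.2 - q.2.1)
      (by fun_prop) (by fun_prop)
  have hm : Measurable fun q : (α × E3) × E3 × S2 => sqrtM q.2.1 :=
    measurable_sqrtM.comp (by fun_prop)
  have h1 : Measurable fun q : (α × E3) × E3 × S2 => F q.1.1 q.2.1 :=
    measurable_comp₂ hF (g := fun q : (α × E3) × E3 × S2 => q.1.1) (by fun_prop) (by fun_prop)
  exact (((hk.mul hm).mul h1).stronglyMeasurable.integral_prod_right'
    (ν := collisionMeasure)).measurable

lemma measurable_sqrtM_snd {α : Type*} [MeasurableSpace α] :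
    Measurable fun p : α × E3 => sqrtM p.2 := measurable_sqrtM.comp measurable_snd

lemma measurable_shift {α : Type*} [MeasurableSpace α] {F : α → E3 → ℝ}
    (hF : Measurable fun p : α × E3 => F p.1 p.2) :
    Measurable fun p : α × E3 => shift (F p.1) p.2 := measurable_sqrtM_snd.add hF

lemma measurable_source {α : Type*} [MeasurableSpace α] (hK : KernelBounds γ b C)
    {F : α → E3 → ℝ} (hF : Measurable fun p : α × E3 => F p.1 p.2) :
    Measurable fun p : α × E3 => source γ b (F p.1) p.2 :=
  (((measurable_gain hK (F := fun _ => sqrtM) measurable_sqrtM_snd hF).add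
    (measurable_gain hK (G := fun _ => sqrtM) hF measurable_sqrtM_snd)).add
    (measurable_gain hK hF hF)).sub (measurable_sqrtM_snd.mul (measurable_freq hK hF))

/-- The change of variables `(z, ω) ↦ (v - z, ω)`. -/
def relEquiv (v : E3) : (E3 × S2) ≃ᵐ (E3 × S2) :=
  MeasurableEquiv.prodCongr (MeasurableEquiv.subLeft v) (MeasurableEquiv.refl S2)

lemma relEquiv_apply (v : E3) (p : E3 × S2) : relEquiv v p = (v - p.1, p.2) := rfl

lemma measurePreserving_relEquiv (v : E3) :
    MeasurePreserving (relEquiv v) collisionMeasure collisionMeasure :=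
  (Measure.measurePreserving_sub_left (volume : Measure E3) v).prod (MeasurePreserving.id sphereMeasure)

/-- In the relative velocity z = v − u the possibly singular kernel no longer depends on v; only
continuous factors do. -/
lemma gain_eq_rel (f g : E3 → ℝ) (v : E3) :
    gain γ b f g v = ∫ p : E3 × S2, kernel γ b p.1 p.2 * sqrtM (v - p.1) *
      (f (postU v (v - p.1) p.2) * g (postV v (v - p.1) p.2)) ∂collisionMeasure := by
  rw [gain, ← (measurePreserving_relEquiv v).integral_comp']
  congr 1; ext p
  simp only [relEquiv_apply, sub_sub_cancel]

lemma freq_eq_rel (f : E3 → ℝ) (v : E3) :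
    freq γ b f v = ∫ p : E3 × S2, kernel γ b p.1 p.2 * sqrtM (v - p.1) * f (v - p.1)
      ∂collisionMeasure := by
  rw [freq, ← (measurePreserving_relEquiv v).integral_comp']
  congr 1; ext p
  simp only [relEquiv_apply, sub_sub_cancel]

lemma integrable_rel (hK : KernelBounds γ b C) (v : E3) :
    Integrable (fun p : E3 × S2 => kernel γ b p.1 p.2 *
      (jap (v - p.1) ^ 4 * Real.exp (-(1 / 16 * ‖v - p.1‖ ^ 2)))) collisionMeasure := by
  have h := (measurePreserving_relEquiv v).integrable_comp_of_integrable (hK.freq_integrable v)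
  refine h.congr (Filter.Eventually.of_forall fun p => ?_)
  simp only [Function.comp, relEquiv_apply, sub_sub_cancel]

/-- A dominating function uniform for v within distance 1 of v₀. The weaker Gaussian exp (−|·|² /
16) in `KernelBounds` leaves room for this translation. -/
lemma sqrtM_le_near {v v₀ z : E3} (h : ‖v - v₀‖ ≤ 1) :
    sqrtM (v - z) ≤ Real.exp (1 / 4) *
      (jap (v₀ - z) ^ 4 * Real.exp (-(1 / 16 * ‖v₀ - z‖ ^ 2))) := by
  have h1 : ‖v₀ - z‖ ≤ ‖v - z‖ + 1 := by
    have : v₀ - z = (v - z) - (v - v₀) := by abel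
    rw [this]
    exact (norm_sub_le _ _).trans (by linarith)
  have h2 : 1 ≤ jap (v₀ - z) ^ 4 := one_le_pow₀ (one_le_jap _)
  calc sqrtM (v - z) ≤ Real.exp (-‖v - z‖ ^ 2 / 4) := sqrtM_le _
    _ ≤ Real.exp (1 / 4 + -(1 / 16 * ‖v₀ - z‖ ^ 2)) := by
        rw [Real.exp_le_exp]
        nlinarith [norm_nonneg (v - z), norm_nonneg (v₀ - z), sq_nonneg (‖v - z‖ - 1)]
    _ = Real.exp (1 / 4) * (1 * Real.exp (-(1 / 16 * ‖v₀ - z‖ ^ 2))) := by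
        rw [Real.exp_add, one_mul]
    _ ≤ _ := by gcongr

/-- Dominated convergence, with the translated Gaussian times the kernel as majorant near each
point. -/
lemma continuous_collision_integral {α : Type*} [TopologicalSpace α] [FirstCountableTopology α]
    [MeasurableSpace α] [BorelSpace α] (hK : KernelBounds γ b C)
    {H : α × E3 → E3 × S2 → ℝ} {E : ℝ} (hHm : ∀ q, Measurable (H q))
    (hHc : ∀ p, Continuous fun q => H q p) (hHb : ∀ q p, |H q p| ≤ E) :
    Continuous fun q : α × E3 => ∫ p : E3 × S2, kernel γ b p.1 p.2 * sqrtM (q.2 - p.1) * H q p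
      ∂collisionMeasure := by
  rw [continuous_iff_continuousAt]
  intro q₀
  have hm : ∀ q : α × E3, Measurable fun p : E3 × S2 => sqrtM (q.2 - p.1) := fun q =>
    measurable_sqrtM.comp (by fun_prop)
  refine continuousAt_of_dominated (bound := fun p : E3 × S2 => E * (Real.exp (1 / 4) *
    (kernel γ b p.1 p.2 * (jap (q₀.2 - p.1) ^ 4 * Real.exp (-(1 / 16 * ‖q₀.2 - p.1‖ ^ 2))))))
    (Filter.Eventually.of_forall fun q =>
      ((hK.measurable.mul (hm q)).mul (hHm q)).aestronglyMeasurable) ?_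
    (((integrable_rel hK q₀.2).const_mul _).const_mul _)
    (Filter.Eventually.of_forall fun p => ?_)
  · have : ∀ᶠ q : α × E3 in nhds q₀, ‖q.2 - q₀.2‖ < 1 := by
      have hc : Continuous fun q : α × E3 => ‖q.2 - q₀.2‖ := by fun_prop
      exact hc.continuousAt.eventually_lt continuousAt_const (by simp)
    filter_upwards [this] with q hq
    refine Filter.Eventually.of_forall fun p => ?_
    have hk := hK.nonneg p.1 p.2
    have hs := sqrtM_le_near (z := p.1) hq.le
    have hs0 := sqrtM_pos (q.2 - p.1)
    rw [Real.norm_eq_abs, abs_mul, abs_mul, abs_of_nonneg hk, abs_of_pos hs0]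
    calc kernel γ b p.1 p.2 * sqrtM (q.2 - p.1) * |H q p| ≤
          kernel γ b p.1 p.2 * (Real.exp (1 / 4) *
            (jap (q₀.2 - p.1) ^ 4 * Real.exp (-(1 / 16 * ‖q₀.2 - p.1‖ ^ 2)))) * E := by
          have := jap_pos (q₀.2 - p.1)
          exact mul_le_mul (mul_le_mul_of_nonneg_left hs hk) (hHb q p) (abs_nonneg _)
            (by positivity)
      _ = _ := by ring
  · have := hHc p
    have := continuous_sqrtM
    exact (by fun_prop : Continuous fun q : α × E3 =>
      kernel γ b p.1 p.2 * sqrtM (q.2 - p.1) * H q p).continuousAt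

variable {α : Type*} [TopologicalSpace α] [FirstCountableTopology α] [MeasurableSpace α]
  [BorelSpace α]

lemma continuous_gain (hK : KernelBounds γ b C) {F G : α → E3 → ℝ} {E E' : ℝ}
    (hF : Continuous fun p : α × E3 => F p.1 p.2) (hG : Continuous fun p : α × E3 => G p.1 p.2)
    (hFb : ∀ a v, |F a v| ≤ E) (hGb : ∀ a v, |G a v| ≤ E') :
    Continuous fun p : α × E3 => gain γ b (F p.1) (G p.1) p.2 := by
  simp only [gain_eq_rel]
  refine continuous_collision_integral hK (E := E * E')
    (H := fun q p => F q.1 (postU q.2 (q.2 - p.1) p.2) * G q.1 (postV q.2 (q.2 - p.1) p.2))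
    (fun q => ?_) (fun p => ?_) (fun q p => ?_)
  · have h1 : Continuous fun p : E3 × S2 => F q.1 (postU q.2 (q.2 - p.1) p.2) :=
      hF.comp (f := fun p : E3 × S2 => (q.1, postU q.2 (q.2 - p.1) p.2))
        (by unfold postU; fun_prop)
    have h2 : Continuous fun p : E3 × S2 => G q.1 (postV q.2 (q.2 - p.1) p.2) :=
      hG.comp (f := fun p : E3 × S2 => (q.1, postV q.2 (q.2 - p.1) p.2))
        (by unfold postV; fun_prop)
    exact (h1.mul h2).measurable
  · have h1 : Continuous fun q : α × E3 => F q.1 (postU q.2 (q.2 - p.1) p.2) :=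
      hF.comp (f := fun q : α × E3 => (q.1, postU q.2 (q.2 - p.1) p.2))
        (by unfold postU; fun_prop)
    have h2 : Continuous fun q : α × E3 => G q.1 (postV q.2 (q.2 - p.1) p.2) :=
      hG.comp (f := fun q : α × E3 => (q.1, postV q.2 (q.2 - p.1) p.2))
        (by unfold postV; fun_prop)
    exact h1.mul h2
  · rw [abs_mul]
    exact mul_le_mul (hFb _ _) (hGb _ _) (abs_nonneg _)
      ((abs_nonneg _).trans (hFb q.1 (postU q.2 (q.2 - p.1) p.2)))

lemma continuous_freq (hK : KernelBounds γ b C) {F : α → E3 → ℝ} {E : ℝ}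
    (hF : Continuous fun p : α × E3 => F p.1 p.2) (hFb : ∀ a v, |F a v| ≤ E) :
    Continuous fun p : α × E3 => freq γ b (F p.1) p.2 := by
  simp only [freq_eq_rel]
  refine continuous_collision_integral hK (E := E)
    (H := fun q p => F q.1 (q.2 - p.1)) (fun q => ?_) (fun p => ?_) (fun q p => hFb _ _)
  · have h1 : Continuous fun p : E3 × S2 => F q.1 (q.2 - p.1) :=
      hF.comp (f := fun p : E3 × S2 => (q.1, q.2 - p.1)) (by fun_prop)
    exact h1.measurable
  · exact hF.comp (f := fun q : α × E3 => (q.1, q.2 - p.1)) (by fun_prop)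

lemma abs_sqrtM_le_one (v : E3) : |sqrtM v| ≤ 1 := by
  rw [abs_of_pos (sqrtM_pos v)]; exact sqrtM_le_one v

lemma continuous_source (hK : KernelBounds γ b C) {F : α → E3 → ℝ} {E : ℝ}
    (hF : Continuous fun p : α × E3 => F p.1 p.2) (hFb : ∀ a v, |F a v| ≤ E) :
    Continuous fun p : α × E3 => source γ b (F p.1) p.2 := by
  have hm : Continuous fun p : α × E3 => sqrtM p.2 := continuous_sqrtM.comp continuous_snd
  exact (((continuous_gain hK (F := fun _ => sqrtM) hm hF (fun _ => abs_sqrtM_le_one) hFb).add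
    (continuous_gain hK (G := fun _ => sqrtM) hF hm hFb (fun _ => abs_sqrtM_le_one))).add
    (continuous_gain hK hF hF hFb hFb)).sub (hm.mul (continuous_freq hK hF hFb))

end Parameters

/-! ### Dependence of primitives and Duhamel integrals on parameters. -/

lemma measurable_primitive {α : Type*} [MeasurableSpace α] {a : α → ℝ → ℝ}
    (ha : Measurable fun p : α × ℝ => a p.1 p.2) :
    Measurable fun p : α × ℝ => ∫ s in (0 : ℝ)..p.2, a p.1 s := by
  -- Rescaling time to the fixed interval (0, 1] turns the variable upper limit into a parameter of
  -- the integrand; the identity holds for every sign of the time.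
  have h : ∀ p : α × ℝ, ∫ s in (0 : ℝ)..p.2, a p.1 s =
      p.2 * ∫ r in Ioc (0 : ℝ) 1, a p.1 (r * p.2) := by
    intro p
    have := intervalIntegral.mul_integral_comp_mul_right (a := 0) (b := 1) (f := a p.1) p.2
    rw [intervalIntegral.integral_of_le zero_le_one] at this
    rw [this, zero_mul, one_mul]
  simp only [h]
  refine measurable_snd.mul ?_
  have hm : Measurable fun q : (α × ℝ) × ℝ => a q.1.1 (q.2 * q.1.2) :=
    measurable_comp₂ ha (g := fun q : (α × ℝ) × ℝ => q.1.1) (by fun_prop) (by fun_prop)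
  exact (hm.stronglyMeasurable.integral_prod_right' (ν := volume.restrict (Ioc 0 1))).measurable

lemma measurable_duhamel {α : Type*} [MeasurableSpace α] {a g : α → ℝ → ℝ} {y₀ : α → ℝ}
    (ha : Measurable fun p : α × ℝ => a p.1 p.2) (hg : Measurable fun p : α × ℝ => g p.1 p.2)
    (hy : Measurable y₀) : Measurable fun p : α × ℝ => duhamel (a p.1) (g p.1) (y₀ p.1) p.2 := by
  have hA := measurable_primitive ha
  have hE : Measurable fun p : α × ℝ => Real.exp (∫ τ in (0 : ℝ)..p.2, a p.1 τ) * g p.1 p.2 :=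
    (Real.measurable_exp.comp hA).mul hg
  have hI := measurable_primitive (a := fun x s => Real.exp (∫ τ in (0 : ℝ)..s, a x τ) * g x s) hE
  exact (Real.measurable_exp.comp hA.neg).mul ((hy.comp measurable_fst).add hI)

lemma continuous_primitive {α : Type*} [TopologicalSpace α] [FirstCountableTopology α]
    [LocallyCompactSpace α] {a : α → ℝ → ℝ}
    (ha : Continuous fun p : α × ℝ => a p.1 p.2) :
    Continuous fun p : α × ℝ => ∫ s in (0 : ℝ)..p.2, a p.1 s :=
  intervalIntegral.continuous_parametric_primitive_of_continuous (f := a) ha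

lemma continuous_duhamel {α : Type*} [TopologicalSpace α] [FirstCountableTopology α]
    [LocallyCompactSpace α] {a g : α → ℝ → ℝ} {y₀ : α → ℝ}
    (ha : Continuous fun p : α × ℝ => a p.1 p.2) (hg : Continuous fun p : α × ℝ => g p.1 p.2)
    (hy : Continuous y₀) :
    Continuous fun p : α × ℝ => duhamel (a p.1) (g p.1) (y₀ p.1) p.2 := by
  have hA := continuous_primitive ha
  have hE : Continuous fun p : α × ℝ => Real.exp (∫ τ in (0 : ℝ)..p.2, a p.1 τ) * g p.1 p.2 :=
    (Real.continuous_exp.comp hA).mul hg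
  have hI := continuous_primitive (a := fun x s => Real.exp (∫ τ in (0 : ℝ)..s, a x τ) * g x s) hE
  exact (Real.continuous_exp.comp hA.neg).mul ((hy.comp continuous_fst).add hI)

lemma intervalIntegrable_of_bounded {a : ℝ → ℝ} (ha : Measurable a) {M T : ℝ} (hT : 0 ≤ T)
    (h : ∀ s ∈ Icc 0 T, |a s| ≤ M) : IntervalIntegrable a volume 0 T := by
  rw [intervalIntegrable_iff_integrableOn_Ioc_of_le hT]
  refine Measure.integrableOn_of_bounded (M := M) measure_Ioc_lt_top.ne ha.aestronglyMeasurable ?_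
  filter_upwards [ae_restrict_mem measurableSet_Ioc] with s hs
  exact h s ⟨hs.1.le, hs.2⟩

/-! ### The iteration along characteristics -/

/-- Truncation of a time to `[0, T]`. -/
def clamp (T t : ℝ) : ℝ := max 0 (min t T)

lemma clamp_mem {T : ℝ} (hT : 0 ≤ T) (t : ℝ) : clamp T t ∈ Icc 0 T :=
  ⟨le_max_left _ _, max_le hT (min_le_right _ _)⟩

lemma clamp_of_mem {T t : ℝ} (ht : t ∈ Icc 0 T) : clamp T t = t := by
  rw [clamp, min_eq_left ht.2, max_eq_right ht.1]

lemma continuous_clamp (T : ℝ) : Continuous (clamp T) := by unfold clamp; fun_prop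

section Step

set_option linter.unusedSectionVars false

variable {Ω : Type} [AddCommGroup Ω]

/-- The solution, along the characteristic through `y` with velocity `v`, of the equation
whose coefficients are those of `f`. -/
def charStep (γ : ℝ) (b : ℝ → ℝ) (π : E3 →+ Ω) (f₀ : Ω → E3 → ℝ) (f : ℝ → Ω → E3 → ℝ)
    (y : Ω) (v : E3) (t : ℝ) : ℝ :=
  duhamel (fun s => freq γ b (shift (f s (y + π (s • v)))) v)
    (fun s => source γ b (f s (y + π (s • v))) v) (f₀ y v) t

/-- The map whose fixed points on `[0, T]` are the mild solutions. -/
def step (γ : ℝ) (b : ℝ → ℝ) (π : E3 →+ Ω) (T : ℝ) (f₀ : Ω → E3 → ℝ) (f : ℝ → Ω → E3 → ℝ)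
    (t : ℝ) (x : Ω) (v : E3) : ℝ :=
  charStep γ b π f₀ f (x - π (clamp T t • v)) v (clamp T t)

/-- A positive function of the position that grows at most linearly. -/
structure SlowOn (π : E3 →+ Ω) (κ : Ω → ℝ) : Prop where
  pos : ∀ x, 0 < κ x
  le : ∀ x z, κ (x + π z) ≤ (1 + ‖z‖) * κ x

lemma SlowOn.one (π : E3 →+ Ω) : SlowOn π fun _ => 1 :=
  ⟨fun _ => one_pos, fun _ z => by linarith [norm_nonneg z]⟩

/-- At times s ≤ 1 a change of velocity moves the foot x − s v by no more than the change itself, so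
slow growth in space becomes slow growth in velocity. -/
lemma SlowOn.slowWeight {π : E3 →+ Ω} {κ : Ω → ℝ} (h : SlowOn π κ) {s : ℝ} (hs : s ∈ Icc (0 : ℝ) 1)
    (x : Ω) : SlowWeight fun v => κ (x - π (s • v)) := by
  refine ⟨fun v => h.pos _, fun v v' => ?_⟩
  have e : x - π (s • v) = (x - π (s • v')) + π (s • (v' - v)) := by
    rw [smul_sub, map_sub]; abel
  rw [e]
  refine (h.le _ _).trans (mul_le_mul_of_nonneg_right ?_ (h.pos _).le)
  rw [norm_smul, Real.norm_of_nonneg hs.1, norm_sub_rev v v']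
  nlinarith [norm_nonneg (v' - v), hs.2]

/-- A positive function of the position that may serve as a decay rate. -/
structure GrowthOn (π : E3 →+ Ω) (ϑ : Ω → ℝ) : Prop where
  pos : ∀ x, 0 < ϑ x
  growth : ∀ s ∈ Icc (0 : ℝ) 1, ∀ x, GrowthWeight fun v => ϑ (x - π (s • v))

lemma GrowthOn.one (π : E3 →+ Ω) : GrowthOn π fun _ => 1 :=
  ⟨fun _ => one_pos, fun _ _ _ => GrowthWeight.one⟩

variable [TopologicalSpace Ω] [IsTopologicalAddGroup Ω] [SecondCountableTopology Ω]
  [MeasurableSpace Ω] [BorelSpace Ω]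

/-- The class of functions on which the iteration takes place. -/
structure Admissible (β M : ℝ) (f : ℝ → Ω → E3 → ℝ) : Prop where
  measurable : Measurable fun p : (ℝ × Ω) × E3 => f p.1.1 p.1.2 p.2
  bound : ∀ t x v, |f t x v| ≤ M * (weight β v)⁻¹
  nonneg : ∀ t x v, 0 ≤ shift (f t x) v

/-- The class of data. -/
structure AdmissibleData (β M : ℝ) (f₀ : Ω → E3 → ℝ) : Prop where
  measurable : Measurable fun p : Ω × E3 => f₀ p.1 p.2
  bound : ∀ x v, |f₀ x v| ≤ M * (weight β v)⁻¹
  nonneg : ∀ x v, 0 ≤ shift (f₀ x) v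

/-- The standing assumptions on the collision kernel and on the characteristics. -/
structure Setting (γ β : ℝ) (b : ℝ → ℝ) (C : ℝ) (π : E3 →+ Ω) : Prop where
  lt_beta : 3 < β
  kernel : ∃ C', KernelBounds γ b C'
  bounds : Bounds γ β b C
  continuous : Continuous π

variable {γ β : ℝ} {b : ℝ → ℝ} {C M M₀ T : ℝ} {π : E3 →+ Ω} {f₀ g₀ : Ω → E3 → ℝ}
  {f g : ℝ → Ω → E3 → ℝ}

lemma Admissible.nonneg_const (hf : Admissible β M f) : 0 ≤ M := by
  have := (abs_nonneg _).trans (hf.bound 0 0 0)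
  exact nonneg_of_mul_nonneg_left this (inv_pos.2 (weight_pos β 0))

lemma AdmissibleData.nonneg_const (hf : AdmissibleData β M f₀) : 0 ≤ M := by
  have := (abs_nonneg _).trans (hf.bound 0 0)
  exact nonneg_of_mul_nonneg_left this (inv_pos.2 (weight_pos β 0))

lemma Admissible.decays (hf : Admissible β M f) (hβ : 1 ≤ β) (t : ℝ) (x : Ω) :
    Decays M (f t x) :=
  Decays.of_weight hβ hf.nonneg_const
    (hf.measurable.comp (f := fun v => ((t, x), v)) (by fun_prop)) (hf.bound t x)

lemma Setting.one_le_beta (hS : Setting γ β b C π) : 1 ≤ β := by linarith [hS.lt_beta]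

lemma Setting.measurable_along (hS : Setting γ β b C π) :
    Measurable fun q : (Ω × E3) × ℝ => (q.2, q.1.1 + π (q.2 • q.1.2)) := by
  have := hS.continuous
  have h : Continuous fun q : (Ω × E3) × ℝ => (q.2, q.1.1 + π (q.2 • q.1.2)) := by fun_prop
  exact h.measurable

lemma Setting.measurable_freq_along (hS : Setting γ β b C π) (hf : Admissible β M f) :
    Measurable fun q : (Ω × E3) × ℝ =>
      freq γ b (shift (f q.2 (q.1.1 + π (q.2 • q.1.2)))) q.1.2 := by
  obtain ⟨C', hK⟩ := hS.kernel
  have h := measurable_freq hK (α := ℝ × Ω) (F := fun p => shift (f p.1 p.2))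
    (measurable_shift (F := fun p : ℝ × Ω => f p.1 p.2) hf.measurable)
  have hm : Measurable fun q : (Ω × E3) × ℝ => q.1.2 := by fun_prop
  exact h.comp (f := fun q : (Ω × E3) × ℝ => ((q.2, q.1.1 + π (q.2 • q.1.2)), q.1.2))
    (hS.measurable_along.prodMk hm)

lemma Setting.measurable_source_along (hS : Setting γ β b C π) (hf : Admissible β M f) :
    Measurable fun q : (Ω × E3) × ℝ =>
      source γ b (f q.2 (q.1.1 + π (q.2 • q.1.2))) q.1.2 := by
  obtain ⟨C', hK⟩ := hS.kernel
  have h := measurable_source hK (α := ℝ × Ω) (F := fun p => f p.1 p.2) hf.measurable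
  have hm : Measurable fun q : (Ω × E3) × ℝ => q.1.2 := by fun_prop
  exact h.comp (f := fun q : (Ω × E3) × ℝ => ((q.2, q.1.1 + π (q.2 • q.1.2)), q.1.2))
    (hS.measurable_along.prodMk hm)

lemma Setting.exists_freq_le (hS : Setting γ β b C π) (M : ℝ) :
    ∃ B : ℝ, 0 ≤ B ∧ ∀ f : ℝ → Ω → E3 → ℝ, Admissible β M f →
      ∀ t x v, |freq γ b (shift (f t x)) v| ≤ B * jap v := by
  obtain ⟨C', hK⟩ := hS.kernel
  obtain ⟨E, hE, hm⟩ := exists_decays_sqrtM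
  refine ⟨C' * (E + |M|), mul_nonneg (by linarith [hK.one_le]) (by positivity),
    fun f hf t x v => ?_⟩
  have hM := hf.nonneg_const
  have hd : Decays (E + M) (shift (f t x)) := hm.add (hf.decays hS.one_le_beta t x)
  rw [abs_of_nonneg hM]
  exact abs_freq_le hK hd.nonneg hd.le_jap_pow

lemma Setting.abs_source_le (hS : Setting γ β b C π) (hf : Admissible β M f) (t : ℝ) (x : Ω)
    (v : E3) : |source γ b (f t x) v| ≤ C * (M * (1 + M) * (weight β v)⁻¹) := by
  have := hS.bounds.source_le GrowthWeight.one hf.nonneg_const hf.nonneg_const (hf.bound t x)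
    (by simpa using hf.bound t x) v
  simpa using this

lemma Setting.intervalIntegrable_freq (hS : Setting γ β b C π) (hf : Admissible β M f)
    (hT : 0 ≤ T) (y : Ω) (v : E3) :
    IntervalIntegrable (fun s => freq γ b (shift (f s (y + π (s • v)))) v) volume 0 T := by
  obtain ⟨B, hB, h⟩ := hS.exists_freq_le M
  have hm : Measurable fun s : ℝ => freq γ b (shift (f s (y + π (s • v)))) v :=
    (hS.measurable_freq_along hf).comp (f := fun s => ((y, v), s)) (by fun_prop)
  exact intervalIntegrable_of_bounded hm hT fun s _ => h f hf _ _ _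

lemma Setting.intervalIntegrable_source (hS : Setting γ β b C π) (hf : Admissible β M f)
    (hT : 0 ≤ T) (y : Ω) (v : E3) :
    IntervalIntegrable (fun s => source γ b (f s (y + π (s • v))) v) volume 0 T := by
  have hm : Measurable fun s : ℝ => source γ b (f s (y + π (s • v))) v :=
    (hS.measurable_source_along hf).comp (f := fun s => ((y, v), s)) (by fun_prop)
  exact intervalIntegrable_of_bounded hm hT fun s _ => hS.abs_source_le hf _ _ _

lemma Setting.freq_nonneg (hS : Setting γ β b C π) (hf : Admissible β M f) (t : ℝ) (x : Ω)
    (v : E3) : 0 ≤ freq γ b (shift (f t x)) v := by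
  obtain ⟨C', hK⟩ := hS.kernel
  exact Boltzmann.freq_nonneg hK (hf.nonneg t x) v

lemma Setting.isPrim_charStep (hS : Setting γ β b C π) (hf : Admissible β M f)
    (hT : 0 ≤ T) (y : Ω) (v : E3) :
    IsPrim T (charStep γ b π f₀ f y v) (fun t => source γ b (f t (y + π (t • v))) v -
      freq γ b (shift (f t (y + π (t • v)))) v * charStep γ b π f₀ f y v t) :=
  isPrim_duhamel hT (hS.intervalIntegrable_freq hf hT y v) (hS.intervalIntegrable_source hf hT y v)

/-- Decay is measured at the foot x − s v, which is the fixed point y along the characteristic. Thus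
ϑ(y) factors out of the time integral, and only the constant in front of it evolves. -/
lemma Setting.abs_charStep_le (hS : Setting γ β b C π) (hf : Admissible β M f) (hT : 0 ≤ T)
    (hT1 : T ≤ 1) {ϑ : Ω → ℝ} (hϑ : GrowthOn π ϑ) {A₀ : ℝ} {A : ℝ → ℝ}
    (hAi : IntervalIntegrable A volume 0 T) (hA0 : ∀ s ∈ Icc 0 T, 0 ≤ A s) {y : Ω} {v : E3}
    (h0 : |f₀ y v| ≤ A₀ * ((weight β v)⁻¹ * (ϑ y)⁻¹))
    (hA : ∀ s ∈ Icc 0 T, ∀ x v, |f s x v| ≤ A s * ((weight β v)⁻¹ * (ϑ (x - π (s • v)))⁻¹))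
    {t : ℝ} (ht : t ∈ Icc 0 T) :
    |charStep γ b π f₀ f y v t| ≤
      (A₀ + C * (1 + M) * ∫ s in (0 : ℝ)..t, A s) * ((weight β v)⁻¹ * (ϑ y)⁻¹) := by
  have h := abs_duhamel_le (y₀ := f₀ y v) (hS.intervalIntegrable_freq hf hT y v)
    (fun s _ => hS.freq_nonneg hf _ _ _)
    (h := fun s => C * (1 + M) * ((weight β v)⁻¹ * (ϑ y)⁻¹) * A s) (hAi.const_mul _)
    (g := fun s => source γ b (f s (y + π (s • v))) v) (fun s hs => ?_) ht
  · rw [intervalIntegral.integral_const_mul] at h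
    refine h.trans ?_
    linear_combination h0
  · have h1 := hS.bounds.source_le (hϑ.growth s ⟨hs.1, hs.2.trans hT1⟩ (y + π (s • v)))
      (hA0 s hs) hf.nonneg_const (hf.bound s _) (hA s hs _) v
    rw [add_sub_cancel_right] at h1
    linear_combination h1

lemma Setting.abs_shift_le (hS : Setting γ β b C π) (hf : Admissible β M f) (t : ℝ) (x : Ω)
    (v : E3) : |shift (f t x) v| ≤ (C + M) * (weight β v)⁻¹ := by
  have h1 := hS.bounds.sqrtM_le v
  have h2 := hf.bound t x v
  have h3 := sqrtM_pos v
  rw [shift]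
  calc |sqrtM v + f t x v| ≤ |sqrtM v| + |f t x v| := abs_add_le _ _
    _ ≤ C * (weight β v)⁻¹ + M * (weight β v)⁻¹ := by rw [abs_of_pos h3]; gcongr
    _ = _ := by ring

/-- Four collision terms arise: two from the gain, one from the Gaussian loss in `source`, and one
from the difference of frequencies acting on the second solution. Each contributes C (C + M) D,
whence the 4. -/
lemma Setting.abs_charStep_sub_le (hS : Setting γ β b C π) (hf : Admissible β M f)
    (hg : Admissible β M g) (hT : 0 ≤ T) (hT1 : T ≤ 1) {κ : Ω → ℝ} (hκ : SlowOn π κ)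
    {D₀ : ℝ} {D : ℝ → ℝ} (hDi : IntervalIntegrable D volume 0 T) (hD0 : ∀ s ∈ Icc 0 T, 0 ≤ D s)
    {y : Ω} {v : E3} (h0 : |f₀ y v - g₀ y v| ≤ D₀ * ((weight (β - 2) v)⁻¹ * κ y))
    (hD : ∀ s ∈ Icc 0 T, ∀ x v,
      |f s x v - g s x v| ≤ D s * ((weight (β - 2) v)⁻¹ * κ (x - π (s • v))))
    (hgb : ∀ t ∈ Icc 0 T, |charStep γ b π g₀ g y v t| ≤ M * (weight β v)⁻¹)
    {t : ℝ} (ht : t ∈ Icc 0 T) :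
    |charStep γ b π f₀ f y v t - charStep γ b π g₀ g y v t| ≤
      (D₀ + 4 * C * (C + M) * ∫ s in (0 : ℝ)..t, D s) * ((weight (β - 2) v)⁻¹ * κ y) := by
  obtain ⟨C', hK⟩ := hS.kernel
  have hM := hf.nonneg_const
  have hC := hS.bounds.one_le
  have h := abs_duhamel_sub_le (y₀ := f₀ y v) (y₀' := g₀ y v) hT
    (hS.intervalIntegrable_freq hf hT y v) (fun s _ => hS.freq_nonneg hf _ _ _)
    (hS.intervalIntegrable_source hf hT y v)
    (hS.intervalIntegrable_freq hg hT y v) (hS.intervalIntegrable_source hg hT y v)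
    (h := fun s => 4 * C * (C + M) * ((weight (β - 2) v)⁻¹ * κ y) * D s) (hDi.const_mul _)
    (fun s hs => ?_) ht
  · rw [intervalIntegral.integral_const_mul] at h
    refine h.trans ?_
    linear_combination h0
  · set x := y + π (s • v) with hx
    have hdf := hf.decays hS.one_le_beta s x
    have hdg := hg.decays hS.one_le_beta s x
    obtain ⟨E, -, hm⟩ := exists_decays_sqrtM
    have hef : Decays (E + M) (shift (f s x)) := hm.add hdf
    have heg : Decays (E + M) (shift (g s x)) := hm.add hdg
    have hslow := hκ.slowWeight ⟨hs.1, hs.2.trans hT1⟩ x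
    have hCM : 0 ≤ C + M := by linarith
    have b1 := (hS.bounds.diff_le hslow (hD0 s hs) hCM (hD s hs x) (hS.abs_shift_le hf s x) v).1
    have b2 := (hS.bounds.diff_le hslow (hD0 s hs) hCM (hD s hs x) (hS.abs_shift_le hg s x) v).2.1
    have b3 := (hS.bounds.diff_le hslow (hD0 s hs) hCM (hD s hs x) (e := sqrtM) (fun v => by
      rw [abs_of_pos (sqrtM_pos v)]
      refine (hS.bounds.sqrtM_le v).trans
        (mul_le_mul_of_nonneg_right (by linarith) (inv_pos.2 (weight_pos β v)).le)) v).2.2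
    -- The envelope (C + M) / w_β stands in for the output `charStep` of the second iterate, known
    -- only along this one characteristic.
    have b4 := (hS.bounds.diff_le hslow (hD0 s hs) hCM (hD s hs x)
      (e := fun v => (C + M) * (weight β v)⁻¹) (fun v => by
        rw [abs_of_nonneg (mul_nonneg hCM (inv_pos.2 (weight_pos β v)).le)]) v).2.2
    have ey : x - π (s • v) = y := by rw [hx, add_sub_cancel_right]
    rw [ey] at b1 b2 b3 b4
    have e1 := source_sub_source hK hdf hdg v
    have e2 : freq γ b (shift (f s x)) v - freq γ b (shift (g s x)) v =
        freq γ b (fun u => f s x u - g s x u) v := by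
      rw [← freq_sub hK hef heg]
      congr 1; ext u; simp only [shift]; ring
    have hw := inv_pos.2 (weight_pos β v)
    rw [abs_of_nonneg (mul_nonneg hCM hw.le)] at b4
    have b5 : |freq γ b (fun u => f s x u - g s x u) v| * |charStep γ b π g₀ g y v s| ≤
        C * (D s * (C + M) * ((weight (β - 2) v)⁻¹ * κ y)) := by
      refine le_trans ?_ b4
      rw [mul_comm]
      refine mul_le_mul_of_nonneg_right ((hgb s hs).trans ?_) (abs_nonneg _)
      exact mul_le_mul_of_nonneg_right (by linarith) hw.le
    rw [e1, e2]
    have t1 := abs_sub (gain γ b (fun u => f s x u - g s x u) (shift (f s x)) v +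
      gain γ b (shift (g s x)) (fun u => f s x u - g s x u) v)
      (sqrtM v * freq γ b (fun u => f s x u - g s x u) v)
    have t2 := abs_add_le (gain γ b (fun u => f s x u - g s x u) (shift (f s x)) v)
      (gain γ b (shift (g s x)) (fun u => f s x u - g s x u) v)
    rw [abs_mul (sqrtM v)] at t1
    change _ + |freq γ b (fun u => f s x u - g s x u) v| * |charStep γ b π g₀ g y v s| ≤ _
    linear_combination t1 + t2 + b1 + b2 + b3 + b5

/-- The total density `√μ + f` along a characteristic solves the equation with the gain term
as its source. -/
lemma Setting.shift_charStep (hS : Setting γ β b C π) (hf : Admissible β M f) (hT : 0 ≤ T)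
    (y : Ω) (v : E3) {t : ℝ} (ht : t ∈ Icc 0 T) :
    sqrtM v + charStep γ b π f₀ f y v t =
      duhamel (fun s => freq γ b (shift (f s (y + π (s • v)))) v)
        (fun s => gain γ b (shift (f s (y + π (s • v)))) (shift (f s (y + π (s • v)))) v)
        (sqrtM v + f₀ y v) t := by
  obtain ⟨C', hK⟩ := hS.kernel
  have h1 : IsPrim T (fun t => sqrtM v + charStep γ b π f₀ f y v t) (fun t =>
      gain γ b (shift (f t (y + π (t • v)))) (shift (f t (y + π (t • v)))) v -
      freq γ b (shift (f t (y + π (t • v)))) v * (sqrtM v + charStep γ b π f₀ f y v t)) := by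
    refine ((isPrim_const (sqrtM v)).add (hS.isPrim_charStep (f₀ := f₀) hf hT y v)).congr hT
      (fun _ _ => rfl) (Filter.Eventually.of_forall fun s _ => ?_)
    rw [gain_shift hK (hf.decays hS.one_le_beta s _)]
    ring
  have h2 := h1.eq_duhamel hT (hS.intervalIntegrable_freq hf hT y v) ht
  simpa [charStep, duhamel_zero] using h2

lemma Setting.charStep_nonneg (hS : Setting γ β b C π) (hf : Admissible β M f) (hT : 0 ≤ T)
    (y : Ω) (v : E3) (h0 : 0 ≤ shift (f₀ y) v) {t : ℝ} (ht : t ∈ Icc 0 T) :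
    0 ≤ sqrtM v + charStep γ b π f₀ f y v t := by
  obtain ⟨C', hK⟩ := hS.kernel
  rw [hS.shift_charStep hf hT y v ht]
  exact duhamel_nonneg h0 ht.1 fun s _ => gain_nonneg hK (hf.nonneg _ _) (hf.nonneg _ _) v

lemma Setting.measurable_charStep (hS : Setting γ β b C π) (hf : Admissible β M f)
    (hf₀ : Measurable fun p : Ω × E3 => f₀ p.1 p.2) :
    Measurable fun q : (Ω × E3) × ℝ => charStep γ b π f₀ f q.1.1 q.1.2 q.2 := by
  have h1 := hS.measurable_freq_along hf
  have h2 := hS.measurable_source_along hf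
  unfold charStep
  generalize freq γ b = F at h1 ⊢
  generalize source γ b = G at h2 ⊢
  exact measurable_duhamel
      (a := fun (q : Ω × E3) s => F (shift (f s (q.1 + π (s • q.2)))) q.2)
      (g := fun (q : Ω × E3) s => G (f s (q.1 + π (s • q.2))) q.2)
      (y₀ := fun q : Ω × E3 => f₀ q.1 q.2) h1 h2 hf₀

lemma Setting.measurable_step (hS : Setting γ β b C π) (hf : Admissible β M f)
    (hf₀ : Measurable fun p : Ω × E3 => f₀ p.1 p.2) (T : ℝ) :
    Measurable fun p : (ℝ × Ω) × E3 => step γ b π T f₀ f p.1.1 p.1.2 p.2 := by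
  have h := hS.measurable_charStep hf hf₀
  have hc := continuous_clamp T
  have hπ := hS.continuous
  have hm : Continuous fun p : (ℝ × Ω) × E3 =>
      ((p.1.2 - π (clamp T p.1.1 • p.2), p.2), clamp T p.1.1) := by fun_prop
  unfold step
  exact measurable_comp₂ (f := fun (q : Ω × E3) t => charStep γ b π f₀ f q.1 q.2 t) h
    (g := fun p : (ℝ × Ω) × E3 => (p.1.2 - π (clamp T p.1.1 • p.2), p.2))
    (h := fun p : (ℝ × Ω) × E3 => clamp T p.1.1) hm.measurable.fst hm.measurable.snd

/-- The smallness condition on the time interval. -/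
structure Short (C M₀ M T : ℝ) : Prop where
  nonneg : 0 ≤ T
  le_one : T ≤ 1
  le : M₀ + C * T * M * (1 + M) ≤ M

lemma Setting.abs_charStep_le_const (hS : Setting γ β b C π) (hf : Admissible β M f)
    (hf₀ : AdmissibleData β M₀ f₀) (hT : Short C M₀ M T) (y : Ω) (v : E3) {t : ℝ}
    (ht : t ∈ Icc 0 T) : |charStep γ b π f₀ f y v t| ≤ M * (weight β v)⁻¹ := by
  have hM := hf.nonneg_const
  have hC := hS.bounds.one_le
  have h := hS.abs_charStep_le hf hT.nonneg hT.le_one (GrowthOn.one π) (f₀ := f₀) (A₀ := M₀)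
    (A := fun _ => M) intervalIntegrable_const (fun _ _ => hM) (y := y) (v := v)
    (by simpa using hf₀.bound y v) (fun s _ _ _ => by simpa using hf.bound s _ _) ht
  rw [intervalIntegral.integral_const, inv_one, mul_one, sub_zero, smul_eq_mul] at h
  refine h.trans (mul_le_mul_of_nonneg_right (le_trans ?_ hT.le) (inv_pos.2 (weight_pos β v)).le)
  have : C * (1 + M) * (t * M) ≤ C * (1 + M) * (T * M) := by
    have := ht.2
    gcongr
  linarith

lemma Setting.admissible_step (hS : Setting γ β b C π) (hf : Admissible β M f)
    (hf₀ : AdmissibleData β M₀ f₀) (hT : Short C M₀ M T) :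
    Admissible β M (step γ b π T f₀ f) :=
  ⟨hS.measurable_step hf hf₀.measurable T,
    fun t _ v => hS.abs_charStep_le_const hf hf₀ hT _ v (clamp_mem hT.nonneg t),
    fun t _ v => hS.charStep_nonneg hf hT.nonneg _ v (hf₀.nonneg _ v) (clamp_mem hT.nonneg t)⟩

lemma step_along (f₀ : Ω → E3 → ℝ) (f : ℝ → Ω → E3 → ℝ) (y : Ω) (v : E3) {t : ℝ}
    (ht : t ∈ Icc 0 T) :
    step γ b π T f₀ f t (y + π (t • v)) v = charStep γ b π f₀ f y v t := by
  rw [step, clamp_of_mem ht, add_sub_cancel_right]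

lemma step_eq {f₀ : Ω → E3 → ℝ} {f : ℝ → Ω → E3 → ℝ} (x : Ω) (v : E3) {t : ℝ}
    (ht : t ∈ Icc 0 T) :
    step γ b π T f₀ f t x v = charStep γ b π f₀ f (x - π (t • v)) v t := by
  rw [step, clamp_of_mem ht]

lemma integral_exp_mul_le {l c : ℝ} (hl : 0 < l) (hc : 0 ≤ c) (t : ℝ) :
    ∫ s in (0 : ℝ)..t, c * Real.exp (l * s) ≤ c / l * Real.exp (l * t) := by
  rw [intervalIntegral.integral_const_mul]
  have h0 : ∀ x : ℝ, HasDerivAt (fun s => Real.exp (l * s) / l) (Real.exp (l * x)) x := by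
    intro x
    have := ((hasDerivAt_id x).const_mul l).exp.div_const l
    simpa [hl.ne'] using this
  rw [intervalIntegral.integral_eq_sub_of_hasDerivAt (fun x _ => h0 x)
    ((by fun_prop : Continuous fun s : ℝ => Real.exp (l * s)).intervalIntegrable _ _)]
  have : 0 ≤ c * (Real.exp (l * 0) / l) := by positivity
  rw [mul_sub, div_mul_eq_mul_div, ← mul_div_assoc]
  linarith

end Step

/-! ### The fixed point -/

section FixedPoint

set_option linter.unusedSectionVars false

open Filter

variable {Ω : Type} [AddCommGroup Ω] [TopologicalSpace Ω] [IsTopologicalAddGroup Ω]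
  [SecondCountableTopology Ω] [MeasurableSpace Ω] [BorelSpace Ω]
  {γ β : ℝ} {b : ℝ → ℝ} {C M M₀ T : ℝ} {π : E3 →+ Ω} {f₀ g₀ : Ω → E3 → ℝ}
  {f g : ℝ → Ω → E3 → ℝ}

/-- The exponential rate in the contraction estimate. -/
def rate (C M : ℝ) : ℝ := 8 * C * (C + M)

lemma Setting.rate_pos (hS : Setting γ β b C π) (hM : 0 ≤ M) : 0 < rate C M := by
  have := hS.bounds.one_le
  unfold rate; positivity

/-- Contraction in a norm weighted by exp (`rate` · t): integrating in time gains 1 / `rate`, and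
`rate` is twice the constant 4 C (C + M). The factor 1/2 needs T ≤ 1 but no further smallness of T.
-/
lemma Setting.abs_step_sub_le (hS : Setting γ β b C π) (hf : Admissible β M f)
    (hg : Admissible β M g) (hT : 0 ≤ T) (hT1 : T ≤ 1) {κ : Ω → ℝ} (hκ : SlowOn π κ)
    {D₀ D : ℝ} (hD₀ : 0 ≤ D₀) (hD : 0 ≤ D)
    (h0 : ∀ x v, |f₀ x v - g₀ x v| ≤ D₀ * ((weight (β - 2) v)⁻¹ * κ x))
    (hfg : ∀ s ∈ Icc 0 T, ∀ x v, |f s x v - g s x v| ≤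
      D * Real.exp (rate C M * s) * ((weight (β - 2) v)⁻¹ * κ (x - π (s • v))))
    (hgb : ∀ t ∈ Icc 0 T, ∀ x v, |step γ b π T g₀ g t x v| ≤ M * (weight β v)⁻¹)
    {t : ℝ} (ht : t ∈ Icc 0 T) (x : Ω) (v : E3) :
    |step γ b π T f₀ f t x v - step γ b π T g₀ g t x v| ≤
      (D₀ + D / 2) * Real.exp (rate C M * t) * ((weight (β - 2) v)⁻¹ * κ (x - π (t • v))) := by
  have hM := hf.nonneg_const
  have hC := hS.bounds.one_le
  have hl := hS.rate_pos hM
  rw [step_eq x v ht, step_eq x v ht]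
  have hc : Continuous fun s : ℝ => D * Real.exp (rate C M * s) := by fun_prop
  have h := hS.abs_charStep_sub_le hf hg hT hT1 hκ (hc.intervalIntegrable 0 T)
    (fun s _ => by positivity) (h0 (x - π (t • v)) v) hfg (fun s hs => by
      rw [← step_along (T := T) g₀ g _ _ hs]; exact hgb s hs _ _) ht
  refine h.trans (mul_le_mul_of_nonneg_right ?_
    (mul_nonneg (inv_pos.2 (weight_pos _ v)).le (hκ.pos _).le))
  have h1 := integral_exp_mul_le hl hD t
  have h2 : 1 ≤ Real.exp (rate C M * t) := Real.one_le_exp (mul_nonneg hl.le ht.1)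
  have h3 : 4 * C * (C + M) * (D / rate C M * Real.exp (rate C M * t)) =
      D / 2 * Real.exp (rate C M * t) := by
    have : C + M ≠ 0 := by positivity
    unfold rate; field_simp; ring
  have h4 : 0 ≤ 4 * C * (C + M) := by positivity
  calc _ ≤ D₀ * Real.exp (rate C M * t) +
        4 * C * (C + M) * (D / rate C M * Real.exp (rate C M * t)) := by
        refine add_le_add (le_mul_of_one_le_right hD₀ h2) (mul_le_mul_of_nonneg_left h1 h4)
    _ = _ := by rw [h3]; ring

/-- The Picard iterates. -/
def iter (γ : ℝ) (b : ℝ → ℝ) (π : E3 →+ Ω) (T : ℝ) (f₀ : Ω → E3 → ℝ) :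
    ℕ → ℝ → Ω → E3 → ℝ
  | 0 => fun _ _ _ => 0
  | n + 1 => step γ b π T f₀ (iter γ b π T f₀ n)

/-- The solution with data `f₀`, the limit of the Picard iterates. -/
def sol (γ : ℝ) (b : ℝ → ℝ) (π : E3 →+ Ω) (T : ℝ) (f₀ : Ω → E3 → ℝ) (t : ℝ) (x : Ω) (v : E3) : ℝ :=
  limUnder atTop fun n => iter γ b π T f₀ n t x v

lemma admissible_zero (hM : 0 ≤ M) : Admissible β M (fun (_ : ℝ) (_ : Ω) _ => (0 : ℝ)) :=
  ⟨measurable_const, fun _ _ v => by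
    have := weight_pos β v
    simp only [abs_zero]; positivity, fun _ _ v => by simpa [shift] using (sqrtM_pos v).le⟩

lemma Setting.admissible_iter (hS : Setting γ β b C π) (hf₀ : AdmissibleData β M₀ f₀)
    (hT : Short C M₀ M T) (hM : 0 ≤ M) (n : ℕ) : Admissible β M (iter γ b π T f₀ n) := by
  induction n with
  | zero => exact admissible_zero hM
  | succ n ih => exact hS.admissible_step ih hf₀ hT

/-- Because `step` clamps time, bounds on [0, T] give statements at every real time; joint
measurability and pointwise limits then need no restriction of the domain. -/
lemma iter_clamp (f₀ : Ω → E3 → ℝ) (hT : 0 ≤ T) (n : ℕ) (t : ℝ) (x : Ω) (v : E3) :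
    iter γ b π T f₀ n (clamp T t) x v = iter γ b π T f₀ n t x v := by
  cases n with
  | zero => rfl
  | succ n => simp only [iter, step, clamp_of_mem (clamp_mem hT t)]

lemma sol_clamp (f₀ : Ω → E3 → ℝ) (hT : 0 ≤ T) (t : ℝ) (x : Ω) (v : E3) :
    sol γ b π T f₀ (clamp T t) x v = sol γ b π T f₀ t x v := by
  simp only [sol, iter_clamp f₀ hT]

lemma weight_inv_le (β : ℝ) (v : E3) : (weight β v)⁻¹ ≤ (weight (β - 2) v)⁻¹ := by
  have h1 := weight_add_two (β - 2) v
  rw [sub_add_cancel] at h1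
  have h2 := weight_pos (β - 2) v
  refine inv_anti₀ h2 ?_
  rw [h1]
  exact le_mul_of_one_le_right h2.le (one_le_pow₀ (one_le_jap v))

lemma Setting.abs_iter_succ_sub_le (hS : Setting γ β b C π) (hf₀ : AdmissibleData β M₀ f₀)
    (hT : Short C M₀ M T) (hM : 0 ≤ M) (n : ℕ) {t : ℝ} (ht : t ∈ Icc 0 T) (x : Ω) (v : E3) :
    |iter γ b π T f₀ (n + 1) t x v - iter γ b π T f₀ n t x v| ≤
      M * (1 / 2) ^ n * Real.exp (rate C M * t) * (weight (β - 2) v)⁻¹ := by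
  induction n generalizing t x v with
  | zero =>
    have h1 := (hS.admissible_iter hf₀ hT hM 1).bound t x v
    have h2 : 1 ≤ Real.exp (rate C M * t) := Real.one_le_exp (mul_nonneg (hS.rate_pos hM).le ht.1)
    have h3 := inv_pos.2 (weight_pos (β - 2) v)
    change |iter γ b π T f₀ 1 t x v - 0| ≤ _
    rw [sub_zero, pow_zero, mul_one]
    refine h1.trans ((mul_le_mul_of_nonneg_left (weight_inv_le β v) hM).trans ?_)
    exact mul_le_mul_of_nonneg_right (le_mul_of_one_le_right hM h2) h3.le
  | succ n ih =>
    have h := hS.abs_step_sub_le (hS.admissible_iter hf₀ hT hM (n + 1))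
      (hS.admissible_iter hf₀ hT hM n) hT.nonneg hT.le_one (SlowOn.one π) (f₀ := f₀) (g₀ := f₀)
      (D₀ := 0) (D := M * (1 / 2) ^ n) le_rfl (by positivity) (fun x v => by simp)
      (fun s hs x v => by simpa using ih hs x v)
      (fun t _ x v => (hS.admissible_iter hf₀ hT hM (n + 1)).bound t x v) ht x v
    refine h.trans (le_of_eq ?_)
    rw [pow_succ]; ring

lemma Setting.abs_iter_succ_sub_le' (hS : Setting γ β b C π) (hf₀ : AdmissibleData β M₀ f₀)
    (hT : Short C M₀ M T) (hM : 0 ≤ M) {t : ℝ} (ht : t ∈ Icc 0 T) (x : Ω) (v : E3) (n : ℕ) :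
    dist (iter γ b π T f₀ n t x v) (iter γ b π T f₀ (n + 1) t x v) ≤
      M * Real.exp (rate C M * t) * (weight (β - 2) v)⁻¹ * (1 / 2) ^ n := by
  rw [dist_comm, Real.dist_eq]
  refine (hS.abs_iter_succ_sub_le hf₀ hT hM n ht x v).trans (le_of_eq (by ring))

lemma Setting.tendsto_iter (hS : Setting γ β b C π) (hf₀ : AdmissibleData β M₀ f₀)
    (hT : Short C M₀ M T) (hM : 0 ≤ M) (t : ℝ) (x : Ω) (v : E3) :
    Tendsto (fun n => iter γ b π T f₀ n t x v) atTop (nhds (sol γ b π T f₀ t x v)) := by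
  rw [← sol_clamp f₀ hT.nonneg]
  simp only [← iter_clamp f₀ hT.nonneg _ t]
  exact (cauchySeq_of_le_geometric _ _ (by norm_num)
    (hS.abs_iter_succ_sub_le' hf₀ hT hM (clamp_mem hT.nonneg t) x v)).tendsto_limUnder

lemma Setting.abs_sol_sub_iter_le (hS : Setting γ β b C π) (hf₀ : AdmissibleData β M₀ f₀)
    (hT : Short C M₀ M T) (hM : 0 ≤ M) (n : ℕ) {t : ℝ} (ht : t ∈ Icc 0 T) (x : Ω) (v : E3) :
    |sol γ b π T f₀ t x v - iter γ b π T f₀ n t x v| ≤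
      2 * M * (1 / 2) ^ n * Real.exp (rate C M * t) * (weight (β - 2) v)⁻¹ := by
  have := dist_le_of_le_geometric_of_tendsto _ _ (by norm_num)
    (hS.abs_iter_succ_sub_le' hf₀ hT hM ht x v) (hS.tendsto_iter hf₀ hT hM t x v) n
  rw [dist_comm, Real.dist_eq] at this
  refine this.trans (le_of_eq (by ring))

lemma Setting.admissible_sol (hS : Setting γ β b C π) (hf₀ : AdmissibleData β M₀ f₀)
    (hT : Short C M₀ M T) (hM : 0 ≤ M) : Admissible β M (sol γ b π T f₀) := by
  have hi := hS.admissible_iter hf₀ hT hM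
  refine ⟨?_, fun t x v => ?_, fun t x v => ?_⟩
  · exact measurable_of_tendsto_metrizable (fun n => (hi n).measurable)
      (tendsto_pi_nhds.2 fun p => hS.tendsto_iter hf₀ hT hM _ _ _)
  · exact le_of_tendsto (hS.tendsto_iter hf₀ hT hM t x v).abs
      (Eventually.of_forall fun n => (hi n).bound t x v)
  · exact ge_of_tendsto ((hS.tendsto_iter hf₀ hT hM t x v).const_add (sqrtM v))
      (Eventually.of_forall fun n => (hi n).nonneg t x v)

lemma tendsto_const_mul_half_pow (c : ℝ) :
    Tendsto (fun n : ℕ => c * (1 / 2 : ℝ) ^ n) atTop (nhds 0) := by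
  simpa using (tendsto_pow_atTop_nhds_zero_of_lt_one (r := (1 / 2 : ℝ)) (by norm_num)
    (by norm_num)).const_mul c

/-- The contraction estimate, applied to `sol` and the n-th iterate, shows that `step sol` is also
the limit of the iterates. -/
lemma Setting.step_sol (hS : Setting γ β b C π) (hf₀ : AdmissibleData β M₀ f₀)
    (hT : Short C M₀ M T) (hM : 0 ≤ M) (t : ℝ) (x : Ω) (v : E3) :
    step γ b π T f₀ (sol γ b π T f₀) t x v = sol γ b π T f₀ t x v := by
  have key : ∀ t ∈ Icc 0 T, step γ b π T f₀ (sol γ b π T f₀) t x v = sol γ b π T f₀ t x v := by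
    intro t ht
    have h : ∀ n, |step γ b π T f₀ (sol γ b π T f₀) t x v - iter γ b π T f₀ (n + 1) t x v| ≤
        M * Real.exp (rate C M * t) * (weight (β - 2) v)⁻¹ * (1 / 2) ^ n := by
      intro n
      have h := hS.abs_step_sub_le (hS.admissible_sol hf₀ hT hM)
        (hS.admissible_iter hf₀ hT hM n) hT.nonneg hT.le_one (SlowOn.one π) (f₀ := f₀) (g₀ := f₀)
        (D₀ := 0) (D := 2 * M * (1 / 2) ^ n) le_rfl (by positivity) (fun x v => by simp)
        (fun s hs x v => by simpa using hS.abs_sol_sub_iter_le hf₀ hT hM n hs x v)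
        (fun t _ x v => (hS.admissible_iter hf₀ hT hM (n + 1)).bound t x v) ht x v
      refine h.trans (le_of_eq (by ring))
    have h1 : Tendsto (fun n => iter γ b π T f₀ (n + 1) t x v) atTop
        (nhds (step γ b π T f₀ (sol γ b π T f₀) t x v)) := by
      rw [tendsto_iff_dist_tendsto_zero]
      refine squeeze_zero (fun _ => dist_nonneg) (fun n => ?_) (tendsto_const_mul_half_pow
        (M * Real.exp (rate C M * t) * (weight (β - 2) v)⁻¹))
      rw [dist_comm, Real.dist_eq]; exact h n
    exact tendsto_nhds_unique h1
      ((hS.tendsto_iter hf₀ hT hM t x v).comp (tendsto_add_atTop_nat 1))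
  rw [← sol_clamp f₀ hT.nonneg t, ← key _ (clamp_mem hT.nonneg t), step, step,
    clamp_of_mem (clamp_mem hT.nonneg t)]

lemma Setting.charStep_sol (hS : Setting γ β b C π) (hf₀ : AdmissibleData β M₀ f₀)
    (hT : Short C M₀ M T) (hM : 0 ≤ M) {t : ℝ} (ht : t ∈ Icc 0 T) (y : Ω) (v : E3) :
    charStep γ b π f₀ (sol γ b π T f₀) y v t = sol γ b π T f₀ t (y + π (t • v)) v := by
  rw [← step_along (T := T) f₀ _ y v ht, hS.step_sol hf₀ hT hM]

lemma Setting.abs_sol_decay (hS : Setting γ β b C π) (hf₀ : AdmissibleData β M₀ f₀)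
    (hT : Short C M₀ M T) (hM : 0 ≤ M) {ϑ : Ω → ℝ} (hϑ : GrowthOn π ϑ) {A₀ : ℝ} (hA₀ : 0 ≤ A₀)
    (h0 : ∀ x v, |f₀ x v| ≤ A₀ * ((weight β v)⁻¹ * (ϑ x)⁻¹)) {t : ℝ} (ht : t ∈ Icc 0 T)
    (x : Ω) (v : E3) :
    |sol γ b π T f₀ t x v| ≤
      2 * A₀ * Real.exp (rate C M * t) * ((weight β v)⁻¹ * (ϑ (x - π (t • v)))⁻¹) := by
  have hl := hS.rate_pos hM
  have hC := hS.bounds.one_le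
  have key : ∀ n, ∀ t ∈ Icc 0 T, ∀ x v, |iter γ b π T f₀ n t x v| ≤
      2 * A₀ * Real.exp (rate C M * t) * ((weight β v)⁻¹ * (ϑ (x - π (t • v)))⁻¹) := by
    intro n
    induction n with
    | zero =>
      intro t _ x v
      have := inv_pos.2 (hϑ.pos (x - π (t • v)))
      have := weight_pos β v
      simp only [iter, abs_zero]
      positivity
    | succ n ih =>
      intro t ht x v
      have hc : Continuous fun s : ℝ => 2 * A₀ * Real.exp (rate C M * s) := by fun_prop
      have h := hS.abs_charStep_le (hS.admissible_iter hf₀ hT hM n) hT.nonneg hT.le_one hϑ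
        (hc.intervalIntegrable 0 T) (fun s _ => by positivity) (h0 (x - π (t • v)) v) ih ht
      rw [iter, step_eq x v ht]
      refine h.trans (mul_le_mul_of_nonneg_right ?_
        (mul_nonneg (inv_pos.2 (weight_pos _ v)).le (inv_pos.2 (hϑ.pos _)).le))
      have h1 := integral_exp_mul_le hl (by positivity : 0 ≤ 2 * A₀) t
      have h2 : 1 ≤ Real.exp (rate C M * t) := Real.one_le_exp (mul_nonneg hl.le ht.1)
      -- `rate` = 8 C (C + M) with C ≥ 1 is large enough that the time integral of the induction
      -- bound 2 A₀ exp (`rate` · s) costs at most one further A₀.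
      have h3 : C * (1 + M) * (2 * A₀ / rate C M) ≤ A₀ := by
        rw [← mul_div_assoc, div_le_iff₀ hl, rate]
        have : C * A₀ * (1 + M) ≤ C * A₀ * (C + M) := by gcongr
        have : 0 ≤ C * A₀ * (C + M) := by positivity
        linarith
      calc A₀ + C * (1 + M) * ∫ s in (0 : ℝ)..t, 2 * A₀ * Real.exp (rate C M * s)
          ≤ A₀ * Real.exp (rate C M * t) +
            C * (1 + M) * (2 * A₀ / rate C M * Real.exp (rate C M * t)) := by
            refine add_le_add (le_mul_of_one_le_right hA₀ h2)
              (mul_le_mul_of_nonneg_left h1 (by positivity))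
        _ = (A₀ + C * (1 + M) * (2 * A₀ / rate C M)) * Real.exp (rate C M * t) := by ring
        _ ≤ (A₀ + A₀) * Real.exp (rate C M * t) := by gcongr
        _ = _ := by ring
  exact le_of_tendsto (hS.tendsto_iter hf₀ hT hM t x v).abs
    (Eventually.of_forall fun n => key n t ht x v)

/-- The bound 2 D₀ is stable under the recursion D ↦ D₀ + D / 2. The growing weight κ allows data
that are close only locally in space. -/
lemma Setting.abs_sol_sub_sol_le (hS : Setting γ β b C π) (hf₀ : AdmissibleData β M₀ f₀)
    (hg₀ : AdmissibleData β M₀ g₀) (hT : Short C M₀ M T) (hM : 0 ≤ M) {κ : Ω → ℝ}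
    (hκ : SlowOn π κ) {D₀ : ℝ} (hD₀ : 0 ≤ D₀)
    (h0 : ∀ x v, |f₀ x v - g₀ x v| ≤ D₀ * ((weight (β - 2) v)⁻¹ * κ x)) {t : ℝ}
    (ht : t ∈ Icc 0 T) (x : Ω) (v : E3) :
    |sol γ b π T f₀ t x v - sol γ b π T g₀ t x v| ≤ 2 * D₀ * Real.exp (rate C M * t) *
      ((weight (β - 2) v)⁻¹ * κ (x - π (t • v))) := by
  have key : ∀ n, ∀ t ∈ Icc 0 T, ∀ x v,
      |iter γ b π T f₀ n t x v - iter γ b π T g₀ n t x v| ≤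
      2 * D₀ * Real.exp (rate C M * t) * ((weight (β - 2) v)⁻¹ * κ (x - π (t • v))) := by
    intro n
    induction n with
    | zero =>
      intro t _ x v
      have := hκ.pos (x - π (t • v))
      have := weight_pos (β - 2) v
      simp only [iter, sub_self, abs_zero]
      positivity
    | succ n ih =>
      intro t ht x v
      have h := hS.abs_step_sub_le (hS.admissible_iter hf₀ hT hM n)
        (hS.admissible_iter hg₀ hT hM n) hT.nonneg hT.le_one hκ hD₀ (D := 2 * D₀)
        (by positivity) h0 ih
        (fun t _ x v => (hS.admissible_iter hg₀ hT hM (n + 1)).bound t x v) ht x v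
      refine h.trans (le_of_eq (by ring))
  exact le_of_tendsto ((hS.tendsto_iter hf₀ hT hM t x v).sub
    (hS.tendsto_iter hg₀ hT hM t x v)).abs (Eventually.of_forall fun n => key n t ht x v)

/-! ### Continuity -/

lemma Setting.continuous_step [LocallyCompactSpace Ω] (hS : Setting γ β b C π)
    (hf : Admissible β M f) (hfc : Continuous fun p : (ℝ × Ω) × E3 => f p.1.1 p.1.2 p.2)
    (hf₀ : Continuous fun p : Ω × E3 => f₀ p.1 p.2) (T : ℝ) :
    Continuous fun p : (ℝ × Ω) × E3 => step γ b π T f₀ f p.1.1 p.1.2 p.2 := by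
  obtain ⟨C', hK⟩ := hS.kernel
  have hπ := hS.continuous
  have hb : ∀ (p : ℝ × Ω) v, |f p.1 p.2 v| ≤ M := fun p v =>
    (hf.decays hS.one_le_beta _ _).abs_le v
  have hsh : Continuous fun p : (ℝ × Ω) × E3 => shift (f p.1.1 p.1.2) p.2 :=
    (continuous_sqrtM.comp continuous_snd).add hfc
  have hsb : ∀ (p : ℝ × Ω) v, |shift (f p.1 p.2) v| ≤ 1 + M := fun p v =>
    (abs_add_le _ _).trans (add_le_add (abs_sqrtM_le_one v) (hb p v))
  have h1 := continuous_freq hK (F := fun p : ℝ × Ω => shift (f p.1 p.2)) hsh hsb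
  have h2 := continuous_source hK (F := fun p : ℝ × Ω => f p.1 p.2) hfc hb
  have hal : Continuous fun q : (Ω × E3) × ℝ => ((q.2, q.1.1 + π (q.2 • q.1.2)), q.1.2) := by
    fun_prop
  have h3 := h1.comp hal
  have h4 := h2.comp hal
  have h5 : Continuous fun q : (Ω × E3) × ℝ => charStep γ b π f₀ f q.1.1 q.1.2 q.2 := by
    unfold charStep
    simp only [Function.comp_def] at h3 h4
    generalize freq γ b = F at h3 ⊢
    generalize source γ b = G at h4 ⊢
    exact continuous_duhamel
      (a := fun (q : Ω × E3) s => F (shift (f s (q.1 + π (s • q.2)))) q.2)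
      (g := fun (q : Ω × E3) s => G (f s (q.1 + π (s • q.2))) q.2)
      (y₀ := fun q : Ω × E3 => f₀ q.1 q.2) h3 h4 hf₀
  have hc := continuous_clamp T
  have hm : Continuous fun p : (ℝ × Ω) × E3 =>
      ((p.1.2 - π (clamp T p.1.1 • p.2), p.2), clamp T p.1.1) := by fun_prop
  unfold step
  exact Continuous.comp (g := fun q : (Ω × E3) × ℝ => charStep γ b π f₀ f q.1.1 q.1.2 q.2)
    (f := fun p : (ℝ × Ω) × E3 => ((p.1.2 - π (clamp T p.1.1 • p.2), p.2), clamp T p.1.1)) h5 hm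

/-- Each iterate is continuous, and the geometric convergence is uniform because 1 / w_{β−2} ≤ 1. -/
lemma Setting.continuous_sol [LocallyCompactSpace Ω] (hS : Setting γ β b C π)
    (hf₀ : AdmissibleData β M₀ f₀) (hT : Short C M₀ M T) (hM : 0 ≤ M)
    (hc : Continuous fun p : Ω × E3 => f₀ p.1 p.2) :
    Continuous fun p : (ℝ × Ω) × E3 => sol γ b π T f₀ p.1.1 p.1.2 p.2 := by
  have hi : ∀ n, Continuous fun p : (ℝ × Ω) × E3 => iter γ b π T f₀ n p.1.1 p.1.2 p.2 := by
    intro n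
    induction n with
    | zero => exact continuous_const
    | succ n ih => exact hS.continuous_step (hS.admissible_iter hf₀ hT hM n) ih hc T
  have hu : TendstoUniformly (fun n (p : (ℝ × Ω) × E3) => iter γ b π T f₀ n p.1.1 p.1.2 p.2)
      (fun p => sol γ b π T f₀ p.1.1 p.1.2 p.2) atTop := by
    rw [Metric.tendstoUniformly_iff]
    intro ε hε
    filter_upwards [(tendsto_const_mul_half_pow (2 * M * Real.exp (rate C M * T))).eventually
      (gt_mem_nhds hε)] with n hn p
    have hcl := clamp_mem hT.nonneg p.1.1
    rw [Real.dist_eq, ← sol_clamp f₀ hT.nonneg, ← iter_clamp f₀ hT.nonneg]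
    refine ((hS.abs_sol_sub_iter_le hf₀ hT hM n hcl _ _).trans ?_).trans_lt hn
    have h1 : (weight (β - 2) p.2)⁻¹ ≤ 1 := weight_inv_le_one (by linarith [hS.lt_beta]) _
    have h2 : Real.exp (rate C M * clamp T p.1.1) ≤ Real.exp (rate C M * T) :=
      Real.exp_le_exp.2 (mul_le_mul_of_nonneg_left hcl.2 (hS.rate_pos hM).le)
    have h3 := weight_pos (β - 2) p.2
    calc _ ≤ 2 * M * (1 / 2) ^ n * Real.exp (rate C M * T) * 1 := by gcongr
      _ = _ := by ring
  exact hu.continuous (Frequently.of_forall hi)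

end FixedPoint

/-! ### Modifications on null sets -/

section NullSets

open Filter

variable {α : Type*} [MeasurableSpace α] {μ : Measure α} [SFinite μ]

lemma quasiMeasurePreserving_triple_fst :
    Measure.QuasiMeasurePreserving (fun p : E3 × E3 × S2 => p.1) tripleMeasure volume :=
  Measure.quasiMeasurePreserving_fst

/-- A property of almost every velocity holds, at almost every velocity, for almost all
partners before and after the collision. -/
lemma ae_collision {P : α → E3 → Prop} (h : ∀ᵐ q ∂μ.prod (volume : Measure E3), P q.1 q.2) :
    ∀ᵐ q ∂μ.prod (volume : Measure E3), P q.1 q.2 ∧ ∀ᵐ p ∂collisionMeasure,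
      P q.1 p.1 ∧ P q.1 (postU q.2 p.1 p.2) ∧ P q.1 (postV q.2 p.1 p.2) := by
  have key : ∀ φ : E3 × E3 × S2 → E3, Measure.QuasiMeasurePreserving φ tripleMeasure volume →
      ∀ᵐ q ∂μ.prod (volume : Measure E3), ∀ᵐ p ∂collisionMeasure, P q.1 (φ (q.2, p)) := by
    intro φ hφ
    -- Each map φ used below is a measure-preserving map of triples followed by a projection, so it
    -- pulls null sets back to null sets; Fubini then slices.
    have h1 : Measure.QuasiMeasurePreserving (Prod.map id φ) (μ.prod tripleMeasure)
        (μ.prod volume) := MeasureTheory.QuasiMeasurePreserving.prodMap (.id μ) hφ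
    have h2 := h1.ae h
    have h3 := (measurePreserving_prodAssoc μ (volume : Measure E3)
      collisionMeasure).quasiMeasurePreserving.ae h2
    exact Measure.ae_ae_of_ae_prod h3
  have hu := key _ (quasiMeasurePreserving_triple_fst.comp
    measurePreserving_exchange.quasiMeasurePreserving)
  have hv' := key _ (quasiMeasurePreserving_triple_fst.comp
    measurePreserving_collide.quasiMeasurePreserving)
  have hu' := key _ (quasiMeasurePreserving_triple_fst.comp
    (measurePreserving_exchange.comp measurePreserving_collide).quasiMeasurePreserving)
  filter_upwards [h, hu, hv', hu'] with q h0 h1 h2 h3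
  refine ⟨h0, ?_⟩
  filter_upwards [h1, h2, h3] with p h1 h2 h3
  exact ⟨h1, h3, h2⟩

variable {γ : ℝ} {b : ℝ → ℝ}

lemma gain_congr_of_ae {f f' g g' : E3 → ℝ} {v : E3} (h : ∀ᵐ p ∂collisionMeasure,
    f (postU v p.1 p.2) = f' (postU v p.1 p.2) ∧ g (postV v p.1 p.2) = g' (postV v p.1 p.2)) :
    gain γ b f g v = gain γ b f' g' v := by
  refine integral_congr_ae ?_
  filter_upwards [h] with p hp
  rw [hp.1, hp.2]

lemma freq_congr_of_ae {f f' : E3 → ℝ} {v : E3} (h : ∀ᵐ p ∂collisionMeasure, f p.1 = f' p.1) :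
    freq γ b f v = freq γ b f' v := by
  refine integral_congr_ae ?_
  filter_upwards [h] with p hp
  rw [hp]

lemma ae_operators_congr (γ : ℝ) (b : ℝ → ℝ) {F G : α → E3 → ℝ}
    (h : ∀ᵐ q ∂μ.prod (volume : Measure E3), F q.1 q.2 = G q.1 q.2) :
    ∀ᵐ q ∂μ.prod (volume : Measure E3), F q.1 q.2 = G q.1 q.2 ∧
      K γ b (F q.1) q.2 = K γ b (G q.1) q.2 ∧
      Gam γ b (F q.1) (F q.1) q.2 = Gam γ b (G q.1) (G q.1) q.2 ∧
      source γ b (F q.1) q.2 = source γ b (G q.1) q.2 ∧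
      freq γ b (shift (F q.1)) q.2 = freq γ b (shift (G q.1)) q.2 := by
  filter_upwards [ae_collision (P := fun x v => F x v = G x v) h] with q hq
  obtain ⟨h0, hp⟩ := hq
  have e1 : gain γ b sqrtM (F q.1) q.2 = gain γ b sqrtM (G q.1) q.2 :=
    gain_congr_of_ae (hp.mono fun p h => ⟨rfl, h.2.2⟩)
  have e2 : gain γ b (F q.1) sqrtM q.2 = gain γ b (G q.1) sqrtM q.2 :=
    gain_congr_of_ae (hp.mono fun p h => ⟨h.2.1, rfl⟩)
  have e3 : gain γ b (F q.1) (F q.1) q.2 = gain γ b (G q.1) (G q.1) q.2 :=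
    gain_congr_of_ae (hp.mono fun p h => ⟨h.2.1, h.2.2⟩)
  have e4 : freq γ b (F q.1) q.2 = freq γ b (G q.1) q.2 :=
    freq_congr_of_ae (hp.mono fun p h => h.1)
  have e5 : freq γ b (shift (F q.1)) q.2 = freq γ b (shift (G q.1)) q.2 :=
    freq_congr_of_ae (hp.mono fun p h => by rw [shift, shift, h.1])
  refine ⟨h0, ?_, ?_, ?_, e5⟩
  · rw [K_eq, K_eq, e1, e2, e4]
  · rw [Gam_eq, Gam_eq, e3, e4, h0]
  · rw [source, source, e1, e2, e3, e4]

end NullSets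

/-! ### Transport -/

section Transport

set_option linter.unusedSectionVars false

open Filter

variable {Ω : Type} [AddCommGroup Ω] [TopologicalSpace Ω] [IsTopologicalAddGroup Ω]
  [SecondCountableTopology Ω] [MeasureSpace Ω] [BorelSpace Ω] [SigmaFinite (volume : Measure Ω)]
  [(volume : Measure Ω).IsAddLeftInvariant] {π : E3 →+ Ω} {T : ℝ}

/-- A shear: for each fixed second component it is a translation of Ω. Free transport is such a
shear in (x, v). -/
lemma measurePreserving_add_fun {α : Type*} [MeasurableSpace α] (μ : Measure α) [SFinite μ]
    {φ : α → Ω} (hφ : Measurable φ) :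
    MeasurePreserving (fun p : Ω × α => (p.1 + φ p.2, p.2)) (volume.prod μ) (volume.prod μ) := by
  have h := (MeasurePreserving.id μ).skew_product (μc := (volume : Measure Ω)) (μd := volume)
    (g := fun a x => x + φ a) (by
      have : Measurable fun p : α × Ω => p.2 + φ p.1 := by fun_prop
      exact this)
    (Eventually.of_forall fun a => (measurePreserving_add_right volume (φ a)).map_eq)
  exact (Measure.measurePreserving_swap.comp h).comp Measure.measurePreserving_swap

lemma measurePreserving_transport (hπ : Continuous π) (t : ℝ) :
    MeasurePreserving (fun p : Ω × E3 => (p.1 + π (t • p.2), p.2)) volume volume := by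
  have hm : Measurable fun v : E3 => π (t • v) := (by fun_prop : Continuous _).measurable
  exact measurePreserving_add_fun volume hm

lemma measurePreserving_transport_neg (hπ : Continuous π) (t : ℝ) :
    MeasurePreserving (fun p : Ω × E3 => (p.1 - π (t • p.2), p.2)) volume volume := by
  have hm : Measurable fun v : E3 => -π (t • v) := (by fun_prop : Continuous _).measurable
  have := measurePreserving_add_fun (Ω := Ω) (volume : Measure E3) hm
  simp only [← sub_eq_add_neg] at this
  exact this

/-- The measure on `[0, T] × Ω × ℝ³`. -/
def slabMeasure (Ω : Type) [MeasureSpace Ω] (T : ℝ) : Measure ((ℝ × Ω) × E3) :=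
  ((volume.restrict (Icc 0 T)).prod volume).prod volume

lemma ae_slab_of_ae {P : ℝ → Ω → E3 → Prop}
    (hP : MeasurableSet {q : (ℝ × Ω) × E3 | P q.1.1 q.1.2 q.2})
    (h : ∀ᵐ s ∂volume.restrict (Icc 0 T), ∀ᵐ p : Ω × E3, P s p.1 p.2) :
    ∀ᵐ q ∂slabMeasure Ω T, P q.1.1 q.1.2 q.2 := by
  have ha := (measurePreserving_prodAssoc (volume.restrict (Icc 0 T)) (volume : Measure Ω)
    (volume : Measure E3))
  have h1 : ∀ᵐ q ∂(volume.restrict (Icc 0 T)).prod ((volume : Measure Ω).prod (volume : Measure E3)),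
      P q.1 q.2.1 q.2.2 := by
    rw [Measure.ae_prod_iff_ae_ae]
    · exact h
    · exact (MeasurableEquiv.prodAssoc (α := ℝ) (β := Ω) (γ := E3)).symm.measurable hP
  exact ha.quasiMeasurePreserving.ae h1

lemma ae_of_ae_slab {P : ℝ → Ω → E3 → Prop} (h : ∀ᵐ q ∂slabMeasure Ω T, P q.1.1 q.1.2 q.2) :
    ∀ᵐ s ∂volume.restrict (Icc 0 T), ∀ᵐ p : Ω × E3, P s p.1 p.2 := by
  have ha := (measurePreserving_prodAssoc (volume.restrict (Icc 0 T)) (volume : Measure Ω)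
    (volume : Measure E3)).symm
  exact Measure.ae_ae_of_ae_prod (ha.quasiMeasurePreserving.ae h)

/-- The backward characteristic flow is a shear with (v, s) as parameter, so a null set of
space-time meets almost every characteristic at almost no time. -/
lemma ae_along_of_ae_slab (hπ : Continuous π) {P : ℝ → Ω → E3 → Prop}
    (h : ∀ᵐ q ∂slabMeasure Ω T, P q.1.1 q.1.2 q.2) (t : ℝ) :
    ∀ᵐ p : Ω × E3, ∀ᵐ s ∂volume.restrict (Icc 0 T), P s (p.1 - π ((t - s) • p.2)) p.2 := by
  let ρ : Measure ℝ := volume.restrict (Icc 0 T)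
  have h1 := (measurePreserving_prodAssoc ρ (volume : Measure Ω)
    (volume : Measure E3)).symm.quasiMeasurePreserving.ae h
  have h2 := (Measure.measurePreserving_swap (μ := (volume : Measure Ω).prod (volume : Measure E3))
    (ν := ρ)).quasiMeasurePreserving.ae h1
  have hm : Measurable fun q : E3 × ℝ => -π ((t - q.2) • q.1) :=
    (by fun_prop : Continuous _).measurable
  have h5 := (measurePreserving_add_fun (Ω := Ω) ((volume : Measure E3).prod ρ)
    hm).quasiMeasurePreserving.ae
    ((measurePreserving_prodAssoc (volume : Measure Ω) (volume : Measure E3)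
      ρ).symm.quasiMeasurePreserving.ae h2)
  have h6 := (measurePreserving_prodAssoc (volume : Measure Ω) (volume : Measure E3)
    ρ).quasiMeasurePreserving.ae h5
  have h7 := Measure.ae_ae_of_ae_prod h6
  filter_upwards [h7] with p hp
  filter_upwards [hp] with s hs
  rw [sub_eq_add_neg]
  exact hs

end Transport

/-! ### Mild solutions -/

section Mild

set_option linter.unusedSectionVars false

open Filter

variable {Ω : Type} [AddCommGroup Ω] [TopologicalSpace Ω] [IsTopologicalAddGroup Ω]
  [SecondCountableTopology Ω] [MeasurableSpace Ω] [BorelSpace Ω]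
  {γ β : ℝ} {b : ℝ → ℝ} {C M M₀ T : ℝ} {π : E3 →+ Ω} {f₀ g₀ : Ω → E3 → ℝ}
  {f g : ℝ → Ω → E3 → ℝ}

lemma Admissible.mono {M' : ℝ} (hf : Admissible β M f) (h : M ≤ M') : Admissible β M' f :=
  ⟨hf.measurable, fun t x v => (hf.bound t x v).trans
    (mul_le_mul_of_nonneg_right h (inv_pos.2 (weight_pos β v)).le), hf.nonneg⟩

/-- The right-hand side `K f + Γ(f, f)` along the characteristic through `y`. -/
def rhs (γ : ℝ) (b : ℝ → ℝ) (f : E3 → ℝ) (v : E3) : ℝ := K γ b f v + Gam γ b f f v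

lemma duhamel_const (c : ℝ) (g : ℝ → ℝ) (y t : ℝ) :
    duhamel (fun _ => c) g y t =
      Real.exp (-c * t) * y + ∫ s in (0 : ℝ)..t, Real.exp (-c * (t - s)) * g s := by
  rw [duhamel, mul_add, ← intervalIntegral.integral_const_mul]
  simp only [intervalIntegral.integral_const, smul_eq_mul, sub_zero]
  congr 1
  · congr 2; ring
  · congr 1; ext s
    rw [← mul_assoc, ← Real.exp_add]
    congr 2; ring

lemma Setting.rhs_eq (hS : Setting γ β b C π) (hf : Admissible β M f) (t : ℝ) (x : Ω) (v : E3) :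
    rhs γ b (f t x) v = source γ b (f t x) v - f t x v * freq γ b (shift (f t x)) v +
      collisionFreq γ b v * f t x v := by
  obtain ⟨C', hK⟩ := hS.kernel
  exact K_add_Gam hK (hf.decays hS.one_le_beta t x) v

lemma Setting.measurable_along₃ (hS : Setting γ β b C π) {H : (E3 → ℝ) → E3 → ℝ}
    (hH : Measurable fun p : (ℝ × Ω) × E3 => H (f p.1.1 p.1.2) p.2) :
    Measurable fun q : (Ω × E3) × ℝ => H (f q.2 (q.1.1 + π (q.2 • q.1.2))) q.1.2 := by
  have hm : Measurable fun q : (Ω × E3) × ℝ => q.1.2 := by fun_prop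
  exact hH.comp (f := fun q : (Ω × E3) × ℝ => ((q.2, q.1.1 + π (q.2 • q.1.2)), q.1.2))
    (hS.measurable_along.prodMk hm)

lemma Setting.measurable_value_along (hS : Setting γ β b C π) (hf : Admissible β M f) :
    Measurable fun q : (Ω × E3) × ℝ => f q.2 (q.1.1 + π (q.2 • q.1.2)) q.1.2 :=
  hS.measurable_along₃ (H := fun f v => f v) hf.measurable

lemma Setting.exists_Gam_bound (hS : Setting γ β b C π) (hf : Admissible β M f) :
    Measurable (fun p : (ℝ × Ω) × E3 => Gam γ b (f p.1.1 p.1.2) (f p.1.1 p.1.2) p.2) ∧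
    ∃ B, ∀ t x v, |Gam γ b (f t x) (f t x) v| ≤ B * jap v := by
  obtain ⟨C', hK⟩ := hS.kernel
  have hM := hf.nonneg_const
  have hC := hK.one_le
  refine ⟨?_, C' * (M * M) + M * (C' * M), fun t x v => ?_⟩
  · simp only [Gam_eq]
    exact (measurable_gain hK (α := ℝ × Ω) (F := fun p => f p.1 p.2) (G := fun p => f p.1 p.2)
      hf.measurable hf.measurable).sub (hf.measurable.mul
        (measurable_freq hK (α := ℝ × Ω) (F := fun p => f p.1 p.2) hf.measurable))
  · have hd := hf.decays hS.one_le_beta t x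
    have h1 := abs_gain_le hK (v := v) (by positivity) (hd.mul_le_gainWeight hd v)
    have h2 := abs_freq_le hK (v := v) hM hd.le_jap_pow
    have h3 := hd.abs_le v
    have hj := one_le_jap v
    rw [Gam_eq]
    calc _ ≤ |gain γ b (f t x) (f t x) v| + |f t x v| * |freq γ b (f t x) v| := by
          rw [← abs_mul]; exact abs_sub _ _
      _ ≤ C' * (M * M) * jap v + M * (C' * M * jap v) := by
          refine add_le_add (h1.trans (le_mul_of_one_le_right (by positivity) hj)) ?_
          exact mul_le_mul h3 h2 (abs_nonneg _) hM
      _ = _ := by ring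

lemma Setting.measurable_rhs (hS : Setting γ β b C π) (hf : Admissible β M f) :
    Measurable fun p : (ℝ × Ω) × E3 => rhs γ b (f p.1.1 p.1.2) p.2 := by
  obtain ⟨C', hK⟩ := hS.kernel
  simp only [hS.rhs_eq hf]
  have h1 := measurable_source hK (α := ℝ × Ω) (F := fun p => f p.1 p.2) hf.measurable
  have h2 := measurable_freq hK (α := ℝ × Ω) (F := fun p => shift (f p.1 p.2))
    (measurable_shift (F := fun p : ℝ × Ω => f p.1 p.2) hf.measurable)
  have h3 := measurable_freq hK (α := ℝ × Ω) (F := fun _ => sqrtM) measurable_sqrtM_snd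
  simp only [collisionFreq_eq]
  exact (h1.sub (hf.measurable.mul h2)).add (h3.mul hf.measurable)

lemma Setting.intervalIntegrable_rhs (hS : Setting γ β b C π) (hf : Admissible β M f)
    (hT : 0 ≤ T) (y : Ω) (v : E3) :
    IntervalIntegrable (fun s => rhs γ b (f s (y + π (s • v))) v) volume 0 T := by
  obtain ⟨B, hB, hfr⟩ := hS.exists_freq_le M
  have hd := fun t x => hf.decays hS.one_le_beta t x
  have hm : Measurable fun s => rhs γ b (f s (y + π (s • v))) v :=
    (hS.measurable_along₃ (hS.measurable_rhs hf)).comp (f := fun s => ((y, v), s)) (by fun_prop)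
  refine intervalIntegrable_of_bounded (M := C * (M * (1 + M) * (weight β v)⁻¹) +
    M * (B * jap v) + |collisionFreq γ b v| * M) hm hT fun s _ => ?_
  rw [hS.rhs_eq hf]
  refine (abs_add_le _ _).trans (add_le_add ((abs_sub _ _).trans (add_le_add
    (hS.abs_source_le hf _ _ _) ?_)) ?_)
  · rw [abs_mul]
    exact mul_le_mul ((hd _ _).abs_le v) (hfr f hf _ _ _) (abs_nonneg _) hf.nonneg_const
  · rw [abs_mul]
    exact mul_le_mul_of_nonneg_left ((hd _ _).abs_le v) (abs_nonneg _)

lemma Setting.intervalIntegrable_Gam (hS : Setting γ β b C π) (hf : Admissible β M f)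
    (hT : 0 ≤ T) (y : Ω) (v : E3) :
    IntervalIntegrable (fun s => Gam γ b (f s (y + π (s • v))) (f s (y + π (s • v))) v)
      volume 0 T := by
  obtain ⟨h, B, hB⟩ := hS.exists_Gam_bound hf
  have hm : Measurable fun s => Gam γ b (f s (y + π (s • v))) (f s (y + π (s • v))) v :=
    (hS.measurable_along₃ (H := fun f v => Gam γ b f f v) h).comp
      (f := fun s => ((y, v), s)) (by fun_prop)
  exact intervalIntegrable_of_bounded hm hT fun s _ => hB _ _ _

/-- The mild formula of an admissible function in terms of `rhs`. -/
lemma Setting.mild_formula (hS : Setting γ β b C π) (hf : Admissible β M f)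
    {t : ℝ} (ht : 0 ≤ t) (x : Ω) (v : E3) (y₀ : ℝ) :
    Real.exp (-collisionFreq γ b v * t) * y₀
      + (∫ s in (0 : ℝ)..t, Real.exp (-collisionFreq γ b v * (t - s)) *
          K γ b (f s (x - π ((t - s) • v))) v)
      + ∫ s in (0 : ℝ)..t, Real.exp (-collisionFreq γ b v * (t - s)) *
          Gam γ b (f s (x - π ((t - s) • v))) (f s (x - π ((t - s) • v))) v =
    duhamel (fun _ => collisionFreq γ b v)
      (fun s => rhs γ b (f s (x - π (t • v) + π (s • v))) v) y₀ t := by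
  have e : ∀ s : ℝ, x - π ((t - s) • v) = x - π (t • v) + π (s • v) := fun s => by
    rw [sub_smul, map_sub]; abel
  have hc : Continuous fun s : ℝ => Real.exp (-collisionFreq γ b v * (t - s)) := by fun_prop
  have h1 := hS.intervalIntegrable_rhs hf ht (x - π (t • v)) v
  have h2 := hS.intervalIntegrable_Gam hf ht (x - π (t • v)) v
  -- The mild formula has separate integrals of K f and Γ(f, f). Integrability of the first is
  -- recovered as that of their sum minus the second.
  have h3 := h1.sub h2
  simp only [rhs, add_sub_cancel_right] at h3
  rw [duhamel_const, add_assoc, ← intervalIntegral.integral_add]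
  · simp only [e, rhs, mul_add]
  · simp only [e]; exact h3.continuousOn_mul hc.continuousOn
  · simp only [e]; exact h2.continuousOn_mul hc.continuousOn

lemma ae_mem_of_ae_restrict {P : ℝ → Prop} (h : ∀ᵐ s ∂volume.restrict (Icc 0 T), P s) :
    ∀ᵐ s, s ∈ Icc 0 T → P s := (ae_restrict_iff' measurableSet_Icc).1 h

/-- Passes from damping by ν to damping by the full frequency: the mild expression solves both
equations wherever f equals it, and equality at almost every time is enough for the derivative. -/
lemma Setting.charStep_eq_of_duhamel (hS : Setting γ β b C π) (hf : Admissible β M f)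
    (hT : 0 ≤ T) {y : Ω} {v : E3}
    (h : ∀ᵐ s ∂volume.restrict (Icc 0 T), f s (y + π (s • v)) v =
      duhamel (fun _ => collisionFreq γ b v) (fun s => rhs γ b (f s (y + π (s • v))) v)
        (f₀ y v) s) {t : ℝ} (ht : t ∈ Icc 0 T) :
    charStep γ b π f₀ f y v t = duhamel (fun _ => collisionFreq γ b v)
      (fun s => rhs γ b (f s (y + π (s • v))) v) (f₀ y v) t := by
  have h1 := isPrim_duhamel (y₀ := f₀ y v) (a := fun _ => collisionFreq γ b v) hT
    intervalIntegrable_const (hS.intervalIntegrable_rhs hf hT y v)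
  have h2 := h1.congr hT (r := fun t => source γ b (f t (y + π (t • v))) v -
      freq γ b (shift (f t (y + π (t • v)))) v * duhamel (fun _ => collisionFreq γ b v)
      (fun s => rhs γ b (f s (y + π (s • v))) v) (f₀ y v) t) (fun _ _ => rfl) (by
    filter_upwards [ae_mem_of_ae_restrict h] with s hs hsT
    rw [← hs hsT, hS.rhs_eq hf]; ring)
  have h3 := h2.eq_duhamel hT (hS.intervalIntegrable_freq hf hT y v) ht
  rw [h3, duhamel_zero]; rfl

/-- The converse passage, from a fixed point of the iteration to the mild formula. -/
lemma Setting.charStep_eq_duhamel (hS : Setting γ β b C π) (hf : Admissible β M f)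
    (hT : 0 ≤ T) {y : Ω} {v : E3}
    (h : ∀ s ∈ Icc 0 T, f s (y + π (s • v)) v = charStep γ b π f₀ f y v s) {t : ℝ}
    (ht : t ∈ Icc 0 T) :
    charStep γ b π f₀ f y v t = duhamel (fun _ => collisionFreq γ b v)
      (fun s => rhs γ b (f s (y + π (s • v))) v) (f₀ y v) t := by
  have h1 := hS.isPrim_charStep (f₀ := f₀) hf hT y v
  have h2 := h1.congr hT (r := fun t => rhs γ b (f t (y + π (t • v))) v -
      collisionFreq γ b v * charStep γ b π f₀ f y v t) (fun _ _ => rfl)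
    (Eventually.of_forall fun s hs => by rw [← h s hs, hS.rhs_eq hf]; ring)
  have h3 := h2.eq_duhamel hT (a := fun _ => collisionFreq γ b v) intervalIntegrable_const ht
  rw [h3]; congr 1; exact duhamel_zero

/-! ### Truncation -/

/-- Truncation of a function into the class of admissible functions. -/
def trunc (β M : ℝ) (v : E3) (r : ℝ) : ℝ :=
  max (-min (M * (weight β v)⁻¹) (sqrtM v)) (min (M * (weight β v)⁻¹) r)

lemma continuous_trunc (β M : ℝ) : Continuous fun p : E3 × ℝ => trunc β M p.1 p.2 := by
  have h1 : Continuous fun p : E3 × ℝ => (weight β p.1)⁻¹ :=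
    ((continuous_weight β).inv₀ fun v => (weight_pos β v).ne').comp continuous_fst
  have h2 : Continuous fun p : E3 × ℝ => sqrtM p.1 := continuous_sqrtM.comp continuous_fst
  have h3 := h1.const_mul M
  exact (h3.min h2).neg.max (h3.min continuous_snd)

lemma abs_trunc_le (hM : 0 ≤ M) (v : E3) (r : ℝ) : |trunc β M v r| ≤ M * (weight β v)⁻¹ := by
  have h : 0 ≤ M * (weight β v)⁻¹ := mul_nonneg hM (inv_pos.2 (weight_pos β v)).le
  rw [abs_le]
  exact ⟨le_max_of_le_left (neg_le_neg (min_le_left _ _)),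
    max_le (by linarith [le_min h (sqrtM_pos v).le]) (min_le_left _ _)⟩

lemma sqrtM_add_trunc_nonneg (v : E3) (r : ℝ) : 0 ≤ sqrtM v + trunc β M v r := by
  have h1 : -min (M * (weight β v)⁻¹) (sqrtM v) ≤ trunc β M v r := le_max_left _ _
  have h2 := min_le_right (M * (weight β v)⁻¹) (sqrtM v)
  linarith

lemma trunc_eq_self {v : E3} {r : ℝ} (h : |r| ≤ M * (weight β v)⁻¹) (h0 : 0 ≤ sqrtM v + r) :
    trunc β M v r = r := by
  have := abs_le.1 h
  rw [trunc, min_eq_right this.2, max_eq_right]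
  rw [neg_le]
  exact le_min (by linarith) (by linarith)

/-- Truncation is nonexpansive and fixes admissible values, so it can be inserted without spoiling
the contraction. -/
lemma abs_trunc_sub_trunc_le (v : E3) (r r' : ℝ) :
    |trunc β M v r - trunc β M v r'| ≤ |r - r'| := by
  unfold trunc
  refine (abs_max_sub_max_le_max _ _ _ _).trans ?_
  rw [sub_self, abs_zero, max_eq_right (abs_nonneg _)]
  refine (abs_min_sub_min_le_max _ _ _ _).trans ?_
  rw [sub_self, abs_zero, max_eq_right (abs_nonneg _)]

lemma admissible_trunc (hM : 0 ≤ M) {h : ℝ → Ω → E3 → ℝ}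
    (hm : Measurable fun p : (ℝ × Ω) × E3 => h p.1.1 p.1.2 p.2) :
    Admissible β M (fun t x v => trunc β M v (h t x v)) :=
  ⟨measurable_comp₂ (f := fun v r => trunc β M v r) (continuous_trunc β M).measurable
      (g := fun p : (ℝ × Ω) × E3 => p.2) (by fun_prop) hm,
    fun _ _ _ => abs_trunc_le hM _ _, fun _ _ _ => sqrtM_add_trunc_nonneg _ _⟩

lemma admissibleData_trunc (hM : 0 ≤ M) {h : Ω → E3 → ℝ}
    (hm : Measurable fun p : Ω × E3 => h p.1 p.2) :
    AdmissibleData β M (fun x v => trunc β M v (h x v)) :=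
  ⟨measurable_comp₂ (f := fun v r => trunc β M v r) (continuous_trunc β M).measurable
      (g := fun p : Ω × E3 => p.2) (by fun_prop) hm,
    fun _ _ => abs_trunc_le hM _ _, fun _ _ => sqrtM_add_trunc_nonneg _ _⟩

end Mild

/-! ### Existence and uniqueness of mild solutions -/

section MildSolutions

set_option linter.unusedSectionVars false

open Filter

lemma density_eq {Ω : Type} (f : Ω → E3 → ℝ) (x : Ω) (v : E3) :
    density f x v = sqrtM v * shift (f x) v := by
  rw [density, shift, mul_add, sqrtM_mul_self]

lemma density_nonneg_iff {Ω : Type} {f : Ω → E3 → ℝ} {x : Ω} {v : E3} :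
    0 ≤ density f x v ↔ 0 ≤ shift (f x) v := by
  rw [density_eq, mul_nonneg_iff_of_pos_left (sqrtM_pos v)]

variable {Ω : Type} [AddCommGroup Ω] [TopologicalSpace Ω] [IsTopologicalAddGroup Ω]
  [SecondCountableTopology Ω] [MeasureSpace Ω] [BorelSpace Ω] [SigmaFinite (volume : Measure Ω)]
  [(volume : Measure Ω).IsAddLeftInvariant]
  {γ β : ℝ} {b : ℝ → ℝ} {C M M₀ T : ℝ} {π : E3 →+ Ω} {f₀ f₁ : Ω → E3 → ℝ}
  {f g : ℝ → Ω → E3 → ℝ}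

lemma wNorm_le {f : Ω → E3 → ℝ} (h : ∀ x v, |f x v| ≤ M * (weight β v)⁻¹) :
    wNorm β f ≤ ENNReal.ofReal M := by
  rw [wNorm, eLpNorm_exponent_top]
  refine eLpNormEssSup_le_of_ae_bound (Eventually.of_forall fun p => ?_)
  have hw := weight_pos β p.2
  rw [Real.norm_eq_abs, abs_mul, abs_of_pos hw]
  calc weight β p.2 * |f p.1 p.2| ≤ weight β p.2 * (M * (weight β p.2)⁻¹) := by gcongr; exact h _ _
    _ = M := by field_simp

lemma ae_abs_le_of_wNorm_le (hM : 0 ≤ M) {f : Ω → E3 → ℝ} (h : wNorm β f ≤ ENNReal.ofReal M) :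
    ∀ᵐ p : Ω × E3, |f p.1 p.2| ≤ M * (weight β p.2)⁻¹ := by
  rw [wNorm, eLpNorm_exponent_top] at h
  filter_upwards [enorm_ae_le_eLpNormEssSup (fun p : Ω × E3 => weight β p.2 * f p.1 p.2) volume]
    with p hp
  have h1 := hp.trans h
  have hw := weight_pos β p.2
  rw [← ofReal_norm, ENNReal.ofReal_le_ofReal_iff hM, Real.norm_eq_abs, abs_mul,
    abs_of_pos hw] at h1
  rw [← div_eq_mul_inv, le_div_iff₀ hw, mul_comm]
  exact h1

/-- Data for the Boltzmann equation have a representative that is bounded everywhere. -/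
lemma exists_admissibleData
    (hm : AEStronglyMeasurable (fun p : Ω × E3 => f₀ p.1 p.2) volume) (hM : 0 ≤ M)
    (hb : wNorm β f₀ ≤ ENNReal.ofReal M) (h0 : ∀ᵐ p : Ω × E3, 0 ≤ density f₀ p.1 p.2) :
    ∃ f₁ : Ω → E3 → ℝ, AdmissibleData β M f₁ ∧ (∀ᵐ p : Ω × E3, f₀ p.1 p.2 = f₁ p.1 p.2) ∧
      (Continuous (fun p : Ω × E3 => f₀ p.1 p.2) → Continuous fun p : Ω × E3 => f₁ p.1 p.2) := by
  have key : ∃ h : Ω → E3 → ℝ, (Measurable fun p : Ω × E3 => h p.1 p.2) ∧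
      (∀ᵐ p : Ω × E3, f₀ p.1 p.2 = h p.1 p.2) ∧
      (Continuous (fun p : Ω × E3 => f₀ p.1 p.2) → Continuous fun p : Ω × E3 => h p.1 p.2) := by
    -- Continuous data are kept as they are; an arbitrary measurable modification would destroy
    -- continuity.
    by_cases hc : Continuous (fun p : Ω × E3 => f₀ p.1 p.2)
    · exact ⟨f₀, hc.measurable, Eventually.of_forall fun _ => rfl, id⟩
    · exact ⟨fun x v => hm.mk _ (x, v), hm.stronglyMeasurable_mk.measurable, hm.ae_eq_mk,
        fun h => (hc h).elim⟩
  obtain ⟨h, hhm, hae, hhc⟩ := key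
  refine ⟨fun x v => trunc β M v (h x v), admissibleData_trunc hM hhm, ?_, fun hc => ?_⟩
  · filter_upwards [hae, h0, ae_abs_le_of_wNorm_le hM hb] with p h1 h2 h3
    rw [← h1, trunc_eq_self h3 (density_nonneg_iff.1 h2)]
  · exact Continuous.comp (g := fun p : E3 × ℝ => trunc β M p.1 p.2)
      (f := fun p : Ω × E3 => (p.2, h p.1 p.2)) (continuous_trunc β M)
      (continuous_snd.prodMk (hhc hc))

lemma Setting.isMildSolution_sol (hS : Setting γ β b C π) (hf₁ : AdmissibleData β M₀ f₁)
    (hT : Short C M₀ M T) (hM : 0 ≤ M) (h01 : ∀ᵐ p : Ω × E3, f₀ p.1 p.2 = f₁ p.1 p.2) :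
    IsMildSolution π γ b β T f₀ (sol γ b π T f₁) := by
  have hf := hS.admissible_sol hf₁ hT hM
  refine ⟨?_, ⟨M, fun t _ => wNorm_le (hf.bound t)⟩, fun t _ => Eventually.of_forall fun p =>
    density_nonneg_iff.2 (hf.nonneg t p.1 p.2), fun t ht => ?_⟩
  · exact (hf.measurable.comp
      (MeasurableEquiv.prodAssoc (α := ℝ) (β := Ω) (γ := E3)).symm.measurable).aestronglyMeasurable
  · filter_upwards [(measurePreserving_transport_neg hS.continuous t).quasiMeasurePreserving.ae h01]
      with p hp
    rw [hS.mild_formula hf ht.1, hp,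
      ← hS.charStep_eq_duhamel hf hT.nonneg (fun s hs => (hS.charStep_sol hf₁ hT hM hs _ _).symm) ht,
      hS.charStep_sol hf₁ hT hM ht, sub_add_cancel]

/-- Functions that agree almost everywhere have the same image under `step`. -/
lemma Setting.ae_step_congr (hS : Setting γ β b C π)
    (h : ∀ᵐ q ∂slabMeasure Ω T, f q.1.1 q.1.2 q.2 = g q.1.1 q.1.2 q.2) {t : ℝ}
    (ht : t ∈ Icc 0 T) :
    ∀ᵐ p : Ω × E3, step γ b π T f₀ f t p.1 p.2 = step γ b π T f₀ g t p.1 p.2 := by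
  have h1 := ae_operators_congr γ b (F := fun q : ℝ × Ω => f q.1 q.2)
    (G := fun q : ℝ × Ω => g q.1 q.2) h
  have h2 := ae_along_of_ae_slab hS.continuous (P := fun s x v =>
    source γ b (f s x) v = source γ b (g s x) v ∧
      freq γ b (shift (f s x)) v = freq γ b (shift (g s x)) v) (h1.mono fun q hq => hq.2.2.2) t
  filter_upwards [h2] with p hp
  have e : ∀ s : ℝ, p.1 - π ((t - s) • p.2) = p.1 - π (t • p.2) + π (s • p.2) := fun s => by
    rw [sub_smul, map_sub]; abel
  simp only [e] at hp
  have hp' := ae_mem_of_ae_restrict hp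
  rw [step_eq _ _ ht, step_eq _ _ ht, charStep, charStep, duhamel, duhamel]
  have hA : ∀ s ∈ Icc 0 t,
      ∫ τ in (0 : ℝ)..s, freq γ b (shift (f τ (p.1 - π (t • p.2) + π (τ • p.2)))) p.2 =
      ∫ τ in (0 : ℝ)..s, freq γ b (shift (g τ (p.1 - π (t • p.2) + π (τ • p.2)))) p.2 := by
    intro s hs
    refine intervalIntegral.integral_congr_ae ?_
    filter_upwards [hp'] with τ h hτ
    rw [uIoc_of_le hs.1] at hτ
    exact (h ⟨hτ.1.le, hτ.2.trans (hs.2.trans ht.2)⟩).2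
  rw [hA t ⟨ht.1, le_rfl⟩]
  congr 2
  refine intervalIntegral.integral_congr_ae ?_
  filter_upwards [hp'] with τ h hτ
  rw [uIoc_of_le ht.1] at hτ
  rw [(h ⟨hτ.1.le, hτ.2.trans ht.2⟩).1, hA τ ⟨hτ.1.le, hτ.2⟩]

/-- A mild solution has an admissible representative, and it agrees with its image under `step`
at every time. -/
lemma Setting.exists_admissible_of_isMildSolution (hS : Setting γ β b C π)
    (hg : IsMildSolution π γ b β T f₀ g) (hT : 0 ≤ T)
    (hf₁ : Measurable fun p : Ω × E3 => f₁ p.1 p.2)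
    (h01 : ∀ᵐ p : Ω × E3, f₀ p.1 p.2 = f₁ p.1 p.2) :
    ∃ M', 0 ≤ M' ∧ ∀ M'' ≥ M', ∃ G : ℝ → Ω → E3 → ℝ, Admissible β M'' G ∧
      (∀ᵐ s ∂volume.restrict (Icc 0 T), ∀ᵐ p : Ω × E3, g s p.1 p.2 = G s p.1 p.2) ∧
      ∀ t ∈ Icc 0 T, ∀ᵐ p : Ω × E3, g t p.1 p.2 = step γ b π T f₁ G t p.1 p.2 := by
  obtain ⟨M', hM'⟩ := hg.bounded
  refine ⟨max M' 0, le_max_right _ _, fun M'' hM'' => ?_⟩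
  have hM0 : 0 ≤ M'' := (le_max_right _ _).trans hM''
  set h : ℝ → Ω → E3 → ℝ := fun t x v => hg.measurable.mk _ (t, x, v) with hh
  have hhm : Measurable fun p : (ℝ × Ω) × E3 => h p.1.1 p.1.2 p.2 :=
    hg.measurable.stronglyMeasurable_mk.measurable.comp
      (MeasurableEquiv.prodAssoc (α := ℝ) (β := Ω) (γ := E3)).measurable
  have hgh : ∀ᵐ q ∂slabMeasure Ω T, g q.1.1 q.1.2 q.2 = h q.1.1 q.1.2 q.2 :=
    (measurePreserving_prodAssoc (volume.restrict (Icc 0 T)) (volume : Measure Ω)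
      (volume : Measure E3)).quasiMeasurePreserving.ae hg.measurable.ae_eq_mk
  set G : ℝ → Ω → E3 → ℝ := fun t x v => trunc β M'' v (h t x v) with hG
  have hGa : Admissible β M'' G := admissible_trunc hM0 hhm
  have hgG' : ∀ᵐ s ∂volume.restrict (Icc 0 T), ∀ᵐ p : Ω × E3, h s p.1 p.2 = G s p.1 p.2 := by
    filter_upwards [ae_of_ae_slab (P := fun s x v => g s x v = h s x v) hgh, ae_restrict_mem measurableSet_Icc] with s hs hsT
    filter_upwards [hs, hg.nonneg s hsT, ae_abs_le_of_wNorm_le hM0 ((hM' s hsT).trans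
      (ENNReal.ofReal_le_ofReal ((le_max_left _ _).trans hM'')))] with p h1 h2 h3
    rw [hG]
    simp only
    rw [← h1, trunc_eq_self h3 (density_nonneg_iff.1 h2)]
  have hgG : ∀ᵐ q ∂slabMeasure Ω T, g q.1.1 q.1.2 q.2 = G q.1.1 q.1.2 q.2 := by
    have h1 := ae_slab_of_ae (P := fun s x v => h s x v = G s x v)
      (measurableSet_eq_fun hhm hGa.measurable) hgG'
    filter_upwards [hgh, h1] with q h1 h2
    exact h1.trans h2
  have hae := ae_of_ae_slab (P := fun s x v => g s x v = G s x v) hgG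
  refine ⟨G, hGa, hae, ?_⟩
  -- The right-hand side of the mild formula with G in the integrand, as a function on
  -- characteristics. It is defined at every time, whereas G is tied to g only at almost every time.
  let Z : Ω → E3 → ℝ → ℝ := fun y v t => duhamel (fun _ => collisionFreq γ b v)
    (fun s => rhs γ b (G s (y + π (s • v))) v) (f₁ y v) t
  have hgZ : ∀ t ∈ Icc 0 T, ∀ᵐ p : Ω × E3, g t p.1 p.2 = Z (p.1 - π (t • p.2)) p.2 t := by
    intro t ht
    have h1 := ae_operators_congr γ b (F := fun q : ℝ × Ω => g q.1 q.2)
      (G := fun q : ℝ × Ω => G q.1 q.2) hgG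
    have h2 := ae_along_of_ae_slab hS.continuous (P := fun s x v =>
      K γ b (g s x) v = K γ b (G s x) v ∧ Gam γ b (g s x) (g s x) v = Gam γ b (G s x) (G s x) v)
      (h1.mono fun q hq => ⟨hq.2.1, hq.2.2.1⟩) t
    filter_upwards [hg.mild t ht, h2, (measurePreserving_transport_neg
      hS.continuous t).quasiMeasurePreserving.ae h01] with p h3 h4 h5
    have h4' := ae_mem_of_ae_restrict h4
    rw [h3, h5]
    refine Eq.trans ?_ (hS.mild_formula hGa ht.1 p.1 p.2 _)
    congr 1
    · congr 1
      refine intervalIntegral.integral_congr_ae ?_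
      filter_upwards [h4'] with s hs hst
      rw [uIoc_of_le ht.1] at hst
      rw [(hs ⟨hst.1.le, hst.2.trans ht.2⟩).1]
    · refine intervalIntegral.integral_congr_ae ?_
      filter_upwards [h4'] with s hs hst
      rw [uIoc_of_le ht.1] at hst
      rw [(hs ⟨hst.1.le, hst.2.trans ht.2⟩).2]
  have hZm : Measurable fun q : (Ω × E3) × ℝ => Z q.1.1 q.1.2 q.2 := by
    obtain ⟨C', hK⟩ := hS.kernel
    have h1 := hS.measurable_along₃ (f := G) (H := rhs γ b) (hS.measurable_rhs hGa)
    have h2 : Measurable fun q : (Ω × E3) × ℝ => collisionFreq γ b q.1.2 := by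
      simp only [collisionFreq_eq]
      have h3 : Measurable fun v : E3 => freq γ b sqrtM v :=
        (measurable_freq hK (α := Unit) (F := fun _ => sqrtM) measurable_sqrtM_snd).comp
          (f := fun v => ((), v)) (by fun_prop)
      exact h3.comp (by fun_prop)
    exact measurable_duhamel (a := fun (q : Ω × E3) _ => collisionFreq γ b q.2)
      (g := fun (q : Ω × E3) s => rhs γ b (G s (q.1 + π (s • q.2))) q.2)
      (y₀ := fun q : Ω × E3 => f₁ q.1 q.2) h2 h1 hf₁
  have hGZ : ∀ᵐ s ∂volume.restrict (Icc 0 T), ∀ᵐ p : Ω × E3,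
      G s (p.1 + π (s • p.2)) p.2 = Z p.1 p.2 s := by
    filter_upwards [hae, ae_restrict_mem measurableSet_Icc] with s hs hsT
    have h1 : ∀ᵐ p : Ω × E3, G s p.1 p.2 = Z (p.1 - π (s • p.2)) p.2 s := by
      filter_upwards [hs, hgZ s hsT] with p h1 h2
      rw [← h1, h2]
    have h2 := (measurePreserving_transport hS.continuous s).quasiMeasurePreserving.ae h1
    filter_upwards [h2] with p hp
    rwa [add_sub_cancel_right] at hp
  have hset : MeasurableSet {q : ℝ × (Ω × E3) |
      G q.1 (q.2.1 + π (q.1 • q.2.2)) q.2.2 = Z q.2.1 q.2.2 q.1} :=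
    measurable_swap (measurableSet_eq_fun (hS.measurable_value_along hGa) hZm)
  -- Exchanging the quantifiers: on almost every characteristic, G agrees with Z at almost every
  -- time. This is the hypothesis of `charStep_eq_of_duhamel`.
  have hcomm := (Measure.ae_ae_comm (μ := volume.restrict (Icc 0 T))
    (ν := (volume : Measure (Ω × E3))) (p := fun s p =>
      G s (p.1 + π (s • p.2)) p.2 = Z p.1 p.2 s) hset).1 hGZ
  intro t ht
  filter_upwards [hgZ t ht, (measurePreserving_transport_neg
      hS.continuous t).quasiMeasurePreserving.ae hcomm] with p h1 h2
  rw [h1, step_eq _ _ ht, hS.charStep_eq_of_duhamel hGa hT h2 ht]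

/-- The competing solution is bounded by some N that may exceed M, and the interval need not be
short for N, so `step` may leave the class. Truncating after each step repairs this: the iterates of
G remain almost everywhere equal to G, yet approach `sol` pointwise at a geometric rate. The
contraction estimate requires T ≤ 1 and a bound on the image of `sol`, which is `sol` itself. -/
lemma Setting.unique (hS : Setting γ β b C π) (hf₁ : AdmissibleData β M₀ f₁)
    (hT : Short C M₀ M T) (hM : 0 ≤ M) (h01 : ∀ᵐ p : Ω × E3, f₀ p.1 p.2 = f₁ p.1 p.2)
    (hg : IsMildSolution π γ b β T f₀ g) {t : ℝ} (ht : t ∈ Icc 0 T) :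
    ∀ᵐ p : Ω × E3, g t p.1 p.2 = sol γ b π T f₁ t p.1 p.2 := by
  obtain ⟨M', hM', hG⟩ := hS.exists_admissible_of_isMildSolution hg hT.nonneg hf₁.measurable h01
  obtain ⟨G, hGa, hgG, hstep⟩ := hG (max M' M) (le_max_left _ _)
  set N := max M' M
  have hN : 0 ≤ N := hM'.trans (le_max_left _ _)
  have hsol := (hS.admissible_sol hf₁ hT hM).mono (le_max_right M' M : M ≤ N)
  have hl := hS.rate_pos hN
  have hsteps : ∀ H : ℝ → Ω → E3 → ℝ,
      (∀ᵐ q ∂slabMeasure Ω T, H q.1.1 q.1.2 q.2 = G q.1.1 q.1.2 q.2) → ∀ t ∈ Icc 0 T,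
      ∀ᵐ p : Ω × E3, g t p.1 p.2 = step γ b π T f₁ H t p.1 p.2 := by
    intro H hH t ht
    filter_upwards [hstep t ht, hS.ae_step_congr (f₀ := f₁) hH ht] with p h1 h2
    rw [h1, h2]
  have hdiff : ∀ (H : ℝ → Ω → E3 → ℝ) (D : ℝ), 0 ≤ D → Admissible β N H →
      (∀ s ∈ Icc 0 T, ∀ x v, |H s x v - sol γ b π T f₁ s x v| ≤
        D * Real.exp (rate C N * s) * (weight (β - 2) v)⁻¹) →
      ∀ s ∈ Icc 0 T, ∀ x v, |step γ b π T f₁ H s x v - sol γ b π T f₁ s x v| ≤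
        D * (1 / 2) * Real.exp (rate C N * s) * (weight (β - 2) v)⁻¹ := by
    intro H D hD hH hHs s hs x v
    have h := hS.abs_step_sub_le hH hsol hT.nonneg hT.le_one (SlowOn.one π) (f₀ := f₁) (g₀ := f₁)
      (D₀ := 0) (D := D) le_rfl hD (fun x v => by simp)
      (fun s hs x v => by simpa using hHs s hs x v)
      (fun t _ x v => by rw [hS.step_sol hf₁ hT hM]; exact hsol.bound t x v) hs x v
    rw [hS.step_sol hf₁ hT hM] at h
    refine h.trans (le_of_eq (by ring))
  have key : ∀ n : ℕ, ∃ H : ℝ → Ω → E3 → ℝ, Admissible β N H ∧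
      (∀ᵐ q ∂slabMeasure Ω T, H q.1.1 q.1.2 q.2 = G q.1.1 q.1.2 q.2) ∧
      ∀ s ∈ Icc 0 T, ∀ x v, |H s x v - sol γ b π T f₁ s x v| ≤
        2 * N * (1 / 2) ^ n * Real.exp (rate C N * s) * (weight (β - 2) v)⁻¹ := by
    intro n
    induction n with
    | zero =>
      refine ⟨G, hGa, Eventually.of_forall fun _ => rfl, fun s hs x v => ?_⟩
      have h1 : |G s x v - sol γ b π T f₁ s x v| ≤ 2 * N * (weight β v)⁻¹ := by
        refine (abs_sub _ _).trans ?_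
        linarith [hGa.bound s x v, hsol.bound s x v]
      have h2 := weight_inv_le β v
      have h3 : 1 ≤ Real.exp (rate C N * s) := Real.one_le_exp (mul_nonneg hl.le hs.1)
      have h4 := weight_pos (β - 2) v
      rw [pow_zero, mul_one]
      calc _ ≤ 2 * N * (weight (β - 2) v)⁻¹ := h1.trans (by gcongr)
        _ ≤ _ := mul_le_mul_of_nonneg_right (le_mul_of_one_le_right (by positivity) h3)
          (inv_pos.2 h4).le
    | succ n ih =>
      obtain ⟨H, hHa, hHG, hHs⟩ := ih
      have hm := hS.measurable_step (f₀ := f₁) hHa hf₁.measurable T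
      -- One step changes G only on a null set, since g equals both G and `step` of it almost
      -- everywhere; truncation fixes G because G is admissible.
      refine ⟨fun t x v => trunc β N v (step γ b π T f₁ H t x v), admissible_trunc hN hm, ?_,
        fun s hs x v => ?_⟩
      · refine ae_slab_of_ae (P := fun s x v => trunc β N v (step γ b π T f₁ H s x v) = G s x v)
          (measurableSet_eq_fun (admissible_trunc hN hm).measurable hGa.measurable) ?_
        filter_upwards [hgG, ae_restrict_mem measurableSet_Icc] with s hs hsT
        filter_upwards [hs, hsteps H hHG s hsT] with p h1 h2
        rw [← h2, h1, trunc_eq_self (hGa.bound s p.1 p.2) (hGa.nonneg s p.1 p.2)]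
      · have h1 := hdiff H _ (by positivity) hHa hHs s hs x v
        have h2 : sol γ b π T f₁ s x v = trunc β N v (sol γ b π T f₁ s x v) :=
          (trunc_eq_self (hsol.bound s x v) (hsol.nonneg s x v)).symm
        simp only
        rw [h2]
        refine (abs_trunc_sub_trunc_le _ _ _).trans (h1.trans (le_of_eq ?_))
        rw [pow_succ]; ring
  choose H hHa hHG hHs using key
  have hall : ∀ᵐ p : Ω × E3, ∀ n, g t p.1 p.2 = step γ b π T f₁ (H n) t p.1 p.2 :=
    ae_all_iff.2 fun n => hsteps (H n) (hHG n) t ht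
  filter_upwards [hall] with p hp
  have hlim := tendsto_const_mul_half_pow
    (N * Real.exp (rate C N * t) * (weight (β - 2) p.2)⁻¹)
  have hle : |g t p.1 p.2 - sol γ b π T f₁ t p.1 p.2| ≤ 0 := by
    refine ge_of_tendsto hlim (Eventually.of_forall fun n => ?_)
    rw [hp n]
    refine (hdiff (H n) _ (by positivity) (hHa n) (hHs n) t ht p.1 p.2).trans (le_of_eq (by ring))
  exact sub_eq_zero.1 (abs_nonpos_iff.1 hle)

end MildSolutions

/-! ### The measure of colliding pairs and the weak form of the collision operator -/

section Pairs

set_option linter.unusedSectionVars false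

open Filter

/-- Measurable functions of polynomial growth. -/
structure PolyBounded (f : E3 → ℝ) : Prop where
  measurable : Measurable f
  bound : ∃ (A : ℝ) (n : ℕ), 0 ≤ A ∧ ∀ v, |f v| ≤ A * jap v ^ n

lemma PolyBounded.of_le {f : E3 → ℝ} (hf : Measurable f) {A : ℝ} {n : ℕ}
    (h : ∀ v, |f v| ≤ A * jap v ^ n) : PolyBounded f := by
  refine ⟨hf, A, n, ?_, h⟩
  exact nonneg_of_mul_nonneg_left ((abs_nonneg _).trans (h 0)) (pow_pos (jap_pos 0) n)

lemma PolyBounded.mul {f g : E3 → ℝ} (hf : PolyBounded f) (hg : PolyBounded g) :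
    PolyBounded fun v => f v * g v := by
  obtain ⟨A, n, hA, h⟩ := hf.bound
  obtain ⟨B, m, hB, k⟩ := hg.bound
  refine ⟨hf.measurable.mul hg.measurable, A * B, n + m, by positivity, fun v => ?_⟩
  have := jap_pos v
  rw [abs_mul]
  calc _ ≤ (A * jap v ^ n) * (B * jap v ^ m) := mul_le_mul (h v) (k v) (abs_nonneg _) (by positivity)
    _ = _ := by ring

lemma PolyBounded.add {f g : E3 → ℝ} (hf : PolyBounded f) (hg : PolyBounded g) :
    PolyBounded fun v => f v + g v := by
  obtain ⟨A, n, hA, h⟩ := hf.bound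
  obtain ⟨B, m, hB, k⟩ := hg.bound
  refine ⟨hf.measurable.add hg.measurable, A + B, n + m, by positivity, fun v => ?_⟩
  have h1 := one_le_jap v
  have h2 : jap v ^ n ≤ jap v ^ (n + m) := pow_le_pow_right₀ h1 (by omega)
  have h3 : jap v ^ m ≤ jap v ^ (n + m) := pow_le_pow_right₀ h1 (by omega)
  calc _ ≤ |f v| + |g v| := abs_add_le _ _
    _ ≤ A * jap v ^ n + B * jap v ^ m := add_le_add (h v) (k v)
    _ ≤ A * jap v ^ (n + m) + B * jap v ^ (n + m) := by gcongr
    _ = _ := by ring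

lemma PolyBounded.abs {f : E3 → ℝ} (hf : PolyBounded f) : PolyBounded fun v => |f v| := by
  obtain ⟨A, n, hA, h⟩ := hf.bound
  exact ⟨hf.measurable.abs, A, n, hA, fun v => by rw [abs_abs]; exact h v⟩

lemma polyBounded_const (c : ℝ) : PolyBounded fun _ => c :=
  PolyBounded.of_le measurable_const (A := |c|) (n := 0) fun v => by simp

lemma PolyBounded.const_mul {f : E3 → ℝ} (hf : PolyBounded f) (c : ℝ) :
    PolyBounded fun v => c * f v := (polyBounded_const c).mul hf

lemma polyBounded_jap_pow (n : ℕ) : PolyBounded fun v => jap v ^ n :=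
  PolyBounded.of_le (measurable_jap.pow_const n) (A := 1) (n := n) fun v => by
    rw [abs_of_pos (pow_pos (jap_pos v) n), one_mul]

lemma Decays.polyBounded {E : ℝ} {f : E3 → ℝ} (hf : Decays E f) : PolyBounded f :=
  PolyBounded.of_le hf.measurable hf.le_jap_pow

lemma PolyBounded.integrable {f : E3 → ℝ} (hf : PolyBounded f) :
    Integrable fun v => sqrtM v * f v := by
  obtain ⟨A, n, hA, h⟩ := hf.bound
  refine ((integrable_jap_pow_mul_exp n (c := 1 / 4) (by norm_num)).const_mul A).mono'
    (measurable_sqrtM.mul hf.measurable).aestronglyMeasurable (Eventually.of_forall fun v => ?_)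
  have h1 := sqrtM_le v
  have h2 : -‖v‖ ^ 2 / 4 = -(1 / 4 * ‖v‖ ^ 2) := by ring
  rw [h2] at h1
  have h3 := sqrtM_pos v
  have := jap_pos v
  rw [Real.norm_eq_abs, abs_mul, abs_of_pos h3]
  calc _ ≤ Real.exp (-(1 / 4 * ‖v‖ ^ 2)) * (A * jap v ^ n) :=
        mul_le_mul h1 (h v) (abs_nonneg _) (Real.exp_pos _).le
    _ = _ := by ring

/-- Half of the exponent of √μ absorbs the polynomial; the other half still beats the Gaussian in
`KernelBounds`. -/
lemma PolyBounded.exists_freq_le {γ : ℝ} {b : ℝ → ℝ} {C : ℝ} (hK : KernelBounds γ b C)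
    {f : E3 → ℝ} (hf : PolyBounded f) :
    ∃ X : ℝ, 0 ≤ X ∧ ∀ v, Integrable (fun p : E3 × S2 => kernel γ b (v - p.1) p.2 * sqrtM p.1 *
      f p.1) collisionMeasure ∧ |freq γ b f v| ≤ X * jap v := by
  obtain ⟨A, n, hA, h⟩ := hf.bound
  obtain ⟨D, hD, k⟩ := exists_jap_pow_mul_exp_le n (1 / 8) (by norm_num)
  have hC := hK.one_le
  have hle : ∀ u, |sqrtM u * f u| ≤ A * D * (jap u ^ 4 * Real.exp (-(1 / 16 * ‖u‖ ^ 2))) := by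
    intro u
    have h1 := sqrtM_le u
    have h2 : -‖u‖ ^ 2 / 4 = -(1 / 8 * ‖u‖ ^ 2) + -(1 / 8 * ‖u‖ ^ 2) := by ring
    rw [h2, Real.exp_add] at h1
    have h3 := sqrtM_pos u
    have h4 := one_le_jap u
    have h5 : Real.exp (-(1 / 8 * ‖u‖ ^ 2)) ≤ Real.exp (-(1 / 16 * ‖u‖ ^ 2)) := by
      rw [Real.exp_le_exp]; nlinarith [sq_nonneg ‖u‖]
    have h6 : 1 ≤ jap u ^ 4 := one_le_pow₀ h4
    rw [abs_mul, abs_of_pos h3]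
    calc _ ≤ (Real.exp (-(1 / 8 * ‖u‖ ^ 2)) * Real.exp (-(1 / 8 * ‖u‖ ^ 2))) * (A * jap u ^ n) :=
          mul_le_mul h1 (h u) (abs_nonneg _) (by positivity)
      _ = A * (jap u ^ n * Real.exp (-(1 / 8 * ‖u‖ ^ 2))) * Real.exp (-(1 / 8 * ‖u‖ ^ 2)) := by ring
      _ ≤ A * D * Real.exp (-(1 / 16 * ‖u‖ ^ 2)) := by gcongr; exact k u
      _ ≤ A * D * (1 * Real.exp (-(1 / 16 * ‖u‖ ^ 2))) := by rw [one_mul]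
      _ ≤ _ := by gcongr
  refine ⟨C * (A * D), by positivity, fun v => ⟨?_, ?_⟩⟩
  · have := integrable_freq_of_le hK (measurable_sqrtM.mul hf.measurable) (v := v) hle
    simpa only [mul_assoc, Pi.mul_apply] using this
  · have := abs_freq_le_aux hK (v := v) (by positivity) hle
    simpa only [mul_assoc, freq] using this

/-- Measurable functions of colliding pairs of polynomial growth. -/
structure PairBounded (h : E3 × E3 × S2 → ℝ) : Prop where
  measurable : Measurable h
  bound : ∃ (A : ℝ) (n : ℕ), 0 ≤ A ∧ ∀ p, |h p| ≤ A * (jap p.1 ^ n * jap p.2.1 ^ n)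

lemma PairBounded.mul {f g : E3 × E3 × S2 → ℝ} (hf : PairBounded f) (hg : PairBounded g) :
    PairBounded fun p => f p * g p := by
  obtain ⟨A, n, hA, h⟩ := hf.bound
  obtain ⟨B, m, hB, k⟩ := hg.bound
  refine ⟨hf.measurable.mul hg.measurable, A * B, n + m, by positivity, fun p => ?_⟩
  have := jap_pos p.1
  have := jap_pos p.2.1
  rw [abs_mul]
  calc _ ≤ (A * (jap p.1 ^ n * jap p.2.1 ^ n)) * (B * (jap p.1 ^ m * jap p.2.1 ^ m)) :=
        mul_le_mul (h p) (k p) (abs_nonneg _) (by positivity)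
    _ = _ := by ring

lemma PairBounded.of_poly {f : E3 → ℝ} (hf : PolyBounded f) {φ : E3 × E3 × S2 → E3}
    (hφ : Measurable φ) (hle : ∀ p, jap (φ p) ≤ jap p.1 * jap p.2.1) :
    PairBounded fun p => f (φ p) := by
  obtain ⟨A, n, hA, h⟩ := hf.bound
  refine ⟨hf.measurable.comp hφ, A, n, hA, fun p => (h _).trans ?_⟩
  have := jap_pos (φ p)
  rw [← mul_pow]
  gcongr
  exact hle p

lemma jap_le_of_norm_sq_le {x v u : E3} (h : ‖x‖ ^ 2 ≤ ‖u‖ ^ 2 + ‖v‖ ^ 2) :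
    jap x ≤ jap v * jap u := by
  have h1 := jap_pos v
  have h2 := jap_pos u
  have h3 := jap_pos x
  refine (sq_le_sq₀ h3.le (by positivity)).1 ?_
  rw [mul_pow, jap_sq, jap_sq, jap_sq]
  nlinarith [mul_nonneg (sq_nonneg ‖v‖) (sq_nonneg ‖u‖)]

lemma PolyBounded.fst {f : E3 → ℝ} (hf : PolyBounded f) :
    PairBounded fun p : E3 × E3 × S2 => f p.1 :=
  PairBounded.of_poly hf measurable_fst fun p =>
    jap_le_of_norm_sq_le (by nlinarith [sq_nonneg ‖p.2.1‖])

lemma PolyBounded.snd {f : E3 → ℝ} (hf : PolyBounded f) :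
    PairBounded fun p : E3 × E3 × S2 => f p.2.1 :=
  PairBounded.of_poly hf (by fun_prop) fun p =>
    jap_le_of_norm_sq_le (by nlinarith [sq_nonneg ‖p.1‖])

lemma PolyBounded.postV {f : E3 → ℝ} (hf : PolyBounded f) :
    PairBounded fun p : E3 × E3 × S2 => f (postV p.1 p.2.1 p.2.2) :=
  PairBounded.of_poly hf continuous_postV.measurable fun p => jap_le_of_norm_sq_le (by
    have := norm_sq_postU_add_postV p.1 p.2.1 p.2.2
    nlinarith [sq_nonneg ‖Boltzmann.postU p.1 p.2.1 p.2.2‖])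

lemma PolyBounded.postU {f : E3 → ℝ} (hf : PolyBounded f) :
    PairBounded fun p : E3 × E3 × S2 => f (postU p.1 p.2.1 p.2.2) :=
  PairBounded.of_poly hf continuous_postU.measurable fun p => jap_le_of_norm_sq_le (by
    have := norm_sq_postU_add_postV p.1 p.2.1 p.2.2
    nlinarith [sq_nonneg ‖Boltzmann.postV p.1 p.2.1 p.2.2‖])

/-- The density of the measure of colliding pairs. -/
def pairWeight (γ : ℝ) (b : ℝ → ℝ) (p : E3 × E3 × S2) : ℝ :=
  kernel γ b (p.1 - p.2.1) p.2.2 * (sqrtM p.1 * sqrtM p.2.1)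

/-- The measure of colliding pairs `B √μ(v) √μ(u) dv du dω`. -/
def pairMeasure (γ : ℝ) (b : ℝ → ℝ) : Measure (E3 × E3 × S2) :=
  tripleMeasure.withDensity fun p => ENNReal.ofReal (pairWeight γ b p)

variable {γ : ℝ} {b : ℝ → ℝ} {C : ℝ}

lemma measurable_pairWeight (hK : KernelBounds γ b C) : Measurable (pairWeight γ b) := by
  have hk : Measurable fun p : E3 × E3 × S2 => kernel γ b (p.1 - p.2.1) p.2.2 :=
    measurable_comp₂ hK.measurable (g := fun p : E3 × E3 × S2 => p.1 - p.2.1)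
      (by fun_prop) (by fun_prop)
  exact hk.mul ((measurable_sqrtM.comp measurable_fst).mul (measurable_sqrtM.comp (by fun_prop)))

lemma pairWeight_nonneg (hK : KernelBounds γ b C) (p : E3 × E3 × S2) : 0 ≤ pairWeight γ b p :=
  mul_nonneg (hK.nonneg _ _) (mul_nonneg (sqrtM_pos _).le (sqrtM_pos _).le)

lemma toReal_ofReal_pairWeight (hK : KernelBounds γ b C) (p : E3 × E3 × S2) :
    (ENNReal.ofReal (pairWeight γ b p)).toReal = pairWeight γ b p :=
  ENNReal.toReal_ofReal (pairWeight_nonneg hK p)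

lemma pairWeight_collide (p : E3 × E3 × S2) : pairWeight γ b (collide p) = pairWeight γ b p := by
  simp only [pairWeight, collide]
  rw [kernel_post, mul_comm (sqrtM (postV _ _ _)), sqrtM_postU_mul_postV, mul_comm (sqrtM p.2.1)]

lemma pairWeight_exchange (p : E3 × E3 × S2) : pairWeight γ b (exchange p) = pairWeight γ b p := by
  simp only [pairWeight, exchange]
  rw [kernel_swap, mul_comm (sqrtM p.2.1)]

lemma measurePreserving_withDensity {α : Type*} [MeasurableSpace α] {μ : Measure α} {w : α → ℝ≥0∞}
    (hw : Measurable w) {φ : α → α} (hφ : MeasurePreserving φ μ μ) (h : ∀ x, w (φ x) = w x) :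
    MeasurePreserving φ (μ.withDensity w) (μ.withDensity w) := by
  refine ⟨hφ.measurable, Measure.ext fun s hs => ?_⟩
  rw [Measure.map_apply hφ.measurable hs, withDensity_apply _ hs,
    withDensity_apply _ (hφ.measurable hs), ← hφ.setLIntegral_comp_preimage hs hw]
  simp only [h]

lemma measurePreserving_collide_pair (hK : KernelBounds γ b C) :
    MeasurePreserving collide (pairMeasure γ b) (pairMeasure γ b) :=
  measurePreserving_withDensity (measurable_pairWeight hK).ennreal_ofReal
    measurePreserving_collide fun p => by rw [pairWeight_collide]

lemma measurePreserving_exchange_pair (hK : KernelBounds γ b C) :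
    MeasurePreserving exchange (pairMeasure γ b) (pairMeasure γ b) :=
  measurePreserving_withDensity (measurable_pairWeight hK).ennreal_ofReal
    measurePreserving_exchange fun p => by rw [pairWeight_exchange]

lemma integral_comp_of_measurePreserving {α : Type*} [MeasurableSpace α] {μ : Measure α}
    {φ : α → α} (hφ : MeasurePreserving φ μ μ) {h : α → ℝ} (hh : Measurable h) :
    ∫ x, h (φ x) ∂μ = ∫ x, h x ∂μ := by
  have := integral_map (μ := μ) hφ.measurable.aemeasurable (f := h) hh.aestronglyMeasurable
  rw [hφ.map_eq] at this
  exact this.symm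

/-- The inner integral over (u, ω) grows at most like J(v) times the polynomial in v, and the
remaining factor √μ(v) makes this integrable. -/
lemma PairBounded.integrable_triple (hK : KernelBounds γ b C) {h : E3 × E3 × S2 → ℝ}
    (hh : PairBounded h) : Integrable (fun p => pairWeight γ b p * h p) tripleMeasure := by
  obtain ⟨A, n, hA, hle⟩ := hh.bound
  have hm := measurable_pairWeight hK
  have hJ : Integrable (fun p : E3 × E3 × S2 => pairWeight γ b p * (jap p.1 ^ n * jap p.2.1 ^ n))
      tripleMeasure := by
    obtain ⟨X, hX, hf⟩ := (polyBounded_jap_pow n).exists_freq_le hK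
    have hj1 : Measurable fun p : E3 × E3 × S2 => jap p.1 ^ n :=
      (measurable_jap.comp measurable_fst).pow_const n
    have hj2 : Measurable fun p : E3 × E3 × S2 => jap p.2.1 ^ n :=
      (measurable_jap.comp (by fun_prop)).pow_const n
    have e : ∀ (v : E3) (p : E3 × S2), pairWeight γ b (v, p) * (jap v ^ n * jap p.1 ^ n) =
        sqrtM v * jap v ^ n * (kernel γ b (v - p.1) p.2 * sqrtM p.1 * jap p.1 ^ n) := by
      intro v p; simp only [pairWeight]; ring
    have hmm : Measurable fun p : E3 × E3 × S2 =>
        pairWeight γ b p * (jap p.1 ^ n * jap p.2.1 ^ n) := hm.mul (hj1.mul hj2)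
    refine (integrable_prod_iff hmm.aestronglyMeasurable).2
      ⟨Eventually.of_forall fun v => ?_, ?_⟩
    · simp only [e]
      exact (hf v).1.const_mul _
    · have hI := ((polyBounded_jap_pow n).mul (polyBounded_jap_pow 1)).integrable.const_mul X
      refine hI.mono' ?_ (Eventually.of_forall fun v => ?_)
      · exact hmm.aestronglyMeasurable.norm.integral_prod_right'
      · have hnn : ∀ p : E3 × S2, ‖pairWeight γ b (v, p) * (jap v ^ n * jap p.1 ^ n)‖ =
            sqrtM v * jap v ^ n * (kernel γ b (v - p.1) p.2 * sqrtM p.1 * jap p.1 ^ n) := by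
          intro p
          have h1 := hK.nonneg (v - p.1) p.2
          have h2 := sqrtM_pos v
          have h3 := sqrtM_pos p.1
          have h4 := jap_pos v
          have h5 := jap_pos p.1
          rw [e, Real.norm_of_nonneg (by positivity)]
        simp only [hnn]
        rw [integral_const_mul]
        have h2 := sqrtM_pos v
        have h4 := jap_pos v
        have h6 := (hf v).2
        rw [Real.norm_eq_abs, abs_mul, abs_of_nonneg (by positivity : 0 ≤ sqrtM v * jap v ^ n)]
        calc _ ≤ sqrtM v * jap v ^ n * (X * jap v) := mul_le_mul_of_nonneg_left h6 (by positivity)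
          _ = _ := by ring
  refine (hJ.const_mul A).mono' (hm.mul hh.measurable).aestronglyMeasurable
    (Eventually.of_forall fun p => ?_)
  have h0 := pairWeight_nonneg hK p
  rw [Real.norm_eq_abs, abs_mul, abs_of_nonneg h0]
  calc _ ≤ pairWeight γ b p * (A * (jap p.1 ^ n * jap p.2.1 ^ n)) :=
        mul_le_mul_of_nonneg_left (hle p) h0
    _ = _ := by ring

lemma PairBounded.integrable (hK : KernelBounds γ b C) {h : E3 × E3 × S2 → ℝ}
    (hh : PairBounded h) : Integrable h (pairMeasure γ b) := by
  rw [pairMeasure, integrable_withDensity_iff_integrable_smul' (measurable_pairWeight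
    hK).ennreal_ofReal (Eventually.of_forall fun _ => ENNReal.ofReal_lt_top)]
  simp only [toReal_ofReal_pairWeight hK, smul_eq_mul]
  exact hh.integrable_triple hK

lemma PairBounded.integral_eq (hK : KernelBounds γ b C) {h : E3 × E3 × S2 → ℝ}
    (hh : PairBounded h) : ∫ p, h p ∂pairMeasure γ b =
      ∫ v, ∫ p, pairWeight γ b (v, p) * h (v, p) ∂collisionMeasure := by
  rw [pairMeasure, integral_withDensity_eq_integral_toReal_smul (measurable_pairWeight
    hK).ennreal_ofReal (Eventually.of_forall fun _ => ENNReal.ofReal_lt_top)]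
  simp only [toReal_ofReal_pairWeight hK, smul_eq_mul]
  exact integral_prod _ (hh.integrable_triple hK)

lemma PairBounded.integrable_inner (hK : KernelBounds γ b C) {h : E3 × E3 × S2 → ℝ}
    (hh : PairBounded h) :
    Integrable fun v => ∫ p, pairWeight γ b (v, p) * h (v, p) ∂collisionMeasure :=
  (hh.integrable_triple hK).integral_prod_left

lemma integral_pair_gain (f g ψ : E3 → ℝ) (v : E3) :
    ∫ p : E3 × S2, pairWeight γ b (v, p) * (ψ v * (f (postU v p.1 p.2) * g (postV v p.1 p.2)))
      ∂collisionMeasure = sqrtM v * ψ v * gain γ b f g v := by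
  rw [gain, ← integral_const_mul]
  congr 1; ext p; simp only [pairWeight]; ring

lemma integral_pair_freq (f ψ : E3 → ℝ) (v : E3) :
    ∫ p : E3 × S2, pairWeight γ b (v, p) * (ψ v * f p.1) ∂collisionMeasure =
      sqrtM v * ψ v * freq γ b f v := by
  rw [freq, ← integral_const_mul]
  congr 1; ext p; simp only [pairWeight]; ring

lemma pairBounded_gain {f g ψ : E3 → ℝ} (hf : PolyBounded f) (hg : PolyBounded g)
    (hψ : PolyBounded ψ) : PairBounded fun p : E3 × E3 × S2 =>
      ψ p.1 * (f (postU p.1 p.2.1 p.2.2) * g (postV p.1 p.2.1 p.2.2)) :=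
  hψ.fst.mul (hf.postU.mul hg.postV)

lemma integrable_mul_gain (hK : KernelBounds γ b C) {f g ψ : E3 → ℝ} (hf : PolyBounded f)
    (hg : PolyBounded g) (hψ : PolyBounded ψ) :
    Integrable fun v => sqrtM v * ψ v * gain γ b f g v := by
  have := (pairBounded_gain hf hg hψ).integrable_inner hK
  simpa only [integral_pair_gain] using this

lemma integrable_mul_freq (hK : KernelBounds γ b C) {f ψ : E3 → ℝ} (hf : PolyBounded f)
    (hψ : PolyBounded ψ) : Integrable fun v => sqrtM v * ψ v * freq γ b f v := by
  have := (hψ.fst.mul hf.snd).integrable_inner hK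
  simpa only [integral_pair_freq] using this

/-- The weak form of the gain operator. -/
lemma integral_mul_gain (hK : KernelBounds γ b C) {f g ψ : E3 → ℝ} (hf : PolyBounded f)
    (hg : PolyBounded g) (hψ : PolyBounded ψ) :
    ∫ v, sqrtM v * ψ v * gain γ b f g v =
      ∫ p, ψ (postV p.1 p.2.1 p.2.2) * (f p.2.1 * g p.1) ∂pairMeasure γ b := by
  have h1 := (pairBounded_gain hf hg hψ).integral_eq hK
  simp only [integral_pair_gain] at h1
  -- The collision map is an involution that preserves the pair measure, so post- and
  -- pre-collisional velocities trade places.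
  rw [← h1, ← integral_comp_of_measurePreserving (measurePreserving_collide_pair hK)
    (pairBounded_gain hf hg hψ).measurable]
  simp only [collide, postU_post, postV_post]

/-- The weak form of the loss operator. -/
lemma integral_mul_freq (hK : KernelBounds γ b C) {f ψ : E3 → ℝ} (hf : PolyBounded f)
    (hψ : PolyBounded ψ) :
    ∫ v, sqrtM v * ψ v * freq γ b f v = ∫ p, ψ p.1 * f p.2.1 ∂pairMeasure γ b := by
  have h1 := (hψ.fst.mul hf.snd).integral_eq hK
  simp only [integral_pair_freq] at h1
  rw [← h1]

lemma integral_pair_exchange (hK : KernelBounds γ b C) {h : E3 × E3 × S2 → ℝ}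
    (hh : PairBounded h) :
    ∫ p, h (p.2.1, p.1, -p.2.2) ∂pairMeasure γ b = ∫ p, h p ∂pairMeasure γ b :=
  integral_comp_of_measurePreserving (measurePreserving_exchange_pair hK) hh.measurable

end Pairs

/-! ### Collision invariants, entropy production and the `L¹` estimate -/

section Reaction

open Filter

variable {γ : ℝ} {b : ℝ → ℝ} {C : ℝ}

lemma integral_add_sub_sub {α : Type*} [MeasurableSpace α] {μ : Measure α} {f g h k : α → ℝ}
    (hf : Integrable f μ) (hg : Integrable g μ) (hh : Integrable h μ) (hk : Integrable k μ) :
    ∫ x, (f x + g x - h x - k x) ∂μ = ∫ x, f x ∂μ + ∫ x, g x ∂μ - ∫ x, h x ∂μ - ∫ x, k x ∂μ := by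
  have h1 : Integrable (fun x => f x + g x) μ := hf.add hg
  have h2 : Integrable (fun x => f x + g x - h x) μ := h1.sub hh
  rw [integral_sub h2 hk, integral_sub h1 hh, integral_add hf hg]

lemma integral_add_add_sub {α : Type*} [MeasurableSpace α] {μ : Measure α} {f g h k : α → ℝ}
    (hf : Integrable f μ) (hg : Integrable g μ) (hh : Integrable h μ) (hk : Integrable k μ) :
    ∫ x, (f x + g x + h x - k x) ∂μ = ∫ x, f x ∂μ + ∫ x, g x ∂μ + ∫ x, h x ∂μ - ∫ x, k x ∂μ := by
  have h1 : Integrable (fun x => f x + g x) μ := hf.add hg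
  have h2 : Integrable (fun x => f x + g x + h x) μ := h1.add hh
  rw [integral_sub h2 hk, integral_add h1 hh, integral_add hf hg]

/-- The collision term `Q₊ - Q₋` in terms of the density `√μ e`. -/
def reaction (γ : ℝ) (b : ℝ → ℝ) (e : E3 → ℝ) (v : E3) : ℝ :=
  gain γ b e e v - freq γ b e v * e v

/-- The weak form: collision invariance moves the gain onto the test function, and averaging with
the exchange of particles symmetrises in v and u, whence the 1/2. -/
lemma integral_mul_reaction (hK : KernelBounds γ b C) {e ψ : E3 → ℝ} (he : PolyBounded e)
    (hψ : PolyBounded ψ) :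
    ∫ v, sqrtM v * ψ v * reaction γ b e v = 1 / 2 * ∫ p : E3 × E3 × S2,
      (ψ (postV p.1 p.2.1 p.2.2) + ψ (postU p.1 p.2.1 p.2.2) - ψ p.1 - ψ p.2.1) *
        (e p.1 * e p.2.1) ∂pairMeasure γ b := by
  have hee : PairBounded fun p : E3 × E3 × S2 => e p.1 * e p.2.1 := he.fst.mul he.snd
  have b1 := hψ.postV.mul hee
  have b2 := hψ.postU.mul hee
  have b3 := hψ.fst.mul hee
  have b4 := hψ.snd.mul hee
  have e1 : ∫ v, sqrtM v * ψ v * reaction γ b e v =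
      (∫ v, sqrtM v * ψ v * gain γ b e e v) - ∫ v, sqrtM v * (ψ v * e v) * freq γ b e v := by
    rw [← integral_sub (integrable_mul_gain hK he he hψ) (integrable_mul_freq hK he (hψ.mul he))]
    congr 1; ext v; simp only [reaction]; ring
  have x1 := integral_pair_exchange hK b1
  have x3 := integral_pair_exchange hK b3
  simp only [postV_swap] at x1
  have e2 : ∫ p : E3 × E3 × S2,
      (ψ (postV p.1 p.2.1 p.2.2) + ψ (postU p.1 p.2.1 p.2.2) - ψ p.1 - ψ p.2.1) *
        (e p.1 * e p.2.1) ∂pairMeasure γ b =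
      (((∫ p : E3 × E3 × S2, ψ (postV p.1 p.2.1 p.2.2) * (e p.1 * e p.2.1) ∂pairMeasure γ b) +
      (∫ p : E3 × E3 × S2, ψ (postU p.1 p.2.1 p.2.2) * (e p.1 * e p.2.1) ∂pairMeasure γ b)) -
      (∫ p : E3 × E3 × S2, ψ p.1 * (e p.1 * e p.2.1) ∂pairMeasure γ b)) -
      (∫ p : E3 × E3 × S2, ψ p.2.1 * (e p.1 * e p.2.1) ∂pairMeasure γ b) := by
    rw [← integral_add_sub_sub (b1.integrable hK) (b2.integrable hK) (b3.integrable hK)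
      (b4.integrable hK)]
    congr 1; ext p; ring
  rw [e1, e2, integral_mul_gain hK he he hψ, integral_mul_freq hK he (hψ.mul he)]
  have c1 : ∀ p : E3 × E3 × S2, e p.2.1 * e p.1 = e p.1 * e p.2.1 := fun p => mul_comm _ _
  simp only [c1, mul_assoc] at x1 x3 ⊢
  rw [x1, x3]; ring

/-- Collision invariants. -/
def IsInvariant (ψ : E3 → ℝ) : Prop :=
  ∀ v u ω, ψ (postU v u ω) + ψ (postV v u ω) = ψ u + ψ v

lemma integral_invariant_mul_reaction (hK : KernelBounds γ b C) {e ψ : E3 → ℝ}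
    (he : PolyBounded e) (hψ : PolyBounded ψ) (hinv : IsInvariant ψ) :
    ∫ v, sqrtM v * ψ v * reaction γ b e v = 0 := by
  rw [integral_mul_reaction hK he hψ]
  have : ∀ p : E3 × E3 × S2,
      (ψ (postV p.1 p.2.1 p.2.2) + ψ (postU p.1 p.2.1 p.2.2) - ψ p.1 - ψ p.2.1) *
        (e p.1 * e p.2.1) = 0 := fun p => by
    have := hinv p.1 p.2.1 p.2.2
    rw [show ψ (postV p.1 p.2.1 p.2.2) + ψ (postU p.1 p.2.1 p.2.2) - ψ p.1 - ψ p.2.1 = 0 by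
      linarith, zero_mul]
  simp [this]

lemma mul_log_sub_log_le {x y : ℝ} (hx : 0 < x) (hy : 0 < y) :
    (Real.log y - Real.log x) * x ≤ y - x := by
  have h := Real.log_le_sub_one_of_pos (div_pos hy hx)
  rw [Real.log_div hy.ne' hx.ne'] at h
  have h2 := mul_le_mul_of_nonneg_right h hx.le
  have e : (y / x - 1) * x = y - x := by field_simp
  linarith

/-- The entropy production is nonpositive. -/
lemma integral_log_mul_reaction_nonpos (hK : KernelBounds γ b C) {e : E3 → ℝ}
    (he : PolyBounded e) (hpos : ∀ v, 0 < e v)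
    (hψ : PolyBounded fun v => Real.log (e v / sqrtM v)) :
    ∫ v, sqrtM v * Real.log (e v / sqrtM v) * reaction γ b e v ≤ 0 := by
  rw [integral_mul_reaction hK he hψ]
  have hee : PairBounded fun p : E3 × E3 × S2 => e p.1 * e p.2.1 := he.fst.mul he.snd
  have hee' : PairBounded fun p : E3 × E3 × S2 =>
      e (postV p.1 p.2.1 p.2.2) * e (postU p.1 p.2.1 p.2.2) := he.postV.mul he.postU
  -- The total product e e is the same before and after collisions. Together with x (ln y − ln x) ≤
  -- y − x this makes a full symmetrisation of the entropy production unnecessary.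
  have h0 : ∫ p : E3 × E3 × S2, (e (postV p.1 p.2.1 p.2.2) * e (postU p.1 p.2.1 p.2.2) -
      e p.1 * e p.2.1) ∂pairMeasure γ b = 0 := by
    rw [integral_sub (hee'.integrable hK) (hee.integrable hK), sub_eq_zero]
    exact integral_comp_of_measurePreserving (measurePreserving_collide_pair hK) hee.measurable
  have hle : ∀ p : E3 × E3 × S2, (Real.log (e (postV p.1 p.2.1 p.2.2) /
      sqrtM (postV p.1 p.2.1 p.2.2)) + Real.log (e (postU p.1 p.2.1 p.2.2) /
      sqrtM (postU p.1 p.2.1 p.2.2)) - Real.log (e p.1 / sqrtM p.1) -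
      Real.log (e p.2.1 / sqrtM p.2.1)) * (e p.1 * e p.2.1) ≤
      e (postV p.1 p.2.1 p.2.2) * e (postU p.1 p.2.1 p.2.2) - e p.1 * e p.2.1 := by
    rintro ⟨v, u, ω⟩
    have h1 := mul_log_sub_log_le (mul_pos (hpos v) (hpos u))
      (mul_pos (hpos (postV v u ω)) (hpos (postU v u ω)))
    -- The Gaussian parts of the four logarithms cancel by energy conservation, leaving the
    -- logarithm of the quotient of the products.
    have h2 := congrArg Real.log (sqrtM_postU_mul_postV v u ω)
    have n : ∀ v, sqrtM v ≠ 0 := fun v => (sqrtM_pos v).ne'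
    have n' : ∀ v, e v ≠ 0 := fun v => (hpos v).ne'
    rw [Real.log_mul (n _) (n _), Real.log_mul (n _) (n _)] at h2
    rw [Real.log_mul (n' _) (n' _), Real.log_mul (n' _) (n' _)] at h1
    simp only [Real.log_div (n' _) (n _)]
    refine le_trans (le_of_eq ?_) h1
    congr 1; linarith
  have hb := ((hψ.postV.mul hee).integrable hK |>.add ((hψ.postU.mul hee).integrable hK)
    |>.sub ((hψ.fst.mul hee).integrable hK) |>.sub ((hψ.snd.mul hee).integrable hK))
  have := integral_mono (μ := pairMeasure γ b) (hb.congr (Eventually.of_forall fun p => by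
    simp only [Pi.add_apply, Pi.sub_apply]; ring)) ((hee'.integrable hK).sub (hee.integrable hK)) hle
  simp only [Pi.sub_apply, h0] at this
  linarith

lemma isInvariant_one : IsInvariant fun _ => 1 := fun _ _ _ => rfl

lemma isInvariant_inner (w : E3) : IsInvariant fun v => inner ℝ v w := fun v u ω => by
  rw [← inner_add_left, postU_add_postV, inner_add_left]

lemma isInvariant_norm_sq : IsInvariant fun v => ‖v‖ ^ 2 := norm_sq_postU_add_postV

lemma isInvariant_jap_sq : IsInvariant fun v => jap v ^ 2 := fun v u ω => by
  simp only [jap_sq]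
  linarith [norm_sq_postU_add_postV v u ω]

lemma freq_mono (hK : KernelBounds γ b C) {f g : E3 → ℝ} (hf : PolyBounded f)
    (hg : PolyBounded g) (h : ∀ v, f v ≤ g v) (v : E3) : freq γ b f v ≤ freq γ b g v := by
  obtain ⟨_, _, h1⟩ := hf.exists_freq_le hK
  obtain ⟨_, _, h2⟩ := hg.exists_freq_le hK
  exact integral_mono (h1 v).1 (h2 v).1 fun p => mul_le_mul_of_nonneg_left (h _)
    (mul_nonneg (hK.nonneg _ _) (sqrtM_pos _).le)

lemma freq_const_mul (c : ℝ) (f : E3 → ℝ) (v : E3) :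
    freq γ b (fun u => c * f u) v = c * freq γ b f v := by
  rw [freq, freq, ← integral_const_mul]
  congr 1; ext p; ring

/-- The collision terms in the equation for the difference of two solutions. -/
def diffReaction (γ : ℝ) (b : ℝ → ℝ) (d g : E3 → ℝ) (v : E3) : ℝ :=
  gain γ b d g v + gain γ b g d v + freq γ b d v * g v - freq γ b g v * d v

/-- After collision and exchange everything is integrated against g(u) d(v), with coefficient J(u')²
+ J(v')² + J(u)² − J(v)². Energy conservation turns this into 2 J(u)²: the powers of J(v), which
would destroy the estimate, cancel. -/
lemma integral_jap_sq_mul_diffReaction (hK : KernelBounds γ b C) {d g : E3 → ℝ}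
    (hd : PolyBounded d) (hg : PolyBounded g) :
    Integrable (fun v => sqrtM v * jap v ^ 2 * diffReaction γ b d g v) ∧
    ∫ v, sqrtM v * jap v ^ 2 * diffReaction γ b d g v =
      2 * ∫ v, sqrtM v * d v * freq γ b (fun u => jap u ^ 2 * g u) v := by
  have hφ := polyBounded_jap_pow 2
  have i1 := integrable_mul_gain hK hd hg hφ
  have i2 := integrable_mul_gain hK hg hd hφ
  have i3 := integrable_mul_freq hK hd (hφ.mul hg)
  have i4 := integrable_mul_freq hK hg (hφ.mul hd)
  have hI := ((i1.add i2).add i3).sub i4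
  have hc : ∀ v, (((fun v => sqrtM v * jap v ^ 2 * gain γ b d g v) +
      (fun v => sqrtM v * jap v ^ 2 * gain γ b g d v) +
      (fun v => sqrtM v * (jap v ^ 2 * g v) * freq γ b d v)) -
      (fun v => sqrtM v * (jap v ^ 2 * d v) * freq γ b g v)) v =
      sqrtM v * jap v ^ 2 * diffReaction γ b d g v := fun v => by
    simp only [Pi.add_apply, Pi.sub_apply, diffReaction]; ring
  refine ⟨hI.congr (Eventually.of_forall hc), ?_⟩
  have e1 : ∫ v, sqrtM v * jap v ^ 2 * diffReaction γ b d g v =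
      (((∫ v, sqrtM v * jap v ^ 2 * gain γ b d g v) +
      (∫ v, sqrtM v * jap v ^ 2 * gain γ b g d v)) +
      (∫ v, sqrtM v * (jap v ^ 2 * g v) * freq γ b d v)) -
      (∫ v, sqrtM v * (jap v ^ 2 * d v) * freq γ b g v) := by
    rw [← integral_add_add_sub i1 i2 i3 i4]
    exact integral_congr_ae (Eventually.of_forall fun v => (hc v).symm)
  have hdg : PairBounded fun p : E3 × E3 × S2 => d p.2.1 * g p.1 := hd.snd.mul hg.fst
  have hgd : PairBounded fun p : E3 × E3 × S2 => g p.2.1 * d p.1 := hg.snd.mul hd.fst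
  rw [e1, integral_mul_gain hK hd hg hφ, integral_mul_gain hK hg hd hφ,
    integral_mul_freq hK hd (hφ.mul hg), integral_mul_freq hK hg (hφ.mul hd),
    integral_mul_freq hK (hφ.mul hg) hd]
  have x1 := integral_pair_exchange hK (hφ.postV.mul hdg)
  have x3 := integral_pair_exchange hK ((hφ.mul hg).fst.mul hd.snd)
  simp only [postV_swap] at x1
  have b1 := (hφ.postU.mul hgd).integrable hK
  have b2 := (hφ.postV.mul hgd).integrable hK
  have b3 := ((hφ.mul hg).snd.mul hd.fst).integrable hK
  have b4 := ((hφ.mul hd).fst.mul hg.snd).integrable hK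
  have x3' : ∫ p : E3 × E3 × S2, jap p.1 ^ 2 * g p.1 * d p.2.1 ∂pairMeasure γ b =
      ∫ p : E3 × E3 × S2, jap p.2.1 ^ 2 * g p.2.1 * d p.1 ∂pairMeasure γ b := x3.symm
  have x1' : ∫ p : E3 × E3 × S2, jap (postV p.1 p.2.1 p.2.2) ^ 2 * (d p.2.1 * g p.1)
      ∂pairMeasure γ b = ∫ p : E3 × E3 × S2, jap (postU p.1 p.2.1 p.2.2) ^ 2 * (g p.2.1 * d p.1)
      ∂pairMeasure γ b := by
    rw [← x1]; congr 1; ext p; ring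
  rw [x1', x3', ← integral_add_add_sub b1 b2 b3 b4, ← integral_const_mul]
  refine integral_congr_ae (Eventually.of_forall fun p => ?_)
  have := isInvariant_jap_sq p.1 p.2.1 p.2.2
  linear_combination (g p.2.1 * d p.1) * this

/-- The collision term of the difference of two solutions is controlled in `L¹`. -/
lemma exists_integral_diffReaction_le (hK : KernelBounds γ b C) :
    ∃ X : ℝ, 0 ≤ X ∧ ∀ (d g : E3 → ℝ) (E : ℝ), PolyBounded d → PolyBounded g →
      (∀ v, 0 ≤ d v) → (∀ v, 0 ≤ g v) → (∀ v, g v ≤ E) →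
      ∫ v, sqrtM v * jap v ^ 2 * diffReaction γ b d g v ≤
        X * E * ∫ v, sqrtM v * jap v ^ 2 * d v := by
  have hφ := polyBounded_jap_pow 2
  obtain ⟨X, hX, hXle⟩ := hφ.exists_freq_le hK
  refine ⟨2 * X, by positivity, fun d g E hd hg hd0 hg0 hgE => ?_⟩
  have hE : 0 ≤ E := (hg0 0).trans (hgE 0)
  rw [(integral_jap_sq_mul_diffReaction hK hd hg).2, mul_assoc, mul_assoc]
  refine mul_le_mul_of_nonneg_left ?_ (by norm_num)
  rw [← integral_const_mul, ← integral_const_mul]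
  refine integral_mono (integrable_mul_freq hK (hφ.mul hg) hd) ?_ fun v => ?_
  · have := ((hφ.mul hd).integrable.const_mul E).const_mul X
    simpa only [mul_assoc] using this
  · have h1 : freq γ b (fun u => jap u ^ 2 * g u) v ≤ E * freq γ b (fun u => jap u ^ 2) v := by
      rw [← freq_const_mul]
      refine freq_mono hK (hφ.mul hg) (hφ.const_mul E) (fun u => ?_) v
      rw [mul_comm]
      exact mul_le_mul_of_nonneg_right (hgE u) (pow_nonneg (jap_pos u).le 2)
    have h2 := (le_abs_self _).trans (hXle v).2
    -- The remaining frequency grows only linearly in v, which the weight J(v)² of the norm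
    -- accommodates.
    have h3 : jap v ≤ jap v ^ 2 := by nlinarith [one_le_jap v]
    have h4 := sqrtM_pos v
    have h5 := hd0 v
    calc sqrtM v * d v * freq γ b (fun u => jap u ^ 2 * g u) v
        ≤ sqrtM v * d v * (E * (X * jap v ^ 2)) := by
          refine mul_le_mul_of_nonneg_left (h1.trans ?_) (by positivity)
          exact mul_le_mul_of_nonneg_left (h2.trans (by gcongr)) hE
      _ = _ := by ring

end Reaction

/-! ### Integrals along characteristics -/

section Along

set_option linter.unusedSectionVars false

open Filter

variable {Ω : Type} [AddCommGroup Ω] [TopologicalSpace Ω] [IsTopologicalAddGroup Ω]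
  [SecondCountableTopology Ω] [MeasureSpace Ω] [BorelSpace Ω] [SigmaFinite (volume : Measure Ω)]
  [(volume : Measure Ω).IsAddLeftInvariant]
  {π : E3 →+ Ω} {T : ℝ}

lemma integral_transport (hπ : Continuous π) {h : Ω → E3 → ℝ}
    (hh : Measurable fun p : Ω × E3 => h p.1 p.2) (t : ℝ) :
    ∫ p : Ω × E3, h (p.1 + π (t • p.2)) p.2 = ∫ p : Ω × E3, h p.1 p.2 :=
  integral_comp_of_measurePreserving (measurePreserving_transport hπ t) hh

lemma integrable_transport_iff (hπ : Continuous π) {h : Ω → E3 → ℝ}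
    (hh : Measurable fun p : Ω × E3 => h p.1 p.2) (t : ℝ) :
    Integrable (fun p : Ω × E3 => h (p.1 + π (t • p.2)) p.2) ↔
      Integrable (fun p : Ω × E3 => h p.1 p.2) :=
  (measurePreserving_transport hπ t).integrable_comp (g := fun p : Ω × E3 => h p.1 p.2)
    hh.aestronglyMeasurable

variable {R : ℝ → Ω → E3 → ℝ} {H : Ω × E3 → ℝ}

lemma measurable_slice (hR : Measurable fun p : (ℝ × Ω) × E3 => R p.1.1 p.1.2 p.2) (s : ℝ) :
    Measurable fun p : Ω × E3 => R s p.1 p.2 :=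
  hR.comp (f := fun p : Ω × E3 => ((s, p.1), p.2)) (by fun_prop)

lemma integrable_slice (hπ : Continuous π)
    (hR : Measurable fun p : (ℝ × Ω) × E3 => R p.1.1 p.1.2 p.2) (hH : Integrable H)
    (hle : ∀ s ∈ Icc 0 T, ∀ y v, |R s (y + π (s • v)) v| ≤ H (y, v)) {s : ℝ} (hs : s ∈ Icc 0 T) :
    Integrable fun p : Ω × E3 => R s p.1 p.2 := by
  have hm := measurable_slice hR s
  rw [← integrable_transport_iff hπ hm s]
  refine hH.mono' ?_ (Eventually.of_forall fun p => hle s hs p.1 p.2)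
  exact (hm.comp (measurePreserving_transport hπ s).measurable).aestronglyMeasurable

/-- Fubini under a majorant depending on the foot (y, v) alone; invariance of the measure under
transport then removes the characteristic from the space integral. -/
lemma integral_along (hπ : Continuous π)
    (hR : Measurable fun p : (ℝ × Ω) × E3 => R p.1.1 p.1.2 p.2) (hH : Integrable H)
    (hle : ∀ s ∈ Icc 0 T, ∀ y v, |R s (y + π (s • v)) v| ≤ H (y, v)) {t : ℝ} (ht : t ∈ Icc 0 T) :
    IntervalIntegrable (fun s => ∫ p : Ω × E3, R s p.1 p.2) volume 0 t ∧
    Integrable (fun p : Ω × E3 => ∫ s in (0 : ℝ)..t, R s (p.1 + π (s • p.2)) p.2) ∧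
    ∫ p : Ω × E3, ∫ s in (0 : ℝ)..t, R s (p.1 + π (s • p.2)) p.2 =
      ∫ s in (0 : ℝ)..t, ∫ p : Ω × E3, R s p.1 p.2 := by
  have hal : Measurable fun q : (Ω × E3) × ℝ => R q.2 (q.1.1 + π (q.2 • q.1.2)) q.1.2 := by
    have hc : Continuous fun q : (Ω × E3) × ℝ => ((q.2, q.1.1 + π (q.2 • q.1.2)), q.1.2) := by
      fun_prop
    exact hR.comp hc.measurable
  have hI : Integrable (fun q : (Ω × E3) × ℝ => R q.2 (q.1.1 + π (q.2 • q.1.2)) q.1.2)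
      (volume.prod (volume.restrict (Ioc 0 t))) := by
    have hH' : Integrable (fun q : (Ω × E3) × ℝ => H q.1)
        (volume.prod (volume.restrict (Ioc 0 t))) := hH.comp_fst _
    refine hH'.mono' hal.aestronglyMeasurable ?_
    have h1 : ∀ᵐ s ∂volume.restrict (Ioc 0 t), s ∈ Ioc 0 t := ae_restrict_mem measurableSet_Ioc
    have h2 := (Measure.quasiMeasurePreserving_snd (μ := (volume : Measure (Ω × E3)))
      (ν := volume.restrict (Ioc 0 t))).ae h1
    filter_upwards [h2] with q hq
    exact hle q.2 ⟨hq.1.le, hq.2.trans ht.2⟩ q.1.1 q.1.2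
  have e : ∀ s, ∫ p : Ω × E3, R s (p.1 + π (s • p.2)) p.2 = ∫ p : Ω × E3, R s p.1 p.2 :=
    fun s => integral_transport hπ (measurable_slice hR s) s
  refine ⟨?_, ?_, ?_⟩
  · rw [intervalIntegrable_iff_integrableOn_Ioc_of_le ht.1]
    have := hI.integral_prod_right
    simp only [e] at this
    exact this
  · simp only [intervalIntegral.integral_of_le ht.1]
    exact hI.integral_prod_left
  · simp only [intervalIntegral.integral_of_le ht.1]
    rw [integral_integral_swap hI]
    simp only [e]

/-- Z is only assumed integrable, so Gronwall is applied to its primitive Y, which satisfies Y' − c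
Y ≤ Z₀, and the result is inserted once more into the hypothesis. -/
lemma gronwall_of_le_add_integral {Z : ℝ → ℝ} {Z₀ c : ℝ} (hT : 0 ≤ T) (hT1 : T ≤ 1)
    (hZ : IntervalIntegrable Z volume 0 T) (hZ₀ : 0 ≤ Z₀) (hc : 0 ≤ c)
    (h : ∀ t ∈ Icc 0 T, Z t ≤ Z₀ + c * ∫ s in (0 : ℝ)..t, Z s) {t : ℝ} (ht : t ∈ Icc 0 T) :
    Z t ≤ (1 + c * Real.exp c) * Z₀ := by
  set Y : ℝ → ℝ := fun t => ∫ s in (0 : ℝ)..t, Z s with hY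
  have hp : IsPrim T Y Z := isPrim_integral hT hZ
  have hp' : IsPrim T Y (fun t => (Z t - c * Y t) - (-c) * Y t) :=
    hp.congr hT (fun _ _ => rfl) (Eventually.of_forall fun _ _ => by ring)
  have h1 := hp'.eq_duhamel hT (a := fun _ => -c) intervalIntegrable_const ht
  rw [duhamel_const] at h1
  have h0 : Y 0 = 0 := intervalIntegral.integral_same
  rw [h0, mul_zero, zero_add] at h1
  have hi : IntervalIntegrable (fun s => Z s - c * Y s) volume 0 t :=
    IntervalIntegrable.mono_right (hZ.sub ((hp.continuousOn.intervalIntegrable).const_mul c)) ht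
  have h2 : Y t ≤ ∫ _ in (0 : ℝ)..t, Real.exp c * Z₀ := by
    rw [h1]
    refine intervalIntegral.integral_mono_on ht.1
      (hi.continuousOn_mul (by fun_prop)) intervalIntegrable_const fun s hs => ?_
    have h3 : Z s - c * Y s ≤ Z₀ := by
      have := h s ⟨hs.1, hs.2.trans ht.2⟩
      simp only [hY]; linarith
    have h4 : Real.exp (- -c * (t - s)) ≤ Real.exp c := by
      rw [Real.exp_le_exp]
      nlinarith [hs.1, hs.2, ht.1, ht.2]
    calc _ ≤ Real.exp (- -c * (t - s)) * Z₀ := mul_le_mul_of_nonneg_left h3 (Real.exp_pos _).le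
      _ ≤ _ := mul_le_mul_of_nonneg_right h4 hZ₀
  rw [intervalIntegral.integral_const, smul_eq_mul, sub_zero] at h2
  have h5 : t * (Real.exp c * Z₀) ≤ 1 * (Real.exp c * Z₀) :=
    mul_le_mul_of_nonneg_right (ht.2.trans hT1) (by positivity)
  have h6 := mul_le_mul_of_nonneg_left (h2.trans h5) hc
  have := h t ht
  linarith

end Along

/-! ### Solutions with spatial decay -/

section Decaying

set_option linter.unusedSectionVars false

open Filter

variable {Ω : Type} [AddCommGroup Ω] [TopologicalSpace Ω] [IsTopologicalAddGroup Ω]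
  [SecondCountableTopology Ω] [MeasureSpace Ω] [BorelSpace Ω] [SigmaFinite (volume : Measure Ω)]
  [(volume : Measure Ω).IsAddLeftInvariant]
  {γ β : ℝ} {b : ℝ → ℝ} {C M A T : ℝ} {π : E3 →+ Ω} {f₀ g₀ : Ω → E3 → ℝ}
  {f g : ℝ → Ω → E3 → ℝ} {ϑ : Ω → ℝ}

/-- An integrable decay rate. -/
structure IntegrableRate (π : E3 →+ Ω) (ϑ : Ω → ℝ) : Prop where
  growth : GrowthOn π ϑ
  integrable : Integrable fun x => (ϑ x)⁻¹

/-- A solution of the Boltzmann equation with decay in space. -/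
structure DecayingSolution (γ : ℝ) (b : ℝ → ℝ) (π : E3 →+ Ω) (β M A T : ℝ) (ϑ : Ω → ℝ)
    (f₀ : Ω → E3 → ℝ) (f : ℝ → Ω → E3 → ℝ) : Prop where
  nonneg_time : 0 ≤ T
  time_le : T ≤ 1
  nonneg : 0 ≤ A
  admissible : Admissible β M f
  decay : ∀ t ∈ Icc 0 T, ∀ x v, |f t x v| ≤ A * ((weight β v)⁻¹ * (ϑ (x - π (t • v)))⁻¹)
  eq : ∀ t ∈ Icc 0 T, ∀ y v, charStep γ b π f₀ f y v t = f t (y + π (t • v)) v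

lemma DecayingSolution.zero (hf : DecayingSolution γ b π β M A T ϑ f₀ f) (x : Ω) (v : E3) :
    f 0 x v = f₀ x v := by
  have := hf.eq 0 ⟨le_rfl, hf.nonneg_time⟩ x v
  rw [charStep, duhamel_zero, zero_smul, map_zero, add_zero] at this
  exact this.symm

lemma reaction_shift_eq {C' : ℝ} (hK : KernelBounds γ b C') {E : ℝ} {φ : E3 → ℝ}
    (hφ : Decays E φ) (v : E3) :
    reaction γ b (shift φ) v = source γ b φ v - freq γ b (shift φ) v * φ v := by
  rw [reaction, gain_shift hK hφ]
  simp only [shift]; ring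

lemma DecayingSolution.isPrim (hS : Setting γ β b C π)
    (hf : DecayingSolution γ b π β M A T ϑ f₀ f) (y : Ω) (v : E3) :
    IsPrim T (fun t => f t (y + π (t • v)) v)
      (fun t => reaction γ b (shift (f t (y + π (t • v)))) v) := by
  obtain ⟨C', hK⟩ := hS.kernel
  refine (hS.isPrim_charStep (f₀ := f₀) hf.admissible hf.nonneg_time y v).congr hf.nonneg_time
    (fun t ht => hf.eq t ht y v) (Eventually.of_forall fun t ht => ?_)
  rw [hf.eq t ht, reaction_shift_eq hK (hf.admissible.decays hS.one_le_beta t _)]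

/-- Supplies the integrable majorant for collision terms along characteristics. One power of J(v)
comes from the loss and is absorbed later by √μ. -/
lemma DecayingSolution.exists_reaction_le (hS : Setting γ β b C π) (hϑ : GrowthOn π ϑ)
    (hf : DecayingSolution γ b π β M A T ϑ f₀ f) :
    ∃ X, ∀ s ∈ Icc 0 T, ∀ y v,
      |reaction γ b (shift (f s (y + π (s • v)))) v| ≤ X * jap v * (ϑ y)⁻¹ := by
  obtain ⟨C', hK⟩ := hS.kernel
  obtain ⟨B, hB, hfr⟩ := hS.exists_freq_le M
  have hM := hf.admissible.nonneg_const
  have hA := hf.nonneg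
  have hC := hS.bounds.one_le
  refine ⟨C * (A * (1 + M)) + B * A, fun s hs y v => ?_⟩
  have h1 := hS.bounds.source_le (hϑ.growth s ⟨hs.1, hs.2.trans hf.time_le⟩ (y + π (s • v)))
    hA hM (hf.admissible.bound s _) (hf.decay s hs _) v
  have h2 := hfr f hf.admissible s (y + π (s • v)) v
  have h3 := hf.decay s hs (y + π (s • v)) v
  rw [add_sub_cancel_right] at h1 h3
  have hw : (weight β v)⁻¹ ≤ 1 := weight_inv_le_one (by linarith [hS.lt_beta]) v
  have hw0 := inv_pos.2 (weight_pos β v)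
  have hϑ0 := inv_pos.2 (hϑ.pos y)
  have hj := one_le_jap v
  rw [reaction_shift_eq hK (hf.admissible.decays hS.one_le_beta s _)]
  calc _ ≤ |source γ b (f s (y + π (s • v))) v| +
        |freq γ b (shift (f s (y + π (s • v)))) v| * |f s (y + π (s • v)) v| := by
        rw [← abs_mul]; exact abs_sub _ _
    _ ≤ C * (A * (1 + M) * ((weight β v)⁻¹ * (ϑ y)⁻¹)) +
        B * jap v * (A * ((weight β v)⁻¹ * (ϑ y)⁻¹)) :=
        add_le_add h1 (mul_le_mul h2 h3 (abs_nonneg _) (by positivity))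
    _ ≤ C * (A * (1 + M) * (1 * (ϑ y)⁻¹)) * jap v + B * jap v * (A * (1 * (ϑ y)⁻¹)) := by
        refine add_le_add ((le_mul_of_one_le_right (by positivity) hj).trans' ?_) ?_
        · gcongr
        · gcongr
    _ = _ := by ring

lemma IntegrableRate.integrable_mul (hϑ : IntegrableRate π ϑ) {φ : E3 → ℝ} (hφ : PolyBounded φ) :
    Integrable fun p : Ω × E3 => sqrtM p.2 * φ p.2 * (ϑ p.1)⁻¹ := by
  have := hϑ.integrable.mul_prod (ν := (volume : Measure E3)) hφ.integrable
  refine this.congr (Eventually.of_forall fun p => ?_)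
  simp only; ring

lemma measurable_reaction {α : Type*} [MeasurableSpace α] {C' : ℝ} (hK : KernelBounds γ b C')
    {F : α → E3 → ℝ} (hF : Measurable fun p : α × E3 => F p.1 p.2) :
    Measurable fun p : α × E3 => reaction γ b (F p.1) p.2 :=
  (measurable_gain hK hF hF).sub ((measurable_freq hK hF).mul hF)

lemma Setting.measurable_reaction_shift (hS : Setting γ β b C π) (hf : Admissible β M f) :
    Measurable fun p : (ℝ × Ω) × E3 => reaction γ b (shift (f p.1.1 p.1.2)) p.2 := by
  obtain ⟨C', hK⟩ := hS.kernel
  exact measurable_reaction hK (F := fun p : ℝ × Ω => shift (f p.1 p.2))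
    (measurable_shift (F := fun p : ℝ × Ω => f p.1 p.2) hf.measurable)

lemma Setting.polyBounded_shift (hS : Setting γ β b C π) (hf : Admissible β M f) (t : ℝ) (x : Ω) :
    PolyBounded (shift (f t x)) := by
  obtain ⟨E, _, hm⟩ := exists_decays_sqrtM
  exact (hm.add (hf.decays hS.one_le_beta t x)).polyBounded

lemma DecayingSolution.abs_le (hS : Setting γ β b C π) (hϑ : GrowthOn π ϑ)
    (hf : DecayingSolution γ b π β M A T ϑ f₀ f) {t : ℝ} (ht : t ∈ Icc 0 T) (y : Ω) (v : E3) :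
    |f t (y + π (t • v)) v| ≤ A * (ϑ y)⁻¹ := by
  have h := hf.decay t ht (y + π (t • v)) v
  rw [add_sub_cancel_right] at h
  refine h.trans ?_
  have hw : (weight β v)⁻¹ ≤ 1 := weight_inv_le_one (by linarith [hS.lt_beta]) v
  have hϑ0 := inv_pos.2 (hϑ.pos y)
  have := hf.nonneg
  calc A * ((weight β v)⁻¹ * (ϑ y)⁻¹) ≤ A * (1 * (ϑ y)⁻¹) := by gcongr
    _ = _ := by rw [one_mul]

/-- Moments of decaying solutions. -/
lemma DecayingSolution.integrable_moment (hS : Setting γ β b C π) (hϑ : IntegrableRate π ϑ)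
    (hf : DecayingSolution γ b π β M A T ϑ f₀ f) {ψ : E3 → ℝ} (hψ : PolyBounded ψ) {t : ℝ}
    (ht : t ∈ Icc 0 T) : Integrable fun p : Ω × E3 => sqrtM p.2 * ψ p.2 * f t p.1 p.2 := by
  have hm : Measurable fun p : (ℝ × Ω) × E3 => sqrtM p.2 * ψ p.2 * f p.1.1 p.1.2 p.2 :=
    (measurable_sqrtM_snd.mul (hψ.measurable.comp measurable_snd)).mul hf.admissible.measurable
  have hH := (hϑ.integrable_mul hψ.abs).const_mul A
  refine integrable_slice (R := fun t x v => sqrtM v * ψ v * f t x v) hS.continuous hm hH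
    (fun s hs y v => ?_) ht
  have h1 := hf.abs_le hS hϑ.growth hs y v
  rw [abs_mul, abs_mul, abs_of_pos (sqrtM_pos v)]
  calc _ ≤ sqrtM v * |ψ v| * (A * (ϑ y)⁻¹) :=
        mul_le_mul_of_nonneg_left h1 (mul_nonneg (sqrtM_pos v).le (abs_nonneg _))
    _ = _ := by ring

/-- Conservation laws of decaying solutions. -/
lemma DecayingSolution.moment_eq (hS : Setting γ β b C π) (hϑ : IntegrableRate π ϑ)
    (hf : DecayingSolution γ b π β M A T ϑ f₀ f) {ψ : E3 → ℝ} (hψ : PolyBounded ψ)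
    (hinv : IsInvariant ψ) {t : ℝ} (ht : t ∈ Icc 0 T) :
    ∫ p : Ω × E3, sqrtM p.2 * ψ p.2 * f t p.1 p.2 =
      ∫ p : Ω × E3, sqrtM p.2 * ψ p.2 * f₀ p.1 p.2 := by
  obtain ⟨C', hK⟩ := hS.kernel
  obtain ⟨X, hX⟩ := hf.exists_reaction_le hS hϑ.growth
  set R : ℝ → Ω → E3 → ℝ := fun s x v => sqrtM v * ψ v * reaction γ b (shift (f s x)) v with hR
  have hw : Measurable fun p : (ℝ × Ω) × E3 => sqrtM p.2 * ψ p.2 :=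
    measurable_sqrtM_snd.mul (hψ.measurable.comp measurable_snd)
  have hm : Measurable fun p : (ℝ × Ω) × E3 => R p.1.1 p.1.2 p.2 :=
    hw.mul (hS.measurable_reaction_shift hf.admissible)
  have hH := (hϑ.integrable_mul (hψ.abs.mul (polyBounded_jap_pow 1))).const_mul X
  have hle : ∀ s ∈ Icc 0 T, ∀ y v, |R s (y + π (s • v)) v| ≤
      X * (sqrtM v * (|ψ v| * jap v ^ 1) * (ϑ y)⁻¹) := by
    intro s hs y v
    rw [hR, abs_mul, abs_mul, abs_of_pos (sqrtM_pos v)]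
    calc _ ≤ sqrtM v * |ψ v| * (X * jap v * (ϑ y)⁻¹) :=
          mul_le_mul_of_nonneg_left (hX s hs y v) (mul_nonneg (sqrtM_pos v).le (abs_nonneg _))
      _ = _ := by ring
  obtain ⟨-, hI, he⟩ := integral_along hS.continuous hm hH hle ht
  -- At each point x the velocity integral of a collision invariant against the collision term
  -- vanishes.
  have hzero : ∀ s ∈ Icc 0 T, ∫ p : Ω × E3, R s p.1 p.2 = 0 := by
    intro s hs
    have hi := integrable_slice hS.continuous hm hH hle hs
    rw [Measure.volume_eq_prod] at hi ⊢
    rw [integral_prod _ hi]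
    simp only [hR, integral_invariant_mul_reaction hK (hS.polyBounded_shift hf.admissible s _)
      hψ hinv, integral_zero]
  have hz : ∫ s in (0 : ℝ)..t, ∫ p : Ω × E3, R s p.1 p.2 = 0 := by
    refine (intervalIntegral.integral_congr (g := fun _ => (0 : ℝ)) fun s hs => ?_).trans
      intervalIntegral.integral_zero
    rw [uIcc_of_le ht.1] at hs
    exact hzero s ⟨hs.1, hs.2.trans ht.2⟩
  have hi0 := hf.integrable_moment hS hϑ hψ ⟨le_rfl, hf.nonneg_time⟩
  simp only [hf.zero] at hi0
  have hmt : Measurable fun p : Ω × E3 => sqrtM p.2 * ψ p.2 * f t p.1 p.2 :=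
    measurable_slice (R := fun t x v => sqrtM v * ψ v * f t x v)
      (hw.mul hf.admissible.measurable) t
  rw [← integral_transport (h := fun x v => sqrtM v * ψ v * f t x v) hS.continuous hmt t]
  have hpt : ∀ p : Ω × E3, sqrtM p.2 * ψ p.2 * f t (p.1 + π (t • p.2)) p.2 =
      sqrtM p.2 * ψ p.2 * f₀ p.1 p.2 + ∫ s in (0 : ℝ)..t, R s (p.1 + π (s • p.2)) p.2 := by
    intro p
    have := (hf.isPrim hS p.1 p.2).eq_add_integral hf.nonneg_time ht
    simp only [zero_smul, map_zero, add_zero, hf.zero] at this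
    rw [this, mul_add, ← intervalIntegral.integral_const_mul]
  simp only [hpt]
  rw [integral_add hi0 hI, he, hz, add_zero]

end Decaying

/-! ### Stability in `L¹` -/

section QuadraticBounds

variable {γ β : ℝ} {b : ℝ → ℝ} {C : ℝ}

lemma gain_mono (hK : KernelBounds γ b C) {E F E' F' : ℝ} {f g f' g' : E3 → ℝ} (hf : Decays E f)
    (hg : Decays F g) (hf' : Decays E' f') (hg' : Decays F' g') (hf0 : ∀ v, 0 ≤ f v)
    (hg0 : ∀ v, 0 ≤ g v) (hff : ∀ v, f v ≤ f' v) (hgg : ∀ v, g v ≤ g' v) (v : E3) :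
    gain γ b f g v ≤ gain γ b f' g' v :=
  integral_mono (hf.integrable_gain hK hg v) (hf'.integrable_gain hK hg' v) fun _ =>
    mul_le_mul_of_nonneg_left
      (mul_le_mul (hff _) (hgg _) (hg0 _) ((hf0 _).trans (hff _)))
      (mul_nonneg (hK.nonneg _ _) (sqrtM_pos _).le)

lemma gain_const_mul_left (c : ℝ) (f g : E3 → ℝ) (v : E3) :
    gain γ b (fun u => c * f u) g v = c * gain γ b f g v := by
  rw [gain, gain, ← integral_const_mul]
  congr 1; ext p; ring

lemma gain_const_mul_right (c : ℝ) (f g : E3 → ℝ) (v : E3) :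
    gain γ b f (fun u => c * g u) v = c * gain γ b f g v := by
  rw [gain, gain, ← integral_const_mul]
  congr 1; ext p; ring

/-- Every factor is nonnegative, so d may be replaced by h and e by √μ + h, which reduces all terms
to estimates already known. The outcome is linear in `A`: one factor always retains the decay in
space. -/
lemma exists_quadratic_le (hK : KernelBounds γ b C) (hβ : 1 ≤ β) {M : ℝ} (hM : 0 ≤ M) :
    ∃ X : ℝ, 0 ≤ X ∧ ∀ {ϑ : E3 → ℝ}, GrowthWeight ϑ → ∀ {h d e : E3 → ℝ} {A : ℝ}, 0 ≤ A →
      Measurable h → Measurable d → Measurable e → (∀ v, h v ≤ M * (weight β v)⁻¹) →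
      (∀ v, h v ≤ A * ((weight β v)⁻¹ * (ϑ v)⁻¹)) → (∀ v, 0 ≤ d v) → (∀ v, d v ≤ h v) →
      (∀ v, 0 ≤ e v) → (∀ v, e v ≤ sqrtM v + h v) → ∀ v,
      gain γ b d e v + gain γ b e d v + freq γ b d v * e v + freq γ b e v * d v ≤
        X * A * jap v * (ϑ v)⁻¹ := by
  obtain ⟨B, hB, hBb⟩ := exists_sqrtM_weight_le β 5
  obtain ⟨E, hE, hm⟩ := exists_decays_sqrtM
  have hC := hK.one_le
  set G : ℝ := C * (81 * 2 ^ (β / 2) * B) with hG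
  set S : ℝ := C * (16 * 2 ^ (β / 2) * M) with hS
  have hG0 : 0 ≤ G := by positivity
  have hS0 : 0 ≤ S := by positivity
  refine ⟨3 * G + 2 * S + C * M + C * (1 + M), by positivity,
    fun {ϑ} hϑ {h d e A} hA hhm hdm hem h1 h2 hd0 hdh he0 heh v => ?_⟩
  have hh0 : ∀ v, 0 ≤ h v := fun v => (hd0 v).trans (hdh v)
  have hw1 : ∀ v, (weight β v)⁻¹ ≤ 1 := weight_inv_le_one (by linarith)
  have hhD : Decays M h := Decays.of_weight hβ hM hhm fun v => by
    rw [abs_of_nonneg (hh0 v)]; exact h1 v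
  have hdD : Decays M d := Decays.of_weight hβ hM hdm fun v => by
    rw [abs_of_nonneg (hd0 v)]; exact (hdh v).trans (h1 v)
  have hsD : Decays (E + M) fun v => sqrtM v + h v := hm.add hhD
  have heD : Decays (E + M) e := ⟨hem, fun v => by
    rw [abs_of_nonneg (he0 v)]
    exact ((heh v).trans (le_abs_self _)).trans (hsD.bound v)⟩
  have h1a : ∀ v, |h v| ≤ M * (weight β v)⁻¹ := fun v => by rw [abs_of_nonneg (hh0 v)]; exact h1 v
  have h2a : ∀ v, |h v| ≤ A * ((weight β v)⁻¹ * (ϑ v)⁻¹) := fun v => by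
    rw [abs_of_nonneg (hh0 v)]; exact h2 v
  have hs := abs_gain_self_le hK hβ hϑ hA hM h1a h2a v
  obtain ⟨k1, k2, k3⟩ := abs_gain_sqrtM_le hK hβ hϑ hA hB hBb h2a v
  set q := (weight β v)⁻¹ * (ϑ v)⁻¹ with hq
  have hϑ0 := inv_pos.2 (hϑ.pos v)
  have hw0 := inv_pos.2 (weight_pos β v)
  have hj := one_le_jap v
  have hq0 : 0 ≤ q := by positivity
  have hqj : q ≤ jap v * (ϑ v)⁻¹ :=
    mul_le_mul_of_nonneg_right ((hw1 v).trans hj) hϑ0.le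
  have hqϑ : q ≤ (ϑ v)⁻¹ := by
    have := mul_le_mul_of_nonneg_right (hw1 v) hϑ0.le
    rwa [one_mul] at this
  have g1 : gain γ b d e v ≤ gain γ b h sqrtM v + gain γ b h h v := by
    rw [← gain_add_right hK hm hhD hhD]
    exact gain_mono hK hdD heD hhD hsD hd0 he0 hdh heh v
  have g2 : gain γ b e d v ≤ gain γ b sqrtM h v + gain γ b h h v := by
    rw [← gain_add_left hK hm hhD hhD]
    exact gain_mono hK heD hdD hsD hhD he0 hd0 heh hdh v
  have f0 : 0 ≤ freq γ b h v := freq_nonneg hK hh0 v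
  have fd : freq γ b d v ≤ freq γ b h v := freq_mono hK hdD.polyBounded hhD.polyBounded hdh v
  have one_le_pow : ∀ u, (1 : ℝ) ≤ jap u ^ 4 := fun u => one_le_pow₀ (one_le_jap u)
  have hle : ∀ u, h u ≤ M := fun u => (h1 u).trans (mul_le_of_le_one_right hM (hw1 u))
  have fh : freq γ b h v ≤ C * M * jap v := (le_abs_self _).trans (abs_freq_le hK hM fun u => by
    rw [abs_of_nonneg (hh0 u)]
    exact (hle u).trans (le_mul_of_one_le_right hM (one_le_pow u)))
  have fe : freq γ b e v ≤ C * (1 + M) * jap v :=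
    (le_abs_self _).trans (abs_freq_le hK (by positivity) fun u => by
      rw [abs_of_nonneg (he0 u)]
      exact ((heh u).trans (add_le_add (sqrtM_le_one u) (hle u))).trans
        (le_mul_of_one_le_right (by positivity) (one_le_pow u)))
  have g3 : freq γ b d v * e v ≤ |sqrtM v * freq γ b h v| + C * M * jap v * (A * q) := by
    calc freq γ b d v * e v ≤ freq γ b h v * (sqrtM v + h v) :=
          mul_le_mul fd (heh v) (he0 v) f0
      _ = sqrtM v * freq γ b h v + freq γ b h v * h v := by ring
      _ ≤ _ := add_le_add (le_abs_self _) (mul_le_mul fh (h2 v) (hh0 v) (by positivity))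
  have g4 : freq γ b e v * d v ≤ C * (1 + M) * jap v * (A * q) :=
    mul_le_mul fe ((hdh v).trans (h2 v)) (hd0 v) (by positivity)
  have a1 := le_abs_self (gain γ b h sqrtM v)
  have a2 := le_abs_self (gain γ b sqrtM h v)
  have a3 := le_abs_self (gain γ b h h v)
  calc _ ≤ (3 * G + 2 * S) * (A * q) + (C * M + C * (1 + M)) * jap v * (A * q) := by
        rw [hG, hS]; linarith
    _ ≤ (3 * G + 2 * S) * (A * (jap v * (ϑ v)⁻¹)) +
        (C * M + C * (1 + M)) * jap v * (A * (ϑ v)⁻¹) := by gcongr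
    _ = _ := by ring

end QuadraticBounds

section Stability

set_option linter.unusedSectionVars false

open Filter

variable {Ω : Type} [AddCommGroup Ω] [TopologicalSpace Ω] [IsTopologicalAddGroup Ω]
  [SecondCountableTopology Ω] [MeasureSpace Ω] [BorelSpace Ω] [SigmaFinite (volume : Measure Ω)]
  [(volume : Measure Ω).IsAddLeftInvariant]
  {γ β : ℝ} {b : ℝ → ℝ} {C M A T : ℝ} {π : E3 →+ Ω} {f₀ g₀ : Ω → E3 → ℝ}
  {f g : ℝ → Ω → E3 → ℝ} {ϑ : Ω → ℝ}

/-- The mean of the densities of two perturbations. -/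
def meanShift (f g : E3 → ℝ) (v : E3) : ℝ := 1 / 2 * (shift f v + shift g v)

/-- Written with the difference d and the mean density, the difference of two quadratic collision
terms is exactly bilinear. The mean is nonnegative, so its frequency damps d. -/
lemma reaction_sub_reaction {C' : ℝ} (hK : KernelBounds γ b C') {E F : ℝ} {f g : E3 → ℝ}
    (hf : Decays E (shift f)) (hg : Decays F (shift g)) (v : E3) :
    reaction γ b (shift f) v - reaction γ b (shift g) v =
      (gain γ b (fun u => f u - g u) (meanShift f g) v +
        gain γ b (meanShift f g) (fun u => f u - g u) v -
        freq γ b (fun u => f u - g u) v * meanShift f g v) -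
      freq γ b (meanShift f g) v * (f v - g v) := by
  have hd : (fun u => f u - g u) = fun u => shift f u - shift g u := by
    ext u; simp only [shift]; ring
  have hm : meanShift f g = fun u => 1 / 2 * (shift f u + shift g u) := rfl
  have hdv : f v - g v = shift f v - shift g v := congrFun hd v
  rw [hd, hdv, hm, gain_const_mul_right, gain_const_mul_left, freq_const_mul,
    gain_sub_left hK hf hg (hf.add hg), gain_sub_right hK hf hg (hf.add hg),
    gain_add_right hK hf hg hf, gain_add_right hK hf hg hg, gain_add_left hK hf hg hf,
    gain_add_left hK hf hg hg, freq_add hK hf hg, freq_sub hK hf hg]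
  simp only [reaction]; ring

lemma abs_gain_le_gain_abs (f g : E3 → ℝ) (hK : KernelBounds γ b C) (v : E3) :
    |gain γ b f g v| ≤ gain γ b (fun u => |f u|) (fun u => |g u|) v := by
  refine (abs_integral_le_integral_abs).trans (le_of_eq ?_)
  congr 1; ext p
  rw [abs_mul, abs_mul, abs_mul, abs_of_nonneg (hK.nonneg _ _), abs_of_pos (sqrtM_pos _)]

lemma abs_freq_le_freq_abs (f : E3 → ℝ) (hK : KernelBounds γ b C) (v : E3) :
    |freq γ b f v| ≤ freq γ b (fun u => |f u|) v := by
  refine (abs_integral_le_integral_abs).trans (le_of_eq ?_)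
  congr 1; ext p
  rw [abs_mul, abs_mul, abs_of_nonneg (hK.nonneg _ _), abs_of_pos (sqrtM_pos _)]

lemma measurable_meanShift {α : Type*} [MeasurableSpace α] {F G : α → E3 → ℝ}
    (hF : Measurable fun p : α × E3 => F p.1 p.2) (hG : Measurable fun p : α × E3 => G p.1 p.2) :
    Measurable fun p : α × E3 => meanShift (F p.1) (G p.1) p.2 :=
  ((measurable_shift hF).add (measurable_shift hG)).const_mul _

lemma Admissible.meanShift_nonneg (hf : Admissible β M f) (hg : Admissible β M g) (t : ℝ) (x : Ω)
    (v : E3) : 0 ≤ meanShift (f t x) (g t x) v :=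
  mul_nonneg (by norm_num) (add_nonneg (hf.nonneg t x v) (hg.nonneg t x v))

lemma Setting.decays_shift (hS : Setting γ β b C π) (hf : Admissible β M f) (t : ℝ) (x : Ω) :
    Decays (C + M) (shift (f t x)) := by
  have hC := hS.bounds.one_le
  have hM := hf.nonneg_const
  exact Decays.of_weight hS.one_le_beta (by linarith) (measurable_sqrtM.add
    (hf.decays hS.one_le_beta t x).measurable) (hS.abs_shift_le hf t x)

lemma Setting.meanShift_le (hS : Setting γ β b C π) (hf : Admissible β M f)
    (hg : Admissible β M g) (t : ℝ) (x : Ω) (v : E3) :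
    meanShift (f t x) (g t x) v ≤ 1 + M := by
  have h1 := (le_abs_self _).trans ((hf.decays hS.one_le_beta t x).abs_le v)
  have h2 := (le_abs_self _).trans ((hg.decays hS.one_le_beta t x).abs_le v)
  have h3 := sqrtM_le_one v
  simp only [meanShift, shift]; linarith

/-- The terms in the equation of the difference of two decaying solutions. -/
lemma DecayingSolution.exists_diff_le (hS : Setting γ β b C π) (hϑ : GrowthOn π ϑ)
    (hf : DecayingSolution γ b π β M A T ϑ f₀ f) (hg : DecayingSolution γ b π β M A T ϑ g₀ g) :
    ∃ X, ∀ s ∈ Icc 0 T, ∀ y v,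
      gain γ b (fun u => |f s (y + π (s • v)) u - g s (y + π (s • v)) u|)
        (meanShift (f s (y + π (s • v))) (g s (y + π (s • v)))) v +
      gain γ b (meanShift (f s (y + π (s • v))) (g s (y + π (s • v))))
        (fun u => |f s (y + π (s • v)) u - g s (y + π (s • v)) u|) v +
      freq γ b (fun u => |f s (y + π (s • v)) u - g s (y + π (s • v)) u|) v *
        meanShift (f s (y + π (s • v))) (g s (y + π (s • v))) v +
      freq γ b (meanShift (f s (y + π (s • v))) (g s (y + π (s • v)))) v *
        |f s (y + π (s • v)) v - g s (y + π (s • v)) v| ≤ X * jap v * (ϑ y)⁻¹ := by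
  obtain ⟨C', hK⟩ := hS.kernel
  have hM := hf.admissible.nonneg_const
  have hA := hf.nonneg
  obtain ⟨X, hX, hle⟩ := exists_quadratic_le hK hS.one_le_beta (M := 2 * M) (by positivity)
  -- The common majorant is h = |f| + |g|, which doubles both constants M and A.
  refine ⟨X * (2 * A), fun s hs y v => ?_⟩
  set x := y + π (s • v) with hx
  have hfm := (hf.admissible.decays hS.one_le_beta s x).measurable
  have hgm := (hg.admissible.decays hS.one_le_beta s x).measurable
  have := hle (hϑ.growth s ⟨hs.1, hs.2.trans hf.time_le⟩ x) (A := 2 * A)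
    (h := fun u => |f s x u| + |g s x u|) (d := fun u => |f s x u - g s x u|)
    (e := meanShift (f s x) (g s x)) (by positivity) (hfm.abs.add hgm.abs) (hfm.sub hgm).abs
    (((measurable_sqrtM.add hfm).add (measurable_sqrtM.add hgm)).const_mul _)
    (fun u => by
      have h1 := hf.admissible.bound s x u
      have h2 := hg.admissible.bound s x u
      linarith)
    (fun u => by
      have h1 := hf.decay s hs x u
      have h2 := hg.decay s hs x u
      linarith)
    (fun u => abs_nonneg _) (fun u => abs_sub _ _)
    (hf.admissible.meanShift_nonneg hg.admissible s x)
    (fun u => by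
      have h1 := le_abs_self (f s x u)
      have h2 := le_abs_self (g s x u)
      have h3 := abs_nonneg (f s x u)
      have h4 := abs_nonneg (g s x u)
      simp only [meanShift, shift]; linarith) v
  rwa [hx, add_sub_cancel_right] at this

/-- Stability of decaying solutions in the weighted `L¹` norm. -/
lemma Setting.exists_integral_abs_sub_le (hS : Setting γ β b C π) (M : ℝ) :
    ∃ X, ∀ {A T : ℝ} {ϑ : Ω → ℝ} {f₀ g₀ : Ω → E3 → ℝ} {f g : ℝ → Ω → E3 → ℝ},
      IntegrableRate π ϑ → DecayingSolution γ b π β M A T ϑ f₀ f →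
      DecayingSolution γ b π β M A T ϑ g₀ g → ∀ t ∈ Icc 0 T,
      ∫ p : Ω × E3, sqrtM p.2 * jap p.2 ^ 2 * |f t p.1 p.2 - g t p.1 p.2| ≤
        X * ∫ p : Ω × E3, sqrtM p.2 * jap p.2 ^ 2 * |f₀ p.1 p.2 - g₀ p.1 p.2| := by
  obtain ⟨C', hK⟩ := hS.kernel
  obtain ⟨X, hX, hXle⟩ := exists_integral_diffReaction_le hK
  -- The Gronwall constant for c = X (1 + M), where 1 + M bounds the mean density. It does not
  -- depend on A, ϑ or T, so one constant serves all the cut-off solutions.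
  refine ⟨1 + X * (1 + M) * Real.exp (X * (1 + M)), fun {A T ϑ f₀ g₀ f g} hϑ hf hg t ht => ?_⟩
  have hM := hf.admissible.nonneg_const
  obtain ⟨Y, hY⟩ := hf.exists_diff_le hS hϑ.growth hg
  have hT := hf.nonneg_time
  set d : ℝ → Ω → E3 → ℝ := fun s x v => f s x v - g s x v with hd
  set e : ℝ → Ω → E3 → ℝ := fun s x => meanShift (f s x) (g s x) with he
  have hfm := hf.admissible.measurable
  have hgm := hg.admissible.measurable
  have hdm : Measurable fun p : (ℝ × Ω) × E3 => d p.1.1 p.1.2 p.2 := hfm.sub hgm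
  have hem : Measurable fun p : (ℝ × Ω) × E3 => e p.1.1 p.1.2 p.2 :=
    measurable_meanShift (F := fun p : ℝ × Ω => f p.1 p.2) (G := fun p : ℝ × Ω => g p.1 p.2) hfm hgm
  have hda : Measurable fun p : (ℝ × Ω) × E3 => |d p.1.1 p.1.2 p.2| := hdm.abs
  have he0 : ∀ s x v, 0 ≤ e s x v := hf.admissible.meanShift_nonneg hg.admissible
  have gain₁ := measurable_gain hK (F := fun p : ℝ × Ω => fun v => |d p.1 p.2 v|)
    (G := fun p : ℝ × Ω => e p.1 p.2) hda hem
  have gain₂ := measurable_gain hK (G := fun p : ℝ × Ω => fun v => |d p.1 p.2 v|)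
    (F := fun p : ℝ × Ω => e p.1 p.2) hem hda
  have freq₁ := measurable_freq hK (F := fun p : ℝ × Ω => fun v => |d p.1 p.2 v|) hda
  have freq₂ := measurable_freq hK (F := fun p : ℝ × Ω => e p.1 p.2) hem
  set P : ℝ → Ω → E3 → ℝ := fun s x v =>
    gain γ b (fun u => |d s x u|) (e s x) v + gain γ b (e s x) (fun u => |d s x u|) v +
      freq γ b (fun u => |d s x u|) v * e s x v with hP
  have hPm : Measurable fun p : (ℝ × Ω) × E3 => P p.1.1 p.1.2 p.2 :=
    (gain₁.add gain₂).add (freq₁.mul hem)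
  have hP0 : ∀ s x v, 0 ≤ P s x v := fun s x v =>
    add_nonneg (add_nonneg (gain_nonneg hK (fun _ => abs_nonneg _) (he0 s x) v)
      (gain_nonneg hK (he0 s x) (fun _ => abs_nonneg _) v))
      (mul_nonneg (Boltzmann.freq_nonneg hK (fun _ => abs_nonneg _) v) (he0 s x v))
  have hN0 : ∀ s x v, 0 ≤ freq γ b (e s x) v := fun s x v => Boltzmann.freq_nonneg hK (he0 s x) v
  have hY' : ∀ s ∈ Icc 0 T, ∀ y v, P s (y + π (s • v)) v +
      freq γ b (e s (y + π (s • v))) v * |d s (y + π (s • v)) v| ≤ Y * jap v * (ϑ y)⁻¹ := hY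
  have hline : ∀ (y : Ω) (v : E3), Measurable fun s : ℝ => ((s, y + π (s • v)), v) := fun y v => by
    have hc := hS.continuous
    exact Continuous.measurable (by fun_prop)
  have hPi : ∀ y v, IntervalIntegrable (fun s => P s (y + π (s • v)) v) volume 0 T := fun y v =>
    intervalIntegrable_of_bounded (M := Y * jap v * (ϑ y)⁻¹)
      (hPm.comp (f := fun s : ℝ => ((s, y + π (s • v)), v)) (hline y v)) hT fun s hs => by
      refine (abs_of_nonneg (hP0 _ _ _)).trans_le ?_
      have := hY' s hs y v
      have h2 := mul_nonneg (hN0 s (y + π (s • v)) v) (abs_nonneg (d s (y + π (s • v)) v))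
      linarith
  obtain ⟨B, hB, hBle⟩ := hS.exists_freq_le M
  have hNle : ∀ s x v, freq γ b (e s x) v ≤ B * jap v := fun s x v => by
    have : freq γ b (e s x) v = 1 / 2 * (freq γ b (shift (f s x)) v + freq γ b (shift (g s x)) v) := by
      rw [← freq_add hK (hS.decays_shift hf.admissible s x) (hS.decays_shift hg.admissible s x),
        ← freq_const_mul]
      rfl
    have h1 := (le_abs_self _).trans (hBle f hf.admissible s x v)
    have h2 := (le_abs_self _).trans (hBle g hg.admissible s x v)
    rw [this]; linarith
  have hNi : ∀ y v, IntervalIntegrable (fun s => freq γ b (e s (y + π (s • v))) v) volume 0 T :=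
    fun y v => intervalIntegrable_of_bounded (M := B * jap v)
      (freq₂.comp (f := fun s : ℝ => ((s, y + π (s • v)), v)) (hline y v)) hT fun s hs => by
      exact (abs_of_nonneg (hN0 _ _ _)).trans_le (hNle _ _ _)
  -- The inequality for |d| along a characteristic: terms without a favourable sign are replaced by
  -- their absolute values, while the loss through the mean frequency is kept, since the
  -- cancellation in `diffReaction` needs it.
  have hpt : ∀ t ∈ Icc 0 T, ∀ (y : Ω) (v : E3), |d t (y + π (t • v)) v| ≤ |f₀ y v - g₀ y v| +
      ∫ s in (0 : ℝ)..t, diffReaction γ b (fun u => |d s (y + π (s • v)) u|)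
        (e s (y + π (s • v))) v := by
    intro t ht y v
    set p : ℝ → ℝ := fun s => gain γ b (d s (y + π (s • v))) (e s (y + π (s • v))) v +
      gain γ b (e s (y + π (s • v))) (d s (y + π (s • v))) v -
      freq γ b (d s (y + π (s • v))) v * e s (y + π (s • v)) v with hp
    have hprim : IsPrim T (fun s => d s (y + π (s • v)) v)
        (fun s => p s - freq γ b (e s (y + π (s • v))) v * d s (y + π (s • v)) v) :=
      ((hf.isPrim hS y v).sub (hg.isPrim hS y v)).congr hT (fun _ _ => rfl)
        (Eventually.of_forall fun s _ => reaction_sub_reaction hK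
          (hS.decays_shift hf.admissible s _) (hS.decays_shift hg.admissible s _) v)
    have hpP : ∀ s ∈ Icc 0 T, |p s| ≤ P s (y + π (s • v)) v := by
      intro s _
      have ea : (fun u => |e s (y + π (s • v)) u|) = e s (y + π (s • v)) :=
        funext fun u => abs_of_nonneg (he0 _ _ _)
      have h1 := abs_gain_le_gain_abs (d s (y + π (s • v))) (e s (y + π (s • v))) hK v
      have h2 := abs_gain_le_gain_abs (e s (y + π (s • v))) (d s (y + π (s • v))) hK v
      have h3 := abs_freq_le_freq_abs (d s (y + π (s • v))) hK v
      rw [ea] at h1 h2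
      have h4 := mul_le_mul_of_nonneg_right h3 (he0 s (y + π (s • v)) v)
      have h5 := abs_mul (freq γ b (d s (y + π (s • v))) v) (e s (y + π (s • v)) v)
      rw [abs_of_nonneg (he0 s (y + π (s • v)) v)] at h5
      have h6 := abs_sub (gain γ b (d s (y + π (s • v))) (e s (y + π (s • v))) v +
        gain γ b (e s (y + π (s • v))) (d s (y + π (s • v))) v)
        (freq γ b (d s (y + π (s • v))) v * e s (y + π (s • v)) v)
      have h7 := abs_add_le (gain γ b (d s (y + π (s • v))) (e s (y + π (s • v))) v)
        (gain γ b (e s (y + π (s • v))) (d s (y + π (s • v))) v)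
      simp only [hp, hP]
      linarith
    have := hprim.abs_le hT (hNi y v) (fun s _ => hN0 _ _ _) (hPi y v) hpP ht
    simp only [zero_smul, map_zero, add_zero] at this
    simp only [hd, hf.zero, hg.zero] at this
    exact this
  have hwm : Measurable fun p : (ℝ × Ω) × E3 => sqrtM p.2 * jap p.2 ^ 2 :=
    measurable_sqrtM_snd.mul ((measurable_jap.comp measurable_snd).pow_const 2)
  set R : ℝ → Ω → E3 → ℝ := fun s x v => sqrtM v * jap v ^ 2 *
    diffReaction γ b (fun u => |d s x u|) (e s x) v with hR
  have hRm : Measurable fun p : (ℝ × Ω) × E3 => R p.1.1 p.1.2 p.2 :=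
    hwm.mul (hPm.sub (freq₂.mul hda))
  have hw0 : ∀ v, 0 ≤ sqrtM v * jap v ^ 2 := fun v =>
    mul_nonneg (sqrtM_pos v).le (pow_nonneg (jap_pos v).le 2)
  have hRH := (hϑ.integrable_mul ((polyBounded_jap_pow 2).mul (polyBounded_jap_pow 1))).const_mul Y
  have hRle : ∀ s ∈ Icc 0 T, ∀ y v, |R s (y + π (s • v)) v| ≤
      Y * (sqrtM v * (jap v ^ 2 * jap v ^ 1) * (ϑ y)⁻¹) := by
    intro s hs y v
    have h1 := hY' s hs y v
    have h2 := mul_nonneg (hN0 s (y + π (s • v)) v) (abs_nonneg (d s (y + π (s • v)) v))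
    have h3 := hP0 s (y + π (s • v)) v
    have h4 : |diffReaction γ b (fun u => |d s (y + π (s • v)) u|) (e s (y + π (s • v))) v| ≤
        Y * jap v * (ϑ y)⁻¹ := by
      have : diffReaction γ b (fun u => |d s (y + π (s • v)) u|) (e s (y + π (s • v))) v =
          P s (y + π (s • v)) v -
            freq γ b (e s (y + π (s • v))) v * |d s (y + π (s • v)) v| := rfl
      rw [this, _root_.abs_le]
      constructor <;> linarith
    calc |R s (y + π (s • v)) v| = sqrtM v * jap v ^ 2 *
        |diffReaction γ b (fun u => |d s (y + π (s • v)) u|) (e s (y + π (s • v))) v| := by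
          simp only [hR]; rw [abs_mul, abs_of_nonneg (hw0 v)]
      _ ≤ sqrtM v * jap v ^ 2 * (Y * jap v * (ϑ y)⁻¹) := mul_le_mul_of_nonneg_left h4 (hw0 v)
      _ = _ := by ring
  set W : ℝ → Ω → E3 → ℝ := fun s x v => sqrtM v * jap v ^ 2 * |d s x v| with hW
  have hWm : Measurable fun p : (ℝ × Ω) × E3 => W p.1.1 p.1.2 p.2 := hwm.mul hda
  have hWH := (hϑ.integrable_mul (polyBounded_jap_pow 2)).const_mul (2 * A)
  have hWle : ∀ s ∈ Icc 0 T, ∀ y v, |W s (y + π (s • v)) v| ≤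
      2 * A * (sqrtM v * jap v ^ 2 * (ϑ y)⁻¹) := by
    intro s hs y v
    have h1 := hf.abs_le hS hϑ.growth hs y v
    have h2 := hg.abs_le hS hϑ.growth hs y v
    have h3 := abs_sub (f s (y + π (s • v)) v) (g s (y + π (s • v)) v)
    simp only [hW]
    rw [abs_mul, abs_of_nonneg (hw0 v), abs_abs]
    calc _ ≤ sqrtM v * jap v ^ 2 * (2 * (A * (ϑ y)⁻¹)) := by
          refine mul_le_mul_of_nonneg_left ?_ (hw0 v)
          simp only [hd]; linarith
      _ = _ := by ring
  have hZi := (integral_along hS.continuous hWm hWH hWle ⟨hT, le_rfl⟩).1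
  have hWi := fun s hs => integrable_slice hS.continuous hWm hWH hWle (s := s) hs
  have hW0 : ∀ p : Ω × E3, W 0 p.1 p.2 = sqrtM p.2 * jap p.2 ^ 2 * |f₀ p.1 p.2 - g₀ p.1 p.2| := by
    intro p; simp only [hW, hd, hf.zero, hg.zero]
  have hRZ : ∀ s ∈ Icc 0 T, ∫ p : Ω × E3, R s p.1 p.2 ≤
      X * (1 + M) * ∫ p : Ω × E3, W s p.1 p.2 := by
    intro s hs
    have hi := integrable_slice hS.continuous hRm hRH hRle hs
    have hj := hWi s hs
    rw [Measure.volume_eq_prod] at hi hj ⊢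
    rw [integral_prod _ hi, integral_prod _ hj, ← integral_const_mul]
    refine integral_mono hi.integral_prod_left (hj.integral_prod_left.const_mul _) fun x => ?_
    refine hXle (fun u => |d s x u|) (e s x) (1 + M) ?_ ?_ (fun _ => abs_nonneg _) (he0 s x)
      (hS.meanShift_le hf.admissible hg.admissible s x)
    · exact ((hf.admissible.decays hS.one_le_beta s x).sub
        (hg.admissible.decays hS.one_le_beta s x)).abs.polyBounded
    · exact ((hS.polyBounded_shift hf.admissible s x).add
        (hS.polyBounded_shift hg.admissible s x)).const_mul _
  have hgr : ∀ τ ∈ Icc 0 T, ∫ p : Ω × E3, W τ p.1 p.2 ≤ (∫ p : Ω × E3, W 0 p.1 p.2) +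
      X * (1 + M) * ∫ s in (0 : ℝ)..τ, ∫ p : Ω × E3, W s p.1 p.2 := by
    intro τ hτ
    obtain ⟨hRi, hRI, hRe⟩ := integral_along hS.continuous hRm hRH hRle hτ
    have hW0i := hWi 0 ⟨le_rfl, hT⟩
    rw [← integral_transport hS.continuous (measurable_slice hWm τ) τ]
    calc ∫ p : Ω × E3, W τ (p.1 + π (τ • p.2)) p.2
        ≤ ∫ p : Ω × E3, (W 0 p.1 p.2 + ∫ s in (0 : ℝ)..τ, R s (p.1 + π (s • p.2)) p.2) := by
          refine integral_mono ((integrable_transport_iff hS.continuous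
            (measurable_slice hWm τ) τ).2 (hWi τ hτ)) (hW0i.add hRI) fun p => ?_
          have := mul_le_mul_of_nonneg_left (hpt τ hτ p.1 p.2) (hw0 p.2)
          rw [mul_add, ← intervalIntegral.integral_const_mul] at this
          rw [hW0]
          exact this
      _ = (∫ p : Ω × E3, W 0 p.1 p.2) + ∫ s in (0 : ℝ)..τ, ∫ p : Ω × E3, R s p.1 p.2 := by
          rw [integral_add hW0i hRI, hRe]
      _ ≤ _ := by
          rw [← intervalIntegral.integral_const_mul]
          exact add_le_add le_rfl (intervalIntegral.integral_mono_on hτ.1 hRi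
            ((IntervalIntegrable.mono_right hZi hτ).const_mul _)
            fun s hs => hRZ s ⟨hs.1, hs.2.trans hτ.2⟩)
  have key := gronwall_of_le_add_integral (Z := fun s => ∫ p : Ω × E3, W s p.1 p.2)
    (Z₀ := ∫ p : Ω × E3, W 0 p.1 p.2) (c := X * (1 + M)) hT hf.time_le hZi
    (integral_nonneg fun _ => mul_nonneg (hw0 _) (abs_nonneg _)) (by positivity)
    hgr ht
  simpa only [hW0] using key

end Stability

/-! ### Entropy of decaying solutions -/

section RelativeEntropy

open InformationTheory

/-- The density of the entropy of `√μ (√μ + φ)` relative to `μ`. -/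
def relEntropy (φ : E3 → ℝ) (v : E3) : ℝ :=
  sqrtM v * sqrtM v * klFun (shift φ v / sqrtM v)

lemma relEntropy_nonneg {φ : E3 → ℝ} {v : E3} (h : 0 ≤ shift φ v) : 0 ≤ relEntropy φ v :=
  mul_nonneg (mul_self_nonneg _) (klFun_nonneg (div_nonneg h (sqrtM_pos v).le))

/-- Near r = 1 the function is quadratically small, but a bound linear in |r − 1| is what matches
the L¹ hypothesis on F − μ. -/
lemma klFun_le {r : ℝ} (hr : 0 ≤ r) : klFun r ≤ |r - 1| * (1 + max 0 (Real.log r)) := by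
  rw [klFun]
  rcases le_total r 1 with h | h
  · have h1 : r * Real.log r ≤ 0 := mul_nonpos_of_nonneg_of_nonpos hr (Real.log_nonpos hr h)
    have h2 : |r - 1| = 1 - r := by rw [abs_of_nonpos (by linarith)]; ring
    have h3 : 0 ≤ (1 - r) * max 0 (Real.log r) := mul_nonneg (by linarith) (le_max_left _ _)
    rw [h2]; linarith
  · have h1 := Real.log_le_sub_one_of_pos (by linarith : 0 < r)
    rw [abs_of_nonneg (by linarith), max_eq_right (Real.log_nonneg h)]
    nlinarith

lemma exists_neg_log_sqrtM_le : ∃ L : ℝ, 0 ≤ L ∧ ∀ v, -Real.log (sqrtM v) ≤ L * jap v ^ 2 := by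
  have h0 : 0 ≤ Real.log ((2 * Real.pi) ^ (3 / 2 : ℝ)) := Real.log_nonneg two_pi_rpow_ge_one
  refine ⟨Real.log ((2 * Real.pi) ^ (3 / 2 : ℝ)) + 1, by positivity, fun v => ?_⟩
  rw [sqrtM, Real.log_sqrt (maxwellian_pos v).le, log_maxwellian, jap_sq]
  nlinarith [sq_nonneg ‖v‖]

lemma log_shift_div_le {φ : E3 → ℝ} {M : ℝ} (hM : 0 ≤ M) {v : E3} (h : |φ v| ≤ M)
    (h0 : 0 ≤ shift φ v) :
    Real.log (shift φ v / sqrtM v) ≤ Real.log (1 + M) - Real.log (sqrtM v) := by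
  have hm := sqrtM_pos v
  have hl : 0 ≤ Real.log (1 + M) := Real.log_nonneg (by linarith)
  have hl' : Real.log (sqrtM v) ≤ 0 := Real.log_nonpos hm.le (sqrtM_le_one v)
  rcases h0.eq_or_lt with h1 | h1
  · rw [← h1, zero_div, Real.log_zero]; linarith
  · rw [Real.log_div h1.ne' hm.ne']
    refine sub_le_sub_right (Real.log_le_log h1 ?_) _
    have := (le_abs_self _).trans h
    have := sqrtM_le_one v
    simp only [shift]; linarith

/-- For bounded f the logarithm of F / μ is at most quadratic in v from above. Hence a finite defect
of mass and energy already gives finite relative entropy. -/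
lemma exists_relEntropy_le {M : ℝ} (hM : 0 ≤ M) : ∃ L : ℝ, 0 ≤ L ∧ ∀ {φ : E3 → ℝ} {v : E3},
    |φ v| ≤ M → 0 ≤ shift φ v → relEntropy φ v ≤ L * (sqrtM v * jap v ^ 2 * |φ v|) := by
  obtain ⟨L, hL, hLle⟩ := exists_neg_log_sqrtM_le
  have hl : 0 ≤ Real.log (1 + M) := Real.log_nonneg (by linarith)
  refine ⟨1 + Real.log (1 + M) + L, by positivity, fun {φ v} h h0 => ?_⟩
  have hm := sqrtM_pos v
  have h1 := klFun_le (div_nonneg h0 hm.le)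
  have h2 : |shift φ v / sqrtM v - 1| = |φ v| / sqrtM v := by
    have : shift φ v / sqrtM v - 1 = φ v / sqrtM v := by simp only [shift]; field_simp; ring
    rw [this, abs_div, abs_of_pos hm]
  have hj : 1 ≤ jap v ^ 2 := one_le_pow₀ (one_le_jap v)
  have h3 : 1 + max 0 (Real.log (shift φ v / sqrtM v)) ≤ (1 + Real.log (1 + M) + L) * jap v ^ 2 := by
    have h4 := log_shift_div_le hM h h0
    have h5 := hLle v
    have h6 : max 0 (Real.log (shift φ v / sqrtM v)) ≤ Real.log (1 + M) + L * jap v ^ 2 :=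
      max_le (by positivity) (by linarith)
    nlinarith
  rw [h2] at h1
  calc relEntropy φ v ≤ sqrtM v * sqrtM v * (|φ v| / sqrtM v *
        ((1 + Real.log (1 + M) + L) * jap v ^ 2)) :=
        mul_le_mul_of_nonneg_left (h1.trans (mul_le_mul_of_nonneg_left h3 (by positivity)))
          (mul_self_nonneg _)
    _ = _ := by field_simp

lemma measurable_relEntropy {α : Type*} [MeasurableSpace α] {F : α → E3 → ℝ}
    (hF : Measurable fun p : α × E3 => F p.1 p.2) :
    Measurable fun p : α × E3 => relEntropy (F p.1) p.2 :=
  (measurable_sqrtM_snd.mul measurable_sqrtM_snd).mul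
    (measurable_klFun.comp ((measurable_shift hF).div measurable_sqrtM_snd))

lemma contDiffOn_klFun {lo hi : ℝ} (hlo : 0 < lo) : ContDiffOn ℝ 1 klFun (Icc lo hi) := by
  have h : ContDiffOn ℝ 1 (fun x : ℝ => x * Real.log x + 1 - x) (Icc lo hi) :=
    ((contDiffOn_id.mul (contDiffOn_id.log fun x hx => (hlo.trans_le hx.1).ne')).add
      contDiffOn_const).sub contDiffOn_id
  exact h

end RelativeEntropy

section DecayingEntropy

set_option linter.unusedSectionVars false

open Filter InformationTheory

variable {Ω : Type} [AddCommGroup Ω] [TopologicalSpace Ω] [IsTopologicalAddGroup Ω]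
  [SecondCountableTopology Ω] [MeasureSpace Ω] [BorelSpace Ω] [SigmaFinite (volume : Measure Ω)]
  [(volume : Measure Ω).IsAddLeftInvariant]
  {γ β : ℝ} {b : ℝ → ℝ} {C M A T c : ℝ} {π : E3 →+ Ω} {f₀ : Ω → E3 → ℝ}
  {f : ℝ → Ω → E3 → ℝ} {ϑ : Ω → ℝ}

lemma integrable_relEntropy {φ : Ω → E3 → ℝ} (hφ : Measurable fun p : Ω × E3 => φ p.1 p.2)
    (hM : 0 ≤ M) (hb : ∀ x v, |φ x v| ≤ M) (h0 : ∀ x v, 0 ≤ shift (φ x) v)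
    (hi : Integrable fun p : Ω × E3 => sqrtM p.2 * jap p.2 ^ 2 * |φ p.1 p.2|) :
    Integrable fun p : Ω × E3 => relEntropy (φ p.1) p.2 := by
  obtain ⟨L, hL, hle⟩ := exists_relEntropy_le hM
  refine (hi.const_mul L).mono' (measurable_relEntropy hφ).aestronglyMeasurable
    (Eventually.of_forall fun p => ?_)
  rw [Real.norm_of_nonneg (relEntropy_nonneg (h0 _ _))]
  exact hle (hb _ _) (h0 _ _)

/-- A decaying solution stays above a multiple of the Maxwellian that depends on the velocity. -/
lemma DecayingSolution.exists_le_shift (hS : Setting γ β b C π)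
    (hf : DecayingSolution γ b π β M A T ϑ f₀ f) (hc : 0 ≤ c)
    (h0 : ∀ y v, c * sqrtM v ≤ shift (f₀ y) v) :
    ∃ B : ℝ, 0 ≤ B ∧ ∀ t ∈ Icc 0 T, ∀ x v,
      c * sqrtM v * Real.exp (-(B * jap v)) ≤ shift (f t x) v := by
  obtain ⟨C', hK⟩ := hS.kernel
  obtain ⟨B, hB, hfr⟩ := hS.exists_freq_le M
  refine ⟨B, hB, fun t ht x v => ?_⟩
  set y := x - π (t • v) with hy
  have e1 := hS.shift_charStep (f₀ := f₀) hf.admissible hf.nonneg_time y v ht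
  rw [hf.eq t ht, hy, sub_add_cancel, ← hy] at e1
  -- Dropping the nonnegative gain leaves the data damped by at most exp (−B J(v)), since the
  -- frequency is at most B J(v) and T ≤ 1.
  have h1 := le_duhamel (a := fun s => freq γ b (shift (f s (y + π (s • v)))) v)
    (g := fun s => gain γ b (shift (f s (y + π (s • v)))) (shift (f s (y + π (s • v)))) v)
    (y₀ := sqrtM v + f₀ y v) ht.1 fun s _ => gain_nonneg hK (hf.admissible.nonneg s _)
      (hf.admissible.nonneg s _) v
  rw [← e1] at h1
  refine le_trans ?_ h1
  have hj := jap_pos v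
  have h2 : ∫ s in (0 : ℝ)..t, freq γ b (shift (f s (y + π (s • v)))) v ≤ B * jap v := by
    have h3 : ∫ s in (0 : ℝ)..t, freq γ b (shift (f s (y + π (s • v)))) v ≤
        ∫ _ in (0 : ℝ)..t, B * jap v :=
      intervalIntegral.integral_mono_on ht.1
        (IntervalIntegrable.mono_right (hS.intervalIntegrable_freq hf.admissible
          hf.nonneg_time y v) ht) intervalIntegrable_const fun s _ =>
        (le_abs_self _).trans (hfr f hf.admissible s _ v)
    rw [intervalIntegral.integral_const, smul_eq_mul, sub_zero] at h3
    exact h3.trans (mul_le_of_le_one_left (by positivity) (ht.2.trans hf.time_le))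
  have h4 := sqrtM_pos v
  calc _ = Real.exp (-(B * jap v)) * (c * sqrtM v) := by ring
    _ ≤ _ := mul_le_mul (Real.exp_le_exp.2 (neg_le_neg h2)) (h0 y v) (by positivity)
        (Real.exp_pos _).le

/-- Bounds on both sides make ln (F / μ) a test function of polynomial growth, so the weak form of
the collision operator applies to it. -/
lemma DecayingSolution.exists_abs_log_le (hS : Setting γ β b C π)
    (hf : DecayingSolution γ b π β M A T ϑ f₀ f) (hc : 0 < c)
    (h0 : ∀ y v, c * sqrtM v ≤ shift (f₀ y) v) :
    ∃ Λ : ℝ, 0 ≤ Λ ∧ ∀ t ∈ Icc 0 T, ∀ x v, 0 < shift (f t x) v ∧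
      |Real.log (shift (f t x) v / sqrtM v)| ≤ Λ * jap v ^ 2 := by
  obtain ⟨B, hB, hle⟩ := hf.exists_le_shift hS hc.le h0
  obtain ⟨L, hL, hLle⟩ := exists_neg_log_sqrtM_le
  have hM := hf.admissible.nonneg_const
  have hl : 0 ≤ Real.log (1 + M) := Real.log_nonneg (by linarith)
  refine ⟨|Real.log c| + B + Real.log (1 + M) + L, by positivity, fun t ht x v => ?_⟩
  have hm := sqrtM_pos v
  have h1 := hle t ht x v
  have hpos : 0 < shift (f t x) v := lt_of_lt_of_le (by positivity) h1
  have hj : jap v ≤ jap v ^ 2 := by nlinarith [one_le_jap v]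
  have hj1 : 1 ≤ jap v ^ 2 := one_le_pow₀ (one_le_jap v)
  have h2 := log_shift_div_le hM ((hf.admissible.decays hS.one_le_beta t x).abs_le v) hpos.le
  have h3 : Real.log c - B * jap v ≤ Real.log (shift (f t x) v / sqrtM v) := by
    have e1 : Real.log c - B * jap v = Real.log (c * Real.exp (-(B * jap v))) := by
      rw [Real.log_mul hc.ne' (Real.exp_pos _).ne', Real.log_exp]; ring
    rw [e1]
    refine Real.log_le_log (by positivity) ?_
    rw [le_div_iff₀ hm]
    linarith
  have h4 := neg_abs_le (Real.log c)
  have h5 := hLle v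
  have h6 : |Real.log c| ≤ |Real.log c| * jap v ^ 2 := le_mul_of_one_le_right (abs_nonneg _) hj1
  have h7 : Real.log (1 + M) ≤ Real.log (1 + M) * jap v ^ 2 := le_mul_of_one_le_right hl hj1
  have h8 : B * jap v ≤ B * jap v ^ 2 := mul_le_mul_of_nonneg_left hj hB
  have h9 : 0 ≤ L * jap v ^ 2 := by positivity
  have h10 := abs_nonneg (Real.log c)
  have h11 : 0 ≤ B * jap v ^ 2 := by positivity
  refine ⟨hpos, ?_⟩
  rw [_root_.abs_le]
  constructor <;> nlinarith

/-- The entropy inequality for decaying solutions. -/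
lemma DecayingSolution.integral_relEntropy_le (hS : Setting γ β b C π) (hϑ : IntegrableRate π ϑ)
    (hf : DecayingSolution γ b π β M A T ϑ f₀ f) (hc : 0 < c)
    (h0 : ∀ y v, c * sqrtM v ≤ shift (f₀ y) v) {t : ℝ} (ht : t ∈ Icc 0 T) :
    Integrable (fun p : Ω × E3 => relEntropy (f t p.1) p.2) ∧
    ∫ p : Ω × E3, relEntropy (f t p.1) p.2 ≤ ∫ p : Ω × E3, relEntropy (f₀ p.1) p.2 := by
  obtain ⟨C', hK⟩ := hS.kernel
  obtain ⟨X, hX⟩ := hf.exists_reaction_le hS hϑ.growth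
  obtain ⟨Λ, hΛ, hlog⟩ := hf.exists_abs_log_le hS hc h0
  have hM := hf.admissible.nonneg_const
  have hT := hf.nonneg_time
  set R : ℝ → Ω → E3 → ℝ := fun s x v => sqrtM v * Real.log (shift (f s x) v / sqrtM v) *
    reaction γ b (shift (f s x)) v with hR
  have hsm : Measurable fun p : (ℝ × Ω) × E3 => shift (f p.1.1 p.1.2) p.2 :=
    measurable_shift (F := fun p : ℝ × Ω => f p.1 p.2) hf.admissible.measurable
  have hm : Measurable fun p : (ℝ × Ω) × E3 => R p.1.1 p.1.2 p.2 :=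
    (measurable_sqrtM_snd.mul (Real.measurable_log.comp (hsm.div measurable_sqrtM_snd))).mul
      (hS.measurable_reaction_shift hf.admissible)
  have hH := (hϑ.integrable_mul ((polyBounded_jap_pow 2).mul (polyBounded_jap_pow 1))).const_mul
    (Λ * X)
  have hle : ∀ s ∈ Icc 0 T, ∀ y v, |R s (y + π (s • v)) v| ≤
      Λ * X * (sqrtM v * (jap v ^ 2 * jap v ^ 1) * (ϑ y)⁻¹) := by
    intro s hs y v
    rw [hR, abs_mul, abs_mul, abs_of_pos (sqrtM_pos v)]
    have hm := sqrtM_pos v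
    calc _ ≤ sqrtM v * (Λ * jap v ^ 2) * (X * jap v * (ϑ y)⁻¹) :=
          mul_le_mul (mul_le_mul_of_nonneg_left (hlog s hs _ v).2 hm.le) (hX s hs y v)
            (abs_nonneg _) (by positivity)
      _ = _ := by ring
  obtain ⟨hRi, hI, he⟩ := integral_along hS.continuous hm hH hle ht
  -- Entropy production, integrated first in velocity at fixed position.
  have hneg : ∀ s ∈ Icc 0 T, ∫ p : Ω × E3, R s p.1 p.2 ≤ 0 := by
    intro s hs
    have hi := integrable_slice hS.continuous hm hH hle hs
    rw [Measure.volume_eq_prod] at hi ⊢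
    rw [integral_prod _ hi]
    refine integral_nonpos fun x => ?_
    have hφ := hS.polyBounded_shift hf.admissible s x
    refine integral_log_mul_reaction_nonpos hK hφ (fun v => (hlog s hs x v).1) ?_
    exact PolyBounded.of_le (Real.measurable_log.comp (hφ.measurable.div measurable_sqrtM))
      fun v => (hlog s hs x v).2
  have hent : ∀ s ∈ Icc 0 T, Integrable fun p : Ω × E3 => relEntropy (f s p.1) p.2 := by
    intro s hs
    refine integrable_relEntropy (measurable_slice hf.admissible.measurable s) hM
      (fun x => (hf.admissible.decays hS.one_le_beta s x).abs_le) (hf.admissible.nonneg s) ?_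
    have := (hf.integrable_moment hS hϑ (polyBounded_jap_pow 2) hs).abs
    refine this.congr (Eventually.of_forall fun p => ?_)
    have hw : 0 ≤ sqrtM p.2 * jap p.2 ^ 2 :=
      mul_nonneg (sqrtM_pos _).le (pow_nonneg (jap_pos _).le 2)
    simp only [abs_mul (sqrtM p.2 * jap p.2 ^ 2), abs_of_nonneg hw]
  have hent0 := hent 0 ⟨le_rfl, hT⟩
  have hf0 : ∀ x, f 0 x = f₀ x := fun x => funext fun v => hf.zero x v
  simp only [hf0] at hent0
  refine ⟨hent t ht, ?_⟩
  have hpt : ∀ p : Ω × E3, relEntropy (f t (p.1 + π (t • p.2))) p.2 =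
      relEntropy (f₀ p.1) p.2 + ∫ s in (0 : ℝ)..t, R s (p.1 + π (s • p.2)) p.2 := by
    rintro ⟨y, v⟩
    have hmv := sqrtM_pos v
    have hz : IsPrim T (fun s => shift (f s (y + π (s • v))) v / sqrtM v)
        (fun s => (sqrtM v)⁻¹ * reaction γ b (shift (f s (y + π (s • v)))) v) := by
      refine ((isPrim_const (sqrtM v)⁻¹).mul ((isPrim_const (sqrtM v)).add
        (hf.isPrim hS y v))).congr hT (fun s _ => ?_) (Eventually.of_forall fun s _ => ?_)
      · simp only [shift]; ring
      · ring
    obtain ⟨B, hB, hlow⟩ := hf.exists_le_shift hS hc.le h0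
    set lo := c * Real.exp (-(B * jap v)) with hlo
    set hi := (1 + M) / sqrtM v with hhi
    have hlo0 : 0 < lo := by positivity
    -- On a fixed characteristic F / μ stays in [lo, hi] with lo > 0, away from the singularity of
    -- the logarithm at vacuum; there `klFun` is C¹ with derivative the logarithm.
    have hcomp := hz.comp (φ := klFun) (φ' := Real.log) (lo := lo) (hi := hi)
      (contDiffOn_klFun hlo0) (fun r hr => hasDerivAt_klFun (hlo0.trans_le hr.1).ne')
      (fun s hs => by
        rw [uIcc_of_le hT] at hs
        have h1 := hlow s hs (y + π (s • v)) v
        have h2 := (hf.admissible.decays hS.one_le_beta s (y + π (s • v))).abs_le v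
        have h3 := (le_abs_self _).trans h2
        have h4 := sqrtM_le_one v
        refine ⟨(le_div_iff₀ hmv).2 ?_, div_le_div_of_nonneg_right ?_ hmv.le⟩
        · simp only [hlo]; linarith
        · simp only [shift]; linarith)
    have := hcomp.eq_add_integral hT ht
    simp only [zero_smul, map_zero, add_zero, hf0] at this
    simp only [relEntropy]
    rw [this, mul_add, ← intervalIntegral.integral_const_mul]
    congr 1
    refine intervalIntegral.integral_congr fun s _ => ?_
    simp only [hR]
    field_simp
  have hmt := measurable_slice (R := fun s x v => relEntropy (f s x) v)
    (measurable_relEntropy (F := fun p : ℝ × Ω => f p.1 p.2) hf.admissible.measurable) t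
  rw [← integral_transport (h := fun x v => relEntropy (f t x) v) hS.continuous hmt t]
  simp only [hpt]
  rw [integral_add hent0 hI, he]
  have : ∫ s in (0 : ℝ)..t, ∫ p : Ω × E3, R s p.1 p.2 ≤ ∫ _ in (0 : ℝ)..t, (0 : ℝ) :=
    intervalIntegral.integral_mono_on ht.1 hRi intervalIntegrable_const
      fun s hs => hneg s ⟨hs.1, hs.2.trans ht.2⟩
  rw [intervalIntegral.integral_zero] at this
  linarith

end DecayingEntropy

/-! ### Conservation laws and entropy inequality for data with finite defects -/

section Fatou

open Filter

/-- Fatou's lemma with a varying upper bound; it yields integrability of the limit together with the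
inequality. -/
lemma integrable_of_tendsto_of_integral_le {α : Type*} [MeasurableSpace α] {μ : Measure α}
    {F : ℕ → α → ℝ} {G : α → ℝ} {c : ℕ → ℝ} {l : ℝ} (hF : ∀ n, Measurable (F n))
    (hF0 : ∀ n x, 0 ≤ F n x) (hFi : ∀ n, Integrable (F n) μ) (hFc : ∀ n, ∫ x, F n x ∂μ ≤ c n)
    (hc : Tendsto c atTop (nhds l)) (hG : ∀ x, Tendsto (fun n => F n x) atTop (nhds (G x))) :
    Integrable G μ ∧ ∫ x, G x ∂μ ≤ l := by
  have hl : 0 ≤ l := ge_of_tendsto' hc fun n => (integral_nonneg (hF0 n)).trans (hFc n)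
  have h : ∫⁻ x, ENNReal.ofReal (G x) ∂μ ≤ ENNReal.ofReal l := by
    calc ∫⁻ x, ENNReal.ofReal (G x) ∂μ
        = ∫⁻ x, liminf (fun n => ENNReal.ofReal (F n x)) atTop ∂μ := by
          congr 1; ext x
          exact ((ENNReal.tendsto_ofReal (hG x)).liminf_eq).symm
      _ ≤ liminf (fun n => ∫⁻ x, ENNReal.ofReal (F n x) ∂μ) atTop :=
          lintegral_liminf_le fun n => (hF n).ennreal_ofReal
      _ ≤ liminf (fun n => ENNReal.ofReal (c n)) atTop := by
          refine liminf_le_liminf (Eventually.of_forall fun n => ?_)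
          rw [← ofReal_integral_eq_lintegral_ofReal (hFi n) (Eventually.of_forall (hF0 n))]
          exact ENNReal.ofReal_le_ofReal (hFc n)
      _ = ENNReal.ofReal l := (ENNReal.tendsto_ofReal hc).liminf_eq
  have := integrable_of_lintegral_le (measurable_of_tendsto_metrizable hF (tendsto_pi_nhds.2 hG))
    (fun x => ge_of_tendsto' (hG x) fun n => hF0 n x) ENNReal.ofReal_ne_top h
  rwa [ENNReal.toReal_ofReal hl] at this

end Fatou

section Limit

set_option linter.unusedSectionVars false

open Filter InformationTheory

variable {Ω : Type} [AddCommGroup Ω] [TopologicalSpace Ω] [IsTopologicalAddGroup Ω]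
  [SecondCountableTopology Ω] [MeasureSpace Ω] [BorelSpace Ω] [SigmaFinite (volume : Measure Ω)]
  [(volume : Measure Ω).IsAddLeftInvariant]
  {γ β : ℝ} {b : ℝ → ℝ} {C M M₀ A T : ℝ} {π : E3 →+ Ω} {f₀ : Ω → E3 → ℝ} {θ : Ω → ℝ}

/-- A slowly varying weight on the position space whose fourth power is an integrable decay
rate. -/
structure SpaceWeight (π : E3 →+ Ω) (θ : Ω → ℝ) : Prop where
  measurable : Measurable θ
  one_le : ∀ x, 1 ≤ θ x
  slow : SlowOn π θ
  decayRate : IntegrableRate π fun x => θ x ^ 4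

/-- A cut-off factor in space. -/
def cutoff (θ : Ω → ℝ) (n : ℕ) (x : Ω) : ℝ :=
  if θ x ≤ n + 2 then 1 - ((n : ℝ) + 2)⁻¹ else 0

lemma inv_add_two_mem (n : ℕ) : 0 < ((n : ℝ) + 2)⁻¹ ∧ ((n : ℝ) + 2)⁻¹ ≤ 1 :=
  ⟨by positivity, inv_le_one_of_one_le₀ (by have : (0 : ℝ) ≤ n := n.cast_nonneg; linarith)⟩

lemma cutoff_nonneg (n : ℕ) (x : Ω) : 0 ≤ cutoff θ n x := by
  have := inv_add_two_mem n
  rw [cutoff]; split_ifs <;> linarith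

lemma cutoff_le (n : ℕ) (x : Ω) : cutoff θ n x ≤ 1 - ((n : ℝ) + 2)⁻¹ := by
  have := inv_add_two_mem n
  rw [cutoff]; split_ifs <;> linarith

lemma cutoff_le_one (n : ℕ) (x : Ω) : cutoff θ n x ≤ 1 :=
  (cutoff_le n x).trans (by linarith [inv_add_two_mem n])

/-- The cut-off error is small relative to the growing weight θ. Stability with κ = θ then gives
pointwise convergence, although the error is not uniformly small. -/
lemma SpaceWeight.one_sub_cutoff_le (hθ : SpaceWeight π θ) (n : ℕ) (x : Ω) :
    1 - cutoff θ n x ≤ ((n : ℝ) + 2)⁻¹ * θ x := by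
  have h1 := hθ.one_le x
  have h2 := inv_add_two_mem n
  rw [cutoff]; split_ifs with h
  · nlinarith
  · rw [sub_zero, ← div_eq_inv_mul, one_le_div (by positivity)]
    exact (not_le.1 h).le

lemma SpaceWeight.cutoff_mul_le (hθ : SpaceWeight π θ) (n : ℕ) (x : Ω) :
    cutoff θ n x ≤ ((n : ℝ) + 2) ^ 4 * (θ x ^ 4)⁻¹ := by
  have h1 := hθ.one_le x
  have h2 := inv_add_two_mem n
  rw [cutoff]; split_ifs with h
  · rw [← div_eq_mul_inv]
    refine le_trans (by linarith) ((one_le_div (by positivity)).2 ?_)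
    gcongr
  · positivity

lemma SpaceWeight.measurable_cutoff (hθ : SpaceWeight π θ) (n : ℕ) : Measurable (cutoff θ n) :=
  Measurable.ite (measurableSet_le hθ.measurable measurable_const) measurable_const
    measurable_const

lemma tendsto_inv_add_two_mul (c : ℝ) :
    Tendsto (fun n : ℕ => ((n : ℝ) + 2)⁻¹ * c) atTop (nhds 0) := by
  have h : Tendsto (fun n : ℕ => ((n : ℝ) + 2)⁻¹) atTop (nhds 0) :=
    tendsto_inv_atTop_zero.comp (tendsto_atTop_add_const_right _ _ tendsto_natCast_atTop_atTop)
  simpa using h.mul_const c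

lemma SpaceWeight.tendsto_cutoff (hθ : SpaceWeight π θ) (x : Ω) :
    Tendsto (fun n => cutoff θ n x) atTop (nhds 1) := by
  have h : Tendsto (fun n : ℕ => 1 - ((n : ℝ) + 2)⁻¹ * θ x) atTop (nhds 1) := by
    simpa using (tendsto_inv_add_two_mul (θ x)).const_sub 1
  exact tendsto_of_tendsto_of_tendsto_of_le_of_le h tendsto_const_nhds
    (fun n => by have := hθ.one_sub_cutoff_le n x; simp only; linarith)
    (fun n => cutoff_le_one n x)

/-- Data cut off in space. -/
def cutData (θ : Ω → ℝ) (f₀ : Ω → E3 → ℝ) (n : ℕ) (x : Ω) (v : E3) : ℝ :=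
  cutoff θ n x * f₀ x v

lemma abs_cutData_le (n : ℕ) (x : Ω) (v : E3) : |cutData θ f₀ n x v| ≤ |f₀ x v| := by
  rw [cutData, abs_mul, abs_of_nonneg (cutoff_nonneg n x)]
  exact mul_le_of_le_one_left (abs_nonneg _) (cutoff_le_one n x)

/-- The cut density is a convex combination of μ and F₀ in which μ keeps at least the share 1 / (n +
2). This provides the positive lower bound needed for the logarithm. -/
lemma le_shift_cutData (h0 : ∀ x v, 0 ≤ shift (f₀ x) v) (n : ℕ) (x : Ω) (v : E3) :
    ((n : ℝ) + 2)⁻¹ * sqrtM v ≤ shift (cutData θ f₀ n x) v := by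
  have h1 := mul_nonneg (cutoff_nonneg (θ := θ) n x) (h0 x v)
  have h2 := mul_le_mul_of_nonneg_right (cutoff_le (θ := θ) n x) (sqrtM_pos v).le
  simp only [shift, cutData] at h1 ⊢
  linarith

lemma SpaceWeight.measurable_cutData (hθ : SpaceWeight π θ)
    (hm : Measurable fun p : Ω × E3 => f₀ p.1 p.2) (n : ℕ) :
    Measurable fun p : Ω × E3 => cutData θ f₀ n p.1 p.2 :=
  ((hθ.measurable_cutoff n).comp measurable_fst).mul hm

lemma SpaceWeight.admissibleData_cutData (hθ : SpaceWeight π θ) (hf₀ : AdmissibleData β M₀ f₀)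
    (n : ℕ) : AdmissibleData β M₀ (cutData θ f₀ n) :=
  ⟨hθ.measurable_cutData hf₀.measurable n,
    fun x v => (abs_cutData_le n x v).trans (hf₀.bound x v),
    fun x v => (mul_nonneg (inv_add_two_mem n).1.le (sqrtM_pos v).le).trans
      (le_shift_cutData hf₀.nonneg n x v)⟩

lemma SpaceWeight.tendsto_cutData (hθ : SpaceWeight π θ) (x : Ω) (v : E3) :
    Tendsto (fun n => cutData θ f₀ n x v) atTop (nhds (f₀ x v)) := by
  have h := (hθ.tendsto_cutoff x).mul_const (f₀ x v)
  rw [one_mul] at h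
  exact h

lemma DecayingSolution.mono {ϑ : Ω → ℝ} {f : ℝ → Ω → E3 → ℝ} {A' : ℝ} (hϑ : GrowthOn π ϑ)
    (hf : DecayingSolution γ b π β M A T ϑ f₀ f) (h : A ≤ A') :
    DecayingSolution γ b π β M A' T ϑ f₀ f :=
  ⟨hf.nonneg_time, hf.time_le, hf.nonneg.trans h, hf.admissible, fun t ht x v =>
    (hf.decay t ht x v).trans (mul_le_mul_of_nonneg_right h
      (mul_nonneg (inv_pos.2 (weight_pos _ _)).le (inv_pos.2 (hϑ.pos _)).le)), hf.eq⟩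

/-- Cut-off data are supported where θ ≤ n + 2 and so trivially decay like θ⁻⁴. The decay constant
grows with n, but no limit estimate depends on it. -/
lemma SpaceWeight.exists_decayingSolution (hθ : SpaceWeight π θ) (hS : Setting γ β b C π)
    (hf₀ : AdmissibleData β M₀ f₀) (hT : Short C M₀ M T) (hM : 0 ≤ M) (n : ℕ) :
    ∃ A, DecayingSolution γ b π β M A T (fun x => θ x ^ 4) (cutData θ f₀ n)
      (sol γ b π T (cutData θ f₀ n)) := by
  have hf := hθ.admissibleData_cutData hf₀ n
  have hM₀ := hf₀.nonneg_const
  have hr := hS.rate_pos hM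
  refine ⟨2 * (M₀ * ((n : ℝ) + 2) ^ 4) * Real.exp (rate C M * T), hT.nonneg, hT.le_one,
    by positivity, hS.admissible_sol hf hT hM, fun t ht x v => ?_,
    fun t ht y v => hS.charStep_sol hf hT hM ht y v⟩
  have h0 : ∀ x v, |cutData θ f₀ n x v| ≤
      M₀ * ((n : ℝ) + 2) ^ 4 * ((weight β v)⁻¹ * (θ x ^ 4)⁻¹) := by
    intro x v
    rw [cutData, abs_mul, abs_of_nonneg (cutoff_nonneg n x)]
    have hw := inv_pos.2 (weight_pos β v)
    have := hθ.one_le x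
    calc _ ≤ ((n : ℝ) + 2) ^ 4 * (θ x ^ 4)⁻¹ * (M₀ * (weight β v)⁻¹) :=
          mul_le_mul (hθ.cutoff_mul_le n x) (hf₀.bound x v) (abs_nonneg _) (by positivity)
      _ = _ := by ring
  refine (hS.abs_sol_decay hf hT hM hθ.decayRate.growth (by positivity) h0 ht x v).trans ?_
  have hw := inv_pos.2 (weight_pos β v)
  have hp := inv_pos.2 (hθ.decayRate.growth.pos (x - π (t • v)))
  have := ht.2
  gcongr

lemma SpaceWeight.tendsto_sol (hθ : SpaceWeight π θ) (hS : Setting γ β b C π)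
    (hf₀ : AdmissibleData β M₀ f₀) (hT : Short C M₀ M T) (hM : 0 ≤ M) {t : ℝ} (ht : t ∈ Icc 0 T)
    (x : Ω) (v : E3) : Tendsto (fun n => sol γ b π T (cutData θ f₀ n) t x v) atTop
      (nhds (sol γ b π T f₀ t x v)) := by
  rw [tendsto_iff_dist_tendsto_zero]
  have hM₀ := hf₀.nonneg_const
  refine squeeze_zero (fun _ => dist_nonneg) (fun n => ?_) (tendsto_inv_add_two_mul
    (2 * M₀ * Real.exp (rate C M * t) * ((weight (β - 2) v)⁻¹ * θ (x - π (t • v)))))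
  have h0 : ∀ x v, |cutData θ f₀ n x v - f₀ x v| ≤
      ((n : ℝ) + 2)⁻¹ * M₀ * ((weight (β - 2) v)⁻¹ * θ x) := by
    intro x v
    have e : cutData θ f₀ n x v - f₀ x v = -((1 - cutoff θ n x) * f₀ x v) := by
      rw [cutData]; ring
    have h1 := hθ.one_le x
    have h2 := inv_add_two_mem n
    rw [e, abs_neg, abs_mul, abs_of_nonneg (by linarith [cutoff_le_one (θ := θ) n x])]
    calc _ ≤ ((n : ℝ) + 2)⁻¹ * θ x * (M₀ * (weight (β - 2) v)⁻¹) :=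
          mul_le_mul (hθ.one_sub_cutoff_le n x) ((hf₀.bound x v).trans
            (mul_le_mul_of_nonneg_left (weight_inv_le β v) hM₀)) (abs_nonneg _)
            (mul_nonneg h2.1.le (by linarith))
      _ = _ := by ring
  rw [Real.dist_eq]
  refine (hS.abs_sol_sub_sol_le (hθ.admissibleData_cutData hf₀ n) hf₀ hT hM hθ.slow
    (mul_nonneg (inv_add_two_mem n).1.le hM₀) h0 ht x v).trans (le_of_eq ?_)
  ring

lemma momentWeight_nonneg (v : E3) : 0 ≤ sqrtM v * jap v ^ 2 :=
  mul_nonneg (sqrtM_pos v).le (pow_nonneg (jap_pos v).le 2)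

lemma measurable_momentWeight {α : Type*} [MeasurableSpace α] :
    Measurable fun p : α × E3 => sqrtM p.2 * jap p.2 ^ 2 :=
  measurable_sqrtM_snd.mul ((measurable_jap.comp measurable_snd).pow_const 2)

lemma SpaceWeight.tendsto_integral_cutData_sub (hθ : SpaceWeight π θ)
    (hm : Measurable fun p : Ω × E3 => f₀ p.1 p.2)
    (hi : Integrable fun p : Ω × E3 => sqrtM p.2 * jap p.2 ^ 2 * |f₀ p.1 p.2|) {h : Ω → E3 → ℝ}
    (hhm : Measurable fun p : Ω × E3 => h p.1 p.2) (hh : ∀ x v, |h x v| ≤ |f₀ x v|) :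
    Tendsto (fun n => ∫ p : Ω × E3, sqrtM p.2 * jap p.2 ^ 2 *
      |h p.1 p.2 - cutData θ f₀ n p.1 p.2|) atTop
      (nhds (∫ p : Ω × E3, sqrtM p.2 * jap p.2 ^ 2 * |h p.1 p.2 - f₀ p.1 p.2|)) := by
  refine tendsto_integral_of_dominated_convergence
    (fun p => 2 * (sqrtM p.2 * jap p.2 ^ 2 * |f₀ p.1 p.2|)) (fun n => ?_) (hi.const_mul 2)
    (fun n => Eventually.of_forall fun p => ?_) (Eventually.of_forall fun p => ?_)
  · exact (measurable_momentWeight.mul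
      (hhm.sub (hθ.measurable_cutData hm n)).abs).aestronglyMeasurable
  · rw [Real.norm_of_nonneg (mul_nonneg (momentWeight_nonneg _) (abs_nonneg _))]
    have h1 := abs_sub (h p.1 p.2) (cutData θ f₀ n p.1 p.2)
    have h2 := hh p.1 p.2
    have h3 := abs_cutData_le (θ := θ) (f₀ := f₀) n p.1 p.2
    calc _ ≤ sqrtM p.2 * jap p.2 ^ 2 * (2 * |f₀ p.1 p.2|) :=
          mul_le_mul_of_nonneg_left (by linarith) (momentWeight_nonneg _)
      _ = _ := by ring
  · exact (((hθ.tendsto_cutData p.1 p.2).const_sub _).abs).const_mul _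

/-- Solutions with cut-off data approximate the solution in the weighted `L¹` norm. -/
lemma SpaceWeight.tendsto_integral_sol_sub (hθ : SpaceWeight π θ) (hS : Setting γ β b C π)
    (hf₀ : AdmissibleData β M₀ f₀) (hT : Short C M₀ M T) (hM : 0 ≤ M)
    (hi : Integrable fun p : Ω × E3 => sqrtM p.2 * jap p.2 ^ 2 * |f₀ p.1 p.2|)
    {t : ℝ} (ht : t ∈ Icc 0 T) :
    (∀ n, Integrable fun p : Ω × E3 => sqrtM p.2 * jap p.2 ^ 2 *
      |sol γ b π T (cutData θ f₀ n) t p.1 p.2 - sol γ b π T f₀ t p.1 p.2|) ∧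
    Tendsto (fun n => ∫ p : Ω × E3, sqrtM p.2 * jap p.2 ^ 2 *
      |sol γ b π T (cutData θ f₀ n) t p.1 p.2 - sol γ b π T f₀ t p.1 p.2|) atTop (nhds 0) := by
  obtain ⟨X, hX⟩ := hS.exists_integral_abs_sub_le M
  choose A hA using hθ.exists_decayingSolution hS hf₀ hT hM
  have hm := hf₀.measurable
  have hmn := fun n => hθ.measurable_cutData hm n
  have hsol : ∀ n, Measurable fun p : Ω × E3 => sol γ b π T (cutData θ f₀ n) t p.1 p.2 :=
    fun n => measurable_slice (hA n).admissible.measurable t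
  have hsi : ∀ n, Integrable fun p : Ω × E3 => sqrtM p.2 * jap p.2 ^ 2 *
      sol γ b π T (cutData θ f₀ n) t p.1 p.2 := fun n =>
    (hA n).integrable_moment hS hθ.decayRate (polyBounded_jap_pow 2) ht
  have key : ∀ n, (Integrable fun p : Ω × E3 => sqrtM p.2 * jap p.2 ^ 2 *
      |sol γ b π T (cutData θ f₀ n) t p.1 p.2 - sol γ b π T f₀ t p.1 p.2|) ∧
      ∫ p : Ω × E3, sqrtM p.2 * jap p.2 ^ 2 *
        |sol γ b π T (cutData θ f₀ n) t p.1 p.2 - sol γ b π T f₀ t p.1 p.2| ≤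
      X * ∫ p : Ω × E3, sqrtM p.2 * jap p.2 ^ 2 * |cutData θ f₀ n p.1 p.2 - f₀ p.1 p.2| := by
    intro n
    -- Stability is available only between two decaying solutions. The n-th is compared with the
    -- k-th, and k → ∞ by Fatou; afterwards n → ∞.
    refine integrable_of_tendsto_of_integral_le (F := fun k (p : Ω × E3) =>
      sqrtM p.2 * jap p.2 ^ 2 * |sol γ b π T (cutData θ f₀ n) t p.1 p.2 -
        sol γ b π T (cutData θ f₀ k) t p.1 p.2|)
      (c := fun k => X * ∫ p : Ω × E3, sqrtM p.2 * jap p.2 ^ 2 *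
        |cutData θ f₀ n p.1 p.2 - cutData θ f₀ k p.1 p.2|)
      (fun k => measurable_momentWeight.mul ((hsol n).sub (hsol k)).abs)
      (fun k p => mul_nonneg (momentWeight_nonneg _) (abs_nonneg _)) (fun k => ?_) (fun k => ?_)
      ((hθ.tendsto_integral_cutData_sub hm hi (hmn n) (abs_cutData_le n)).const_mul X)
      (fun p => (((hθ.tendsto_sol hS hf₀ hT hM ht p.1 p.2).const_sub _).abs).const_mul _)
    · refine (((hsi n).sub (hsi k)).abs).congr (Eventually.of_forall fun p => ?_)
      simp only [Pi.sub_apply]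
      rw [← mul_sub, abs_mul, abs_of_nonneg (momentWeight_nonneg _)]
    -- The stability estimate asks for a common decay constant, whose value is irrelevant.
    · exact hX hθ.decayRate ((hA n).mono hθ.decayRate.growth (le_max_left (A n) (A k)))
        ((hA k).mono hθ.decayRate.growth (le_max_right (A n) (A k))) t ht
  refine ⟨fun n => (key n).1, ?_⟩
  have hz : Tendsto (fun n => X * ∫ p : Ω × E3, sqrtM p.2 * jap p.2 ^ 2 *
      |cutData θ f₀ n p.1 p.2 - f₀ p.1 p.2|) atTop (nhds 0) := by
    have := (hθ.tendsto_integral_cutData_sub hm hi hm fun _ _ => le_rfl).const_mul X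
    simp only [sub_self, abs_zero, mul_zero, integral_zero] at this
    simpa only [abs_sub_comm] using this
  exact squeeze_zero (fun n => integral_nonneg fun p =>
    mul_nonneg (momentWeight_nonneg _) (abs_nonneg _)) (fun n => (key n).2) hz

lemma integrable_moment_of_abs {φ : Ω → E3 → ℝ} (hm : Measurable fun p : Ω × E3 => φ p.1 p.2)
    (hi : Integrable fun p : Ω × E3 => sqrtM p.2 * jap p.2 ^ 2 * |φ p.1 p.2|) {ψ : E3 → ℝ}
    (hψ : Measurable ψ) {L : ℝ} (hle : ∀ v, |ψ v| ≤ L * jap v ^ 2) :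
    Integrable fun p : Ω × E3 => sqrtM p.2 * ψ p.2 * φ p.1 p.2 := by
  refine (hi.const_mul L).mono' ((measurable_sqrtM_snd.mul
    (hψ.comp measurable_snd)).mul hm).aestronglyMeasurable (Eventually.of_forall fun p => ?_)
  rw [Real.norm_eq_abs, abs_mul, abs_mul, abs_of_pos (sqrtM_pos _)]
  calc _ ≤ sqrtM p.2 * (L * jap p.2 ^ 2) * |φ p.1 p.2| :=
        mul_le_mul_of_nonneg_right (mul_le_mul_of_nonneg_left (hle _) (sqrtM_pos _).le)
          (abs_nonneg _)
    _ = _ := by ring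

lemma tendsto_moment {F : ℕ → Ω → E3 → ℝ} {φ : Ω → E3 → ℝ}
    (hF : ∀ n, Measurable fun p : Ω × E3 => F n p.1 p.2)
    (hφ : Measurable fun p : Ω × E3 => φ p.1 p.2)
    (hφi : Integrable fun p : Ω × E3 => sqrtM p.2 * jap p.2 ^ 2 * |φ p.1 p.2|)
    (hi : ∀ n, Integrable fun p : Ω × E3 => sqrtM p.2 * jap p.2 ^ 2 * |F n p.1 p.2 - φ p.1 p.2|)
    (h : Tendsto (fun n => ∫ p : Ω × E3, sqrtM p.2 * jap p.2 ^ 2 * |F n p.1 p.2 - φ p.1 p.2|)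
      atTop (nhds 0)) {ψ : E3 → ℝ} (hψ : Measurable ψ) {L : ℝ}
    (hle : ∀ v, |ψ v| ≤ L * jap v ^ 2) :
    Tendsto (fun n => ∫ p : Ω × E3, sqrtM p.2 * ψ p.2 * F n p.1 p.2) atTop
      (nhds (∫ p : Ω × E3, sqrtM p.2 * ψ p.2 * φ p.1 p.2)) := by
  rw [tendsto_iff_dist_tendsto_zero]
  have h' := h.const_mul L
  rw [mul_zero] at h'
  refine squeeze_zero (fun _ => dist_nonneg) (fun n => ?_) h'
  have i1 := integrable_moment_of_abs hφ hφi hψ hle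
  have i2 := integrable_moment_of_abs (φ := fun x v => F n x v - φ x v) ((hF n).sub hφ) (hi n)
    hψ hle
  have e : ∀ p : Ω × E3, sqrtM p.2 * ψ p.2 * F n p.1 p.2 =
      sqrtM p.2 * ψ p.2 * (F n p.1 p.2 - φ p.1 p.2) + sqrtM p.2 * ψ p.2 * φ p.1 p.2 :=
    fun p => by ring
  rw [Real.dist_eq]
  simp only [e]
  rw [integral_add i2 i1, add_sub_cancel_right, ← integral_const_mul]
  refine (abs_integral_le_integral_abs).trans (integral_mono i2.abs ((hi n).const_mul L)
    fun p => ?_)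
  simp only [abs_mul, abs_of_pos (sqrtM_pos _)]
  calc _ ≤ sqrtM p.2 * (L * jap p.2 ^ 2) * |F n p.1 p.2 - φ p.1 p.2| :=
        mul_le_mul_of_nonneg_right (mul_le_mul_of_nonneg_left (hle _) (sqrtM_pos _).le)
          (abs_nonneg _)
    _ = _ := by ring

/-- Finite defects propagate, and the moments of collision invariants are conserved. -/
lemma SpaceWeight.moments_sol (hθ : SpaceWeight π θ) (hS : Setting γ β b C π)
    (hf₀ : AdmissibleData β M₀ f₀) (hT : Short C M₀ M T) (hM : 0 ≤ M)
    (hi : Integrable fun p : Ω × E3 => sqrtM p.2 * jap p.2 ^ 2 * |f₀ p.1 p.2|)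
    {t : ℝ} (ht : t ∈ Icc 0 T) :
    (Integrable fun p : Ω × E3 => sqrtM p.2 * jap p.2 ^ 2 * |sol γ b π T f₀ t p.1 p.2|) ∧
    ∀ {ψ : E3 → ℝ}, Measurable ψ → IsInvariant ψ → ∀ {L : ℝ}, (∀ v, |ψ v| ≤ L * jap v ^ 2) →
      ∫ p : Ω × E3, sqrtM p.2 * ψ p.2 * sol γ b π T f₀ t p.1 p.2 =
        ∫ p : Ω × E3, sqrtM p.2 * ψ p.2 * f₀ p.1 p.2 := by
  obtain ⟨hni, hn⟩ := hθ.tendsto_integral_sol_sub hS hf₀ hT hM hi ht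
  choose A hA using hθ.exists_decayingSolution hS hf₀ hT hM
  have hm := hf₀.measurable
  have hmn := fun n => hθ.measurable_cutData hm n
  have hsn : ∀ n, Measurable fun p : Ω × E3 => sol γ b π T (cutData θ f₀ n) t p.1 p.2 :=
    fun n => measurable_slice (hA n).admissible.measurable t
  have hs : Measurable fun p : Ω × E3 => sol γ b π T f₀ t p.1 p.2 :=
    measurable_slice (hS.admissible_sol hf₀ hT hM).measurable t
  have hsi : Integrable fun p : Ω × E3 => sqrtM p.2 * jap p.2 ^ 2 *
      |sol γ b π T f₀ t p.1 p.2| := by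
    -- Any single approximant suffices here: its moment and its distance to the solution are both
    -- integrable.
    have h0 := ((hA 0).integrable_moment hS hθ.decayRate (polyBounded_jap_pow 2) ht).abs
    refine (h0.add (hni 0)).mono' (measurable_momentWeight.mul hs.abs).aestronglyMeasurable
      (Eventually.of_forall fun p => ?_)
    have hw := momentWeight_nonneg p.2
    have h1 := abs_sub_abs_le_abs_sub (sol γ b π T f₀ t p.1 p.2)
      (sol γ b π T (cutData θ f₀ 0) t p.1 p.2)
    rw [abs_sub_comm] at h1
    rw [Real.norm_of_nonneg (mul_nonneg hw (abs_nonneg _)), Pi.add_apply,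
      abs_mul, abs_of_nonneg hw, ← mul_add]
    exact mul_le_mul_of_nonneg_left (by linarith) hw
  refine ⟨hsi, fun {ψ} hψ hinv {L} hle => ?_⟩
  have t1 := tendsto_moment hsn hs hsi hni hn hψ hle
  have hcut : ∀ n, Integrable fun p : Ω × E3 => sqrtM p.2 * jap p.2 ^ 2 *
      |cutData θ f₀ n p.1 p.2 - f₀ p.1 p.2| := by
    intro n
    refine hi.mono' (measurable_momentWeight.mul ((hmn n).sub hm).abs).aestronglyMeasurable
      (Eventually.of_forall fun p => ?_)
    have hw := momentWeight_nonneg p.2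
    rw [Real.norm_of_nonneg (mul_nonneg hw (abs_nonneg _))]
    refine mul_le_mul_of_nonneg_left ?_ hw
    have e : cutData θ f₀ n p.1 p.2 - f₀ p.1 p.2 = -((1 - cutoff θ n p.1) * f₀ p.1 p.2) := by
      rw [cutData]; ring
    have h1 := cutoff_le_one (θ := θ) n p.1
    have h2 := cutoff_nonneg (θ := θ) n p.1
    rw [e, abs_neg, abs_mul, abs_of_nonneg (by linarith)]
    exact mul_le_of_le_one_left (abs_nonneg _) (by linarith)
  have hz : Tendsto (fun n => ∫ p : Ω × E3, sqrtM p.2 * jap p.2 ^ 2 *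
      |cutData θ f₀ n p.1 p.2 - f₀ p.1 p.2|) atTop (nhds 0) := by
    have := hθ.tendsto_integral_cutData_sub hm hi hm fun _ _ => le_rfl
    simp only [sub_self, abs_zero, mul_zero, integral_zero] at this
    simpa only [abs_sub_comm] using this
  have t2 := tendsto_moment hmn hm hi hcut hz hψ hle
  refine tendsto_nhds_unique t1 (t2.congr fun n => ?_)
  exact ((hA n).moment_eq hS hθ.decayRate (PolyBounded.of_le hψ hle) hinv ht).symm

/-- Convexity of `klFun`, which vanishes at 1: mixing with the Maxwellian does not increase relative
entropy, so cut-off data have at most the entropy of the original data. -/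
lemma relEntropy_const_mul_le {φ : E3 → ℝ} {r : ℝ} (hr0 : 0 ≤ r) (hr : r ≤ 1) {v : E3}
    (h : 0 ≤ shift φ v) : relEntropy (fun u => r * φ u) v ≤ relEntropy φ v := by
  have hm := sqrtM_pos v
  have hq : 0 ≤ shift φ v / sqrtM v := div_nonneg h hm.le
  have e : shift (fun u => r * φ u) v / sqrtM v = (1 - r) • (1 : ℝ) + r • (shift φ v / sqrtM v) := by
    simp only [shift, smul_eq_mul]; field_simp; ring
  have hc := convexOn_klFun.2 (mem_Ici.2 zero_le_one) (mem_Ici.2 hq) (sub_nonneg.2 hr) hr0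
    (by ring)
  rw [← e, klFun_one, smul_zero, zero_add, smul_eq_mul] at hc
  refine mul_le_mul_of_nonneg_left (hc.trans ?_) (mul_self_nonneg _)
  exact mul_le_of_le_one_left (klFun_nonneg hq) hr

/-- The entropy inequality. -/
lemma SpaceWeight.integral_relEntropy_sol_le (hθ : SpaceWeight π θ) (hS : Setting γ β b C π)
    (hf₀ : AdmissibleData β M₀ f₀) (hT : Short C M₀ M T) (hM : 0 ≤ M)
    (hi : Integrable fun p : Ω × E3 => sqrtM p.2 * jap p.2 ^ 2 * |f₀ p.1 p.2|)
    {t : ℝ} (ht : t ∈ Icc 0 T) :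
    Integrable (fun p : Ω × E3 => relEntropy (f₀ p.1) p.2) ∧
    Integrable (fun p : Ω × E3 => relEntropy (sol γ b π T f₀ t p.1) p.2) ∧
    ∫ p : Ω × E3, relEntropy (sol γ b π T f₀ t p.1) p.2 ≤
      ∫ p : Ω × E3, relEntropy (f₀ p.1) p.2 := by
  choose A hA using hθ.exists_decayingSolution hS hf₀ hT hM
  have hβ : 0 ≤ β := by linarith [hS.lt_beta]
  have hb : ∀ x v, |f₀ x v| ≤ M₀ := fun x v => (hf₀.bound x v).trans
    (mul_le_of_le_one_right hf₀.nonneg_const (weight_inv_le_one hβ v))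
  have h0 := integrable_relEntropy hf₀.measurable hf₀.nonneg_const hb hf₀.nonneg hi
  have hcut : ∀ n, Integrable fun p : Ω × E3 => relEntropy (cutData θ f₀ n p.1) p.2 := fun n =>
    h0.mono' (measurable_relEntropy (hθ.measurable_cutData hf₀.measurable n)).aestronglyMeasurable
      (Eventually.of_forall fun p => by
        rw [Real.norm_of_nonneg (relEntropy_nonneg
          ((hθ.admissibleData_cutData hf₀ n).nonneg _ _))]
        exact relEntropy_const_mul_le (cutoff_nonneg n p.1) (cutoff_le_one n p.1)
          (hf₀.nonneg _ _))
  have hent := fun n => (hA n).integral_relEntropy_le hS hθ.decayRate (inv_add_two_mem n).1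
    (le_shift_cutData hf₀.nonneg n) ht
  refine ⟨h0, integrable_of_tendsto_of_integral_le (F := fun n (p : Ω × E3) =>
    relEntropy (sol γ b π T (cutData θ f₀ n) t p.1) p.2)
    -- A constant bound is enough, so the entropies of the cut-off data need not be shown to
    -- converge.
    (c := fun _ => ∫ p : Ω × E3, relEntropy (f₀ p.1) p.2)
    (fun n => measurable_relEntropy (measurable_slice (hA n).admissible.measurable t))
    (fun n p => relEntropy_nonneg ((hA n).admissible.nonneg _ _ _)) (fun n => (hent n).1)
    (fun n => (hent n).2.trans (integral_mono (hcut n) h0 fun p =>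
      relEntropy_const_mul_le (cutoff_nonneg n p.1) (cutoff_le_one n p.1) (hf₀.nonneg _ _)))
    tendsto_const_nhds (fun p => ?_)⟩
  have h1 := hθ.tendsto_sol hS hf₀ hT hM ht p.1 p.2
  have h2 := (h1.const_add (sqrtM p.2)).div_const (sqrtM p.2)
  exact ((continuous_klFun.tendsto _).comp h2).const_mul _

end Limit

/-! ### Defects -/

section Defects

set_option linter.unusedSectionVars false

open Filter InformationTheory

variable {Ω : Type} [AddCommGroup Ω] [TopologicalSpace Ω] [IsTopologicalAddGroup Ω]
  [SecondCountableTopology Ω] [MeasureSpace Ω] [BorelSpace Ω] [SigmaFinite (volume : Measure Ω)]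
  [(volume : Measure Ω).IsAddLeftInvariant] {φ φ' : Ω → E3 → ℝ}

lemma density_sub_maxwellian (φ : Ω → E3 → ℝ) (x : Ω) (v : E3) :
    density φ x v - maxwellian v = sqrtM v * φ x v := by
  rw [density]; ring

lemma finiteDefect_congr (h : ∀ᵐ p : Ω × E3, φ p.1 p.2 = φ' p.1 p.2) (hφ : FiniteDefect φ) :
    FiniteDefect φ' :=
  hφ.congr (h.mono fun p hp => by simp only [density, hp])

lemma integrable_of_finiteDefect (h : FiniteDefect φ) :
    Integrable fun p : Ω × E3 => sqrtM p.2 * jap p.2 ^ 2 * |φ p.1 p.2| := by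
  refine h.abs.congr (Eventually.of_forall fun p => ?_)
  simp only
  rw [density_sub_maxwellian, ← jap_sq, abs_mul, abs_mul, abs_of_pos (sqrtM_pos _),
    abs_of_nonneg (pow_nonneg (jap_pos _).le 2)]
  ring

lemma finiteDefect_of_integrable (hm : Measurable fun p : Ω × E3 => φ p.1 p.2)
    (h : Integrable fun p : Ω × E3 => sqrtM p.2 * jap p.2 ^ 2 * |φ p.1 p.2|) :
    FiniteDefect φ := by
  have := integrable_moment_of_abs (ψ := fun v => jap v ^ 2) hm h (measurable_jap.pow_const 2)
    (L := 1) fun v => by rw [one_mul, abs_of_nonneg (pow_nonneg (jap_pos v).le 2)]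
  refine this.congr (Eventually.of_forall fun p => ?_)
  simp only
  rw [density_sub_maxwellian, jap_sq]
  ring

lemma defectMass_eq (φ : Ω → E3 → ℝ) :
    defectMass φ = ∫ p : Ω × E3, sqrtM p.2 * (fun _ => 1 : E3 → ℝ) p.2 * φ p.1 p.2 := by
  simp only [defectMass, density_sub_maxwellian, mul_one]

lemma defectEnergy_eq (φ : Ω → E3 → ℝ) :
    defectEnergy φ = ∫ p : Ω × E3, sqrtM p.2 * (fun v => ‖v‖ ^ 2 : E3 → ℝ) p.2 * φ p.1 p.2 := by
  simp only [defectEnergy, density_sub_maxwellian]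
  congr 1; ext p; ring

lemma abs_inner_le_jap_sq (w v : E3) : |inner ℝ v w| ≤ ‖w‖ * jap v ^ 2 := by
  refine (abs_real_inner_le_norm v w).trans ?_
  rw [mul_comm]
  refine mul_le_mul_of_nonneg_left ?_ (norm_nonneg _)
  nlinarith [norm_le_jap v, one_le_jap v]

/-- Momentum is tested against a fixed vector w, which reduces its conservation to the scalar
invariant v ↦ v · w. -/
lemma inner_defectMomentum (hm : Measurable fun p : Ω × E3 => φ p.1 p.2)
    (h : Integrable fun p : Ω × E3 => sqrtM p.2 * jap p.2 ^ 2 * |φ p.1 p.2|) (w : E3) :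
    inner ℝ w (defectMomentum φ) =
      ∫ p : Ω × E3, sqrtM p.2 * (fun v => inner ℝ v w : E3 → ℝ) p.2 * φ p.1 p.2 := by
  have hi : Integrable fun p : Ω × E3 => (density φ p.1 p.2 - maxwellian p.2) • p.2 := by
    simp only [density_sub_maxwellian]
    refine h.mono' (((measurable_sqrtM_snd.mul hm).smul measurable_snd).aestronglyMeasurable)
      (Eventually.of_forall fun p => ?_)
    rw [norm_smul, Real.norm_eq_abs, abs_mul, abs_of_pos (sqrtM_pos _)]
    have h1 : ‖p.2‖ ≤ jap p.2 ^ 2 := by nlinarith [norm_le_jap p.2, one_le_jap p.2]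
    calc _ ≤ sqrtM p.2 * |φ p.1 p.2| * jap p.2 ^ 2 :=
          mul_le_mul_of_nonneg_left h1 (mul_nonneg (sqrtM_pos _).le (abs_nonneg _))
      _ = _ := by ring
  rw [defectMomentum, ← integral_inner hi]
  congr 1; ext p
  rw [inner_smul_right, density_sub_maxwellian, real_inner_comm]
  ring

/-- The linear part of the entropy. -/
def entropyWeight (v : E3) : ℝ := 1 + Real.log (maxwellian v)

lemma measurable_entropyWeight : Measurable entropyWeight :=
  measurable_const.add (Real.measurable_log.comp continuous_maxwellian.measurable)

lemma isInvariant_entropyWeight : IsInvariant entropyWeight := fun v u ω => by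
  simp only [entropyWeight, log_maxwellian]
  linarith [norm_sq_postU_add_postV v u ω]

lemma exists_abs_entropyWeight_le : ∃ L : ℝ, ∀ v, |entropyWeight v| ≤ L * jap v ^ 2 := by
  refine ⟨1 + |Real.log ((2 * Real.pi) ^ (3 / 2 : ℝ))|, fun v => ?_⟩
  rw [entropyWeight, log_maxwellian, jap_sq, abs_le]
  have h1 := neg_abs_le (Real.log ((2 * Real.pi) ^ (3 / 2 : ℝ)))
  have h2 := le_abs_self (Real.log ((2 * Real.pi) ^ (3 / 2 : ℝ)))
  have h3 := abs_nonneg (Real.log ((2 * Real.pi) ^ (3 / 2 : ℝ)))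
  have h4 := sq_nonneg ‖v‖
  constructor <;> nlinarith

/-- Taylor expansion of r ln r at μ with exact remainder μ `klFun` (F / μ). Vacuum points, where the
logarithm takes its default value 0, are checked separately. -/
lemma entropyDensity_eq {x : Ω} {v : E3} (h : 0 ≤ shift (φ x) v) :
    entropyDensity φ (x, v) = relEntropy (φ x) v + sqrtM v * entropyWeight v * φ x v := by
  have hm := sqrtM_pos v
  simp only [entropyDensity]
  rw [density_eq, relEntropy, klFun, entropyWeight, ← sqrtM_mul_self v,
    Real.log_mul hm.ne' hm.ne']
  rcases h.eq_or_lt with h0 | h0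
  · have : φ x v = - sqrtM v := by simp only [shift] at h0; linarith
    rw [← h0, this]; simp; ring
  · rw [Real.log_mul hm.ne' h0.ne', Real.log_div h0.ne' hm.ne']
    simp only [shift]
    field_simp
    ring

lemma entropyDensity_congr (h : ∀ᵐ p : Ω × E3, φ p.1 p.2 = φ' p.1 p.2) :
    entropyDensity φ =ᵐ[volume] entropyDensity φ' :=
  h.mono fun p hp => by simp only [entropyDensity, density, hp]

lemma integrable_entropyDensity (hm : Measurable fun p : Ω × E3 => φ p.1 p.2)
    (h : Integrable fun p : Ω × E3 => sqrtM p.2 * jap p.2 ^ 2 * |φ p.1 p.2|)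
    (h0 : ∀ x v, 0 ≤ shift (φ x) v)
    (hr : Integrable fun p : Ω × E3 => relEntropy (φ p.1) p.2) :
    Integrable (entropyDensity φ) ∧ defectEntropy φ =
      (∫ p : Ω × E3, relEntropy (φ p.1) p.2) +
        ∫ p : Ω × E3, sqrtM p.2 * entropyWeight p.2 * φ p.1 p.2 := by
  obtain ⟨L, hL⟩ := exists_abs_entropyWeight_le
  have hi := integrable_moment_of_abs hm h measurable_entropyWeight hL
  have e : entropyDensity φ = fun p : Ω × E3 =>
      relEntropy (φ p.1) p.2 + sqrtM p.2 * entropyWeight p.2 * φ p.1 p.2 :=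
    funext fun p => entropyDensity_eq (h0 p.1 p.2)
  rw [defectEntropy, e]
  exact ⟨hr.add hi, integral_add hr hi⟩

end Defects

/-! ### Local existence -/

section LocalExistence

set_option linter.unusedSectionVars false

open Filter

/-- With M = 2 M₀ the required increment is M₀ (1 + 2 M₀) / (4 (1 + M₀)), at most M₀; the factor 8
in the lifespan also keeps T ≤ 1. -/
lemma short_lifespan {C M₀ : ℝ} (hC : 1 ≤ C) (hM₀ : 0 ≤ M₀) :
    Short C M₀ (2 * M₀) (8 * C * (1 + M₀))⁻¹ := by
  refine ⟨by positivity, inv_le_one_of_one_le₀ (by nlinarith), ?_⟩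
  have e : C * (8 * C * (1 + M₀))⁻¹ * (2 * M₀) * (1 + 2 * M₀) =
      M₀ * ((1 + 2 * M₀) / (4 * (1 + M₀))) := by field_simp; ring
  have h : (1 + 2 * M₀) / (4 * (1 + M₀)) ≤ 1 := (div_le_one (by positivity)).2 (by linarith)
  rw [e]
  nlinarith

variable {Ω : Type} [AddCommGroup Ω] [TopologicalSpace Ω] [IsTopologicalAddGroup Ω]
  [SecondCountableTopology Ω] [LocallyCompactSpace Ω] [MeasureSpace Ω] [BorelSpace Ω]
  [SigmaFinite (volume : Measure Ω)] [(volume : Measure Ω).IsAddLeftInvariant]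
  {γ β : ℝ} {b : ℝ → ℝ} {C : ℝ} {π : E3 →+ Ω} {θ : Ω → ℝ}

lemma Setting.localExistence (hS : Setting γ β b C π) (hθ : SpaceWeight π θ) :
    LocalExistence π γ b β C := by
  intro f₀ hm hfin h0
  set M₀ := (wNorm β f₀).toReal
  have hM₀ : 0 ≤ M₀ := ENNReal.toReal_nonneg
  have hM : 0 ≤ 2 * M₀ := by positivity
  have hw : ENNReal.ofReal M₀ = wNorm β f₀ := ENNReal.ofReal_toReal hfin.ne
  have hT : Short C M₀ (2 * M₀) (lifespan C β f₀) := short_lifespan hS.bounds.one_le hM₀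
  obtain ⟨f₁, hf₁, h01, hcont⟩ := exists_admissibleData hm hM₀ hw.ge h0
  set f := sol γ b π (lifespan C β f₀) f₁
  have hadm := hS.admissible_sol hf₁ hT hM
  refine ⟨f, hS.isMildSolution_sol hf₁ hT hM h01, fun t _ => ?_,
    fun g hg t ht => hS.unique hf₁ hT hM h01 hg ht, fun hdef => ?_, fun hc => ?_⟩
  · rw [← hw, ← ENNReal.ofReal_ofNat, ← ENNReal.ofReal_mul (by norm_num)]
    exact wNorm_le (hadm.bound t)
  · have hi := integrable_of_finiteDefect (finiteDefect_congr h01 hdef)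
    have hlife : (0 : ℝ) ∈ Icc 0 (lifespan C β f₀) := ⟨le_rfl, hT.nonneg⟩
    have hm₁ := hf₁.measurable
    have hent₀ := integrable_entropyDensity hm₁ hi hf₁.nonneg
      (hθ.integral_relEntropy_sol_le hS hf₁ hT hM hi hlife).1
    have hmom : ∀ ψ : E3 → ℝ, ∫ p : Ω × E3, sqrtM p.2 * ψ p.2 * f₀ p.1 p.2 =
        ∫ p : Ω × E3, sqrtM p.2 * ψ p.2 * f₁ p.1 p.2 := fun ψ =>
      integral_congr_ae (h01.mono fun p hp => by simp only [hp])
    refine ⟨hent₀.1.congr (entropyDensity_congr h01).symm, fun t ht => ?_⟩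
    obtain ⟨hit, hcons⟩ := hθ.moments_sol hS hf₁ hT hM hi ht
    obtain ⟨-, hrt, hle⟩ := hθ.integral_relEntropy_sol_le hS hf₁ hT hM hi ht
    have hmt : Measurable fun p : Ω × E3 => f t p.1 p.2 := measurable_slice hadm.measurable t
    have hentt := integrable_entropyDensity hmt hit (hadm.nonneg t) hrt
    have hj : ∀ v, 1 ≤ jap v ^ 2 := fun v => one_le_pow₀ (one_le_jap v)
    refine ⟨finiteDefect_of_integrable hmt hit, hentt.1, ?_, ?_, ?_, ?_⟩
    · rw [defectMass_eq, defectMass_eq]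
      refine Eq.trans ?_ (hmom fun _ => 1).symm
      exact hcons measurable_const isInvariant_one (L := 1) fun v => by
        rw [abs_one, one_mul]; exact hj v
    · have e0 : defectMomentum f₀ = defectMomentum f₁ :=
        integral_congr_ae (h01.mono fun p hp => by simp only [density, hp])
      rw [e0]
      refine ext_inner_left ℝ fun w => ?_
      rw [inner_defectMomentum hmt hit, inner_defectMomentum hm₁ hi]
      exact hcons (measurable_id.inner measurable_const) (isInvariant_inner w)
        (abs_inner_le_jap_sq w)
    · rw [defectEnergy_eq, defectEnergy_eq]
      refine Eq.trans ?_ (hmom fun v => ‖v‖ ^ 2).symm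
      exact hcons (measurable_norm.pow_const 2) isInvariant_norm_sq (L := 1) fun v => by
        rw [abs_of_nonneg (sq_nonneg _), one_mul, jap_sq]; linarith
    · have e0 : defectEntropy f₀ = defectEntropy f₁ :=
        integral_congr_ae (entropyDensity_congr h01)
      obtain ⟨L, hL⟩ := exists_abs_entropyWeight_le
      -- The linear part of the entropy is the moment of 1 + ln μ, a collision invariant, hence
      -- equal at both times. Only the relative entropies remain to be compared.
      rw [e0, hentt.2, hent₀.2, hcons measurable_entropyWeight isInvariant_entropyWeight hL]
      exact add_le_add_left hle _
  · refine Continuous.continuousOn ?_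
    have h := hS.continuous_sol hf₁ hT hM (hcont hc)
    exact h.comp (f := fun p : ℝ × Ω × E3 => ((p.1, p.2.1), p.2.2)) (by fun_prop)

/-- The weight `1 + |x|` on the whole space. -/
lemma spaceWeight_one_add_norm :
    SpaceWeight (AddMonoidHom.id E3) fun x : E3 => 1 + ‖x‖ := by
  have hslow : ∀ x z : E3, 1 + ‖x + z‖ ≤ (1 + ‖z‖) * (1 + ‖x‖) := fun x z => by
    nlinarith [norm_add_le x z, norm_nonneg x, norm_nonneg z]
  have hpos : ∀ x : E3, 0 < 1 + ‖x‖ := fun x => by positivity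
  refine ⟨measurable_const.add measurable_norm, fun x => by linarith [norm_nonneg x],
    ⟨hpos, hslow⟩, ⟨⟨fun x => pow_pos (hpos x) 4, fun s hs x =>
      ⟨fun v => pow_pos (hpos _) 4, fun v v' => ?_, fun v u ω => ?_⟩⟩, ?_⟩⟩
  · rw [← mul_pow]
    refine pow_le_pow_left₀ (hpos _).le ?_ 4
    have h := hslow (x - s • v') (s • (v' - v))
    have e : x - s • v' + s • (v' - v) = x - s • v := by rw [smul_sub]; abel
    rw [e, norm_smul, Real.norm_of_nonneg hs.1, norm_sub_rev v' v] at h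
    refine h.trans (mul_le_mul_of_nonneg_right ?_ (hpos _).le)
    have := mul_le_of_le_one_left (norm_nonneg (v - v')) hs.2
    linarith
  · have hsq : ∀ w : E3, ‖x - s • w‖ ^ 2 = ‖x‖ ^ 2 - 2 * s * inner ℝ x w + s ^ 2 * ‖w‖ ^ 2 := by
      intro w
      rw [norm_sub_sq_real, inner_smul_right, norm_smul, mul_pow, Real.norm_eq_abs, sq_abs]
      ring
    have h1 := norm_sq_postU_add_postV v u ω
    have h2 := congrArg (inner ℝ x) (postU_add_postV v u ω)
    rw [inner_add_right, inner_add_right] at h2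
    -- Momentum and energy conservation survive the affine map w ↦ x − s w. Therefore the weight in
    -- space behaves at the feet of characteristics as the velocity weight does at collisions.
    have h3 : ‖x - s • postU v u ω‖ ^ 2 + ‖x - s • postV v u ω‖ ^ 2 =
        ‖x - s • u‖ ^ 2 + ‖x - s • v‖ ^ 2 := by
      rw [hsq, hsq, hsq, hsq]
      linear_combination s ^ 2 * h1 - 2 * s * h2
    change (1 + ‖x - s • v‖) ^ 4 ≤ 8 * ((1 + ‖x - s • postU v u ω‖) ^ 4 +
      (1 + ‖x - s • postV v u ω‖) ^ 4)
    set p := ‖x - s • postU v u ω‖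
    set q := ‖x - s • postV v u ω‖
    have hp : 0 ≤ p := norm_nonneg _
    have hq : 0 ≤ q := norm_nonneg _
    have h4 : ‖x - s • v‖ ≤ p + q := by
      refine abs_le_of_sq_le_sq' ?_ (by positivity) |>.2
      nlinarith [sq_nonneg ‖x - s • u‖, mul_nonneg hp hq]
    calc (1 + ‖x - s • v‖) ^ 4 ≤ ((1 + p) + (1 + q)) ^ 4 :=
          pow_le_pow_left₀ (hpos _).le (by linarith) 4
      _ ≤ 2 ^ (4 - 1) * ((1 + p) ^ 4 + (1 + q) ^ 4) :=
          add_pow_le (by positivity) (by positivity) 4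
      _ = _ := by norm_num
  -- The fourth power suffices because 4 exceeds the dimension 3.
  · have h := integrable_one_add_norm (E := E3) (μ := volume) (r := 4) (by
      rw [finrank_euclideanSpace_fin]; norm_num)
    refine h.congr (Eventually.of_forall fun x => ?_)
    simp only
    rw [Real.rpow_neg (hpos x).le, ← Real.rpow_natCast]
    norm_num

/-- In finite volume no decay is needed: constants are integrable, and the same argument covers the
torus. -/
lemma spaceWeight_one [IsFiniteMeasure (volume : Measure Ω)] (π : E3 →+ Ω) :
    SpaceWeight π fun _ => 1 := by
  refine ⟨measurable_const, fun _ => le_rfl, SlowOn.one π, ?_, integrable_const _⟩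
  simpa only [one_pow] using GrowthOn.one π

/-- In finite volume the Gaussian factor √μ makes every moment of a bounded perturbation integrable.
-/
lemma finiteDefect_of_wNorm_lt_top [IsFiniteMeasure (volume : Measure Ω)] {f₀ : Ω → E3 → ℝ}
    (hβ : 0 ≤ β) (hm : AEStronglyMeasurable (fun p : Ω × E3 => f₀ p.1 p.2) volume)
    (h : wNorm β f₀ < ∞) : FiniteDefect f₀ := by
  have hb := ae_abs_le_of_wNorm_le (β := β) (f := f₀) (ENNReal.toReal_nonneg)
    (ENNReal.ofReal_toReal h.ne).ge
  set M := (wNorm β f₀).toReal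
  have hM : 0 ≤ M := ENNReal.toReal_nonneg
  have hi : Integrable (fun p : Ω × E3 => M * (sqrtM p.2 * jap p.2 ^ 2)) :=
    ((integrable_const M).mul_prod (μ := (volume : Measure Ω)) (polyBounded_jap_pow 2).integrable)
  have e : ∀ p : Ω × E3, (1 + ‖p.2‖ ^ 2) * (density f₀ p.1 p.2 - maxwellian p.2) =
      sqrtM p.2 * jap p.2 ^ 2 * f₀ p.1 p.2 := fun p => by
    rw [density_sub_maxwellian, jap_sq]; ring
  simp only [FiniteDefect, e]
  refine hi.mono' ((measurable_momentWeight.aestronglyMeasurable).mul hm) (hb.mono fun p hp => ?_)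
  rw [norm_mul, Real.norm_of_nonneg (momentWeight_nonneg _), mul_comm, Real.norm_eq_abs]
  refine mul_le_mul_of_nonneg_right (hp.trans ?_) (momentWeight_nonneg _)
  exact mul_le_of_le_one_right hM (weight_inv_le_one hβ _)

/-- The covering map of the torus as a homomorphism. -/
def torusHom (L : ℝ) : E3 →+ T3 L where
  toFun := toTorus L
  map_zero' := funext fun _ => rfl
  map_add' _ _ := funext fun _ => rfl

lemma continuous_torusHom (L : ℝ) : Continuous (torusHom L) :=
  continuous_pi fun i => (AddCircle.continuous_mk' L).comp (EuclideanSpace.proj i).continuous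

lemma isCutoff_zero {Cb : ℝ} (hCb : 0 < Cb) : IsCutoff Cb fun _ => 0 :=
  ⟨measurable_const, fun _ _ => le_rfl, fun _ _ => by positivity⟩

end LocalExistence

theorem exists_localExistence {γ β Cb : ℝ} (hγ : -3 < γ) (hγ1 : γ ≤ 1) (hβ : 3 < β)
    (hCb : 0 < Cb) :
    ∃ C₄ : ℝ, 1 ≤ C₄ ∧ ∀ b : ℝ → ℝ, IsCutoff Cb b →
      LocalExistence (Ω := E3) id γ b β C₄ ∧
      ∀ (L : ℝ) [Fact (0 < L)],
        (∀ f₀ : T3 L → E3 → ℝ,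
          AEStronglyMeasurable (fun p : T3 L × E3 => f₀ p.1 p.2) volume →
          wNorm β f₀ < ∞ → FiniteDefect f₀) ∧
        LocalExistence (toTorus L) γ b β C₄ := by
  obtain ⟨C, hC⟩ := exists_kernelBounds hγ hγ1 hCb
  obtain ⟨C₄, hC₄⟩ := exists_bounds hβ C
  -- The constant is fixed before `b`, so C₄ ≥ 1 is read off from the trivial angular function b =
  -- 0.
  refine ⟨C₄, (hC₄ _ (hC _ (isCutoff_zero hCb))).one_le, fun b hb => ⟨?_, fun L _ => ⟨?_, ?_⟩⟩⟩
  · exact Setting.localExistence (π := AddMonoidHom.id E3)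
      ⟨hβ, ⟨C, hC b hb⟩, hC₄ b (hC b hb), continuous_id⟩ spaceWeight_one_add_norm
  · exact fun f₀ hm h => finiteDefect_of_wNorm_lt_top (by linarith) hm h
  · exact Setting.localExistence (π := torusHom L)
      ⟨hβ, ⟨C, hC b hb⟩, hC₄ b (hC b hb), continuous_torusHom L⟩ (spaceWeight_one _)

end Boltzmann

end

theorem proposition2p1 (γ : ℝ) (hγ : -3 < γ) (hγ1 : γ ≤ 1) (β : ℝ) (hβ : 3 < β)
    (Cb : ℝ) (hCb : 0 < Cb) :
    ∃ C₄ : ℝ, 1 ≤ C₄ ∧ ∀ b : ℝ → ℝ, Boltzmann.IsCutoff Cb b →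
      Boltzmann.LocalExistence (Ω := Boltzmann.E3) id γ b β C₄ ∧
      ∀ (L : ℝ) [Fact (0 < L)],
        (∀ f₀ : Boltzmann.T3 L → Boltzmann.E3 → ℝ,
          MeasureTheory.AEStronglyMeasurable
            (fun p : Boltzmann.T3 L × Boltzmann.E3 => f₀ p.1 p.2) MeasureTheory.volume →
          Boltzmann.wNorm β f₀ < ⊤ → Boltzmann.FiniteDefect f₀) ∧
        Boltzmann.LocalExistence (Boltzmann.toTorus L) γ b β C₄ :=
  Boltzmann.exists_localExistence hγ hγ1 hβ hCb
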